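/- **Setting.** Functions $u$ on $\mathbb T^3=(\mathbb R/2\pi\mathbb Z)^3$ are written $u(x)=\sum_{k\in\mathbb Z^3}\widehat u_k e^{ik\cdot x}$, $\|u\|_{H^\sigma}^2=\sum_k(1+|k|^2)^\sigma|\widehat u_k|^2$, and $B_R^{H^\sigma}=\{\|u\|_{H^\sigma}\le R\}$. Fix a radial $\chi\in C_c^\infty(\mathbb R^3;\mathbb R)$ with $\chi=1$ on $[-\frac12,\frac12]^3$ and $\operatorname{supp}\chi\subset\{|x|<1\}$, and an even $\eta\in C_c^\infty(\mathbb R;[0,1])$ with $\eta=1$ on $[-\frac12,\frac12]$ and $\operatorname{supp}\eta\subset(-1,1)$. For an integer $N\ge1$ let $\chi_N(k)=\chi(k/N)$, let $S_N$ be the Fourier multiplier with symbol $\chi_N$, and let $\Pi_N$ be the projector onto the frequencies $|k|\le N$; for $N=\infty$ put $\chi_\infty=1$, $S_\infty=\Pi_\infty=\mathrm{Id}$. Let $\Phi_N(t)$ be the flow of $$i\partial_t u+\Delta u=S_N\big(|S_Nu|^4S_Nu\big),$$ which for $N=\infty$ is the defocusing quintic NLS. Let $\mu_s$ be the law of $\sum_k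 g_k(1+|k|^{2s})^{-1/2}e^{ik\cdot x}$, where the $g_k$ are i.i.d. complex Gaussians whose real and imaginary parts are independent standard normal variables. For $\vec k=(k_1,\dots,k_6)\in(\mathbb Z^3)^6$ let $$\Omega(\vec k)=\sum_{j=1}^6(-1)^{j-1}|k_j|^2,\quad \psi_{2s}(\vec k)=\sum_{j=1}^6(-1)^{j-1}|k_j|^{2s},\quad \lambda(\vec k)=\Big(\sum_{j=1}^6|k_j|^2\Big)^{1/2}.$$ For $0<\delta_0<\frac23$ let $$R_{s,N}(u)=\frac16\,\mathrm{Im}\sum_{k_1-k_2+k_3-k_4+k_5-k_6=0}\Big(1-\eta\Big(\frac{\Omega(\vec k)}{\lambda(\vec k)^{\delta_0}}\Big)\Big)\frac{\psi_{2s}(\vec k)}{-i\,\Omega(\vec k)}\Big(\prod_{j=1}^6\chi_N(k_j)\Big)\widehat u_{k_1}\overline{\widehat u_{k_2}}\,\widehat u_{k_3}\overline{\widehat u_{k_4}}\,\widehat u_{k_5}\overline{\widehat u_{k_6}},$$ where terms with $\Omega(\vec k)=0$ are zero, and $$E_{s,N}(u)=\frac12\sum_k(1+|k|^{2s})|\widehat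 u_k|^2+R_{s,N}(u).$$ For $N=\infty$, $R_{s,\infty}(u)$ is the sum of the series wherever it converges absolutely, and in general it is the limit of $R_{s,N}$ in $\mu_s$-measure as $N\to\infty$. Let $$Q_{s,N}(u)=\frac{d}{dt}E_{s,N}\big(\Pi_N\Phi_N(t)u\big)\Big|_{t=0}$$ for every $u\in\bigcup_{\sigma\ge1}H^{\sigma}$ if $N<\infty$ and for every $u\in H^s$ if $N=\infty$. Since $\mu_s(H^s)=0$, $Q_{s,\infty}$ is extended to $\mu_s$-almost every $u$ as the limit of $Q_{s,N}$ in $\mu_s$-measure as $N\to\infty$. Finally, for $R\ge1$, let $\overline\rho_{s,R,N}$ be the measure with $$d\overline\rho_{s,R,N}(u)=\eta\big(\|\Pi_Nu\|_{H^\sigma}/R\big)\,e^{-R_{s,N}(u)}\,d\mu_s(u).$$ **Proposition.** Let $s\ge10$. There is $\delta_1\in(0,\frac23)$ such that for every $\delta_0\in(\delta_1,\frac23)$ the following holds. The limits and derivatives that define $R_{s,\infty}$ and $Q_{s,N}$, $1\le N\le\infty$, exist, and there are $\varepsilon>0$ and $\beta\in(0,1)$ such that for every $R\ge1$ there is a constant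 $C(s,R)>0$ (which may also depend on the fixed $\chi,\eta,\delta_0$) such that for all $\sigma\in(s-\frac32-\varepsilon,\,s-\frac32)$ and all $N\in\{1,2,\dots\}\cup\{\infty\}$, $$\big\|\mathbf 1_{B_R^{H^\sigma}}\,Q_{s,N}\big\|_{L^p(\mu_s)}\le C(s,R)\,p^\beta\quad\text{for all }p\in[2,\infty),$$ $$\big\|\mathbf 1_{B_R^{H^\sigma}}\,Q_{s,N}\big\|_{L^p(\overline\rho_{s,R,N})}\le C(s,R)\,p^\beta\quad\text{for all }p\in[1,\infty).$$ -/

import Mathlib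

open MeasureTheory ProbabilityTheory Filter Topology Set
open scoped ENNReal ContDiff ComplexConjugate

noncomputable section

namespace NLSEnergy

/-! ### Phase space

A function `u` on the torus `(ℝ/2πℤ)³` is represented by the family `(û_k)` of its Fourier
coefficients, `u(x) = ∑_k û_k e^{ik·x}`. -/

/-- Frequencies `k ∈ ℤ³`. -/
abbrev Freq := Fin 3 → ℤ

/-- Families of Fourier coefficients. -/
abbrev Coeff := Freq → ℂ

/-- `|k|²`, for the Euclidean norm of `k ∈ ℤ³`. -/
def nsq (k : Freq) : ℝ := ∑ i, (k i : ℝ) ^ 2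

/-- `k` as a point of Euclidean space. -/
def toEuclid (k : Freq) : EuclideanSpace ℝ (Fin 3) := WithLp.toLp 2 (fun i => (k i : ℝ))

/-- The `H^σ` norm `(∑_k (1+|k|²)^σ |û_k|²)^{1/2} ∈ [0,∞]`. -/
def sobNorm (σ : ℝ) (u : Coeff) : ℝ≥0∞ :=
  (∑' k, ENNReal.ofReal ((1 + nsq k) ^ σ * ‖u k‖ ^ 2)) ^ (1 / 2 : ℝ)

/-- The Sobolev space `H^σ(𝕋³)`. -/
def Sob (σ : ℝ) : Set Coeff := {u | sobNorm σ u < ⊤}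

/-- The centred closed ball of radius `R` in `H^σ(𝕋³)`. -/
def sobBall (σ R : ℝ) : Set Coeff := {u | sobNorm σ u ≤ ENNReal.ofReal R}

/-! ### The Gaussian measure -/

/-- The standard complex Gaussian law: independent standard real and imaginary parts. -/
def stdComplexGaussian : Measure ℂ :=
  ((gaussianReal 0 1).prod (gaussianReal 0 1)).map Complex.measurableEquivRealProd.symm

instance : IsProbabilityMeasure stdComplexGaussian :=
  Measure.isProbabilityMeasure_map Complex.measurableEquivRealProd.symm.measurable.aemeasurable

/-- The measure `μ_s`: the law of the random Fourier series
`∑_k g_k (1+|k|^{2s})^{-1/2} e^{ik·x}` with `(g_k)` i.i.d. standard complex Gaussian. -/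
def gaussianSob (s : ℝ) : Measure Coeff :=
  (Measure.infinitePi (fun _ : Freq => stdComplexGaussian)).map
    (fun g k => g k / (Real.sqrt (1 + nsq k ^ s) : ℂ))

/-! ### Cutoffs and the truncated equation; `N = ⊤` stands for `N = ∞` -/

/-- A smooth radial cutoff on `ℝ³`, equal to `1` on `[-1/2,1/2]³`, supported in `{|x| < 1}`. -/
structure IsFreqCutoff (χ : EuclideanSpace ℝ (Fin 3) → ℝ) : Prop where
  smooth : ContDiff ℝ ∞ χ
  radial : ∀ x y, ‖x‖ = ‖y‖ → χ x = χ y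
  eq_one : ∀ x : EuclideanSpace ℝ (Fin 3), (∀ i, |x i| ≤ 1 / 2) → χ x = 1
  supp : tsupport χ ⊆ Metric.ball 0 1

/-- A standard (smooth, even, `[0,1]`-valued) bump function on `ℝ`, equal to `1` on
`[-1/2,1/2]`, supported in `(-1,1)`. -/
structure IsBump (η : ℝ → ℝ) : Prop where
  smooth : ContDiff ℝ ∞ η
  even : ∀ x, η (-x) = η x
  mem_Icc : ∀ x, η x ∈ Icc (0 : ℝ) 1
  eq_one : ∀ x, |x| ≤ 1 / 2 → η x = 1
  supp : tsupport η ⊆ Ioo (-1) 1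

open scoped Classical in
/-- The symbol `χ_N(k) = χ(k/N)` of `S_N`; `S_∞` is the identity. -/
def cut (χ : EuclideanSpace ℝ (Fin 3) → ℝ) (N : ℕ∞) (k : Freq) : ℝ :=
  if N = ⊤ then 1 else χ ((N.toNat : ℝ)⁻¹ • toEuclid k)

open scoped Classical in
/-- The sharp frequency truncation `Π_N` to `|k| ≤ N`; `Π_∞` is the identity. -/
def proj (N : ℕ∞) (u : Coeff) : Coeff :=
  fun k => if N = ⊤ ∨ nsq k ≤ (N.toNat : ℝ) ^ 2 then u k else 0

/-- The function `x ↦ S_N u(x) = ∑_k χ_N(k) û_k e^{ik·x}`. The torus `(ℝ/2πℤ)³` is rescaled to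
`(ℝ/ℤ)³` by `x = 2πy`, so that `e^{ik·x}` is Mathlib's `UnitAddTorus.mFourier k` at `y`. -/
def smoothed (χ : EuclideanSpace ℝ (Fin 3) → ℝ) (N : ℕ∞) (u : Coeff)
    (y : UnitAddTorus (Fin 3)) : ℂ :=
  ∑' k, (cut χ N k : ℂ) * u k * UnitAddTorus.mFourier k y

/-- The `k`-th Fourier coefficient of the nonlinearity `S_N(|S_N u|⁴ S_N u)`. -/
def nonlin (χ : EuclideanSpace ℝ (Fin 3) → ℝ) (N : ℕ∞) (u : Coeff) (k : Freq) : ℂ :=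
  (cut χ N k : ℂ) *
    UnitAddTorus.mFourierCoeff
      (fun y => ((‖smoothed χ N u y‖ ^ 4 : ℝ) : ℂ) * smoothed χ N u y) k

/-- `U` is an `H^σ` solution on the time interval `(-T,T)`, continuous in time with values in
`H^σ`, of `i∂ₜu + Δu = S_N(|S_N u|⁴ S_N u)` with initial value `u₀`; the equation is written for
each Fourier coefficient. For `N = ⊤` this is the equation `i∂ₜu + Δu = |u|⁴u`. -/
structure IsSolution (χ : EuclideanSpace ℝ (Fin 3) → ℝ) (N : ℕ∞) (σ T : ℝ) (u₀ : Coeff)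
    (U : ℝ → Coeff) : Prop where
  init : U 0 = u₀
  mem : ∀ t ∈ Ioo (-T) T, U t ∈ Sob σ
  cont : ∀ t ∈ Ioo (-T) T, Tendsto (fun t' => sobNorm σ (U t' - U t)) (𝓝 t) (𝓝 0)
  eqn : ∀ t ∈ Ioo (-T) T, ∀ k,
    HasDerivAt (fun t' => U t' k)
      (-Complex.I * ((nsq k : ℂ) * U t k + nonlin χ N (U t) k)) t

/-! ### The modified energy -/

/-- The index set `k₁ - k₂ + k₃ - k₄ + k₅ - k₆ = 0`; here `k j` is `k_{j+1}`. -/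
abbrev Hyperplane := {k : Fin 6 → Freq // ∑ j : Fin 6, (-1 : ℤ) ^ (j : ℕ) • k j = 0}

/-- The resonant function `Ω = ∑_j (-1)^{j-1} |k_j|²`. -/
def Om (k : Fin 6 → Freq) : ℝ := ∑ j : Fin 6, (-1 : ℝ) ^ (j : ℕ) * nsq (k j)

/-- `ψ_{2s} = ∑_j (-1)^{j-1} |k_j|^{2s}`. -/
def psi (s : ℝ) (k : Fin 6 → Freq) : ℝ := ∑ j : Fin 6, (-1 : ℝ) ^ (j : ℕ) * nsq (k j) ^ s

/-- `λ = (∑_j |k_j|²)^{1/2}`. -/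
def lam (k : Fin 6 → Freq) : ℝ := Real.sqrt (∑ j : Fin 6, nsq (k j))

/-- The summand
`(1 - χ(Ω/λ^δ₀)) ψ_{2s}/(-iΩ) · ∏_j χ_N(k_j) · û_{k₁} conj(û_{k₂}) ⋯ û_{k₅} conj(û_{k₆})`.
It vanishes when `Ω = 0`, since there the first factor does. -/
def corrTerm (χ : EuclideanSpace ℝ (Fin 3) → ℝ) (η : ℝ → ℝ) (s δ₀ : ℝ) (N : ℕ∞) (u : Coeff)
    (k : Hyperplane) : ℂ :=
  ((1 - η (Om k.1 / lam k.1 ^ δ₀) : ℝ) : ℂ) * ((psi s k.1 : ℂ) / (-Complex.I * (Om k.1 : ℂ))) *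
    (∏ j : Fin 6, (cut χ N (k.1 j) : ℂ)) *
    (u (k.1 0) * conj (u (k.1 1)) * u (k.1 2) * conj (u (k.1 3)) * u (k.1 4) * conj (u (k.1 5)))

/-- The correction `R_{s,N}(u) = (1/6) Im ∑ …`, as a series: a finite sum for finite `N ≥ 1`; for
`N = ⊤` it is meaningful where the series converges absolutely. -/
def corrSeries (χ : EuclideanSpace ℝ (Fin 3) → ℝ) (η : ℝ → ℝ) (s δ₀ : ℝ) (N : ℕ∞)
    (u : Coeff) : ℝ :=
  (1 / 6) * (∑' k : Hyperplane, corrTerm χ η s δ₀ N u k).im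

/-- The modified energy `E_{s,N}(u) = ½ ∑_k (1+|k|^{2s})|û_k|² + R_{s,N}(u)`, for `u ∈ H^s`. -/
def energy (χ : EuclideanSpace ℝ (Fin 3) → ℝ) (η : ℝ → ℝ) (s δ₀ : ℝ) (N : ℕ∞) (u : Coeff) : ℝ :=
  (1 / 2) * ∑' k, (1 + nsq k ^ s) * ‖u k‖ ^ 2 + corrSeries χ η s δ₀ N u

/-- `q(u)` is the time derivative at `0` of `E_{s,N}(Π_N Φ_N(t)u)` for all `u ∈ H^σ`, where
`Φ_N(t)u` is the `H^σ` solution with initial value `u`. -/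
def IsEnergyRateOn (χ : EuclideanSpace ℝ (Fin 3) → ℝ) (η : ℝ → ℝ) (s δ₀ : ℝ) (N : ℕ∞) (σ : ℝ)
    (q : Coeff → ℝ) : Prop :=
  ∀ u ∈ Sob σ, (∃ T > 0, ∃ U, IsSolution χ N σ T u U) ∧
    ∀ T > 0, ∀ U, IsSolution χ N σ T u U →
      HasDerivAt (fun t => energy χ η s δ₀ N (proj N (U t))) (q u) 0

/-- `Rc N` is (a version of) `R_{s,N}` for all `1 ≤ N ≤ ∞`. For `N = ∞` it is given by the series
wherever that converges absolutely and, up to `μ_s`-null sets, it is the limit in `μ_s`-measure of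
the `R_{s,N}`. -/
structure IsCorrection (χ : EuclideanSpace ℝ (Fin 3) → ℝ) (η : ℝ → ℝ) (s δ₀ : ℝ)
    (Rc : ℕ∞ → Coeff → ℝ) : Prop where
  aemeas : ∀ N, N ≠ 0 → AEMeasurable (Rc N) (gaussianSob s)
  fin : ∀ N : ℕ, N ≠ 0 → ∀ u, Rc N u = corrSeries χ η s δ₀ N u
  top : ∀ u, Summable (corrTerm χ η s δ₀ ⊤ u) → Rc ⊤ u = corrSeries χ η s δ₀ ⊤ u
  lim : TendstoInMeasure (gaussianSob s) (fun N : ℕ => Rc N) atTop (Rc ⊤)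

/-- `Q N` is (a version of) `Q_{s,N} = d/dt E_{s,N}(Φ_N(t)u)|_{t=0}` for all `1 ≤ N ≤ ∞`. The part
`½‖·‖²` of the energy is infinite at `μ_s`-almost every `u`. For finite `N` the modes `|k| > N` have
constant modulus and are removed from the energy by `Π_N`. For `N = ∞`, the derivative is literally
`Q ⊤ u` whenever the energy is finite, that is for `u ∈ H^s`, and `Q ⊤` is extended to
`μ_s`-almost all `u` as the limit in `μ_s`-measure of the `Q N`. -/
structure IsEnergyRate (χ : EuclideanSpace ℝ (Fin 3) → ℝ) (η : ℝ → ℝ) (s δ₀ : ℝ)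
    (Q : ℕ∞ → Coeff → ℝ) : Prop where
  aemeas : ∀ N, N ≠ 0 → AEMeasurable (Q N) (gaussianSob s)
  fin : ∀ N : ℕ, N ≠ 0 → ∀ σ, 1 ≤ σ → IsEnergyRateOn χ η s δ₀ N σ (Q N)
  top : IsEnergyRateOn χ η s δ₀ ⊤ s (Q ⊤)
  lim : TendstoInMeasure (gaussianSob s) (fun N : ℕ => Q N) atTop (Q ⊤)

/-! ### The weighted measures -/

/-- The weighted measure `ρ̄_{s,R,N}`. For finite `N` it is the product of
`χ_R(‖u‖_{H^σ}) e^{-R_{s,N}(u)} dμ_{s,N}` on the modes `|k| ≤ N` with the law of the remaining modes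
under `μ_s`, that is, it has the density `χ_R(‖Π_N u‖_{H^σ}) e^{-R_{s,N}(u)}` with respect to `μ_s`;
for `N = ⊤` the density is `χ_R(‖u‖_{H^σ}) e^{-R_s(u)}`. (It is set to `0` off the
`μ_s`-null set where the norm is infinite.) -/
def weighted (η : ℝ → ℝ) (s σ R : ℝ) (Rc : ℕ∞ → Coeff → ℝ) (N : ℕ∞) : Measure Coeff :=
  (gaussianSob s).withDensity
    ((Sob σ).indicator fun u =>
      ENNReal.ofReal (η ((sobNorm σ (proj N u)).toReal / R) * Real.exp (-Rc N u)))

end NLSEnergy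

end

noncomputable section
namespace NLSEnergy
open ENNReal (ofReal ofReal_le_ofReal mul_ne_top ofReal_mul ofReal_ne_top pow_ne_top tsum_le_tsum
  ofReal_pow toReal_ofReal rpow_two ofReal_add ofReal_one ofReal_tsum_of_nonneg toReal_mono
  rpow_inv_le_iff one_rpow mul_rpow_of_nonneg toReal_ofNat toReal_nonneg ofReal_rpow_of_nonneg
  le_tsum tsum_add tendsto_nhds_zero toReal_mul add_ne_top)
open Real (sqrt exp rpow_pos_of_pos rpow_nonneg rpow_mul rpow_add rpow_natCast exp_pos mul_rpow
  norm_eq_abs rpow_le_rpow rpow_neg one_le_rpow sq_sqrt rpow_le_rpow_of_exponent_le norm_of_nonneg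
  rpow_one exp_add sqrt_sq sqrt_eq_rpow dist_eq div_rpow sqrt_le_left rpow_neg_one sqrt_mul
  one_le_exp)
open Finset (sum_congr mem_filter sum_le_sum mul_sum sum_nonneg sum_add_distrib prod_congr sum_const
  sum_eq_zero sum_mul sum_neg_distrib sum_eq_single single_le_sum le_sup add_sum_erase
  ne_of_mem_erase prod_const abs_sum_le_sum_abs measurable_sum sum_sub_distrib card_univ prod_nonneg
  card_le_univ prod_le_prod' mul_prod_erase sum_comm sum_nbij' sum_image)
open UnitAddTorus (mFourier mFourier_neg)
open Complex (measurableEquivRealProd norm_real abs_im_le_norm add_im im_tsum conj_ofReal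
  measurable_im im_ofReal_mul real_smul hasSum_im conj_tsum reCLM mul_re add_re abs_re_le_norm
  norm_conj ofReal_sum)
open Function (comp_apply update_of_ne)
open Nat (odd_iff)

variable {χ : EuclideanSpace ℝ (Fin 3) → ℝ} {η : ℝ → ℝ}

section

/-! ### Quadratic forms in Gaussian variables -/

/-- Identity or complex conjugation. -/
def twist (b : Bool) (z : ℂ) : ℂ := bif b then conj z else z

@[simp] lemma twist_true (z : ℂ) : twist true z = conj z := rfl
@[simp] lemma twist_false (z : ℂ) : twist false z = z := rfl
@[simp] lemma norm_twist (b : Bool) (z : ℂ) : ‖twist b z‖ = ‖z‖ := by cases b <;> simp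
lemma twist_add (b : Bool) (z w : ℂ) : twist b (z + w) = twist b z + twist b w := by
  cases b <;> simp
lemma twist_mul (b : Bool) (z w : ℂ) : twist b (z * w) = twist b z * twist b w := by
  cases b <;> simp
@[simp] lemma twist_ofReal (b : Bool) (x : ℝ) : twist b (x : ℂ) = x := by
  cases b <;> simp
lemma conj_twist (b : Bool) (z : ℂ) : conj (twist b z) = twist (!b) z := by cases b <;> simp
@[fun_prop] lemma continuous_twist (b : Bool) : Continuous (twist b) := by
  cases b
  · exact continuous_id
  · exact Complex.continuous_conj
@[fun_prop] lemma measurable_twist (b : Bool) : Measurable (twist b) :=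
  (continuous_twist b).measurable

lemma lintegral_exp_gaussianReal (t : ℝ) :
    ∫⁻ x, ofReal (exp (t * x)) ∂(gaussianReal 0 1)
      = ofReal (exp (t ^ 2 / 2)) := by
  rw [← ofReal_integral_eq_lintegral_ofReal (integrable_exp_mul_gaussianReal t)
    (ae_of_all _ fun x => (exp_pos _).le)]
  have := congrFun (mgf_id_gaussianReal (μ := 0) (v := 1)) t
  simp only [mgf, id] at this
  rw [this]
  simp

lemma lintegral_exp_re_stdComplexGaussian (b : ℂ) :
    ∫⁻ z, ofReal (exp (b * z).re) ∂stdComplexGaussian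
      = ofReal (exp (‖b‖ ^ 2 / 2)) := by
  rw [stdComplexGaussian, lintegral_map (by fun_prop)
    measurableEquivRealProd.symm.measurable]
  have : ∀ x : ℝ × ℝ, ofReal (exp (b * measurableEquivRealProd.symm x).re)
      = ofReal (exp (b.re * x.1)) * ofReal (exp ((-b.im) * x.2)) := by
    intro x
    rw [← ofReal_mul (exp_pos _).le, ← exp_add]
    congr 2
    simp [measurableEquivRealProd, mul_re]
    ring
  simp_rw [this]
  rw [lintegral_prod_mul (f := fun x : ℝ => ofReal (exp (b.re * x)))
      (g := fun x : ℝ => ofReal (exp ((-b.im) * x))) (by fun_prop) (by fun_prop),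
    lintegral_exp_gaussianReal,
    lintegral_exp_gaussianReal, ← ofReal_mul (exp_pos _).le, ← exp_add,
    Complex.sq_norm, Complex.normSq_apply]
  congr 2
  ring

instance : IsGaussian stdComplexGaussian := by
  have h : stdComplexGaussian = ((gaussianReal 0 1).prod (gaussianReal 0 1)).map
      (Complex.equivRealProdCLM.symm : (ℝ × ℝ) ≃L[ℝ] ℂ) := rfl
  rw [h]
  infer_instance

lemma eLpNorm_ofReal {α ε : Type*} [MeasurableSpace α] [ENorm ε] {p : ℝ} (hp : 0 < p)
    {f : α → ε} {μ : Measure α} :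
    eLpNorm f (ofReal p) μ = (∫⁻ x, ‖f x‖ₑ ^ p ∂μ) ^ (1 / p) := by
  rw [eLpNorm_eq_lintegral_rpow_enorm_toReal (by simpa using hp) ofReal_ne_top,
    toReal_ofReal hp.le]

variable {ι : Type*} [Fintype ι]

lemma lintegral_exp_re_pi (b : ι → ℂ) :
    ∫⁻ g, ofReal (exp (∑ i, b i * g i).re)
        ∂(Measure.pi fun _ : ι => stdComplexGaussian)
      = ofReal (exp ((∑ i, ‖b i‖ ^ 2) / 2)) := by
  have h : ∀ g : ι → ℂ, ofReal (exp (∑ i, b i * g i).re)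
      = ∏ i, ofReal (exp (b i * g i).re) := by
    intro g
    rw [Complex.re_sum, Real.exp_sum, ENNReal.ofReal_prod_of_nonneg]
    exact fun i _ => (exp_pos _).le
  simp_rw [h]
  have hi : iIndepFun (fun (i : ι) (g : ι → ℂ) => ofReal (exp (b i * g i).re))
      (Measure.pi fun _ : ι => stdComplexGaussian) :=
    iIndepFun_pi (μ := fun _ : ι => stdComplexGaussian)
      (X := fun i z => ofReal (exp (b i * z).re)) (fun i => by fun_prop)
  rw [lintegral_prod_eq_prod_lintegral_of_indepFun _ _ hi (fun i => by fun_prop)]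
  have : ∀ i, ∫⁻ g, ofReal (exp (b i * g i).re)
      ∂(Measure.pi fun _ : ι => stdComplexGaussian) = ofReal (exp (‖b i‖ ^ 2 / 2)) := by
    intro i
    rw [← lintegral_exp_re_stdComplexGaussian]
    exact (measurePreserving_eval (fun _ : ι => stdComplexGaussian) i).lintegral_comp
      (f := fun z => ofReal (exp (b i * z).re)) (by fun_prop)
  simp_rw [this]
  rw [← ENNReal.ofReal_prod_of_nonneg (fun i _ => (exp_pos _).le), ← Real.exp_sum,
    Finset.sum_div]

/-- `|x|^p ≤ (p/(et))^p (e^{tx} + e^{-tx})`. -/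
lemma abs_rpow_le_exp {p t : ℝ} (hp : 0 < p) (ht : 0 < t) (x : ℝ) :
    |x| ^ p ≤ (p / t) ^ p * exp (-p) * (exp (t * x) + exp (t * (-x))) := by
  have h1 : |x| ≤ p / t * exp (t * |x| / p - 1) := by
    have := Real.add_one_le_exp (t * |x| / p - 1)
    calc |x| = p / t * (t * |x| / p - 1 + 1) := by field_simp; ring
      _ ≤ _ := by gcongr
  have h2 : |x| ^ p ≤ (p / t * exp (t * |x| / p - 1)) ^ p :=
    rpow_le_rpow (abs_nonneg _) h1 hp.le
  rw [mul_rpow (by positivity) (exp_pos _).le, ← Real.exp_mul] at h2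
  have h3 : (t * |x| / p - 1) * p = -p + t * |x| := by field_simp; ring
  rw [h3, exp_add, ← mul_assoc] at h2
  refine h2.trans ?_
  gcongr
  rcases abs_cases x with ⟨h, _⟩ | ⟨h, _⟩ <;> rw [h]
  · linarith [exp_pos (t * -x)]
  · linarith [exp_pos (t * x)]

lemma lintegral_abs_re_rpow_le (b : ι → ℂ) {p : ℝ} (hp : 1 ≤ p) :
    ∫⁻ g, ofReal (|(∑ i, b i * g i).re| ^ p)
        ∂(Measure.pi fun _ : ι => stdComplexGaussian)
      ≤ ofReal (2 * (sqrt p * sqrt (∑ i, ‖b i‖ ^ 2)) ^ p) := by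
  set v := ∑ i, ‖b i‖ ^ 2 with hv
  have hv0 : 0 ≤ v := sum_nonneg fun i _ => by positivity
  rcases hv0.eq_or_lt with h0 | h0
  · have hb : ∀ i, b i = 0 := by
      intro i
      have := (Finset.sum_eq_zero_iff_of_nonneg (fun i _ => by positivity)).1 h0.symm i
        (Finset.mem_univ i)
      simpa using this
    simp [hb, Real.zero_rpow (by linarith : p ≠ 0)]
  have hp0 : 0 < p := by linarith
  set t := sqrt p / sqrt v with ht
  have ht0 : 0 < t := by positivity
  have hpt : p / t = sqrt p * sqrt v := by
    rw [ht]; field_simp; rw [sq_sqrt hp0.le]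
  have ht2 : t ^ 2 * v = p := by
    rw [ht, div_pow, sq_sqrt hp0.le, sq_sqrt hv0]; field_simp
  set K := (p / t) ^ p * exp (-p) with hK
  have hK0 : 0 ≤ K := by positivity
  have key : ∀ c : ℝ, c ^ 2 = 1 → ∫⁻ g, ofReal (exp (t * (c * (∑ i, b i * g i).re)))
        ∂(Measure.pi fun _ : ι => stdComplexGaussian) = ofReal (exp (p / 2)) := by
    intro c hc
    have := lintegral_exp_re_pi (fun i => ((t * c : ℝ) : ℂ) * b i)
    have e1 : ∀ g : ι → ℂ, (∑ i, ((t * c : ℝ) : ℂ) * b i * g i).re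
        = t * (c * (∑ i, b i * g i).re) := by
      intro g
      simp_rw [mul_assoc ((t * c : ℝ) : ℂ)]
      rw [← mul_sum, Complex.re_ofReal_mul, mul_assoc]
    simp_rw [e1] at this
    rw [this]
    congr 3
    rw [← ht2, hv, mul_sum]
    refine sum_congr rfl fun i _ => ?_
    rw [norm_mul, mul_pow, norm_real, norm_eq_abs, sq_abs, mul_pow, hc, mul_one]
  calc ∫⁻ g, ofReal (|(∑ i, b i * g i).re| ^ p)
        ∂(Measure.pi fun _ : ι => stdComplexGaussian)
      ≤ ∫⁻ g, ofReal K * (ofReal (exp (t * (1 * (∑ i, b i * g i).re)))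
        + ofReal (exp (t * ((-1) * (∑ i, b i * g i).re))))
        ∂(Measure.pi fun _ : ι => stdComplexGaussian) := by
        refine lintegral_mono fun g => ?_
        rw [← ofReal_add (exp_pos _).le (exp_pos _).le,
          ← ofReal_mul hK0]
        refine ofReal_le_ofReal ?_
        rw [one_mul, neg_one_mul]
        exact abs_rpow_le_exp hp0 ht0 _
    _ = ofReal K * (ofReal (exp (p / 2)) + ofReal (exp (p / 2)))
        := by
        rw [lintegral_const_mul _ (by fun_prop), lintegral_add_left (by fun_prop),
          key 1 (by norm_num), key (-1) (by norm_num)]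
    _ ≤ _ := by
        rw [← ofReal_add (exp_pos _).le (exp_pos _).le, ← ofReal_mul hK0]
        refine ofReal_le_ofReal ?_
        rw [hK, hpt]
        have : exp (-p) * exp (p / 2) ≤ 1 := by
          rw [← exp_add]; exact Real.exp_le_one_iff.2 (by linarith)
        calc _ = 2 * (sqrt p * sqrt v) ^ p * (exp (-p) * exp (p / 2)) := by ring
          _ ≤ 2 * (sqrt p * sqrt v) ^ p * 1 := by gcongr
          _ = _ := mul_one _

/-- Moments of linear combinations of independent complex Gaussians. -/
lemma eLpNorm_linear_le (b : ι → ℂ) (τ : Bool) {p : ℝ} (hp : 1 ≤ p) :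
    eLpNorm (fun g : ι → ℂ => ∑ i, b i * twist τ (g i)) (ofReal p)
        (Measure.pi fun _ : ι => stdComplexGaussian)
      ≤ ofReal (8 * sqrt p * sqrt (∑ i, ‖b i‖ ^ 2)) := by
  have hp0 : 0 < p := by linarith
  rw [eLpNorm_ofReal hp0]
  set S := sqrt p * sqrt (∑ i, ‖b i‖ ^ 2) with hS
  have hS0 : 0 ≤ S := by positivity
  set b' : ι → ℂ := fun i => twist τ (b i)
  have hb' : ∑ i, ‖b' i‖ ^ 2 = ∑ i, ‖b i‖ ^ 2 := by simp [b']
  have hb'' : ∑ i, ‖-Complex.I * b' i‖ ^ 2 = ∑ i, ‖b i‖ ^ 2 := by simp [b']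
  have hnorm : ∀ g : ι → ℂ, ‖∑ i, b i * twist τ (g i)‖ = ‖∑ i, b' i * g i‖ := by
    intro g
    rw [← norm_twist τ (∑ i, b i * twist τ (g i))]
    congr 1
    cases τ
    · simp [b']
    · simp [b']
  have hpt : ∀ g : ι → ℂ, ‖∑ i, b i * twist τ (g i)‖ₑ ^ p ≤
      ofReal (2 ^ p) * (ofReal (|(∑ i, b' i * g i).re| ^ p) +
        ofReal (|(∑ i, (-Complex.I * b' i) * g i).re| ^ p)) := by
    intro g
    rw [← ofReal_norm, hnorm, ofReal_rpow_of_nonneg (norm_nonneg _) hp0.le,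
      ← ofReal_add (by positivity) (by positivity), ← ofReal_mul (by positivity)]
    refine ofReal_le_ofReal ?_
    set z := ∑ i, b' i * g i
    have hz : ∑ i, (-Complex.I * b' i) * g i = -Complex.I * z := by
      rw [mul_sum]; exact sum_congr rfl fun i _ => by ring
    have hz2 : (-Complex.I * z).re = z.im := by simp
    rw [hz, hz2]
    have h1 : ‖z‖ ≤ 2 * max |z.re| |z.im| := by
      have := Complex.norm_le_abs_re_add_abs_im z
      linarith [le_max_left |z.re| |z.im|, le_max_right |z.re| |z.im|]
    calc ‖z‖ ^ p ≤ (2 * max |z.re| |z.im|) ^ p := rpow_le_rpow (norm_nonneg _) h1 hp0.le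
      _ = 2 ^ p * (max |z.re| |z.im|) ^ p := mul_rpow (by norm_num) (by positivity)
      _ ≤ _ := by
        gcongr
        rcases le_total |z.re| |z.im| with h | h
        · rw [max_eq_right h]; linarith [rpow_nonneg (abs_nonneg z.re) p]
        · rw [max_eq_left h]; linarith [rpow_nonneg (abs_nonneg z.im) p]
  have h8 : ofReal (8 * sqrt p * sqrt (∑ i, ‖b i‖ ^ 2))
      = ofReal (8 * S) := by rw [hS, mul_assoc]
  rw [h8, one_div, rpow_inv_le_iff hp0, ofReal_rpow_of_nonneg (by positivity) hp0.le]
  calc _ ≤ ∫⁻ g, ofReal (2 ^ p) * (ofReal (|(∑ i, b' i * g i).re| ^ p) +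
        ofReal (|(∑ i, (-Complex.I * b' i) * g i).re| ^ p))
        ∂(Measure.pi fun _ : ι => stdComplexGaussian) := lintegral_mono hpt
    _ ≤ ofReal (2 ^ p) * (ofReal (2 * S ^ p) + ofReal (2 * S ^ p)) := by
      rw [lintegral_const_mul _ (by fun_prop), lintegral_add_left (by fun_prop)]
      have i1 := lintegral_abs_re_rpow_le b' hp
      have i2 := lintegral_abs_re_rpow_le (fun i => -Complex.I * b' i) hp
      rw [hb'] at i1
      rw [hb''] at i2
      gcongr
    _ ≤ _ := by
      rw [← ofReal_add (by positivity) (by positivity), ← ofReal_mul (by positivity)]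
      refine ofReal_le_ofReal ?_
      rw [mul_rpow (x := 8) (by norm_num) hS0, show (8:ℝ) = 2 * 4 by norm_num,
        mul_rpow (x := 2) (by norm_num) (by norm_num)]
      have : (4:ℝ) ≤ 4 ^ p := by
        conv_lhs => rw [← rpow_one 4]
        exact rpow_le_rpow_of_exponent_le (by norm_num) hp
      have hSp : 0 ≤ S ^ p := by positivity
      calc (2 : ℝ) ^ p * (2 * S ^ p + 2 * S ^ p) = 2 ^ p * 4 * S ^ p := by ring
        _ ≤ _ := by gcongr

end

section

variable {ι : Type*} [Fintype ι]

/-- The product of standard complex Gaussians over a finite index set. -/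
abbrev gaussPi (ι : Type*) [Fintype ι] : Measure (ι → ℂ) :=
  Measure.pi fun _ : ι => stdComplexGaussian

/-- Moments of bilinear forms in two independent Gaussian families. -/
lemma eLpNorm_bilinear_le (a : ι → ι → ℂ) (τ τ' : Bool) {p : ℝ} (hp : 2 ≤ p) :
    eLpNorm (fun x : (ι → ℂ) × (ι → ℂ) => ∑ i, ∑ j, a i j * twist τ (x.1 i) * twist τ' (x.2 j))
        (ofReal p) ((gaussPi ι).prod (gaussPi ι))
      ≤ ofReal (64 * p * sqrt (∑ i, ∑ j, ‖a i j‖ ^ 2)) := by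
  have hp0 : 0 < p := by linarith
  set b : ι → (ι → ℂ) → ℂ := fun i y => ∑ j, a i j * twist τ' (y j) with hb
  have hbm : ∀ i, Measurable (b i) := fun i => by fun_prop
  set G : (ι → ℂ) → ℝ := fun y => ∑ i, ‖b i y‖ ^ 2 with hG
  have hG0 : ∀ y, 0 ≤ G y := fun y => sum_nonneg fun i _ => by positivity
  have hGm : Measurable G := by fun_prop
  have h1 : eLpNorm (fun x : (ι → ℂ) × (ι → ℂ) =>
        ∑ i, ∑ j, a i j * twist τ (x.1 i) * twist τ' (x.2 j))
        (ofReal p) ((gaussPi ι).prod (gaussPi ι))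
      ≤ eLpNorm (fun y => 8 * sqrt p * sqrt (G y)) (ofReal p) (gaussPi ι) := by
    rw [eLpNorm_ofReal hp0, eLpNorm_ofReal hp0, lintegral_prod_symm _ (by fun_prop)]
    refine ENNReal.rpow_le_rpow (lintegral_mono fun y => ?_) (by positivity)
    have h2 := eLpNorm_linear_le (fun i => b i y) τ (p := p) (by linarith)
    rw [eLpNorm_ofReal hp0, one_div, rpow_inv_le_iff hp0] at h2
    refine le_trans (le_of_eq ?_) (h2.trans (le_of_eq ?_))
    · refine lintegral_congr fun x => ?_
      congr 2
      refine sum_congr rfl fun i _ => ?_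
      rw [hb, sum_mul]
      exact sum_congr rfl fun j _ => by ring
    · rw [← ofReal_norm, norm_of_nonneg (by positivity)]
  have h3 : eLpNorm (fun y => 8 * sqrt p * sqrt (G y)) (ofReal p) (gaussPi ι)
      = ofReal (8 * sqrt p) * eLpNorm G (ofReal (p / 2)) (gaussPi ι) ^ (1/2 : ℝ)
      := by
    have : (fun y => 8 * sqrt p * sqrt (G y))
        = (8 * sqrt p) • (fun y => ‖G y‖ ^ (1/2 : ℝ)) := by
      ext y
      simp only [Pi.smul_apply, smul_eq_mul, sqrt_eq_rpow, norm_of_nonneg (hG0 y)]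
    rw [this, eLpNorm_const_smul, ← ofReal_norm, norm_of_nonneg (by positivity),
      eLpNorm_norm_rpow G (by norm_num : (0:ℝ) < 1/2), ← ofReal_mul hp0.le]
    congr 4
    ring
  have h4 : eLpNorm G (ofReal (p / 2)) (gaussPi ι)
      ≤ ∑ i, ofReal ((8 * sqrt p * sqrt (∑ j, ‖a i j‖ ^ 2)) ^ 2) := by
    have : G = ∑ i, fun y => ‖b i y‖ ^ (2:ℝ) := by
      ext y; simp [hG]
    rw [this]
    refine (eLpNorm_sum_le (fun i _ => ?_) ?_).trans (sum_le_sum fun i _ => ?_)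
    · have := hbm i
      exact Measurable.aestronglyMeasurable (by fun_prop)
    · exact ENNReal.one_le_ofReal.2 (by linarith)
    · rw [eLpNorm_norm_rpow (b i) (by norm_num : (0:ℝ) < 2), ← ofReal_mul (by positivity),
        show p / 2 * 2 = p by ring, ofReal_pow (by positivity)]
      have := eLpNorm_linear_le (a i) τ' (p := p) (by linarith)
      calc _ ≤ (ofReal (8 * sqrt p * sqrt (∑ j, ‖a i j‖ ^ 2))) ^ (2:ℝ) :=
            ENNReal.rpow_le_rpow this (by norm_num)
        _ = _ := by norm_num
  rw [h3] at h1
  refine h1.trans ?_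
  calc _ ≤ ofReal (8 * sqrt p) *
        (∑ i, ofReal ((8 * sqrt p * sqrt (∑ j, ‖a i j‖ ^ 2)) ^ 2)) ^ (1/2:ℝ) := by
        gcongr
    _ = _ := by
        rw [← ENNReal.ofReal_sum_of_nonneg (fun i _ => by positivity),
          ofReal_rpow_of_nonneg (sum_nonneg fun i _ => by positivity) (by norm_num),
          ← ofReal_mul (by positivity), ← sqrt_eq_rpow]
        congr 1
        have : ∑ i, (8 * sqrt p * sqrt (∑ j, ‖a i j‖ ^ 2)) ^ 2
            = (8 * sqrt p) ^ 2 * ∑ i, ∑ j, ‖a i j‖ ^ 2 := by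
          rw [mul_sum]
          refine sum_congr rfl fun i _ => ?_
          rw [mul_pow, sq_sqrt (sum_nonneg fun j _ => by positivity)]
        rw [this, sqrt_mul (by positivity), sqrt_sq (by positivity)]
        have hs := Real.mul_self_sqrt hp0.le
        calc _ = 64 * (sqrt p * sqrt p) * sqrt (∑ i, ∑ j, ‖a i j‖ ^ 2) := by ring
          _ = _ := by rw [hs]

lemma integral_dual_gaussPi (L : StrongDual ℝ (ι → ℂ)) : (gaussPi ι)[L] = 0 := by
  have hmp : MeasurePreserving (fun g : ι → ℂ => -g) (gaussPi ι) (gaussPi ι) := by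
    refine measurePreserving_pi (f := fun _ z => -z) _ _ fun i => ?_
    refine ⟨measurable_neg, ?_⟩
    refine Measure.ext_of_charFunDual ?_
    ext M
    have h0 : ∀ M : StrongDual ℝ ℂ, stdComplexGaussian[M] = 0 := by
      intro M
      rw [stdComplexGaussian, integral_map (by fun_prop) (by fun_prop)]
      have : ∀ x : ℝ × ℝ, M (measurableEquivRealProd.symm x)
          = M 1 * x.1 + M Complex.I * x.2 := by
        intro x
        have : measurableEquivRealProd.symm x = x.1 • (1:ℂ) + x.2 • Complex.I := by
          simp [measurableEquivRealProd, Complex.ext_iff]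
        rw [this, map_add, map_smul, map_smul]
        simp [mul_comm]
      simp_rw [this]
      have i1 : Integrable (fun x : ℝ × ℝ => x.1) ((gaussianReal 0 1).prod (gaussianReal 0 1)) :=
        Integrable.comp_fst (f := fun x : ℝ => x) IsGaussian.integrable_id _
      have i2 : Integrable (fun x : ℝ × ℝ => x.2) ((gaussianReal 0 1).prod (gaussianReal 0 1)) :=
        Integrable.comp_snd (f := fun x : ℝ => x) IsGaussian.integrable_id _
      rw [integral_add (i1.const_mul _) (i2.const_mul _), integral_const_mul, integral_const_mul,
        integral_fun_fst (f := fun x : ℝ => x), integral_fun_snd (f := fun x : ℝ => x)]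
      simp
    have e : (fun z : ℂ => -z) = ((-ContinuousLinearMap.id ℝ ℂ : ℂ →L[ℝ] ℂ) : ℂ → ℂ) := rfl
    rw [e, charFunDual_map, IsGaussian.charFunDual_eq, IsGaussian.charFunDual_eq]
    have e2 : (M ∘L (-ContinuousLinearMap.id ℝ ℂ) : StrongDual ℝ ℂ) = -M := by ext; simp
    rw [e2]
    have e3 : Var[(-M : StrongDual ℝ ℂ); stdComplexGaussian] = Var[M; stdComplexGaussian] := by
      have := variance_neg (X := (M : ℂ → ℝ)) (μ := stdComplexGaussian)
      simpa using this
    rw [e3, integral_complex_ofReal, integral_complex_ofReal, h0, h0]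
  have h := hmp.integral_comp' (g := fun g => L g) (f := MeasurableEquiv.neg (ι → ℂ))
  have h' : ∫ x, L (-x) ∂(gaussPi ι) = ∫ x, L x ∂(gaussPi ι) := h
  simp only [map_neg, integral_neg] at h'
  linarith

end

section

variable {ι : Type*} [Fintype ι]

instance : IsGaussian (gaussPi ι) := by
  have hi : iIndepFun (fun (i : ι) (g : ι → ℂ) => g i) (gaussPi ι) :=
    iIndepFun_pi (μ := fun _ : ι => stdComplexGaussian) (X := fun _ z => z) (fun i => by fun_prop)
  have h : HasGaussianLaw (fun (g : ι → ℂ) => (fun i => g i)) (gaussPi ι) := by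
    refine hi.hasGaussianLaw fun i => ⟨?_⟩
    rw [(measurePreserving_eval (fun _ : ι => stdComplexGaussian) i).map_eq]
    infer_instance
  have := h.isGaussian_map
  rwa [Measure.map_id'] at this

lemma memLp_twist_gaussPi (τ : Bool) (i : ι) (p : ℝ≥0∞) (hp : p ≠ ⊤) :
    MemLp (fun g : ι → ℂ => twist τ (g i)) p (gaussPi ι) := by
  have h := IsGaussian.memLp_id stdComplexGaussian p hp
  have h2 : MemLp (fun z => twist τ z) p stdComplexGaussian := by
    refine MemLp.of_le h (by fun_prop) (ae_of_all _ fun z => by simp)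
  exact h2.comp_measurePreserving (measurePreserving_eval (fun _ : ι => stdComplexGaussian) i)

/-- `E[φ(g) φ'(g)]` for a standard complex Gaussian `g`: `2` if `φ ≠ φ'`, `0` otherwise. -/
def pairMean (τ τ' : Bool) : ℂ := if τ = τ' then 0 else 2

lemma integral_twist_mul_twist (τ τ' : Bool) :
    ∫ z, twist τ z * twist τ' z ∂stdComplexGaussian = pairMean τ τ' := by
  have hL : MemLp (fun x : ℝ => x) 2 (gaussianReal 0 1) := IsGaussian.memLp_id _ _ (by simp)
  have hsq : Integrable (fun x : ℝ => x ^ 2) (gaussianReal 0 1) := hL.integrable_sq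
  have hid : Integrable (fun x : ℝ => x) (gaussianReal 0 1) := IsGaussian.integrable_id
  have h2 : ∫ x, x ^ 2 ∂(gaussianReal 0 1) = 1 := by
    have := variance_fun_id_gaussianReal (μ := 0) (v := 1)
    rw [variance_of_integral_eq_zero (by fun_prop) (by simp)] at this
    simpa using this
  set G := (gaussianReal 0 1).prod (gaussianReal 0 1) with hG
  have i1 : Integrable (fun x : ℝ × ℝ => ((x.1 ^ 2 : ℝ) : ℂ)) G := (hsq.comp_fst _).ofReal
  have i2 : Integrable (fun x : ℝ × ℝ => ((x.2 ^ 2 : ℝ) : ℂ)) G := (hsq.comp_snd _).ofReal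
  have i3 : Integrable (fun x : ℝ × ℝ => ((x.1 * x.2 : ℝ) : ℂ)) G := (hid.mul_prod hid).ofReal
  have i12 : Integrable (fun x : ℝ × ℝ => ((x.1 ^ 2 : ℝ) : ℂ) - ((x.2 ^ 2 : ℝ) : ℂ)) G := i1.sub i2
  have e1 : ∫ x, ((x.1 ^ 2 : ℝ) : ℂ) ∂G = 1 := by
    rw [integral_complex_ofReal, integral_fun_fst (f := fun x : ℝ => x ^ 2), h2]; simp
  have e2 : ∫ x, ((x.2 ^ 2 : ℝ) : ℂ) ∂G = 1 := by
    rw [integral_complex_ofReal, integral_fun_snd (f := fun x : ℝ => x ^ 2), h2]; simp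
  have e3 : ∫ x, ((x.1 * x.2 : ℝ) : ℂ) ∂G = 0 := by
    rw [integral_complex_ofReal, integral_prod_mul (f := fun x : ℝ => x) (g := fun x : ℝ => x)]; simp
  rw [stdComplexGaussian, integral_map (by fun_prop) (by fun_prop)]
  have hz : ∀ x : ℝ × ℝ, measurableEquivRealProd.symm x = (x.1 : ℂ) + x.2 * Complex.I := by
    intro x
    simp [measurableEquivRealProd, Complex.ext_iff]
  have hI := Complex.I_mul_I
  rcases Bool.eq_false_or_eq_true τ with h | h <;> rcases Bool.eq_false_or_eq_true τ' with h' | h'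
  · have : ∀ x : ℝ × ℝ, twist τ (measurableEquivRealProd.symm x)
        * twist τ' (measurableEquivRealProd.symm x) =
        ((x.1 ^ 2 : ℝ) : ℂ) - ((x.2 ^ 2 : ℝ) : ℂ) - 2 * Complex.I * ((x.1 * x.2 : ℝ) : ℂ) := by
      intro x; rw [hz, h, h']; simp; linear_combination (x.2:ℂ) ^ 2 * hI
    simp_rw [this]
    rw [integral_sub i12 (i3.const_mul _), integral_sub i1 i2, integral_const_mul, e1, e2,
      e3]
    simp [pairMean, h, h']
  · have : ∀ x : ℝ × ℝ, twist τ (measurableEquivRealProd.symm x)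
        * twist τ' (measurableEquivRealProd.symm x) =
        ((x.1 ^ 2 : ℝ) : ℂ) + ((x.2 ^ 2 : ℝ) : ℂ) := by
      intro x; rw [hz, h, h']; simp; linear_combination -(x.2:ℂ) ^ 2 * hI
    simp_rw [this]
    rw [integral_add i1 i2, e1, e2]
    simp [pairMean, h, h']; norm_num
  · have : ∀ x : ℝ × ℝ, twist τ (measurableEquivRealProd.symm x)
        * twist τ' (measurableEquivRealProd.symm x) =
        ((x.1 ^ 2 : ℝ) : ℂ) + ((x.2 ^ 2 : ℝ) : ℂ) := by
      intro x; rw [hz, h, h']; simp; linear_combination -(x.2:ℂ) ^ 2 * hI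
    simp_rw [this]
    rw [integral_add i1 i2, e1, e2]
    simp [pairMean, h, h']; norm_num
  · have : ∀ x : ℝ × ℝ, twist τ (measurableEquivRealProd.symm x)
        * twist τ' (measurableEquivRealProd.symm x) =
        ((x.1 ^ 2 : ℝ) : ℂ) - ((x.2 ^ 2 : ℝ) : ℂ) + 2 * Complex.I * ((x.1 * x.2 : ℝ) : ℂ) := by
      intro x; rw [hz, h, h']; simp; linear_combination (x.2:ℂ) ^ 2 * hI
    simp_rw [this]
    rw [integral_add i12 (i3.const_mul _), integral_sub i1 i2, integral_const_mul, e1, e2,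
      e3]
    simp [pairMean, h, h']

lemma integral_twist_stdComplexGaussian (τ : Bool) :
    ∫ z, twist τ z ∂stdComplexGaussian = 0 := by
  have hid : Integrable (fun x : ℝ => x) (gaussianReal 0 1) := IsGaussian.integrable_id
  set G := (gaussianReal 0 1).prod (gaussianReal 0 1)
  have i1 : Integrable (fun x : ℝ × ℝ => ((x.1 : ℝ) : ℂ)) G := (hid.comp_fst _).ofReal
  have i2 : Integrable (fun x : ℝ × ℝ => ((x.2 : ℝ) : ℂ)) G := (hid.comp_snd _).ofReal
  have e1 : ∫ x, ((x.1 : ℝ) : ℂ) ∂G = 0 := by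
    rw [integral_complex_ofReal, integral_fun_fst (f := fun x : ℝ => x)]; simp
  have e2 : ∫ x, ((x.2 : ℝ) : ℂ) ∂G = 0 := by
    rw [integral_complex_ofReal, integral_fun_snd (f := fun x : ℝ => x)]; simp
  rw [stdComplexGaussian, integral_map (by fun_prop) (by fun_prop)]
  have : ∀ x : ℝ × ℝ, twist τ (measurableEquivRealProd.symm x)
      = (x.1 : ℂ) + twist τ Complex.I * x.2 := by
    intro x
    have hz : measurableEquivRealProd.symm x = (x.1 : ℂ) + x.2 * Complex.I := by
      simp [measurableEquivRealProd, Complex.ext_iff]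
    rw [hz, twist_add, twist_mul, twist_ofReal, twist_ofReal, mul_comm]
  simp_rw [this]
  rw [integral_add i1 (i2.const_mul _), integral_const_mul, e1, e2]
  simp

lemma integral_twist_mul_twist_gaussPi [DecidableEq ι] (τ τ' : Bool) (i j : ι) :
    ∫ g, twist τ (g i) * twist τ' (g j) ∂(gaussPi ι) = if i = j then pairMean τ τ' else 0 := by
  have hev : ∀ (i : ι) (f : ℂ → ℂ), Measurable f →
      ∫ g, f (g i) ∂(gaussPi ι) = ∫ z, f z ∂stdComplexGaussian := by
    intro i f hf
    rw [← (measurePreserving_eval (fun _ : ι => stdComplexGaussian) i).map_eq,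
      integral_map (measurable_pi_apply i).aemeasurable hf.aestronglyMeasurable]
  split_ifs with h
  · subst h
    rw [← integral_twist_mul_twist]
    exact hev i (fun z => twist τ z * twist τ' z) (by fun_prop)
  · have hi : iIndepFun (fun (i : ι) (g : ι → ℂ) => g i) (gaussPi ι) :=
      iIndepFun_pi (μ := fun _ : ι => stdComplexGaussian) (X := fun _ z => z) (fun i => by fun_prop)
    have h2 := (hi.indepFun h).comp (measurable_twist τ) (measurable_twist τ')
    have h3 := h2.integral_fun_mul_eq_mul_integral
      ((measurable_twist τ).comp (measurable_pi_apply i)).aestronglyMeasurable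
      ((measurable_twist τ').comp (measurable_pi_apply j)).aestronglyMeasurable
    simp only [Function.comp] at h3
    rw [h3, hev i _ (measurable_twist τ), integral_twist_stdComplexGaussian, zero_mul]

lemma bilinear_polarization (a : ι → ι → ℂ) (τ τ' : Bool) (x y : ι → ℂ) :
    (∑ i, ∑ j, a i j * twist τ (x i) * twist τ' (x j))
        - ∑ i, ∑ j, a i j * twist τ (y i) * twist τ' (y j)
      = -((∑ i, ∑ j, a i j * twist τ (((sqrt 2 / 2) • x + (sqrt 2 / 2) • y) i)
            * twist τ' ((-(sqrt 2 / 2) • x + (sqrt 2 / 2) • y) j))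
          + ∑ i, ∑ j, a i j * twist τ ((-(sqrt 2 / 2) • x + (sqrt 2 / 2) • y) i)
            * twist τ' (((sqrt 2 / 2) • x + (sqrt 2 / 2) • y) j)) := by
  rw [← sum_sub_distrib, ← sum_add_distrib, ← sum_neg_distrib]
  refine sum_congr rfl fun i _ => ?_
  rw [← sum_sub_distrib, ← sum_add_distrib, ← sum_neg_distrib]
  refine sum_congr rfl fun j _ => ?_
  have hs : ((sqrt 2 / 2 : ℝ) : ℂ) * ((sqrt 2 / 2 : ℝ) : ℂ) = 1 / 2 := by
    rw [← Complex.ofReal_mul]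
    have : (sqrt 2 / 2) * (sqrt 2 / 2) = 1 / 2 := by
      have := Real.mul_self_sqrt (show (0:ℝ) ≤ 2 by norm_num)
      linarith
    rw [this]; norm_num
  generalize sqrt 2 / 2 = r at hs ⊢
  simp only [Pi.add_apply, Pi.smul_apply, real_smul, twist_add, twist_mul, twist_ofReal]
  push_cast
  linear_combination (2 * a i j * (-(twist τ (x i) * twist τ' (x j)) +
      twist τ (y i) * twist τ' (y j))) * hs

lemma eLpNorm_symmetrized_le (a : ι → ι → ℂ) (τ τ' : Bool) {p : ℝ} (hp : 2 ≤ p)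
    (B : (ι → ℂ) → (ι → ℂ) → ℂ)
    (hB : ∀ x y, B x y = ∑ i, ∑ j, a i j * twist τ (x i) * twist τ' (y j)) :
    eLpNorm (fun x : (ι → ℂ) × (ι → ℂ) => B x.1 x.1 - B x.2 x.2) (ofReal p)
        ((gaussPi ι).prod (gaussPi ι))
      ≤ ofReal (128 * p * sqrt (∑ i, ∑ j, ‖a i j‖ ^ 2)) := by
  have hp0 : 0 < p := by linarith
  have hp1 : 1 ≤ ofReal p :=
    ENNReal.one_le_ofReal.2 (by linarith)
  have hB2 : eLpNorm (fun x : (ι → ℂ) × (ι → ℂ) => B x.1 x.2) (ofReal p)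
      ((gaussPi ι).prod (gaussPi ι))
      ≤ ofReal (64 * p * sqrt (∑ i, ∑ j, ‖a i j‖ ^ 2)) := by
    simp_rw [hB]
    exact eLpNorm_bilinear_le a τ τ' hp
  have hBm : Measurable fun x : (ι → ℂ) × (ι → ℂ) => B x.1 x.2 := by
    simp_rw [hB]; fun_prop
  have hm1 : AEStronglyMeasurable (fun x : (ι → ℂ) × (ι → ℂ) => B x.1 x.2)
    ((gaussPi ι).prod (gaussPi ι)) := hBm.aestronglyMeasurable
  have hm2 : AEStronglyMeasurable (fun x : (ι → ℂ) × (ι → ℂ) => B x.2 x.1)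
    ((gaussPi ι).prod (gaussPi ι)) := (hBm.comp measurable_swap).aestronglyMeasurable
  have hsym := eLpNorm_comp_measurePreserving (p := ofReal p) hm1
    (Measure.measurePreserving_swap (μ := gaussPi ι) (ν := gaussPi ι))
  change eLpNorm (fun x : (ι → ℂ) × (ι → ℂ) => B x.2 x.1) _ _ = _ at hsym
  set F : (ι → ℂ) × (ι → ℂ) → ℂ := fun x => B x.1 x.2 + B x.2 x.1 with hF
  have hFm : AEStronglyMeasurable F ((gaussPi ι).prod (gaussPi ι)) := hm1.add hm2
  have hF2 : eLpNorm F (ofReal p) ((gaussPi ι).prod (gaussPi ι))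
      ≤ ofReal (128 * p * sqrt (∑ i, ∑ j, ‖a i j‖ ^ 2)) := by
    refine (eLpNorm_add_le hm1 hm2 hp1).trans ?_
    rw [hsym]
    refine (add_le_add hB2 hB2).trans (le_of_eq ?_)
    rw [← ofReal_add (by positivity) (by positivity)]
    congr 1; ring
  have hmp : MeasurePreserving (ContinuousLinearMap.rotation (E := ι → ℂ) (Real.pi / 4))
      ((gaussPi ι).prod (gaussPi ι)) ((gaussPi ι).prod (gaussPi ι)) :=
    ⟨(ContinuousLinearMap.rotation (E := ι → ℂ) (Real.pi / 4)).continuous.measurable,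
      IsGaussian.map_rotation_eq_self_of_forall_strongDual_eq_zero
        (integral_dual_gaussPi (ι := ι)) (Real.pi / 4)⟩
  have hid : (fun x : (ι → ℂ) × (ι → ℂ) => B x.1 x.1 - B x.2 x.2)
      = -(F ∘ (ContinuousLinearMap.rotation (E := ι → ℂ) (Real.pi / 4))) := by
    ext x
    simp only [hF, Function.comp, Pi.neg_apply, hB, ContinuousLinearMap.rotation_apply,
      Real.cos_pi_div_four, Real.sin_pi_div_four]
    exact bilinear_polarization a τ τ' x.1 x.2
  rw [hid, eLpNorm_neg, eLpNorm_comp_measurePreserving hFm hmp]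
  exact hF2

/-- Moments of centred quadratic forms in Gaussian variables grow linearly. -/
lemma eLpNorm_quadratic_sub_mean_le (a : ι → ι → ℂ) (τ τ' : Bool) {p : ℝ} (hp : 2 ≤ p) :
    eLpNorm (fun g : ι → ℂ => (∑ i, ∑ j, a i j * twist τ (g i) * twist τ' (g j))
          - ∑ i, a i i * pairMean τ τ')
        (ofReal p) (gaussPi ι)
      ≤ ofReal (128 * p * sqrt (∑ i, ∑ j, ‖a i j‖ ^ 2)) := by
  classical
  have hp0 : 0 < p := by linarith
  have hp1 : 1 ≤ ofReal p :=
    ENNReal.one_le_ofReal.2 (by linarith)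
  set B : (ι → ℂ) → (ι → ℂ) → ℂ := fun x y => ∑ i, ∑ j, a i j * twist τ (x i) * twist τ' (y j)
    with hB
  have hterm : ∀ i j, Integrable (fun g : ι → ℂ => a i j * twist τ (g i) * twist τ' (g j))
      (gaussPi ι) := by
    intro i j
    have := (memLp_twist_gaussPi τ i 2 (by simp)).integrable_mul
      (memLp_twist_gaussPi τ' j 2 (by simp))
    have h2 := this.const_mul (a i j)
    refine h2.congr (ae_of_all _ fun g => ?_)
    simp [mul_assoc]
  have hint : Integrable (fun g => B g g) (gaussPi ι) :=
    integrable_finsetSum _ fun i _ => integrable_finsetSum _ fun j _ => hterm i j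
  have hmean : ∫ g, B g g ∂(gaussPi ι) = ∑ i, a i i * pairMean τ τ' := by
    rw [hB]
    rw [integral_finsetSum _ fun i _ => integrable_finsetSum _ fun j _ => hterm i j]
    refine sum_congr rfl fun i _ => ?_
    rw [integral_finsetSum _ fun j _ => hterm i j]
    simp_rw [mul_assoc, integral_const_mul, integral_twist_mul_twist_gaussPi]
    simp
  rw [← hmean]
  have hBm : Measurable fun x : (ι → ℂ) × (ι → ℂ) => B x.1 x.2 := by fun_prop
  have hBd : Measurable fun g : ι → ℂ => B g g := by fun_prop
  have h1 : eLpNorm (fun g => B g g - ∫ g, B g g ∂(gaussPi ι)) (ofReal p) (gaussPi ι)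
      ≤ eLpNorm (fun x : (ι → ℂ) × (ι → ℂ) => B x.1 x.1 - B x.2 x.2) (ofReal p)
        ((gaussPi ι).prod (gaussPi ι)) := by
    rw [eLpNorm_ofReal hp0, eLpNorm_ofReal hp0, lintegral_prod _ (by fun_prop)]
    refine ENNReal.rpow_le_rpow (lintegral_mono fun x => ?_) (by positivity)
    have e : B x x - ∫ g, B g g ∂(gaussPi ι) = ∫ y, (B x x - B y y) ∂(gaussPi ι) := by
      rw [integral_sub (integrable_const _) hint]; simp
    rw [e]
    have hm : Measurable fun y => B x x - B y y := by fun_prop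
    have := eLpNorm_le_eLpNorm_of_exponent_le (μ := gaussPi ι) hp1
      (f := fun y => B x x - B y y) hm.aestronglyMeasurable
    rw [eLpNorm_one_eq_lintegral_enorm,
      eLpNorm_ofReal hp0, one_div] at this
    exact (ENNReal.le_rpow_inv_iff hp0).1 ((enorm_integral_le_lintegral_enorm _).trans this)
  exact h1.trans (eLpNorm_symmetrized_le a τ τ' hp B fun _ _ => rfl)

end

section

/-! ### The Japanese bracket -/

lemma nsq_nonneg (k : Freq) : 0 ≤ nsq k := sum_nonneg fun _ _ => sq_nonneg _

/-- The Japanese bracket `⟨k⟩ = (1+|k|²)^{1/2}`. -/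
def br (k : Freq) : ℝ := sqrt (1 + nsq k)

lemma br_sq (k : Freq) : br k ^ 2 = 1 + nsq k := sq_sqrt (by linarith [nsq_nonneg k])

lemma one_le_br (k : Freq) : 1 ≤ br k := by
  rw [br, Real.one_le_sqrt]; linarith [nsq_nonneg k]

lemma br_pos (k : Freq) : 0 < br k := lt_of_lt_of_le one_pos (one_le_br k)

lemma one_add_nsq_rpow (k : Freq) (σ : ℝ) : (1 + nsq k) ^ σ = br k ^ (2 * σ) := by
  rw [← br_sq, ← rpow_natCast, ← rpow_mul (br_pos k).le]; norm_num

@[simp] lemma br_zero : br 0 = 1 := by simp [br, nsq]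

lemma br_neg (k : Freq) : br (-k) = br k := by simp [br, nsq]

lemma nsq_neg (k : Freq) : nsq (-k) = nsq k := by simp [nsq]

lemma br_eq_norm (k : Freq) : br k = sqrt (1 + ‖toEuclid k‖ ^ 2) := by
  rw [br, EuclideanSpace.norm_sq_eq]
  simp [toEuclid, nsq]

lemma norm_toEuclid_sq (k : Freq) : ‖toEuclid k‖ ^ 2 = nsq k := by
  rw [EuclideanSpace.norm_sq_eq]; simp [toEuclid, nsq]

lemma toEuclid_add (k l : Freq) : toEuclid (k + l) = toEuclid k + toEuclid l := by
  ext i; simp [toEuclid]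

lemma norm_toEuclid_le_br (k : Freq) : ‖toEuclid k‖ ≤ br k := by
  rw [br_eq_norm]; exact Real.le_sqrt_of_sq_le (by linarith)

lemma br_add_le (k l : Freq) : br (k + l) ≤ br k + br l := by
  have hk := norm_toEuclid_le_br k
  have hl := norm_toEuclid_le_br l
  rw [br_eq_norm (k + l)]
  refine Real.sqrt_le_iff.2 ⟨by linarith [one_le_br k, one_le_br l], ?_⟩
  have h1 : ‖toEuclid (k + l)‖ ≤ ‖toEuclid k‖ + ‖toEuclid l‖ := by
    rw [toEuclid_add]; exact norm_add_le _ _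
  have h2 := br_sq k
  have h3 := br_sq l
  rw [← norm_toEuclid_sq] at h2 h3
  have h4 : ‖toEuclid (k + l)‖ ^ 2 ≤ (‖toEuclid k‖ + ‖toEuclid l‖) ^ 2 :=
    pow_le_pow_left₀ (norm_nonneg _) h1 2
  nlinarith [norm_nonneg (toEuclid k), norm_nonneg (toEuclid l), one_le_br k, one_le_br l,
    mul_le_mul hk hl (norm_nonneg _) (br_pos k).le]

lemma br_sub_le (k l : Freq) : br (k - l) ≤ br k + br l := by
  rw [sub_eq_add_neg, ← br_neg l]; exact br_add_le k (-l)

lemma br_sum_le {α : Type*} (t : Finset α) (f : α → Freq) :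
    br (∑ i ∈ t, f i) ≤ 1 + ∑ i ∈ t, br (f i) := by
  classical
  induction t using Finset.induction_on with
  | empty => simp
  | insert a t ha ih =>
    rw [Finset.sum_insert ha, Finset.sum_insert ha]
    linarith [br_add_le (f a) (∑ i ∈ t, f i)]

lemma summable_pi_prod {n : ℕ} {α : Type*} (f : Fin n → α → ℝ) (h0 : ∀ i a, 0 ≤ f i a)
    (hf : ∀ i, Summable (f i)) : Summable fun v : Fin n → α => ∏ i, f i (v i) := by
  induction n with
  | zero => exact (hasSum_fintype _).summable
  | succ n ih =>
    have h1 := ih (fun i => f i.succ) (fun i a => h0 _ a) (fun i => hf _)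
    have h2 := Summable.mul_of_nonneg (hf 0) h1 (h0 0)
      (fun v => prod_nonneg fun i _ => h0 _ _)
    refine ((Fin.consEquiv (fun _ => α)).symm.summable_iff.2 h2).congr fun v => ?_
    rw [Fin.prod_univ_succ]
    rfl

lemma summable_br_rpow {a : ℝ} (ha : 3 < a) : Summable fun k : Freq => br k ^ (-a) := by
  have h1 : Summable fun m : ℤ => (1 + (m : ℝ) ^ 2) ^ (-(a / 6)) := by
    have h0 : Summable fun m : ℤ => |(m : ℝ)| ^ (-(a / 3)) :=
      Real.summable_abs_int_rpow (by linarith)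
    refine Summable.of_norm_bounded_eventually h0 ?_
    refine (Set.finite_singleton (0:ℤ)).subset fun m hm => ?_
    by_contra hne
    apply hm
    change ‖(1 + (m:ℝ) ^ 2) ^ (-(a / 6))‖ ≤ |(m:ℝ)| ^ (-(a / 3))
    have hm0 : (0:ℝ) < |(m:ℝ)| := by simpa using hne
    rw [norm_of_nonneg (by positivity)]
    calc (1 + (m:ℝ)^2) ^ (-(a/6)) ≤ (|(m:ℝ)| ^ 2) ^ (-(a/6)) := by
          apply Real.rpow_le_rpow_of_nonpos (by positivity) _ (by linarith)
          rw [sq_abs]; linarith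
      _ = |(m : ℝ)| ^ (-(a / 3)) := by
          rw [← rpow_natCast, ← rpow_mul hm0.le]; congr 1; push_cast; ring
  have h2 := summable_pi_prod (n := 3) (fun _ (m : ℤ) => (1 + (m : ℝ) ^ 2) ^ (-(a / 6)))
    (fun _ m => by positivity) (fun _ => h1)
  refine Summable.of_nonneg_of_le (fun k => (rpow_pos_of_pos (br_pos k) _).le) (fun k => ?_) h2
  have hk : ∀ i, 1 + (k i : ℝ) ^ 2 ≤ br k ^ 2 := by
    intro i
    rw [br_sq, nsq]
    gcongr
    exact single_le_sum (f := fun i => (k i : ℝ) ^ 2) (fun i _ => sq_nonneg _)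
      (Finset.mem_univ i)
  calc br k ^ (-a) = ∏ i : Fin 3, (br k ^ 2) ^ (-(a/6)) := by
        rw [prod_const, card_univ, Fintype.card_fin, ← rpow_natCast,
          ← rpow_natCast, ← rpow_mul (by have := br_pos k; positivity), ← rpow_mul (br_pos k).le]
        congr 1; push_cast; ring
    _ ≤ _ := by
        refine Finset.prod_le_prod (fun i _ => by positivity) fun i _ => ?_
        exact Real.rpow_le_rpow_of_nonpos (by positivity) (hk i) (by linarith)

lemma norm_le_of_mem_sobBall {σ R : ℝ} (hR : 0 ≤ R) {u : Coeff} (hu : u ∈ sobBall σ R) (k : Freq) :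
    ‖u k‖ ≤ R * br k ^ (-σ) := by
  have h1 : ofReal ((1 + nsq k) ^ σ * ‖u k‖ ^ 2) ^ (1/2 : ℝ) ≤ ofReal R :=
    (ENNReal.rpow_le_rpow (le_tsum k) (by norm_num)).trans hu
  have h0 : 0 ≤ (1 + nsq k) ^ σ := rpow_nonneg (by linarith [nsq_nonneg k]) _
  rw [ofReal_rpow_of_nonneg (by positivity) (by norm_num),
    ENNReal.ofReal_le_ofReal_iff hR, ← sqrt_eq_rpow, sqrt_mul h0,
    sqrt_sq (norm_nonneg _), one_add_nsq_rpow, sqrt_eq_rpow,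
    ← rpow_mul (br_pos k).le] at h1
  have h2 : 2 * σ * (1/2) = σ := by ring
  rw [h2] at h1
  rw [rpow_neg (br_pos k).le, ← div_eq_mul_inv, le_div_iff₀ (rpow_pos_of_pos (br_pos k) _)]
  linarith

lemma sobBall_mono {σ σ' R : ℝ} (h : σ ≤ σ') : sobBall σ' R ⊆ sobBall σ R := by
  intro u hu
  refine le_trans (b := sobNorm σ' u) ?_ hu
  unfold sobNorm
  gcongr with k
  linarith [nsq_nonneg k]

/-! ### Quadratic forms under the Gaussian measure -/

/-- The variance weight `(1+|k|^{2s})^{-1}`. -/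
def wt (s : ℝ) (k : Freq) : ℝ := (1 + nsq k ^ s)⁻¹

lemma wt_pos (s : ℝ) (k : Freq) : 0 < wt s k :=
  inv_pos.2 (by linarith [rpow_nonneg (nsq_nonneg k) s])

lemma measurable_sobScale (s : ℝ) : Measurable (fun (g : Coeff) (k : Freq) =>
    g k / (sqrt (1 + nsq k ^ s) : ℂ)) := by fun_prop

instance (s : ℝ) : IsProbabilityMeasure (gaussianSob s) :=
  Measure.isProbabilityMeasure_map (measurable_sobScale s).aemeasurable

/-- Mean of `φ(u_k) φ'(u_l)`. -/
def covTerm (s : ℝ) (τ τ' : Bool) (k l : Freq) : ℂ :=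
  if k = l then (wt s k : ℂ) * pairMean τ τ' else 0

lemma eLpNorm_gaussianSob_quadratic_le {α : Type*} (s : ℝ) (T : Finset α) (x y : α → Freq)
    (hinj : ∀ κ ∈ T, ∀ κ' ∈ T, x κ = x κ' → y κ = y κ' → κ = κ') (c : α → ℂ) (τ τ' : Bool)
    {p : ℝ} (hp : 2 ≤ p) :
    eLpNorm (fun u : Coeff => ∑ κ ∈ T, c κ * (twist τ (u (x κ)) * twist τ' (u (y κ))
        - covTerm s τ τ' (x κ) (y κ))) (ofReal p) (gaussianSob s)
      ≤ ofReal (128 * p * sqrt (∑ κ ∈ T, ‖c κ‖ ^ 2 * (wt s (x κ) * wt s (y κ)))) := by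
  classical
  set S : Finset Freq := T.image x ∪ T.image y with hS
  set d : α → ℂ := fun κ => c κ * ((sqrt (wt s (x κ)) * sqrt (wt s (y κ)) : ℝ) : ℂ)
    with hd
  set a : S → S → ℂ := fun i j => ∑ κ ∈ T with x κ = i ∧ y κ = j, d κ with ha
  have hmain := eLpNorm_quadratic_sub_mean_le a τ τ' hp
  have hsum : ∀ (f : S → S → ℂ), ∑ i, ∑ j, a i j * f i j = ∑ κ ∈ T, d κ *
      (if h : x κ ∈ S ∧ y κ ∈ S then f ⟨x κ, h.1⟩ ⟨y κ, h.2⟩ else 0) := by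
    intro f
    simp only [ha, sum_mul, Finset.sum_filter]
    simp_rw [sum_comm (s := Finset.univ) (t := T)]
    refine sum_congr rfl fun κ hκ => ?_
    have h : x κ ∈ S ∧ y κ ∈ S := ⟨Finset.mem_union_left _ (Finset.mem_image_of_mem x hκ),
      Finset.mem_union_right _ (Finset.mem_image_of_mem y hκ)⟩
    rw [dif_pos h, sum_eq_single ⟨x κ, h.1⟩, sum_eq_single ⟨y κ, h.2⟩]
    · simp
    · intro j _ hj
      rw [if_neg, zero_mul]
      rintro ⟨_, h2⟩; exact hj (Subtype.ext h2.symm)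
    · simp
    · intro i _ hi
      refine sum_eq_zero fun j _ => ?_
      rw [if_neg, zero_mul]
      rintro ⟨h2, _⟩; exact hi (Subtype.ext h2.symm)
    · simp
  have hHS : ∑ i, ∑ j, ‖a i j‖ ^ 2 = ∑ κ ∈ T, ‖c κ‖ ^ 2 * (wt s (x κ) * wt s (y κ)) := by
    have h1 : ∀ i j, ‖a i j‖ ^ 2 = ∑ κ ∈ T with x κ = i ∧ y κ = j, ‖d κ‖ ^ 2 := by
      intro i j
      rw [ha]
      have hc : (T.filter fun κ => x κ = i ∧ y κ = j).card ≤ 1 := by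
        rw [Finset.card_le_one]
        intro κ hκ κ' hκ'
        rw [mem_filter] at hκ hκ'
        exact hinj κ hκ.1 κ' hκ'.1 (hκ.2.1.trans hκ'.2.1.symm) (hκ.2.2.trans hκ'.2.2.symm)
      rcases Nat.le_one_iff_eq_zero_or_eq_one.1 hc with h | h
      · simp [Finset.card_eq_zero.1 h]
      · obtain ⟨κ, hκ⟩ := Finset.card_eq_one.1 h
        simp [hκ]
    simp_rw [h1, Finset.sum_filter]
    simp_rw [sum_comm (s := Finset.univ) (t := T)]
    refine sum_congr rfl fun κ hκ => ?_
    have h : x κ ∈ S ∧ y κ ∈ S := ⟨Finset.mem_union_left _ (Finset.mem_image_of_mem x hκ),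
      Finset.mem_union_right _ (Finset.mem_image_of_mem y hκ)⟩
    rw [sum_eq_single ⟨x κ, h.1⟩, sum_eq_single ⟨y κ, h.2⟩]
    · rw [if_pos ⟨rfl, rfl⟩, hd]
      simp only [norm_mul, norm_real, norm_eq_abs, mul_pow, sq_abs]
      rw [sq_sqrt (wt_pos s _).le, sq_sqrt (wt_pos s _).le]
    · intro j _ hj
      rw [if_neg]
      rintro ⟨_, h2⟩; exact hj (Subtype.ext h2.symm)
    · simp
    · intro i _ hi
      refine sum_eq_zero fun j _ => ?_
      rw [if_neg]
      rintro ⟨h2, _⟩; exact hi (Subtype.ext h2.symm)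
    · simp
  rw [hHS] at hmain
  refine le_trans (le_of_eq ?_) hmain
  have hmeasF : Measurable (fun u : Coeff => ∑ κ ∈ T, c κ * (twist τ (u (x κ)) * twist τ' (u (y κ))
        - covTerm s τ τ' (x κ) (y κ))) := by fun_prop
  rw [gaussianSob, eLpNorm_map_measure hmeasF.aestronglyMeasurable
    (measurable_sobScale s).aemeasurable]
  have hmp : MeasurePreserving (S.restrict : Coeff → (S → ℂ))
      (Measure.infinitePi fun _ : Freq => stdComplexGaussian) (gaussPi S) :=
    ⟨by fun_prop, Measure.infinitePi_map_restrict (μ := fun _ : Freq => stdComplexGaussian)⟩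
  have hmG : Measurable (fun g : S → ℂ => (∑ i, ∑ j, a i j * twist τ (g i) * twist τ' (g j))
          - ∑ i, a i i * pairMean τ τ') := by fun_prop
  rw [← eLpNorm_comp_measurePreserving hmG.aestronglyMeasurable hmp]
  congr 1
  ext g
  simp only [Function.comp]
  have e1 : ∑ i, ∑ j, a i j * twist τ (S.restrict g i) * twist τ' (S.restrict g j)
      = ∑ i, ∑ j, a i j * (twist τ (S.restrict g i) * twist τ' (S.restrict g j)) := by
    simp_rw [mul_assoc]
  have e2 : ∑ i, a i i * pairMean τ τ' = ∑ i, ∑ j, a i j * (if i = j then pairMean τ τ' else 0) := by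
    refine sum_congr rfl fun i _ => ?_
    rw [sum_eq_single i]
    · simp
    · intro j _ hj; rw [if_neg hj.symm, mul_zero]
    · simp
  rw [e1, e2, hsum, hsum, ← sum_sub_distrib]
  refine sum_congr rfl fun κ hκ => ?_
  have h : x κ ∈ S ∧ y κ ∈ S := ⟨Finset.mem_union_left _ (Finset.mem_image_of_mem x hκ),
    Finset.mem_union_right _ (Finset.mem_image_of_mem y hκ)⟩
  rw [dif_pos h, dif_pos h, ← mul_sub, hd]
  have hsc : ∀ (τ : Bool) (k : Freq), twist τ (g k / (sqrt (1 + nsq k ^ s) : ℂ))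
      = (sqrt (wt s k) : ℂ) * twist τ (g k) := by
    intro τ k
    rw [wt, Real.sqrt_inv, div_eq_mul_inv, ← Complex.ofReal_inv, twist_mul, twist_ofReal, mul_comm]
  rw [hsc, hsc, covTerm]
  simp only [Finset.restrict, Subtype.mk.injEq]
  split_ifs with hxy
  · have : ((wt s (x κ) : ℝ) : ℂ) = (sqrt (wt s (x κ)) : ℂ) * (sqrt (wt s (y κ)) : ℂ) := by
      rw [← hxy, ← Complex.ofReal_mul, Real.mul_self_sqrt (wt_pos s _).le]
    rw [this]; push_cast; ring
  · push_cast; ring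

end

section

/-! ### Multilinear forms and their low-frequency factors -/

/-- The parity of a slot: odd slots carry a complex conjugate. -/
def slotConj {n : ℕ} (m : Fin n) : Bool := decide ((m : ℕ) % 2 = 1)

/-- The monomial `û_{k₀} conj(û_{k₁}) û_{k₂} ⋯`. -/
def mono {n : ℕ} (u : Coeff) (κ : Fin n → Freq) : ℂ := ∏ m, twist (slotConj m) (u (κ m))

/-- The slots other than `i`, `i'`. -/
def lowSlots {n : ℕ} (i i' : Fin n) : Finset (Fin n) := Finset.univ.filter fun m => m ≠ i ∧ m ≠ i'

/-- The monomial with the slots `i`, `i'` left out. -/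
def lowMono {n : ℕ} (i i' : Fin n) (u : Coeff) (κ : Fin n → Freq) : ℂ :=
  ∏ m ∈ lowSlots i i', twist (slotConj m) (u (κ m))

/-- The product of the brackets of the frequencies in the slots other than `i`, `i'`. -/
def lowBr {n : ℕ} (i i' : Fin n) (κ : Fin n → Freq) : ℝ := ∏ m ∈ lowSlots i i', br (κ m)

/-- The tuple with the entries at `i`, `i'` set to zero. -/
def lowPart {n : ℕ} (i i' : Fin n) (κ : Fin n → Freq) : Fin n → Freq :=
  fun m => if m = i ∨ m = i' then 0 else κ m

lemma mem_lowSlots {n : ℕ} {i i' m : Fin n} : m ∈ lowSlots i i' ↔ m ≠ i ∧ m ≠ i' := by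
  simp [lowSlots]

lemma one_le_prod_br {n : ℕ} (t : Finset (Fin n)) (κ : Fin n → Freq) : 1 ≤ ∏ m ∈ t, br (κ m) := by
  calc (1 : ℝ) = ∏ _m ∈ t, (1 : ℝ) := by simp
    _ ≤ _ := Finset.prod_le_prod (fun _ _ => zero_le_one) fun m _ => one_le_br _

lemma one_le_lowBr {n : ℕ} (i i' : Fin n) (κ : Fin n → Freq) : 1 ≤ lowBr i i' κ :=
  one_le_prod_br _ _

lemma lowPart_of_mem {n : ℕ} {i i' m : Fin n} (κ : Fin n → Freq) (h : m ∈ lowSlots i i') :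
    lowPart i i' κ m = κ m := by
  rw [mem_lowSlots] at h; simp [lowPart, h.1, h.2]

lemma br_le_lowBr {n : ℕ} {i i' m : Fin n} (κ : Fin n → Freq) (h : m ∈ lowSlots i i') :
    br (κ m) ≤ lowBr i i' κ := by
  rw [lowBr, ← mul_prod_erase _ _ h]
  exact le_mul_of_one_le_right (br_pos _).le
    (one_le_prod_br _ _)

lemma lowBr_lowPart {n : ℕ} (i i' : Fin n) (κ : Fin n → Freq) :
    lowBr i i' (lowPart i i' κ) = lowBr i i' κ :=
  prod_congr rfl fun m hm => by rw [lowPart_of_mem κ hm]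

lemma lowMono_lowPart {n : ℕ} (i i' : Fin n) (u : Coeff) (κ : Fin n → Freq) :
    lowMono i i' u (lowPart i i' κ) = lowMono i i' u κ :=
  prod_congr rfl fun m hm => by rw [lowPart_of_mem κ hm]

lemma prod_eq_pair_mul_low {n : ℕ} {i i' : Fin n} (hne : i ≠ i') {M : Type*} [CommMonoid M]
    (f : Fin n → M) : ∏ m, f m = (∏ m ∈ lowSlots i i', f m) * (f i * f i') := by
  have h : (Finset.univ : Finset (Fin n)) = lowSlots i i' ∪ {i, i'} := by
    ext m; simp [mem_lowSlots]; tauto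
  have hd : Disjoint (lowSlots i i') {i, i'} := by
    rw [Finset.disjoint_left]
    intro m hm; rw [mem_lowSlots] at hm; simp [hm.1, hm.2]
  rw [h, Finset.prod_union hd, Finset.prod_pair hne]

lemma sum_eq_pair_add_low {n : ℕ} {i i' : Fin n} (hne : i ≠ i') {M : Type*} [AddCommMonoid M]
    (f : Fin n → M) : ∑ m, f m = (∑ m ∈ lowSlots i i', f m) + (f i + f i') := by
  have h : (Finset.univ : Finset (Fin n)) = lowSlots i i' ∪ {i, i'} := by
    ext m; simp [mem_lowSlots]; tauto
  have hd : Disjoint (lowSlots i i') {i, i'} := by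
    rw [Finset.disjoint_left]
    intro m hm; rw [mem_lowSlots] at hm; simp [hm.1, hm.2]
  rw [h, Finset.sum_union hd, Finset.sum_pair hne]

lemma mono_eq {n : ℕ} {i i' : Fin n} (hne : i ≠ i') (u : Coeff) (κ : Fin n → Freq) :
    mono u κ = lowMono i i' u κ *
      (twist (slotConj i) (u (κ i)) * twist (slotConj i') (u (κ i'))) :=
  prod_eq_pair_mul_low hne _

lemma norm_lowMono_le {n : ℕ} {i i' : Fin n} {σ R : ℝ} (hR : 1 ≤ R) {u : Coeff}
    (hu : u ∈ sobBall σ R) (κ : Fin n → Freq) :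
    ‖lowMono i i' u κ‖ ≤ R ^ n * lowBr i i' κ ^ (-σ) := by
  rw [lowMono, norm_prod, lowBr, ← Real.finsetProd_rpow _ _ (fun m _ => (br_pos _).le)]
  calc ∏ m ∈ lowSlots i i', ‖twist (slotConj m) (u (κ m))‖
      ≤ ∏ m ∈ lowSlots i i', (R * br (κ m) ^ (-σ)) := by
        refine Finset.prod_le_prod (fun _ _ => norm_nonneg _) fun m _ => ?_
        rw [norm_twist]
        exact norm_le_of_mem_sobBall (by linarith) hu _
    _ = R ^ (lowSlots i i').card * ∏ m ∈ lowSlots i i', br (κ m) ^ (-σ) := by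
        rw [Finset.prod_mul_distrib, prod_const]
    _ ≤ _ := by
        gcongr
        · exact prod_nonneg fun m _ => (rpow_pos_of_pos (br_pos _) _).le
        · exact (card_le_univ _).trans (by simp)

/-- The total mass of a power of the bracket. -/
def brMass (a : ℝ) : ℝ := ∑' k : Freq, br k ^ (-a)

lemma sum_lowBr_rpow_le {n : ℕ} (i i' : Fin n) {a : ℝ} (ha : 3 < a) (V : Finset (Fin n → Freq))
    (hV : ∀ v ∈ V, lowPart i i' v = v) :
    ∑ v ∈ V, lowBr i i' v ^ (-a) ≤ brMass a ^ n := by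
  classical
  set K : Finset Freq := V.biUnion fun v => Finset.univ.image v
  have hsub : V ⊆ Fintype.piFinset fun _ : Fin n => K := by
    intro v hv
    rw [Fintype.mem_piFinset]
    intro m
    exact Finset.mem_biUnion.2 ⟨v, hv, Finset.mem_image_of_mem _ (Finset.mem_univ m)⟩
  calc ∑ v ∈ V, lowBr i i' v ^ (-a) ≤ ∑ v ∈ V, ∏ m, br (v m) ^ (-a) := by
        refine sum_le_sum fun v hv => le_of_eq ?_
        rw [lowBr, ← Real.finsetProd_rpow _ _ (fun m _ => (br_pos _).le)]
        refine Finset.prod_subset (Finset.subset_univ _) fun m _ hm => ?_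
        have h0 : v m = 0 := by
          rw [mem_lowSlots] at hm
          rw [← hV v hv, lowPart, if_pos (by tauto)]
        rw [h0, br_zero, Real.one_rpow]
    _ ≤ ∑ v ∈ Fintype.piFinset fun _ : Fin n => K, ∏ m, br (v m) ^ (-a) :=
        Finset.sum_le_sum_of_subset_of_nonneg hsub fun v _ _ =>
          prod_nonneg fun m _ => (rpow_pos_of_pos (br_pos _) _).le
    _ = ∏ _m : Fin n, ∑ k ∈ K, br k ^ (-a) := 
        (Finset.prod_univ_sum (fun _ : Fin n => K) fun _ k => br k ^ (-a)).symm
    _ ≤ brMass a ^ n := by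
        rw [prod_const, card_univ, Fintype.card_fin]
        have hn : ∀ k : Freq, 0 ≤ br k ^ (-a) := fun k => (rpow_pos_of_pos (br_pos _) _).le
        exact pow_le_pow_left₀ (sum_nonneg fun k _ => hn k)
          ((summable_br_rpow ha).sum_le_tsum K fun k _ => hn k) n

lemma sum_fiber_lowPart {n : ℕ} (i i' : Fin n) (T : Finset (Fin n → Freq)) {M : Type*}
    [AddCommMonoid M] [DecidableEq (Fin n → Freq)] (f : (Fin n → Freq) → M) :
    ∑ κ ∈ T, f κ = ∑ v ∈ T.image (lowPart i i'), ∑ κ ∈ T with lowPart i i' κ = v, f κ :=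
  (Finset.sum_fiberwise_of_maps_to (fun _ hκ => Finset.mem_image_of_mem _ hκ) _).symm

lemma lowPart_idem {n : ℕ} (i i' : Fin n) (κ : Fin n → Freq) :
    lowPart i i' (lowPart i i' κ) = lowPart i i' κ := by
  ext m; simp only [lowPart]; split_ifs <;> rfl

/-- A deterministic bound for forms whose inner sums over the pair of slots `i`, `i'` are small. -/
lemma norm_sum_lowMono_le {n : ℕ} {i i' : Fin n} {σ A R Γ : ℝ} (hA : A + 3 < σ)
    (hR : 1 ≤ R) (hΓ : 0 ≤ Γ) (T : Finset (Fin n → Freq)) (c : (Fin n → Freq) → ℂ)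
    (hc : ∀ v, ‖∑ κ ∈ T with lowPart i i' κ = v, c κ‖ ≤ Γ * lowBr i i' v ^ A)
    {u : Coeff} (hu : u ∈ sobBall σ R) :
    ‖∑ κ ∈ T, c κ * lowMono i i' u κ‖ ≤ R ^ n * brMass (σ - A) ^ n * Γ := by
  classical
  rw [sum_fiber_lowPart i i' T]
  have h1 : ∀ v, ∑ κ ∈ T with lowPart i i' κ = v, c κ * lowMono i i' u κ
      = (∑ κ ∈ T with lowPart i i' κ = v, c κ) * lowMono i i' u v := by
    intro v
    rw [sum_mul]
    refine sum_congr rfl fun κ hκ => ?_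
    rw [mem_filter] at hκ
    rw [← hκ.2, lowMono_lowPart]
  refine (norm_sum_le _ _).trans ?_
  calc ∑ v ∈ T.image (lowPart i i'), ‖∑ κ ∈ T with lowPart i i' κ = v, c κ * lowMono i i' u κ‖
      ≤ ∑ v ∈ T.image (lowPart i i'), R ^ n * Γ * lowBr i i' v ^ (-(σ - A)) := by
        refine sum_le_sum fun v _ => ?_
        rw [h1, norm_mul]
        have hb : 0 < lowBr i i' v := lt_of_lt_of_le one_pos (one_le_lowBr _ _ _)
        calc _ ≤ (Γ * lowBr i i' v ^ A) * (R ^ n * lowBr i i' v ^ (-σ)) :=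
              mul_le_mul (hc v) (norm_lowMono_le hR hu v) (norm_nonneg _)
                (mul_nonneg hΓ (rpow_nonneg hb.le _))
          _ = R ^ n * Γ * (lowBr i i' v ^ A * lowBr i i' v ^ (-σ)) := by ring
          _ = _ := by rw [← rpow_add hb]; congr 2; ring
    _ = R ^ n * Γ * ∑ v ∈ T.image (lowPart i i'), lowBr i i' v ^ (-(σ - A)) := by
        rw [mul_sum]
    _ ≤ R ^ n * Γ * brMass (σ - A) ^ n := by
        gcongr
        refine sum_lowBr_rpow_le i i' (by linarith) _ fun v hv => ?_
        obtain ⟨κ, _, rfl⟩ := Finset.mem_image.1 hv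
        exact lowPart_idem i i' κ
    _ = _ := by ring

lemma measurableSet_sobBall (σ R : ℝ) : MeasurableSet (sobBall σ R) := by
  have h : Measurable fun u : Coeff => sobNorm σ u := by
    unfold sobNorm
    refine Measurable.pow_const (Measurable.tsum fun k => ?_) _
    fun_prop
  exact measurableSet_le h measurable_const

lemma measurable_mono {n : ℕ} (κ : Fin n → Freq) : Measurable fun u => mono u κ := by
  unfold mono
  refine Finset.measurable_prod _ fun m _ => ?_
  fun_prop

lemma measurable_lowMono {n : ℕ} (i i' : Fin n) (κ : Fin n → Freq) :
    Measurable fun u => lowMono i i' u κ := by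
  unfold lowMono
  refine Finset.measurable_prod _ fun m _ => ?_
  fun_prop

/-- Moments of a multilinear form on a Sobolev ball, after subtraction of the pairings of the
slots `i` and `i'`. -/
lemma eLpNorm_form_sub_pairing_le {n : ℕ} {i i' : Fin n} (hne : i ≠ i') {s σ A R Γ : ℝ}
    (hA : A + 3 < σ) (hR : 1 ≤ R) (hΓ : 0 ≤ Γ) (T : Finset (Fin n → Freq))
    (c : (Fin n → Freq) → ℂ)
    (hc : ∀ v, ∑ κ ∈ T with lowPart i i' κ = v, ‖c κ‖ ^ 2 * (wt s (κ i) * wt s (κ i'))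
      ≤ (Γ * lowBr i i' v ^ A) ^ 2)
    {p : ℝ} (hp : 2 ≤ p) :
    eLpNorm ((sobBall σ R).indicator fun u => ∑ κ ∈ T, c κ * (mono u κ
        - lowMono i i' u κ * covTerm s (slotConj i) (slotConj i') (κ i) (κ i')))
        (ofReal p) (gaussianSob s)
      ≤ ofReal (128 * R ^ n * brMass (σ - A) ^ n * Γ * p) := by
  classical
  set q : (Fin n → Freq) → Coeff → ℂ := fun κ u =>
    twist (slotConj i) (u (κ i)) * twist (slotConj i') (u (κ i'))
      - covTerm s (slotConj i) (slotConj i') (κ i) (κ i') with hq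
  set F : (Fin n → Freq) → Coeff → ℂ := fun v u =>
    ∑ κ ∈ T with lowPart i i' κ = v, c κ * q κ u with hF
  set V := T.image (lowPart i i') with hV
  have hb : ∀ v, 0 < lowBr i i' v := fun v => lt_of_lt_of_le one_pos (one_le_lowBr _ _ _)
  have hFm : ∀ v, Measurable (F v) := by
    intro v; simp only [hF, hq]; fun_prop
  have hp1 : 1 ≤ ofReal p :=
    ENNReal.one_le_ofReal.2 (by linarith)
  have hpt : ∀ u, ‖(sobBall σ R).indicator (fun u => ∑ κ ∈ T, c κ * (mono u κ
        - lowMono i i' u κ * covTerm s (slotConj i) (slotConj i') (κ i) (κ i'))) u‖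
      ≤ ‖∑ v ∈ V, R ^ n * lowBr i i' v ^ (-σ) * ‖F v u‖‖ := by
    intro u
    have hnn : 0 ≤ ∑ v ∈ V, R ^ n * lowBr i i' v ^ (-σ) * ‖F v u‖ :=
      sum_nonneg fun v _ => by have := hb v; positivity
    rw [norm_of_nonneg hnn]
    by_cases hu : u ∈ sobBall σ R
    · rw [indicator_of_mem hu, sum_fiber_lowPart i i' T]
      refine (norm_sum_le _ _).trans (sum_le_sum fun v _ => ?_)
      have : ∑ κ ∈ T with lowPart i i' κ = v, c κ * (mono u κ
          - lowMono i i' u κ * covTerm s (slotConj i) (slotConj i') (κ i) (κ i'))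
          = lowMono i i' u v * F v u := by
        rw [hF, mul_sum]
        refine sum_congr rfl fun κ hκ => ?_
        rw [mem_filter] at hκ
        rw [← hκ.2, lowMono_lowPart, mono_eq hne]
        ring
      rw [this, norm_mul]
      gcongr
      exact norm_lowMono_le hR hu v
    · rw [indicator_of_notMem hu, norm_zero]; exact hnn
  refine (eLpNorm_mono hpt).trans ?_
  have hFeq : (fun u => ∑ v ∈ V, R ^ n * lowBr i i' v ^ (-σ) * ‖F v u‖)
      = ∑ v ∈ V, (R ^ n * lowBr i i' v ^ (-σ)) • fun u => ‖F v u‖ := by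
    ext u; simp
  rw [hFeq]
  refine (eLpNorm_sum_le (fun v _ => ?_) hp1).trans ?_
  · exact ((hFm v).norm.aestronglyMeasurable).const_smul _
  have hterm : ∀ v ∈ V, eLpNorm ((R ^ n * lowBr i i' v ^ (-σ)) • fun u => ‖F v u‖)
      (ofReal p) (gaussianSob s)
      ≤ ofReal (128 * R ^ n * Γ * p * lowBr i i' v ^ (-(σ - A))) := by
    intro v _
    have h0 : 0 ≤ R ^ n * lowBr i i' v ^ (-σ) := by have := hb v; positivity
    rw [eLpNorm_const_smul, ← ofReal_norm, norm_of_nonneg h0, eLpNorm_norm]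
    have h1 := eLpNorm_gaussianSob_quadratic_le s (T.filter fun κ => lowPart i i' κ = v)
      (fun κ => κ i) (fun κ => κ i') (fun κ hκ κ' hκ' h h' => by
        rw [mem_filter] at hκ hκ'
        ext1 m
        by_cases hm : m = i
        · rw [hm]; exact h
        by_cases hm' : m = i'
        · rw [hm']; exact h'
        · have := congrFun (hκ.2.trans hκ'.2.symm) m
          simpa [lowPart, hm, hm'] using this) c (slotConj i) (slotConj i') hp
    have h2 : sqrt (∑ κ ∈ T with lowPart i i' κ = v, ‖c κ‖ ^ 2 * (wt s (κ i) * wt s (κ i')))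
        ≤ Γ * lowBr i i' v ^ A := by
      rw [Real.sqrt_le_iff]
      have := hb v
      exact ⟨by positivity, hc v⟩
    calc _ ≤ ofReal (R ^ n * lowBr i i' v ^ (-σ)) *
          ofReal (128 * p * (Γ * lowBr i i' v ^ A)) := by
          gcongr
          refine h1.trans (ofReal_le_ofReal ?_)
          gcongr
      _ = _ := by
          rw [← ofReal_mul h0]
          congr 1
          rw [show -(σ - A) = A + -σ by ring, rpow_add (hb v)]
          ring
  refine (sum_le_sum hterm).trans ?_
  have hp0 : 0 ≤ p := by linarith
  have hR0 : 0 ≤ R := by linarith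
  rw [← ENNReal.ofReal_sum_of_nonneg (fun v _ => by have := hb v; positivity), ← mul_sum]
  refine ofReal_le_ofReal ?_
  have h3 : ∑ v ∈ V, lowBr i i' v ^ (-(σ - A)) ≤ brMass (σ - A) ^ n := by
    refine sum_lowBr_rpow_le i i' (by linarith) _ fun v hv => ?_
    obtain ⟨κ, _, rfl⟩ := Finset.mem_image.1 hv
    exact lowPart_idem i i' κ
  calc 128 * R ^ n * Γ * p * ∑ v ∈ V, lowBr i i' v ^ (-(σ - A))
      ≤ 128 * R ^ n * Γ * p * brMass (σ - A) ^ n := by gcongr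
    _ = _ := by ring

end

section

/-! ### Summation of dyadic pieces -/

lemma eLpNorm_tsum_le {α : Type*} [MeasurableSpace α] {μ : Measure α} {f : ℕ → α → ℝ}
    (hf : ∀ j, Measurable (f j)) {p : ℝ} (hp : 1 ≤ p) :
    eLpNorm (fun x => ∑' j, f j x) (ofReal p) μ
      ≤ ∑' j, eLpNorm (f j) (ofReal p) μ := by
  have hp0 : 0 < p := by linarith
  have hp1 : 1 ≤ ofReal p := ENNReal.one_le_ofReal.2 hp
  rw [eLpNorm_ofReal hp0, one_div, rpow_inv_le_iff hp0]
  have h1 : ∫⁻ x, ‖∑' j, f j x‖ₑ ^ p ∂μ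
      ≤ ∫⁻ x, ⨆ n, (∑ j ∈ Finset.range n, ‖f j x‖ₑ) ^ p ∂μ := by
    refine lintegral_mono fun x => ?_
    have h2 : ⨆ n, (∑ j ∈ Finset.range n, ‖f j x‖ₑ) ^ p = (∑' j, ‖f j x‖ₑ) ^ p := by
      rw [ENNReal.tsum_eq_iSup_nat]
      exact ((ENNReal.orderIsoRpow p hp0).map_iSup _).symm
    rw [h2]
    exact ENNReal.rpow_le_rpow enorm_tsum_le_tsum_enorm hp0.le
  refine h1.trans ?_
  rw [lintegral_iSup]
  · refine iSup_le fun n => ?_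
    rw [← rpow_inv_le_iff hp0]
    have h3 := eLpNorm_sum_le (μ := μ) (s := Finset.range n) (f := fun j x => ‖f j x‖ₑ)
      (fun j _ => (hf j).enorm.aestronglyMeasurable) hp1
    rw [eLpNorm_ofReal hp0, one_div] at h3
    simp only [Finset.sum_apply, enorm_eq_self] at h3
    refine h3.trans ?_
    have h4 : ∀ j, eLpNorm (fun x => ‖f j x‖ₑ) (ofReal p) μ
        = eLpNorm (f j) (ofReal p) μ := fun j => eLpNorm_enorm _
    simp_rw [h4]
    exact ENNReal.sum_le_tsum _
  · intro n
    have := hf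
    fun_prop
  · intro m n hmn x
    dsimp only
    gcongr

lemma wt_le {s : ℝ} (hs : 0 ≤ s) (k : Freq) : wt s k ≤ 2 ^ s * br k ^ (-(2 * s)) := by
  have h0 := nsq_nonneg k
  have h1 : (1 + nsq k) ^ s ≤ 2 ^ s * (1 + nsq k ^ s) := by
    rcases le_total (nsq k) 1 with h | h
    · calc (1 + nsq k) ^ s ≤ 2 ^ s := rpow_le_rpow (by linarith) (by linarith) hs
        _ ≤ _ := by
          nlinarith [rpow_pos_of_pos (two_pos : (0:ℝ) < 2) s, rpow_nonneg h0 s]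
    · calc (1 + nsq k) ^ s ≤ (2 * nsq k) ^ s := rpow_le_rpow (by linarith) (by linarith) hs
        _ = 2 ^ s * nsq k ^ s := mul_rpow (by norm_num) h0
        _ ≤ _ := by gcongr; linarith
  rw [one_add_nsq_rpow] at h1
  have hb := rpow_pos_of_pos (br_pos k) (2 * s)
  have hw : 0 < 1 + nsq k ^ s := by linarith [rpow_nonneg h0 s]
  rw [wt, rpow_neg (br_pos k).le, ← div_eq_mul_inv, inv_eq_one_div, div_le_div_iff₀ hw hb]
  linarith

lemma lintegral_coeff_sq (s : ℝ) (k : Freq) :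
    ∫⁻ u : Coeff, ‖u k‖ₑ ^ 2 ∂(gaussianSob s)
      = ofReal (wt s k) * ∫⁻ z, ‖z‖ₑ ^ 2 ∂stdComplexGaussian := by
  rw [gaussianSob, lintegral_map (by fun_prop) (measurable_sobScale s)]
  have h := (measurePreserving_eval_infinitePi (fun _ : Freq => stdComplexGaussian) k)
  have h2 : ∀ z : ℂ, ‖z / (sqrt (1 + nsq k ^ s) : ℂ)‖ₑ ^ 2
      = ofReal (wt s k) * ‖z‖ₑ ^ 2 := by
    intro z
    rw [← ofReal_norm, ← ofReal_norm, ← ofReal_pow (norm_nonneg _),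
      ← ofReal_pow (norm_nonneg _), ← ofReal_mul (wt_pos s k).le]
    congr 1
    rw [norm_div, norm_real, norm_eq_abs, div_pow, sq_abs, sq_sqrt, wt]
    · field_simp
    · linarith [rpow_nonneg (nsq_nonneg k) s]
  simp_rw [h2]
  rw [lintegral_const_mul _ (by fun_prop)]
  congr 1
  exact h.lintegral_comp (f := fun z => ‖z‖ₑ ^ 2) (by fun_prop)

lemma measurable_sobSummand (σ : ℝ) (k : Freq) :
    Measurable fun u : Coeff => ofReal ((1 + nsq k) ^ σ * ‖u k‖ ^ 2) :=
  (((measurable_pi_apply k).norm.pow_const 2).const_mul _).ennreal_ofReal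

lemma ae_mem_Sob {s σ : ℝ} (hs : 0 ≤ s) (hσ : σ < s - 3 / 2) :
    ∀ᵐ u ∂(gaussianSob s), u ∈ Sob σ := by
  have hm2 : ∫⁻ z, ‖z‖ₑ ^ 2 ∂stdComplexGaussian ≠ ⊤ := by
    have h := (IsGaussian.memLp_id stdComplexGaussian 2 (by simp)).eLpNorm_lt_top
    rw [eLpNorm_lt_top_iff_lintegral_rpow_enorm_lt_top (by simp) (by simp)] at h
    simpa using h.ne
  have hfin : ∫⁻ u : Coeff, ∑' k, ofReal ((1 + nsq k) ^ σ * ‖u k‖ ^ 2) ∂(gaussianSob s)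
      ≠ ⊤ := by
    rw [lintegral_tsum (fun k => (measurable_sobSummand σ k).aemeasurable)]
    have hk : ∀ k, ∫⁻ u : Coeff, ofReal ((1 + nsq k) ^ σ * ‖u k‖ ^ 2) ∂(gaussianSob s)
        ≤ ofReal (2 ^ s * br k ^ (-(2 * (s - σ)))) *
          ∫⁻ z, ‖z‖ₑ ^ 2 ∂stdComplexGaussian := by
      intro k
      have h0 : 0 ≤ (1 + nsq k) ^ σ := rpow_nonneg (by linarith [nsq_nonneg k]) _
      have e : ∀ u : Coeff, ofReal ((1 + nsq k) ^ σ * ‖u k‖ ^ 2)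
          = ofReal ((1 + nsq k) ^ σ) * ‖u k‖ₑ ^ 2 := by
        intro u
        rw [ofReal_mul h0, ofReal_pow (norm_nonneg _), ofReal_norm]
      simp_rw [e]
      rw [lintegral_const_mul _ (by fun_prop), lintegral_coeff_sq, ← mul_assoc,
        ← ofReal_mul h0]
      refine mul_le_mul' (ofReal_le_ofReal ?_) le_rfl
      rw [one_add_nsq_rpow]
      calc br k ^ (2 * σ) * wt s k ≤ br k ^ (2 * σ) * (2 ^ s * br k ^ (-(2 * s))) := by
            have := br_pos k
            gcongr; exact wt_le hs k
        _ = _ := by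
            rw [show -(2 * (s - σ)) = 2 * σ + -(2 * s) by ring, rpow_add (br_pos k)]; ring
    refine ne_top_of_le_ne_top ?_ (tsum_le_tsum hk)
    rw [ENNReal.tsum_mul_right]
    refine mul_ne_top ?_ hm2
    have hsum : Summable fun k => 2 ^ s * br k ^ (-(2 * (s - σ))) :=
      (summable_br_rpow (by linarith)).mul_left _
    exact hsum.tsum_ofReal_ne_top
  have := ae_lt_top' (AEMeasurable.tsum fun k => (measurable_sobSummand σ k).aemeasurable) hfin
  filter_upwards [this] with u hu
  exact ENNReal.rpow_lt_top_of_nonneg (by norm_num) hu.ne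

lemma mem_sobBall_of_mem_Sob {σ : ℝ} {u : Coeff} (hu : u ∈ Sob σ) :
    ∃ n : ℕ, u ∈ sobBall σ (n + 1) := by
  obtain ⟨n, hn⟩ := exists_nat_ge (sobNorm σ u).toReal
  refine ⟨n, ?_⟩
  have : sobNorm σ u = ofReal (sobNorm σ u).toReal := (ENNReal.ofReal_toReal hu.ne).symm
  change sobNorm σ u ≤ _
  rw [this]
  exact ofReal_le_ofReal (by linarith)

/-- Quantitative hypotheses on the dyadic pieces `F N j` of a family of random variables. -/
structure DyadicBounds (s σ θ K : ℝ) (C : ℝ → ℝ) (F : ℕ∞ → ℕ → Coeff → ℝ) : Prop where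
  meas : ∀ N j, Measurable (F N j)
  const_nonneg : ∀ R, 1 ≤ R → 0 ≤ C R
  moment : ∀ R, 1 ≤ R → ∀ N, N ≠ 0 → ∀ j : ℕ, ∀ p : ℝ, 2 ≤ p →
    eLpNorm ((sobBall σ R).indicator (F N j)) (ofReal p) (gaussianSob s)
      ≤ ofReal (C R * (p * 2 ^ (-(θ * j))))
  bound : ∀ R, 1 ≤ R → ∀ N, N ≠ 0 → ∀ j : ℕ, ∀ u ∈ sobBall σ R, |F N j u| ≤ C R * 2 ^ (K * j)
  stable : ∀ j, ∃ N₀ : ℕ, ∀ N : ℕ, N₀ ≤ N → F N j = F ⊤ j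

variable {s σ θ K : ℝ} {C : ℝ → ℝ} {F : ℕ∞ → ℕ → Coeff → ℝ}

/-- The growth exponent obtained by interpolation. -/
def interpExp (θ K : ℝ) : ℝ := 1 - θ / (2 * (θ + K))

lemma interpExp_mem (hθ : 0 < θ) (hK : 0 ≤ K) : 0 < interpExp θ K ∧ interpExp θ K < 1 := by
  have h1 : 0 < θ / (2 * (θ + K)) := by positivity
  have h2 : θ / (2 * (θ + K)) ≤ 1 / 2 := by
    rw [div_le_div_iff₀ (by positivity) (by norm_num)]; linarith
  constructor <;> unfold interpExp <;> linarith

lemma DyadicBounds.interpolated (h : DyadicBounds s σ θ K C F) (hθ : 0 < θ) (hK : 0 ≤ K)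
    {R : ℝ} (hR : 1 ≤ R) {N : ℕ∞} (hN : N ≠ 0) (j : ℕ) {p : ℝ} (hp : 2 ≤ p) :
    eLpNorm ((sobBall σ R).indicator (F N j)) (ofReal p) (gaussianSob s)
      ≤ ofReal (C R * p ^ interpExp θ K * 2 ^ (-(θ / 2 * j))) := by
  have hC := h.const_nonneg R hR
  have h1 := h.moment R hR N hN j p hp
  have h2 : eLpNorm ((sobBall σ R).indicator (F N j)) (ofReal p) (gaussianSob s)
      ≤ ofReal (C R * 2 ^ (K * j)) := by
    have := eLpNorm_le_of_ae_bound (p := ofReal p) (μ := gaussianSob s)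
      (f := (sobBall σ R).indicator (F N j)) (C := C R * 2 ^ (K * j)) (ae_of_all _ fun u => by
        by_cases hu : u ∈ sobBall σ R
        · rw [indicator_of_mem hu]; exact h.bound R hR N hN j u hu
        · rw [indicator_of_notMem hu, norm_zero]; positivity)
    rwa [measure_univ, one_rpow, one_mul] at this
  have h3 := le_min h1 h2
  rw [← ENNReal.ofReal_min] at h3
  refine h3.trans (ofReal_le_ofReal ?_)
  rw [← mul_min_of_nonneg _ _ hC, mul_assoc]
  refine mul_le_mul_of_nonneg_left ?_ hC
  set a := p * (2:ℝ) ^ (-(θ * j)) with ha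
  set b := (2:ℝ) ^ (K * j) with hb
  have hp0 : 0 < p := by linarith
  have ha0 : 0 < a := by positivity
  have hb0 : 0 < b := by positivity
  have hm0 : 0 < min a b := lt_min ha0 hb0
  set τ := θ / (2 * (θ + K)) with hτ
  have hE := interpExp_mem hθ hK
  have hτ0 : 0 ≤ τ := by positivity
  calc min a b = (min a b) ^ interpExp θ K * (min a b) ^ τ := by
        rw [← rpow_add hm0, interpExp, ← hτ]; rw [sub_add_cancel, rpow_one]
    _ ≤ a ^ interpExp θ K * b ^ τ := by
        gcongr
        · exact hE.1.le
        · exact min_le_left _ _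
        · exact min_le_right _ _
    _ = _ := by
        rw [ha, hb, mul_rpow hp0.le (by positivity), ← rpow_mul (by norm_num),
          ← rpow_mul (by norm_num), mul_assoc, ← rpow_add (by norm_num)]
        congr 2
        rw [interpExp, hτ]
        have : θ + K ≠ 0 := by positivity
        field_simp
        ring

lemma summable_dyadic (hθ : 0 < θ) : Summable fun j : ℕ => (2:ℝ) ^ (-(θ / 2 * j)) := by
  have : ∀ j : ℕ, (2:ℝ) ^ (-(θ / 2 * j)) = ((2:ℝ) ^ (-(θ / 2))) ^ j := by
    intro j
    rw [← rpow_natCast, ← rpow_mul (by norm_num)]; congr 1; ring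
  simp_rw [this]
  exact summable_geometric_of_lt_one (by positivity)
    (Real.rpow_lt_one_of_one_lt_of_neg (by norm_num) (by linarith))

lemma DyadicBounds.eLpNorm_tsum_le (h : DyadicBounds s σ θ K C F) (hθ : 0 < θ) (hK : 0 ≤ K)
    {R : ℝ} (hR : 1 ≤ R) {N : ℕ∞} (hN : N ≠ 0) {p : ℝ} (hp : 2 ≤ p) :
    eLpNorm ((sobBall σ R).indicator fun u => ∑' j, F N j u) (ofReal p) (gaussianSob s)
      ≤ ofReal (C R * (∑' j : ℕ, (2:ℝ) ^ (-(θ / 2 * j))) * p ^ interpExp θ K) := by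
  have hC := h.const_nonneg R hR
  have e : ((sobBall σ R).indicator fun u => ∑' j, F N j u)
      = fun u => ∑' j, (sobBall σ R).indicator (F N j) u := by
    ext u
    by_cases hu : u ∈ sobBall σ R
    · simp [hu]
    · simp [hu]
  rw [e]
  refine (NLSEnergy.eLpNorm_tsum_le (fun j => (h.meas N j).indicator (measurableSet_sobBall _ _))
    (by linarith)).trans ?_
  refine (tsum_le_tsum fun j => h.interpolated hθ hK hR hN j hp).trans ?_
  rw [← ofReal_tsum_of_nonneg (fun j => by positivity)
    ((summable_dyadic hθ).mul_left _), tsum_mul_left]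
  exact ofReal_le_ofReal (le_of_eq (by ring))

lemma DyadicBounds.ae_summable (h : DyadicBounds s σ θ K C F) (hs : 0 ≤ s)
    (hσ : σ < s - 3 / 2) (hθ : 0 < θ) (hK : 0 ≤ K) {N : ℕ∞} (hN : N ≠ 0) :
    ∀ᵐ u ∂(gaussianSob s), Summable fun j => F N j u := by
  have h1 : ∀ n : ℕ, ∀ᵐ u ∂(gaussianSob s), u ∈ sobBall σ (n + 1) → Summable fun j => F N j u := by
    intro n
    have hR : (1:ℝ) ≤ n + 1 := by linarith [n.cast_nonneg (α := ℝ)]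
    have hC := h.const_nonneg _ hR
    have hm : ∀ j, Measurable ((sobBall σ (n+1)).indicator (F N j)) := fun j =>
      (h.meas N j).indicator (measurableSet_sobBall _ _)
    have hfin : ∫⁻ u, ∑' j, ‖(sobBall σ (n+1)).indicator (F N j) u‖ₑ ∂(gaussianSob s) ≠ ⊤ := by
      rw [lintegral_tsum (fun j => (hm j).enorm.aemeasurable)]
      have hb : ∀ j, ∫⁻ u, ‖(sobBall σ (n+1)).indicator (F N j) u‖ₑ ∂(gaussianSob s)
          ≤ ofReal (C (n+1) * 2 ^ interpExp θ K * 2 ^ (-(θ / 2 * j))) := by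
        intro j
        rw [← eLpNorm_one_eq_lintegral_enorm]
        refine (eLpNorm_le_eLpNorm_of_exponent_le (q := ofReal 2) (by simp)
          (hm j).aestronglyMeasurable).trans (h.interpolated hθ hK hR hN j le_rfl)
      refine ne_top_of_le_ne_top ?_ (tsum_le_tsum hb)
      exact ((summable_dyadic hθ).mul_left _).tsum_ofReal_ne_top
    have := ae_lt_top' (AEMeasurable.tsum fun j => (hm j).enorm.aemeasurable) hfin
    filter_upwards [this] with u hu hmem
    simp only [indicator_of_mem hmem] at hu
    refine Summable.of_norm ?_
    have h2 : ∀ j, ‖F N j u‖ₑ = ((‖F N j u‖₊ : NNReal) : ℝ≥0∞) := fun j => rfl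
    simp_rw [h2] at hu
    have h3 := ENNReal.tsum_coe_ne_top_iff_summable.1 hu.ne
    exact NNReal.summable_coe.2 h3
  filter_upwards [ae_all_iff.2 h1, ae_mem_Sob hs hσ] with u hu hu2
  obtain ⟨n, hn⟩ := mem_sobBall_of_mem_Sob hu2
  exact hu n hn

lemma DyadicBounds.aemeasurable (h : DyadicBounds s σ θ K C F) (hs : 0 ≤ s)
    (hσ : σ < s - 3 / 2) (hθ : 0 < θ) (hK : 0 ≤ K) {N : ℕ∞} (hN : N ≠ 0) :
    AEMeasurable (fun u => ∑' j, F N j u) (gaussianSob s) := by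
  refine aemeasurable_of_tendsto_metrizable_ae (f := fun n u => ∑ j ∈ Finset.range n, F N j u)
    atTop (fun n => ?_) ?_
  · have := h.meas N
    exact (measurable_sum _ fun j _ => this j).aemeasurable
  · filter_upwards [h.ae_summable hs hσ hθ hK hN] with u hu
    exact hu.hasSum.tendsto_sum_nat

lemma DyadicBounds.tendstoInMeasure (h : DyadicBounds s σ θ K C F) (hs : 0 ≤ s)
    (hσ : σ < s - 3 / 2) (hθ : 0 < θ) (hK : 0 ≤ K) :
    TendstoInMeasure (gaussianSob s) (fun (N : ℕ) u => ∑' j, F N j u) atTop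
      (fun u => ∑' j, F ⊤ j u) := by
  have hball : ∀ n : ℕ, TendstoInMeasure (gaussianSob s)
      (fun (N : ℕ) => (sobBall σ (n+1)).indicator fun u => ∑' j, F N j u) atTop
      ((sobBall σ (n+1)).indicator fun u => ∑' j, F ⊤ j u) := by
    intro n
    have hR : (1:ℝ) ≤ n + 1 := by linarith [n.cast_nonneg (α := ℝ)]
    have hC := h.const_nonneg _ hR
    set D := 2 * (C (n+1) * 2 ^ interpExp θ K) with hD
    set b : ℕ → ℕ → ℝ := fun N j =>
      open Classical in if F N j = F ⊤ j then 0 else D * 2 ^ (-(θ / 2 * j)) with hb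
    have hb0 : ∀ N j, 0 ≤ b N j := by intro N j; simp only [hb]; split_ifs <;> positivity
    have hble : ∀ N j, b N j ≤ D * 2 ^ (-(θ / 2 * j)) := by
      intro N j; simp only [hb]; split_ifs
      · positivity
      · rfl
    have hbs : ∀ N, Summable (b N) := fun N =>
      Summable.of_nonneg_of_le (hb0 N) (hble N) ((summable_dyadic hθ).mul_left _)
    have hlim : Tendsto (fun N => ∑' j, b N j) atTop (𝓝 0) := by
      have := tendsto_tsum_of_dominated_convergence (𝓕 := atTop) (f := b) (g := fun _ => (0:ℝ))
        (bound := fun j : ℕ => D * 2 ^ (-(θ / 2 * j))) ((summable_dyadic hθ).mul_left _) (fun j => by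
          obtain ⟨N₀, hN₀⟩ := h.stable j
          refine tendsto_const_nhds.congr' ?_
          filter_upwards [eventually_ge_atTop N₀] with N hN
          simp [hb, hN₀ N hN]) (Eventually.of_forall fun N j => by
            rw [norm_of_nonneg (hb0 N j)]; exact hble N j)
      simpa using this
    have hmeas : ∀ N : ℕ∞, N ≠ 0 → AEStronglyMeasurable
        ((sobBall σ (n+1)).indicator fun u => ∑' j, F N j u) (gaussianSob s) := fun N hN =>
      ((h.aemeasurable hs hσ hθ hK hN).indicator (measurableSet_sobBall _ _)).aestronglyMeasurable
    have key : Tendsto (fun N : ℕ => eLpNorm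
        (((sobBall σ (n+1)).indicator fun u => ∑' j, F (N+1 : ℕ) j u)
          - ((sobBall σ (n+1)).indicator fun u => ∑' j, F ⊤ j u)) (ofReal 2)
          (gaussianSob s)) atTop (𝓝 0) := by
      have h0 : Tendsto (fun N : ℕ => ofReal (∑' j, b (N+1) j)) atTop (𝓝 0) := by
        have := ENNReal.tendsto_ofReal (hlim.comp (tendsto_add_atTop_nat 1))
        simpa using this
      refine tendsto_of_tendsto_of_tendsto_of_le_of_le tendsto_const_nhds h0 (fun _ => zero_le)
        fun N => ?_
      have hN : ((N+1 : ℕ) : ℕ∞) ≠ 0 := by simp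
      have hae : (((sobBall σ (n+1)).indicator fun u => ∑' j, F (N+1 : ℕ) j u)
          - ((sobBall σ (n+1)).indicator fun u => ∑' j, F ⊤ j u)) =ᵐ[gaussianSob s]
          fun u => ∑' j, ((sobBall σ (n+1)).indicator (F (N+1 : ℕ) j)
            - (sobBall σ (n+1)).indicator (F ⊤ j)) u := by
        filter_upwards [h.ae_summable hs hσ hθ hK hN, h.ae_summable hs hσ hθ hK ENat.top_ne_zero]
          with u h1 h2
        by_cases hu : u ∈ sobBall σ (n+1)
        · simp only [Pi.sub_apply, indicator_of_mem hu]
          exact (h1.tsum_sub h2).symm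
        · simp [hu]
      dsimp only
      have hmj : ∀ (N : ℕ∞) j, Measurable ((sobBall σ (n+1)).indicator (F N j)) := fun N j =>
        (h.meas N j).indicator (measurableSet_sobBall _ _)
      rw [eLpNorm_congr_ae hae, ofReal_tsum_of_nonneg (hb0 _) (hbs _)]
      refine (NLSEnergy.eLpNorm_tsum_le (fun j => (hmj _ j).sub (hmj _ j)) (by norm_num)).trans
        (tsum_le_tsum fun j => ?_)
      by_cases hj : F (N+1 : ℕ) j = F ⊤ j
      · rw [hj, sub_self, eLpNorm_zero]; exact zero_le
      · simp only [hb, if_neg hj]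
        refine (eLpNorm_sub_le (hmj _ j).aestronglyMeasurable (hmj _ j).aestronglyMeasurable
          (by simp)).trans ?_
        refine (add_le_add (h.interpolated hθ hK hR hN j le_rfl)
          (h.interpolated hθ hK hR ENat.top_ne_zero j le_rfl)).trans (le_of_eq ?_)
        rw [← ofReal_add (by positivity) (by positivity), hD]
        congr 1; ring
    have h3 := tendstoInMeasure_of_tendsto_eLpNorm (by simp) (fun N => hmeas _ (by simp))
      (hmeas ⊤ ENat.top_ne_zero) key
    intro ε hε
    exact (tendsto_add_atTop_iff_nat 1).1 (h3 ε hε)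
  intro ε hε
  rw [tendsto_nhds_zero]
  intro δ hδ
  have hcompl : Tendsto (fun n : ℕ => gaussianSob s (sobBall σ (n+1))ᶜ) atTop (𝓝 0) := by
    have hanti : Antitone fun n : ℕ => (sobBall σ ((n:ℝ)+1))ᶜ := by
      intro m n hmn
      refine compl_subset_compl.2 fun u hu => ?_
      have hu' : sobNorm σ u ≤ ofReal ((m:ℝ) + 1) := hu
      refine hu'.trans (ofReal_le_ofReal ?_)
      have : (m:ℝ) ≤ n := by exact_mod_cast hmn
      linarith
    have := tendsto_measure_iInter_atTop (μ := gaussianSob s)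
      (fun n : ℕ => (measurableSet_sobBall σ ((n:ℝ)+1)).compl.nullMeasurableSet) hanti
      ⟨0, measure_ne_top _ _⟩
    have hz : gaussianSob s (⋂ n : ℕ, (sobBall σ ((n:ℝ)+1))ᶜ) = 0 := by
      refine measure_mono_null (fun u hu => ?_) (ae_mem_Sob (s := s) hs hσ)
      intro hS
      obtain ⟨n, hn⟩ := mem_sobBall_of_mem_Sob hS
      exact (Set.mem_iInter.1 hu n) hn
    rw [hz] at this
    exact this
  obtain ⟨n, hn⟩ := ((tendsto_nhds_zero.1 hcompl) (δ / 2) (ENNReal.half_pos hδ.ne')).exists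
  have := (tendsto_nhds_zero.1 (hball n ε hε)) (δ / 2) (ENNReal.half_pos hδ.ne')
  filter_upwards [this] with N hN
  rw [← ENNReal.add_halves δ]
  refine le_trans (measure_mono fun u hu => ?_) ((measure_union_le _ _).trans (add_le_add hN hn))
  by_cases hmem : u ∈ sobBall σ (n+1)
  · left
    change ε ≤ edist (indicator _ _ u) (indicator _ _ u)
    rw [indicator_of_mem hmem, indicator_of_mem hmem]
    exact hu
  · right; exact hmem

end

section

/-! ### The smoothly truncated reciprocal -/

/-- `x ↦ (1 - η(x/L))/x`. -/
def cutInv (η : ℝ → ℝ) (L x : ℝ) : ℝ := (1 - η (x / L)) / x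

namespace IsBump

variable (h : IsBump η)
include h

lemma nonneg (x : ℝ) : 0 ≤ η x := (h.mem_Icc x).1

lemma le_one (x : ℝ) : η x ≤ 1 := (h.mem_Icc x).2

lemma abs_le_one (x : ℝ) : |η x| ≤ 1 := (abs_of_nonneg (h.nonneg x)).trans_le (h.le_one x)

lemma eq_zero {x : ℝ} (hx : 1 ≤ |x|) : η x = 0 := by
  by_contra hne
  have := h.supp (subset_tsupport _ hne)
  rw [mem_Ioo, ← abs_lt] at this
  linarith

lemma hasCompactSupport : HasCompactSupport η :=
  HasCompactSupport.of_support_subset_isCompact (isCompact_Icc (a := (-1 : ℝ)) (b := 1))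
    (fun _ hx => Ioo_subset_Icc_self (h.supp (subset_tsupport _ hx)))

lemma exists_lipschitz : ∃ K : ℝ, 0 ≤ K ∧ (∀ x y, |η x - η y| ≤ K * |x - y|) ∧
    ∀ x c, |η (x + c) + η (x - c) - 2 * η x| ≤ K * c ^ 2 := by
  obtain ⟨K₁, h1⟩ := (h.smooth.of_le (m := 1) (by norm_cast)).lipschitzWith_of_hasCompactSupport
    h.hasCompactSupport (by norm_num)
  have hd : ContDiff ℝ 1 (deriv η) := by
    have : ContDiff ℝ (1 + 1) η := h.smooth.of_le (by norm_cast)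
    exact (contDiff_succ_iff_deriv.1 this).2.2
  obtain ⟨K₂, h2⟩ := hd.lipschitzWith_of_hasCompactSupport h.hasCompactSupport.deriv (by norm_num)
  have hdiff : Differentiable ℝ η := h.smooth.differentiable (by simp)
  refine ⟨K₁ + 2 * K₂, by positivity, fun x y => ?_, fun x c => ?_⟩
  · have := h1.dist_le_mul x y
    rw [dist_eq, dist_eq] at this
    refine this.trans ?_
    have h3 : (0:ℝ) ≤ K₂ := K₂.2
    gcongr
    linarith
  · set φ : ℝ → ℝ := fun t => η (x + t) + η (x - t) with hφ
    have hφd : ∀ t, HasDerivAt φ (deriv η (x + t) - deriv η (x - t)) t := by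
      intro t
      have e1 : HasDerivAt (fun t => η (x + t)) (deriv η (x + t)) t := by
        simpa using (hdiff (x + t)).hasDerivAt.comp_const_add x t
      have e2 : HasDerivAt (fun t => η (x - t)) (-deriv η (x - t)) t := by
        simpa using (hdiff (x - t)).hasDerivAt.comp_const_sub x t
      rw [sub_eq_add_neg]; exact e1.add e2
    have hbd : ∀ t ∈ Icc (-|c|) |c|, ‖deriv φ t‖ ≤ 2 * K₂ * |c| := by
      intro t ht
      rw [(hφd t).deriv, norm_eq_abs, ← dist_eq]
      refine (h2.dist_le_mul _ _).trans ?_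
      rw [dist_eq, show x + t - (x - t) = 2 * t by ring, abs_mul, abs_two]
      have := abs_le.2 ht
      have h3 : (0:ℝ) ≤ K₂ := K₂.2
      nlinarith
    have := (convex_Icc (-|c|) |c|).norm_image_sub_le_of_norm_deriv_le
      (fun t _ => (hφd t).differentiableAt) hbd (x := 0) (y := c)
      ⟨by simp, by simp⟩ ⟨neg_abs_le c, le_abs_self c⟩
    rw [norm_eq_abs, norm_eq_abs, sub_zero] at this
    have e : φ c - φ 0 = η (x + c) + η (x - c) - 2 * η x := by simp [hφ]; ring
    rw [e] at this
    refine this.trans ?_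
    have h3 : (0:ℝ) ≤ K₁ := K₁.2
    rw [mul_assoc, ← abs_mul, ← sq, abs_of_nonneg (sq_nonneg c)]
    nlinarith [sq_nonneg c]

lemma abs_one_sub_le (x : ℝ) : |1 - η x| ≤ 1 := by
  rw [abs_le]; constructor <;> linarith [h.nonneg x, h.le_one x]

lemma mul_cutInv (L x : ℝ) : x * cutInv η L x = 1 - η (x / L) := by
  rcases eq_or_ne x 0 with rfl | hx
  · simp [cutInv, h.eq_one 0]
  · rw [cutInv]; field_simp

lemma abs_mul_cutInv_le (L x : ℝ) : |x * cutInv η L x| ≤ 1 := by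
  rw [h.mul_cutInv]; exact h.abs_one_sub_le _

lemma cutInv_neg (L x : ℝ) : cutInv η L (-x) = -cutInv η L x := by
  rw [cutInv, cutInv, neg_div, h.even, div_neg]

lemma abs_cutInv_le {L : ℝ} (hL : 0 < L) (x : ℝ) : |cutInv η L x| ≤ 2 / L := by
  rcases le_total |x / L| (1 / 2) with hx | hx
  · rw [cutInv, h.eq_one _ hx]; simp; positivity
  · rw [abs_div, abs_of_pos hL, le_div_iff₀ hL] at hx
    have hx0 : 0 < |x| := by linarith
    rw [cutInv, abs_div, div_le_div_iff₀ hx0 hL]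
    have := h.abs_one_sub_le (x / L)
    nlinarith [abs_nonneg (1 - η (x / L))]

lemma sq_mul_cutInv_sub_le {L L₀ x y : ℝ} (hL : 1 ≤ L) (hL₀ : 0 < L₀) :
    |y ^ 2 * (cutInv η L x - cutInv η L₀ y)|
      ≤ L + L₀ + 4 * |y - x| + 2 * |y - x| ^ 2 := by
  set Δ := cutInv η L x - cutInv η L₀ y with hΔ
  set c := |y - x| with hc
  have hc0 : 0 ≤ c := abs_nonneg _
  have hL0 : 0 < L := by linarith
  have e1 : x * y * Δ = (y - x) * (1 - η (x / L)) + x * (η (y / L₀) - η (x / L)) := by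
    have := h.mul_cutInv L x
    have := h.mul_cutInv L₀ y
    rw [hΔ]; linear_combination y * h.mul_cutInv L x - x * h.mul_cutInv L₀ y
  have b1 : |x * (η (y / L₀) - η (x / L))| ≤ L + L₀ + c := by
    by_cases hx : |x| < L
    · rw [abs_mul]
      have : |η (y / L₀) - η (x / L)| ≤ 1 := by
        rw [abs_le]
        constructor <;> linarith [h.nonneg (y / L₀), h.le_one (y / L₀), h.nonneg (x / L),
          h.le_one (x / L)]
      nlinarith [abs_nonneg x]
    · by_cases hy : |y| < L₀
      · rw [abs_mul]
        have : |η (y / L₀) - η (x / L)| ≤ 1 := by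
          rw [abs_le]
          constructor <;> linarith [h.nonneg (y / L₀), h.le_one (y / L₀), h.nonneg (x / L),
            h.le_one (x / L)]
        have h2 : |x| ≤ |y| + c := by
          have := abs_sub_abs_le_abs_sub x y
          rw [abs_sub_comm] at this; linarith
        nlinarith [abs_nonneg x]
      · rw [h.eq_zero (x := y / L₀), h.eq_zero (x := x / L)]
        · simp; linarith
        · rw [abs_div, abs_of_pos hL0, le_div_iff₀ hL0]; linarith
        · rw [abs_div, abs_of_pos hL₀, le_div_iff₀ hL₀]; linarith
  have b2 : |x * y * Δ| ≤ L + L₀ + 2 * c := by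
    rw [e1]
    refine (abs_add_le _ _).trans ?_
    have : |(y - x) * (1 - η (x / L))| ≤ c := by
      rw [abs_mul]; nlinarith [h.abs_one_sub_le (x / L), abs_nonneg (1 - η (x / L))]
    linarith
  have b3 : |y * Δ| ≤ 2 + 2 * c := by
    have e : y * Δ = x * cutInv η L x + (y - x) * cutInv η L x - y * cutInv η L₀ y := by
      rw [hΔ]; ring
    rw [e]
    have h1 := h.abs_mul_cutInv_le L x
    have h2 := h.abs_mul_cutInv_le L₀ y
    have h3 : |(y - x) * cutInv η L x| ≤ 2 * c := by
      rw [abs_mul]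
      have : |cutInv η L x| ≤ 2 := (h.abs_cutInv_le hL0 x).trans (by
        rw [div_le_iff₀ hL0]; linarith)
      nlinarith [abs_nonneg (cutInv η L x)]
    rw [abs_le] at h1 h2 h3 ⊢
    constructor <;> linarith [h1.1, h2.1, h3.1, h1.2, h2.2, h3.2]
  have e2 : y ^ 2 * Δ = x * y * Δ + (y - x) * (y * Δ) := by ring
  rw [e2]
  refine (abs_add_le _ _).trans ?_
  rw [abs_mul (y - x)]
  nlinarith [abs_nonneg (y * Δ)]

lemma exists_scale_diff : ∃ K : ℝ, 0 ≤ K ∧ ∀ L L₀ y : ℝ, 0 < L₀ → L₀ ≤ L →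
    |y * (cutInv η L y - cutInv η L₀ y)| ≤ K * ((L - L₀) / L₀) := by
  obtain ⟨K, hK0, hK, -⟩ := h.exists_lipschitz
  refine ⟨K, hK0, fun L L₀ y h0 hL => ?_⟩
  have hLp : 0 < L := h0.trans_le hL
  have e : y * (cutInv η L y - cutInv η L₀ y) = η (y / L₀) - η (y / L) := by
    rw [mul_sub, h.mul_cutInv, h.mul_cutInv]; ring
  rw [e]
  have hq : 0 ≤ (L - L₀) / L₀ := div_nonneg (by linarith) h0.le
  by_cases hy : L ≤ |y|
  · rw [h.eq_zero, h.eq_zero]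
    · simp; positivity
    · rw [abs_div, abs_of_pos hLp, le_div_iff₀ hLp]; linarith
    · rw [abs_div, abs_of_pos h0, le_div_iff₀ h0]; linarith
  · refine (hK _ _).trans (mul_le_mul_of_nonneg_left ?_ hK0)
    have e2 : y / L₀ - y / L = (y / L) * ((L - L₀) / L₀) := by field_simp
    rw [e2, abs_mul, abs_of_nonneg hq]
    have : |y / L| ≤ 1 := by
      rw [abs_div, abs_of_pos hLp, div_le_iff₀ hLp]; linarith
    exact mul_le_of_le_one_left hq this

lemma exists_cutInv_lipschitz : ∃ K : ℝ, 0 ≤ K ∧ ∀ L x y : ℝ, 0 < L →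
    |cutInv η L x - cutInv η L y| ≤ K * |x - y| / L ^ 2 := by
  obtain ⟨K, hK0, hK, -⟩ := h.exists_lipschitz
  refine ⟨2 * (K + 2), by positivity, fun L x y hL => ?_⟩
  have main : ∀ x y : ℝ, 1 / 2 < |x / L| →
      |cutInv η L x - cutInv η L y| ≤ 2 * (K + 2) * |x - y| / L ^ 2 := by
    intro x y hx
    have e : x * (cutInv η L x - cutInv η L y)
        = (η (y / L) - η (x / L)) - (x - y) * cutInv η L y := by
      linear_combination h.mul_cutInv L x - h.mul_cutInv L y
    rw [abs_div, abs_of_pos hL, lt_div_iff₀ hL] at hx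
    have b1 : |η (y / L) - η (x / L)| ≤ K * (|x - y| / L) := by
      refine (hK _ _).trans_eq ?_
      rw [← sub_div, abs_div, abs_of_pos hL, abs_sub_comm]
    have b2 : |(x - y) * cutInv η L y| ≤ 2 * (|x - y| / L) := by
      rw [abs_mul]
      calc |x - y| * |cutInv η L y| ≤ |x - y| * (2 / L) := by
            gcongr; exact h.abs_cutInv_le hL y
        _ = _ := by ring
    have b3 : |x| * |cutInv η L x - cutInv η L y| ≤ (K + 2) * (|x - y| / L) := by
      rw [← abs_mul, e]
      refine (abs_sub _ _).trans ?_
      linarith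
    rw [le_div_iff₀ (by positivity)]
    have b4 : L / 2 * |cutInv η L x - cutInv η L y| ≤ (K + 2) * (|x - y| / L) := by
      refine le_trans ?_ b3
      gcongr; linarith
    have e3 : (K + 2) * (|x - y| / L) = (K + 2) * |x - y| / L := by ring
    rw [e3, le_div_iff₀ hL] at b4
    nlinarith
  by_cases hx : 1 / 2 < |x / L|
  · exact main x y hx
  · by_cases hy : 1 / 2 < |y / L|
    · rw [abs_sub_comm, abs_sub_comm x]; exact main y x hy
    · rw [cutInv, cutInv, h.eq_one _ (not_lt.1 hx), h.eq_one _ (not_lt.1 hy)]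
      simp; positivity

lemma exists_second_diff : ∃ K : ℝ, 0 ≤ K ∧ ∀ L y c : ℝ, 1 ≤ L →
    |y * (cutInv η L (y + c) + cutInv η L (y - c) - 2 * cutInv η L y)|
      ≤ K * ((1 + |c|) ^ (5 / 2 : ℝ) * L ^ (-(1 / 2) : ℝ) * (1 + |y|) ^ (-(3 / 2) : ℝ)) := by
  obtain ⟨K₁, hK10, -, hK1⟩ := h.exists_lipschitz
  obtain ⟨K₂, hK20, hK2⟩ := h.exists_cutInv_lipschitz
  have main : ∀ L y c : ℝ, 1 ≤ L → 2 * |c| ≤ |y| →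
      |y * (cutInv η L (y + c) + cutInv η L (y - c) - 2 * cutInv η L y)|
        ≤ (5 * (K₁ + 2 * K₂) + 16) * (c ^ 2 / (L ^ 2 + y ^ 2)) := by
    intro L y c hL hc
    have hL0 : 0 < L := by linarith
    have hden : 0 < L ^ 2 + y ^ 2 := by positivity
    have e : y * (cutInv η L (y + c) + cutInv η L (y - c) - 2 * cutInv η L y)
        = -(η (y / L + c / L) + η (y / L - c / L) - 2 * η (y / L))
          - c * (cutInv η L (y + c) - cutInv η L (y - c)) := by
      have h1 := h.mul_cutInv L (y + c)
      have h2 := h.mul_cutInv L (y - c)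
      have h3 := h.mul_cutInv L y
      rw [add_div] at h1
      rw [sub_div] at h2
      linear_combination h1 + h2 - 2 * h3
    by_cases hy : |y| < 2 * L
    · have b1 := hK1 (y / L) (c / L)
      have b2 := hK2 L (y + c) (y - c) hL0
      rw [show y + c - (y - c) = 2 * c by ring, abs_mul, abs_two] at b2
      have b3 : |c * (cutInv η L (y + c) - cutInv η L (y - c))| ≤ 2 * K₂ * (c ^ 2 / L ^ 2) := by
        rw [abs_mul]
        calc _ ≤ |c| * (K₂ * (2 * |c|) / L ^ 2) := by gcongr
          _ = 2 * K₂ * (|c| ^ 2 / L ^ 2) := by ring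
          _ = _ := by rw [sq_abs]
      have b4 : |y * (cutInv η L (y + c) + cutInv η L (y - c) - 2 * cutInv η L y)|
          ≤ (K₁ + 2 * K₂) * (c ^ 2 / L ^ 2) := by
        rw [e]
        refine (abs_sub _ _).trans ?_
        rw [abs_neg]
        rw [div_pow] at b1
        linarith
      have b5 : c ^ 2 / L ^ 2 ≤ 5 * (c ^ 2 / (L ^ 2 + y ^ 2)) := by
        rw [← mul_div_assoc, div_le_div_iff₀ (by positivity) hden]
        have : y ^ 2 ≤ 4 * L ^ 2 := by rw [← sq_abs y]; nlinarith [abs_nonneg y]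
        nlinarith [sq_nonneg c]
      have hp : 0 ≤ c ^ 2 / (L ^ 2 + y ^ 2) := by positivity
      nlinarith [mul_le_mul_of_nonneg_left b5 (by positivity : 0 ≤ K₁ + 2 * K₂)]
    · have hfar : ∀ t : ℝ, L ≤ |t| → cutInv η L t = 1 / t := by
        intro t ht
        rw [cutInv, h.eq_zero, sub_zero]
        rw [abs_div, abs_of_pos hL0, le_div_iff₀ hL0]; linarith
      have hy2 : 2 * L ≤ |y| := not_lt.1 hy
      have a1 : |y| / 2 ≤ |y + c| := by
        have := abs_sub_abs_le_abs_sub y (-c)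
        rw [abs_neg, sub_neg_eq_add] at this; linarith
      have a2 : |y| / 2 ≤ |y - c| := by
        have := abs_sub_abs_le_abs_sub y c; linarith
      have hy0 : y ≠ 0 := by intro h0; simp [h0] at hy2; linarith
      have n1 : y + c ≠ 0 := by intro h0; rw [h0, abs_zero] at a1; linarith [abs_pos.2 hy0]
      have n2 : y - c ≠ 0 := by
        intro h0; rw [h0, abs_zero] at a2
        have := abs_pos.2 hy0; linarith
      rw [hfar _ (by linarith), hfar _ (by linarith), hfar y (by linarith)]
      have e2 : y * (1 / (y + c) + 1 / (y - c) - 2 * (1 / y)) = 2 * c ^ 2 / ((y + c) * (y - c)) := by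
        field_simp; ring
      rw [e2, abs_div, abs_mul (y + c), abs_of_nonneg (by positivity : 0 ≤ 2 * c ^ 2)]
      have hy3 : 0 < |y| := abs_pos.2 hy0
      have b : y ^ 2 / 4 ≤ |y + c| * |y - c| := by
        calc y ^ 2 / 4 = (|y| / 2) * (|y| / 2) := by rw [← sq_abs]; ring
          _ ≤ _ := by gcongr
      have b6 : L ^ 2 + y ^ 2 ≤ 8 * (|y + c| * |y - c|) := by
        rw [← sq_abs y] at b ⊢
        nlinarith
      have hb : 2 * c ^ 2 / (|y + c| * |y - c|) ≤ 16 * (c ^ 2 / (L ^ 2 + y ^ 2)) := by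
        rw [← mul_div_assoc, div_le_div_iff₀ (by positivity) hden]
        nlinarith [sq_nonneg c]
      refine hb.trans (mul_le_mul_of_nonneg_right (by linarith) (by positivity))
  refine ⟨2 * (5 * (K₁ + 2 * K₂) + 16) + 64, by positivity, fun L y c hL => ?_⟩
  have hL0 : 0 < L := by linarith
  have hc1 : 0 < 1 + |c| := by positivity
  have hy1 : 0 < 1 + |y| := by positivity
  set D := (1 + |c|) ^ (5 / 2 : ℝ) * L ^ (-(1 / 2) : ℝ) * (1 + |y|) ^ (-(3 / 2) : ℝ) with hD
  have hD0 : 0 ≤ D := by positivity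
  by_cases hc : 2 * |c| ≤ |y|
  · have b1 : c ^ 2 / (L ^ 2 + y ^ 2) ≤ 2 * D := by
      have e1 : c ^ 2 ≤ (1 + |c|) ^ (5 / 2 : ℝ) := by
        calc c ^ 2 ≤ (1 + |c|) ^ 2 := by rw [← sq_abs c]; gcongr; linarith
          _ = (1 + |c|) ^ (2 : ℝ) := by norm_cast
          _ ≤ _ := rpow_le_rpow_of_exponent_le (by linarith [abs_nonneg c]) (by norm_num)
      have e2 : L ^ (1 / 2 : ℝ) * (1 + |y|) ^ (3 / 2 : ℝ) ≤ 2 * (L ^ 2 + y ^ 2) := by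
        calc _ ≤ (L + |y|) ^ (1 / 2 : ℝ) * (L + |y|) ^ (3 / 2 : ℝ) := by
              gcongr; linarith [abs_nonneg y]
          _ = (L + |y|) ^ 2 := by
              rw [← rpow_add (by positivity)]; norm_num
          _ ≤ _ := by rw [← sq_abs y]; nlinarith [sq_nonneg (L - |y|)]
      rw [div_le_iff₀ (by positivity)]
      have e3 : (1 + |c|) ^ (5 / 2 : ℝ) = D * (L ^ (1 / 2 : ℝ) * (1 + |y|) ^ (3 / 2 : ℝ)) := by
        rw [hD, rpow_neg hL0.le, rpow_neg hy1.le]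
        have := rpow_pos_of_pos hL0 (1 / 2)
        have := rpow_pos_of_pos hy1 (3 / 2)
        field_simp
      nlinarith
    refine (main L y c hL hc).trans ?_
    have : 0 ≤ 5 * (K₁ + 2 * K₂) + 16 := by positivity
    nlinarith
  · rw [not_le] at hc
    have b0 : ∀ t, |cutInv η L t| ≤ 2 / L := h.abs_cutInv_le hL0
    have b1 : |cutInv η L (y + c) + cutInv η L (y - c) - 2 * cutInv η L y| ≤ 8 / L := by
      have e1 := abs_le.1 (b0 (y + c))
      have e2 := abs_le.1 (b0 (y - c))
      have e3 := abs_le.1 (b0 y)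
      have : 8 / L = 4 * (2 / L) := by ring
      rw [abs_le]; constructor <;> linarith [e1.1, e2.1, e3.1, e1.2, e2.2, e3.2]
    have b2 : |y * (cutInv η L (y + c) + cutInv η L (y - c) - 2 * cutInv η L y)|
        ≤ 16 * ((1 + |c|) * L⁻¹) := by
      rw [abs_mul]
      calc _ ≤ (2 * (1 + |c|)) * (8 / L) := by gcongr; linarith
        _ = _ := by rw [div_eq_mul_inv]; ring
    have b3 : L⁻¹ ≤ L ^ (-(1 / 2) : ℝ) := by
      rw [← rpow_neg_one]
      exact rpow_le_rpow_of_exponent_le hL (by norm_num)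
    have b4 : (1 + |c|) ≤ 4 * ((1 + |c|) ^ (5 / 2 : ℝ) * (1 + |y|) ^ (-(3 / 2) : ℝ)) := by
      have e1 : (1 + |y|) ^ (3 / 2 : ℝ) ≤ 4 * (1 + |c|) ^ (3 / 2 : ℝ) := by
        calc (1 + |y|) ^ (3 / 2 : ℝ) ≤ (2 * (1 + |c|)) ^ (3 / 2 : ℝ) := by gcongr; linarith
          _ = 2 ^ (3 / 2 : ℝ) * (1 + |c|) ^ (3 / 2 : ℝ) := by rw [mul_rpow] <;> positivity
          _ ≤ 2 ^ (2 : ℝ) * (1 + |c|) ^ (3 / 2 : ℝ) := by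
              gcongr <;> norm_num
          _ = _ := by norm_num
      rw [rpow_neg hy1.le, ← mul_assoc, ← div_eq_mul_inv, le_div_iff₀ (by positivity)]
      calc (1 + |c|) * (1 + |y|) ^ (3 / 2 : ℝ) ≤ (1 + |c|) * (4 * (1 + |c|) ^ (3 / 2 : ℝ)) := by
            gcongr
        _ = 4 * ((1 + |c|) ^ (1 : ℝ) * (1 + |c|) ^ (3 / 2 : ℝ)) := by rw [rpow_one]; ring
        _ = _ := by rw [← rpow_add hc1]; norm_num
    calc _ ≤ 16 * ((1 + |c|) * L⁻¹) := b2
      _ ≤ 16 * ((4 * ((1 + |c|) ^ (5 / 2 : ℝ) * (1 + |y|) ^ (-(3 / 2) : ℝ))) *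
            L ^ (-(1 / 2) : ℝ)) := by gcongr
      _ = 64 * D := by rw [hD]; ring
      _ ≤ _ := by
        refine mul_le_mul_of_nonneg_right ?_ hD0
        have : 0 ≤ 5 * (K₁ + 2 * K₂) + 16 := by positivity
        linarith

end IsBump

end

section

/-! ### Lattice point counting -/

/-- The alternating sum `κ₀ - κ₁ + κ₂ - ⋯`. -/
def altSum {n : ℕ} (κ : Fin n → Freq) : Freq := ∑ m : Fin n, (-1 : ℤ) ^ (m : ℕ) • κ m

/-- The integer `|k|²`. -/
def nsqInt (k : Freq) : ℤ := ∑ i, k i ^ 2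

/-- The scalar product on `ℤ³`. -/
def dotInt (q l : Freq) : ℤ := ∑ i, q i * l i

lemma nsq_eq_cast (k : Freq) : nsq k = (nsqInt k : ℝ) := by simp [nsq, nsqInt]

lemma nsqInt_sub (q l : Freq) : nsqInt (q - l) = nsqInt q - 2 * dotInt q l + nsqInt l := by
  simp only [nsqInt, dotInt, Fin.sum_univ_three, Pi.sub_apply]; ring

lemma nsqInt_add (q l : Freq) : nsqInt (q + l) = nsqInt q + 2 * dotInt q l + nsqInt l := by
  simp only [nsqInt, dotInt, Fin.sum_univ_three, Pi.add_apply]; ring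

/-- The cube of frequencies with coordinates at most `B` in modulus. -/
def freqBox (B : ℕ) : Finset Freq := Fintype.piFinset fun _ => Finset.Icc (-(B : ℤ)) B

lemma card_freqBox (B : ℕ) : (freqBox B).card = (2 * B + 1) ^ 3 := by
  rw [freqBox, Fintype.card_piFinset]
  simp
  omega

lemma abs_coord_le_br (q : Freq) (i : Fin 3) : |(q i : ℝ)| ≤ br q := by
  have h1 : ((q i : ℝ)) ^ 2 ≤ br q ^ 2 := by
    rw [br_sq, nsq]
    have := single_le_sum (f := fun i => ((q i : ℝ)) ^ 2) (fun i _ => sq_nonneg _)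
      (Finset.mem_univ i)
    linarith
  exact abs_le_of_sq_le_sq h1 (br_pos q).le

lemma mem_freqBox_of_br_le {q : Freq} {a : ℝ} (h : br q ≤ a) : q ∈ freqBox ⌊a⌋₊ := by
  rw [freqBox, Fintype.mem_piFinset]
  intro i
  have h1 : |(q i : ℝ)| ≤ a := (abs_coord_le_br q i).trans h
  have h2 : (q i).natAbs ≤ ⌊a⌋₊ := by
    refine Nat.le_floor ?_
    rw [Nat.cast_natAbs]; exact_mod_cast h1
  rw [Finset.mem_Icc]
  omega

lemma sum_dotInt_le {B : ℕ} {S : Finset Freq} (hS : S ⊆ freqBox B) {l : Freq} (hl : l ≠ 0) (r : ℤ)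
    {h : ℤ → ℝ} (h0 : ∀ j, 0 ≤ h j) (hs : Summable h) :
    ∑ q ∈ S, h (2 * dotInt q l + r) ≤ (2 * B + 1) ^ 2 * ∑' j, h j := by
  classical
  obtain ⟨i, hi⟩ : ∃ i, l i ≠ 0 := by
    by_contra hne; push Not at hne; exact hl (funext hne)
  set π : Freq → Freq := fun q => Function.update q i 0 with hπ
  set P : Finset Freq := Fintype.piFinset fun m =>
    if m = i then {0} else Finset.Icc (-(B : ℤ)) B with hP
  have hmaps : ∀ q ∈ S, π q ∈ P := by
    intro q hq
    have := hS hq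
    rw [freqBox, Fintype.mem_piFinset] at this
    rw [hP, Fintype.mem_piFinset]
    intro m
    by_cases hm : m = i
    · subst hm; simp [hπ]
    · simp only [hπ, update_of_ne hm, if_neg hm]; exact this m
  have hcard : P.card = (2 * B + 1) ^ 2 := by
    have hIcc : (Finset.Icc (-(B : ℤ)) B).card = 2 * B + 1 := by simp; omega
    rw [hP, Fintype.card_piFinset, Fin.prod_univ_three]
    fin_cases i <;> simp [hIcc] <;> ring
  rw [← Finset.sum_fiberwise_of_maps_to hmaps]
  have hfib : ∀ p ∈ P, ∑ q ∈ S with π q = p, h (2 * dotInt q l + r) ≤ ∑' j, h j := by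
    intro p _
    have hinj : Set.InjOn (fun q => 2 * dotInt q l + r) (S.filter fun q => π q = p : Finset Freq) := by
      intro q hq q' hq' heq
      simp only [Finset.coe_filter, mem_ofPred_eq] at hq hq'
      have hπe : π q = π q' := hq.2.trans hq'.2.symm
      have hoff : ∀ m, m ≠ i → q m = q' m := by
        intro m hm
        have := congrFun hπe m
        simpa [hπ, update_of_ne hm] using this
      have hdot : dotInt q l = dotInt q' l := by simpa using heq
      have h2 : q i * l i = q' i * l i := by
        rw [dotInt, dotInt, ← add_sum_erase _ _ (Finset.mem_univ i),
          ← add_sum_erase (Finset.univ) (fun m => q' m * l m) (Finset.mem_univ i)] at hdot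
        have : ∑ m ∈ Finset.univ.erase i, q m * l m = ∑ m ∈ Finset.univ.erase i, q' m * l m :=
          sum_congr rfl fun m hm => by rw [hoff m (ne_of_mem_erase hm)]
        linarith
      have h3 : q i = q' i := mul_right_cancel₀ hi h2
      funext m
      by_cases hm : m = i
      · rw [hm, h3]
      · exact hoff m hm
    rw [← sum_image (f := h) hinj]
    exact hs.sum_le_tsum _ (fun j _ => h0 j)
  refine (sum_le_sum hfib).trans ?_
  rw [sum_const, hcard, nsmul_eq_mul]
  push_cast
  rfl

lemma altSum_eq_pair {n : ℕ} {i i' : Fin n} (hne : i ≠ i') (κ : Fin n → Freq) :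
    altSum κ = altSum (lowPart i i' κ) + ((-1 : ℤ) ^ (i : ℕ) • κ i + (-1 : ℤ) ^ (i' : ℕ) • κ i') := by
  rw [altSum, altSum, sum_eq_pair_add_low hne, sum_eq_pair_add_low hne
    (fun m => (-1 : ℤ) ^ (m : ℕ) • lowPart i i' κ m)]
  have h1 : lowPart i i' κ i = 0 := by simp [lowPart]
  have h2 : lowPart i i' κ i' = 0 := by simp [lowPart]
  rw [h1, h2, smul_zero, smul_zero, add_zero, add_zero]
  congr 1
  exact sum_congr rfl fun m hm => by rw [lowPart_of_mem κ hm]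

lemma neg_one_pow_smul_smul (m : ℕ) (k : Freq) : (-1 : ℤ) ^ m • ((-1 : ℤ) ^ m • k) = k := by
  rw [smul_smul, ← mul_pow]; simp

lemma partner_eq {n : ℕ} {i i' : Fin n} (hne : i ≠ i') {κ : Fin n → Freq} (h : altSum κ = 0) :
    κ i' = -((-1 : ℤ) ^ ((i' : ℕ) + i) • κ i) - (-1 : ℤ) ^ (i' : ℕ) • altSum (lowPart i i' κ) := by
  rw [altSum_eq_pair hne] at h
  have h1 : (-1 : ℤ) ^ (i' : ℕ) • κ i' = -((-1 : ℤ) ^ (i : ℕ) • κ i) - altSum (lowPart i i' κ) := by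
    rw [eq_sub_iff_add_eq, eq_neg_iff_add_eq_zero, ← h]; abel
  rw [← neg_one_pow_smul_smul (i' : ℕ) (κ i'), h1, smul_sub, smul_neg, smul_smul, ← pow_add]

lemma eq_of_lowPart_eq {n : ℕ} {i i' : Fin n} (hne : i ≠ i') {κ κ' : Fin n → Freq}
    (h : altSum κ = 0) (h' : altSum κ' = 0) (hlow : lowPart i i' κ = lowPart i i' κ')
    (hi : κ i = κ' i) : κ = κ' := by
  funext m
  by_cases hm : m = i
  · rw [hm, hi]
  by_cases hm' : m = i'
  · rw [hm', partner_eq hne h, partner_eq hne h', hlow, hi]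
  · have hmem : m ∈ lowSlots i i' := mem_lowSlots.2 ⟨hm, hm'⟩
    rw [← lowPart_of_mem κ hmem, ← lowPart_of_mem κ' hmem, hlow]

lemma two_mul_floor_add_one_le {M : ℝ} (hM : 1 ≤ M) : (2 * (⌊3 * M⌋₊ : ℝ) + 1) ≤ 7 * M := by
  have := Nat.floor_le (by linarith : 0 ≤ 3 * M)
  linarith

lemma injOn_fiber {n : ℕ} {i i' : Fin n} (hne : i ≠ i') {T : Finset (Fin n → Freq)}
    (hT : ∀ κ ∈ T, altSum κ = 0) (v : Fin n → Freq) [DecidableEq (Fin n → Freq)] :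
    Set.InjOn (fun κ : Fin n → Freq => κ i)
      (T.filter fun κ => lowPart i i' κ = v : Finset (Fin n → Freq)) := by
  intro κ hκ κ' hκ' h
  simp only [Finset.coe_filter, mem_ofPred_eq] at hκ hκ'
  exact eq_of_lowPart_eq hne (hT _ hκ.1) (hT _ hκ'.1) (hκ.2.trans hκ'.2.symm) h

lemma sum_fiber_le {n : ℕ} {i i' : Fin n} (hne : i ≠ i') {T : Finset (Fin n → Freq)} {M : ℝ}
    (hM : 1 ≤ M) (hT : ∀ κ ∈ T, altSum κ = 0) (hbr : ∀ κ ∈ T, br (κ i) ≤ 3 * M)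
    (v : Fin n → Freq) [DecidableEq (Fin n → Freq)] {g : (Fin n → Freq) → ℝ} {b : ℝ} (hb : 0 ≤ b)
    (hg : ∀ κ ∈ T, lowPart i i' κ = v → g κ ≤ b) :
    ∑ κ ∈ T with lowPart i i' κ = v, g κ ≤ 343 * M ^ 3 * b := by
  have h1 : ∑ κ ∈ T with lowPart i i' κ = v, g κ
      ≤ ((T.filter fun κ => lowPart i i' κ = v).card : ℝ) * b := by
    rw [← nsmul_eq_mul]
    refine Finset.sum_le_card_nsmul _ _ _ fun κ hκ => ?_
    rw [mem_filter] at hκ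
    exact hg κ hκ.1 hκ.2
  refine h1.trans (mul_le_mul_of_nonneg_right ?_ hb)
  have h2 : (T.filter fun κ => lowPart i i' κ = v).card ≤ (freqBox ⌊3 * M⌋₊).card := by
    refine Finset.card_le_card_of_injOn (fun κ => κ i) (fun κ hκ => ?_) (injOn_fiber hne hT v)
    exact mem_freqBox_of_br_le (hbr κ (mem_filter.1 hκ).1)
  rw [card_freqBox] at h2
  calc ((T.filter fun κ => lowPart i i' κ = v).card : ℝ) ≤ (2 * (⌊3 * M⌋₊ : ℝ) + 1) ^ 3 := by
        exact_mod_cast h2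
    _ ≤ (7 * M) ^ 3 := by gcongr; exact two_mul_floor_add_one_le hM
    _ = _ := by ring

lemma sum_fiber_dotInt_le {n : ℕ} {i i' : Fin n} (hne : i ≠ i') {T : Finset (Fin n → Freq)} {M : ℝ}
    (hM : 1 ≤ M) (hT : ∀ κ ∈ T, altSum κ = 0) (hbr : ∀ κ ∈ T, br (κ i) ≤ 3 * M)
    (v : Fin n → Freq) [DecidableEq (Fin n → Freq)] {l : Freq} (hl : l ≠ 0) (r : ℤ)
    {h : ℤ → ℝ} (h0 : ∀ j, 0 ≤ h j) (hs : Summable h) :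
    ∑ κ ∈ T with lowPart i i' κ = v, h (2 * dotInt (κ i) l + r) ≤ 49 * M ^ 2 * ∑' j, h j := by
  classical
  rw [← sum_image (g := fun κ : Fin n → Freq => κ i)
    (f := fun q => h (2 * dotInt q l + r)) (injOn_fiber hne hT v)]
  refine (sum_dotInt_le (B := ⌊3 * M⌋₊) (fun q hq => ?_) hl r h0 hs).trans ?_
  · obtain ⟨κ, hκ, rfl⟩ := Finset.mem_image.1 hq
    exact mem_freqBox_of_br_le (hbr κ (mem_filter.1 hκ).1)
  · have := two_mul_floor_add_one_le hM
    have h3 : 0 ≤ ∑' j, h j := tsum_nonneg h0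
    calc _ ≤ (7 * M) ^ 2 * ∑' j, h j := by gcongr
      _ = _ := by ring

lemma br_neg_one_pow_smul (m : ℕ) (k : Freq) : br ((-1 : ℤ) ^ m • k) = br k := by
  rcases neg_one_pow_eq_or ℤ m with h | h <;> simp [h, br_neg]

lemma br_altSum_le {n : ℕ} (κ : Fin n → Freq) : br (altSum κ) ≤ 1 + ∑ m, br (κ m) := by
  rw [altSum]
  refine (br_sum_le _ _).trans (le_of_eq ?_)
  congr 1
  exact sum_congr rfl fun m _ => br_neg_one_pow_smul _ _

/-! ### The multiplier `ψ` -/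

lemma abs_rpow_sub_rpow_le {s B x y : ℝ} (hs : 1 ≤ s) (hx : 0 ≤ x) (hy : 0 ≤ y) (hxB : x ≤ B)
    (hyB : y ≤ B) : |x ^ s - y ^ s| ≤ s * B ^ (s - 1) * |x - y| := by
  have := (convex_Icc (0:ℝ) B).norm_image_sub_le_of_norm_hasDerivWithin_le
    (f := fun x => x ^ s) (f' := fun x => s * x ^ (s - 1)) (C := s * B ^ (s - 1)) (x := y) (y := x)
    (fun t _ => (Real.hasDerivAt_rpow_const (Or.inr hs)).hasDerivWithinAt)
    (fun t ht => by
      rw [norm_of_nonneg (mul_nonneg (by linarith) (rpow_nonneg ht.1 _))]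
      exact mul_le_mul_of_nonneg_left (rpow_le_rpow ht.1 ht.2 (by linarith)) (by linarith))
    ⟨hy, hyB⟩ ⟨hx, hxB⟩
  simpa [norm_eq_abs] using this

lemma rpow_le_mul_of_le {s B E x : ℝ} (hs : 1 ≤ s) (hx : 0 ≤ x) (hxB : x ≤ B) (hxE : x ≤ E) :
    x ^ s ≤ B ^ (s - 1) * E := by
  have e : x ^ s = x ^ (s - 1) * x := by
    rcases hx.eq_or_lt with rfl | h
    · rw [Real.zero_rpow (by linarith), mul_zero]
    · rw [← Real.rpow_add_one h.ne']; simp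
  rw [e]
  have := rpow_le_rpow hx hxB (by linarith : 0 ≤ s - 1)
  have h0 := rpow_nonneg hx (s - 1)
  have h1 := h0.trans this
  gcongr

lemma rpow_le_mul_sq_of_le {s B E x : ℝ} (hs : 2 ≤ s) (hx : 0 ≤ x) (hxB : x ≤ B) (hxE : x ≤ E) :
    x ^ s ≤ B ^ (s - 2) * E ^ 2 := by
  have h1 := rpow_le_mul_of_le (s := s) (by linarith) hx hxB hxE
  have h2 := rpow_le_mul_of_le (s := s - 1) (by linarith) hx hxB hxE
  have h3 := rpow_le_mul_of_le (s := s) (by linarith) hx le_rfl hxE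
  calc x ^ s ≤ x ^ (s - 1) * E := h3
    _ ≤ B ^ (s - 1 - 1) * E * E := by gcongr; linarith
    _ = _ := by ring_nf

lemma abs_pair_rpow_le {s B x y : ℝ} (hs : 1 ≤ s) (hx : 0 ≤ x) (hy : 0 ≤ y) (hxB : x ≤ B)
    (hyB : y ≤ B) (m m' : ℕ) :
    |(-1 : ℝ) ^ m * x ^ s + (-1 : ℝ) ^ m' * y ^ s|
      ≤ s * B ^ (s - 1) * |(-1 : ℝ) ^ m * x + (-1 : ℝ) ^ m' * y| := by
  have hd := abs_rpow_sub_rpow_le hs hx hy hxB hyB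
  have hB : 0 ≤ B ^ (s - 1) := rpow_nonneg (hx.trans hxB) _
  have hp : |x ^ s + y ^ s| ≤ s * B ^ (s - 1) * |x + y| := by
    have h1 := rpow_le_mul_of_le hs hx hxB le_rfl
    have h2 := rpow_le_mul_of_le hs hy hyB le_rfl
    rw [abs_of_nonneg (add_nonneg (rpow_nonneg hx _) (rpow_nonneg hy _)),
      abs_of_nonneg (add_nonneg hx hy)]
    nlinarith [mul_nonneg hB (add_nonneg hx hy)]
  rcases neg_one_pow_eq_or ℝ m with h | h <;> rcases neg_one_pow_eq_or ℝ m' with h' | h' <;>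
    rw [h, h']
  · simpa using hp
  · simpa [← sub_eq_add_neg] using hd
  · have e1 : -1 * x ^ s + 1 * y ^ s = -(x ^ s - y ^ s) := by ring
    have e2 : -1 * x + 1 * y = -(x - y) := by ring
    rw [e1, e2, abs_neg, abs_neg]; exact hd
  · have e1 : -1 * x ^ s + -1 * y ^ s = -(x ^ s + y ^ s) := by ring
    have e2 : -1 * x + -1 * y = -(x + y) := by ring
    rw [e1, e2, abs_neg, abs_neg]; exact hp

lemma abs_low_sum_le {i i' : Fin 6} (f : Fin 6 → ℝ) {b : ℝ} (hb : 0 ≤ b)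
    (hf : ∀ m ∈ lowSlots i i', |f m| ≤ b) :
    |∑ m ∈ lowSlots i i', (-1 : ℝ) ^ (m : ℕ) * f m| ≤ 6 * b := by
  refine (abs_sum_le_sum_abs _ _).trans ?_
  calc ∑ m ∈ lowSlots i i', |(-1 : ℝ) ^ (m : ℕ) * f m| ≤ ∑ _m ∈ lowSlots i i', b := by
        refine sum_le_sum fun m hm => ?_
        rw [abs_mul, abs_pow, abs_neg, abs_one, one_pow, one_mul]; exact hf m hm
    _ = ((lowSlots i i').card : ℝ) * b := by simp
    _ ≤ _ := by
      have : (lowSlots i i').card ≤ 6 := (card_le_univ _).trans (by simp)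
      gcongr; exact_mod_cast this

lemma abs_Om_pair_le {k : Fin 6 → Freq} {i i' : Fin 6} (hne : i ≠ i') {E : ℝ} (hE : 0 ≤ E)
    (hlow : ∀ m ∈ lowSlots i i', nsq (k m) ≤ E) :
    |Om k - ((-1 : ℝ) ^ (i : ℕ) * nsq (k i) + (-1 : ℝ) ^ (i' : ℕ) * nsq (k i'))| ≤ 6 * E := by
  have e : Om k - ((-1 : ℝ) ^ (i : ℕ) * nsq (k i) + (-1 : ℝ) ^ (i' : ℕ) * nsq (k i'))
      = ∑ m ∈ lowSlots i i', (-1 : ℝ) ^ (m : ℕ) * nsq (k m) := by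
    rw [Om, sum_eq_pair_add_low hne]; ring
  rw [e]
  exact abs_low_sum_le _ hE fun m hm => by rw [abs_of_nonneg (nsq_nonneg _)]; exact hlow m hm

lemma abs_psi_pair_le {s : ℝ} (hs : 2 ≤ s) {k : Fin 6 → Freq} {i i' : Fin 6} (hne : i ≠ i')
    {B E : ℝ} (hB : ∀ m, nsq (k m) ≤ B) (hlow : ∀ m ∈ lowSlots i i', nsq (k m) ≤ E) :
    |psi s k - ((-1 : ℝ) ^ (i : ℕ) * nsq (k i) ^ s + (-1 : ℝ) ^ (i' : ℕ) * nsq (k i') ^ s)|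
      ≤ 6 * (B ^ (s - 2) * E ^ 2) := by
  have e : psi s k - ((-1 : ℝ) ^ (i : ℕ) * nsq (k i) ^ s + (-1 : ℝ) ^ (i' : ℕ) * nsq (k i') ^ s)
      = ∑ m ∈ lowSlots i i', (-1 : ℝ) ^ (m : ℕ) * nsq (k m) ^ s := by
    rw [psi, sum_eq_pair_add_low hne]; ring
  have hB0 : 0 ≤ B := (nsq_nonneg _).trans (hB 0)
  rw [e]
  refine abs_low_sum_le _ (mul_nonneg (rpow_nonneg hB0 _) (sq_nonneg _)) fun m hm => ?_
  rw [abs_of_nonneg (rpow_nonneg (nsq_nonneg _) _)]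
  exact rpow_le_mul_sq_of_le hs (nsq_nonneg _) (hB m) (hlow m hm)

lemma abs_psi_le_Om {s : ℝ} (hs : 1 ≤ s) {k : Fin 6 → Freq} {i i' : Fin 6} (hne : i ≠ i')
    {B E : ℝ} (hE : 0 ≤ E) (hB : ∀ m, nsq (k m) ≤ B)
    (hlow : ∀ m ∈ lowSlots i i', nsq (k m) ≤ E) :
    |psi s k| ≤ s * B ^ (s - 1) * (|Om k| + 12 * E) := by
  have hB0 : 0 ≤ B := (nsq_nonneg _).trans (hB 0)
  have hBs : 0 ≤ B ^ (s - 1) := rpow_nonneg hB0 _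
  have h1 := abs_pair_rpow_le hs (nsq_nonneg (k i)) (nsq_nonneg (k i')) (hB i) (hB i') i i'
  have h2 : |psi s k - ((-1 : ℝ) ^ (i : ℕ) * nsq (k i) ^ s + (-1 : ℝ) ^ (i' : ℕ) * nsq (k i') ^ s)|
      ≤ 6 * (B ^ (s - 1) * E) := by
    have e : psi s k - ((-1 : ℝ) ^ (i : ℕ) * nsq (k i) ^ s + (-1 : ℝ) ^ (i' : ℕ) * nsq (k i') ^ s)
        = ∑ m ∈ lowSlots i i', (-1 : ℝ) ^ (m : ℕ) * nsq (k m) ^ s := by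
      rw [psi, sum_eq_pair_add_low hne]; ring
    rw [e]
    refine abs_low_sum_le _ (mul_nonneg hBs hE) fun m hm => ?_
    rw [abs_of_nonneg (rpow_nonneg (nsq_nonneg _) _)]
    exact rpow_le_mul_of_le hs (nsq_nonneg _) (hB m) (hlow m hm)
  have h3 := abs_Om_pair_le hne hE hlow
  set x := (-1 : ℝ) ^ (i : ℕ) * nsq (k i) + (-1 : ℝ) ^ (i' : ℕ) * nsq (k i')
  set y := (-1 : ℝ) ^ (i : ℕ) * nsq (k i) ^ s + (-1 : ℝ) ^ (i' : ℕ) * nsq (k i') ^ s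
  have h4 : |psi s k| ≤ |y| + 6 * (B ^ (s - 1) * E) := by
    have := abs_sub_abs_le_abs_sub (psi s k) y; linarith
  have h5 : |x| ≤ |Om k| + 6 * E := by
    have := abs_sub_abs_le_abs_sub x (Om k)
    rw [abs_sub_comm] at this; linarith
  have h6 : s * B ^ (s - 1) * |x| ≤ s * B ^ (s - 1) * (|Om k| + 6 * E) := by gcongr
  nlinarith [mul_nonneg hBs hE]

lemma abs_wt_sub_le {s B : ℝ} (hs : 1 ≤ s) {a b : Freq} (ha : nsq a ≤ B) (hb : nsq b ≤ B) :
    |wt s a - wt s b| ≤ s * B ^ (s - 1) * |nsq a - nsq b| * (wt s a * wt s b) := by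
  have h1 : 0 < 1 + nsq a ^ s := by linarith [rpow_nonneg (nsq_nonneg a) s]
  have h2 : 0 < 1 + nsq b ^ s := by linarith [rpow_nonneg (nsq_nonneg b) s]
  have e : wt s a - wt s b = (nsq b ^ s - nsq a ^ s) * (wt s a * wt s b) := by
    rw [wt, wt]; field_simp; ring
  rw [e, abs_mul, abs_of_pos (mul_pos (wt_pos s a) (wt_pos s b)), abs_sub_comm]
  gcongr
  · exact (mul_pos (wt_pos s a) (wt_pos s b)).le
  · exact abs_rpow_sub_rpow_le hs (nsq_nonneg a) (nsq_nonneg b) ha hb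

end

section

/-! ### Moments of multilinear forms on dyadic shells -/

/-- The multilinear form with real coefficients `c`, restricted to the index set `T`. -/
def formSum {n : ℕ} (T : Finset (Fin n → Freq)) (c : (Fin n → Freq) → ℝ) (u : Coeff) : ℂ :=
  ∑ κ ∈ T, (c κ : ℂ) * mono u κ

lemma measurable_formSum {n : ℕ} (T : Finset (Fin n → Freq)) (c : (Fin n → Freq) → ℝ) :
    Measurable (formSum T c) := by
  unfold formSum
  exact measurable_sum _ fun κ _ => (measurable_mono κ).const_mul _

/-- Finite sets of tuples with alternating sum zero and frequencies of size at most `3M`, two of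
which at least have size `M`, up to a constant. -/
structure IsShell {n : ℕ} (T : Finset (Fin n → Freq)) (M : ℝ) : Prop where
  one_le : 1 ≤ M
  altSum_eq : ∀ κ ∈ T, altSum κ = 0
  br_le : ∀ κ ∈ T, ∀ m, br (κ m) ≤ 3 * M
  exists_pair : ∀ κ ∈ T, ∃ i i', i < i' ∧ M / 60 ≤ br (κ i) ∧ M / 60 ≤ br (κ i')

/-- The part of `T` on which the frequencies in the slots `i`, `i'` are large. -/
def bigPair {n : ℕ} (T : Finset (Fin n → Freq)) (M : ℝ) (i i' : Fin n) :
    Finset (Fin n → Freq) :=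
  T.filter fun κ => M / 60 ≤ br (κ i) ∧ M / 60 ≤ br (κ i')

/-- The sum of the pairings of the slots `i`, `i'`. -/
def pairSum {n : ℕ} (s : ℝ) (T : Finset (Fin n → Freq)) (c : (Fin n → Freq) → ℝ) (i i' : Fin n)
    (u : Coeff) : ℂ :=
  ∑ κ ∈ T, (c κ : ℂ) *
    (lowMono i i' u κ * covTerm s (slotConj i) (slotConj i') (κ i) (κ i'))

open scoped Classical in
theorem eLpNorm_formSum_le {n : ℕ} {ρ : ℂ → ℝ} (hρ : ∀ z, |ρ z| ≤ ‖z‖) (hρm : Measurable ρ)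
    (hρadd : ∀ z w, ρ (z + w) = ρ z + ρ w) {T : Finset (Fin n → Freq)} {M : ℝ} (hT : IsShell T M)
    {s σ A R Γ D : ℝ} (hA : A + 3 < σ) (hR : 1 ≤ R) (hΓ : 0 ≤ Γ) (hD : 0 ≤ D)
    (c : (Fin n → Freq) → ℝ)
    (hHS : ∀ i i', i < i' → ∀ v, ∑ κ ∈ bigPair T M i i' with lowPart i i' κ = v,
      c κ ^ 2 * (wt s (κ i) * wt s (κ i')) ≤ (Γ * lowBr i i' v ^ A) ^ 2)
    (hpair : ∀ i i', i < i' → ∀ T' ⊆ bigPair T M i i',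
      (∀ κ ∈ T, lowBr i i' κ < M / 600 → κ ∈ T') → ∀ u ∈ sobBall σ R,
      |ρ (pairSum s T' c i i' u)| ≤ D) {p : ℝ} (hp : 2 ≤ p) :
    eLpNorm ((sobBall σ R).indicator fun u => ρ (formSum T c u)) (ofReal p) (gaussianSob s)
      ≤ ofReal (n ^ 2 * (128 * R ^ n * brMass (σ - A) ^ n * Γ * p + D)) := by
  have hρ0 : ρ 0 = 0 := by simpa using hρadd 0 0
  rcases T.eq_empty_or_nonempty with rfl | ⟨κ₀, hκ₀⟩
  · have : ((sobBall σ R).indicator fun u => ρ (formSum (∅ : Finset (Fin n → Freq)) c u)) = 0 := by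
      ext u; simp [formSum, hρ0, indicator]
    rw [this, eLpNorm_zero]; exact zero_le
  have hex : ∀ κ : Fin n → Freq, ∃ P : Fin n × Fin n, κ ∈ T →
      P.1 < P.2 ∧ M / 60 ≤ br (κ P.1) ∧ M / 60 ≤ br (κ P.2) := by
    intro κ
    by_cases hκ : κ ∈ T
    · obtain ⟨i, i', h⟩ := hT.exists_pair κ hκ
      exact ⟨(i, i'), fun _ => h⟩
    · obtain ⟨i, i', -⟩ := hT.exists_pair κ₀ hκ₀
      exact ⟨(i, i'), fun h => absurd h hκ⟩
  choose sel hsel using hex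
  set S : Fin n × Fin n → Finset (Fin n → Freq) := fun P => T.filter fun κ => sel κ = P with hS
  have hSsub : ∀ P, S P ⊆ bigPair T M P.1 P.2 := by
    intro P κ hκ
    rw [hS, mem_filter] at hκ
    rw [bigPair, mem_filter]
    have := hsel κ hκ.1
    rw [hκ.2] at this
    exact ⟨hκ.1, this.2⟩
  have hSemp : ∀ P, ¬ P.1 < P.2 → S P = ∅ := by
    intro P hP
    rw [hS]
    refine Finset.filter_eq_empty_iff.2 fun κ hκ he => hP ?_
    have := hsel κ hκ
    rw [he] at this
    exact this.1
  have hSlow : ∀ P, P.1 < P.2 → ∀ κ ∈ T, lowBr P.1 P.2 κ < M / 600 → κ ∈ S P := by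
    intro P hP κ hκ hlow
    rw [hS, mem_filter]
    refine ⟨hκ, ?_⟩
    have h := hsel κ hκ
    have hM : 0 < M := by linarith [hT.one_le]
    have hnot : ∀ m, M / 60 ≤ br (κ m) → m = P.1 ∨ m = P.2 := by
      intro m hm
      by_contra hne
      push Not at hne
      have := br_le_lowBr (i := P.1) (i' := P.2) κ (mem_lowSlots.2 hne)
      linarith
    have h1 := hnot _ h.2.1
    have h2 := hnot _ h.2.2
    have h3 := h.1
    rcases h1 with h1 | h1 <;> rcases h2 with h2 | h2
    · rw [h1, h2] at h3; exact absurd h3 (lt_irrefl _)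
    · exact Prod.ext h1 h2
    · rw [h1, h2] at h3; exact absurd h3 (not_lt.2 hP.le)
    · rw [h1, h2] at h3; exact absurd h3 (lt_irrefl _)
  set X : Fin n × Fin n → Coeff → ℂ := fun P u => ∑ κ ∈ S P, (c κ : ℂ) * (mono u κ
    - lowMono P.1 P.2 u κ * covTerm s (slotConj P.1) (slotConj P.2) (κ P.1) (κ P.2)) with hX
  have hXm : ∀ P, Measurable (X P) := fun P => by
    refine measurable_sum _ fun κ _ => Measurable.const_mul ?_ _
    exact (measurable_mono κ).sub ((measurable_lowMono _ _ κ).mul_const _)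
  have hYm : ∀ P, Measurable fun u => pairSum s (S P) c P.1 P.2 u := fun P => by
    unfold pairSum
    refine measurable_sum _ fun κ _ => Measurable.const_mul ?_ _
    exact (measurable_lowMono _ _ κ).mul_const _
  have hρsum : ∀ (f : Fin n × Fin n → ℂ), ρ (∑ P, f P) = ∑ P, ρ (f P) := fun f =>
    map_sum (AddMonoidHom.mk' ρ hρadd) f _
  have hdec : ((sobBall σ R).indicator fun u => ρ (formSum T c u))
      = ∑ P : Fin n × Fin n, (((sobBall σ R).indicator fun u => ρ (X P u))
        + (sobBall σ R).indicator fun u => ρ (pairSum s (S P) c P.1 P.2 u)) := by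
    ext u
    rw [Finset.sum_apply]
    by_cases hu : u ∈ sobBall σ R
    · simp only [Pi.add_apply, indicator_of_mem hu]
      rw [formSum, ← Finset.sum_fiberwise_of_maps_to (s := T) (t := Finset.univ) (g := sel)
        (fun _ _ => Finset.mem_univ _), hρsum]
      refine sum_congr rfl fun P _ => ?_
      rw [← hρadd]
      congr 1
      rw [hX, pairSum, ← sum_add_distrib]
      exact sum_congr rfl fun κ _ => by ring
    · simp [hu]
  rw [hdec]
  have hp1 : (1 : ℝ≥0∞) ≤ ofReal p :=
    ENNReal.one_le_ofReal.2 (by linarith)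
  have hb := measurableSet_sobBall σ R
  have hm1 : ∀ P, AEStronglyMeasurable ((sobBall σ R).indicator fun u => ρ (X P u))
      (gaussianSob s) := fun P =>
    ((hρm.comp (hXm P)).indicator hb).aestronglyMeasurable
  have hm2 : ∀ P, AEStronglyMeasurable ((sobBall σ R).indicator fun u =>
      ρ (pairSum s (S P) c P.1 P.2 u)) (gaussianSob s) := fun P =>
    ((hρm.comp (hYm P)).indicator hb).aestronglyMeasurable
  refine (eLpNorm_sum_le (fun P _ => (hm1 P).add (hm2 P)) hp1).trans ?_
  have hp0 : 0 ≤ p := by linarith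
  have hbm : 0 ≤ brMass (σ - A) := tsum_nonneg fun k => (rpow_pos_of_pos (br_pos k) _).le
  set G := 128 * R ^ n * brMass (σ - A) ^ n * Γ * p with hG
  have hG0 : 0 ≤ G := by positivity
  have hone : ∀ P : Fin n × Fin n, eLpNorm (((sobBall σ R).indicator fun u => ρ (X P u))
        + (sobBall σ R).indicator fun u => ρ (pairSum s (S P) c P.1 P.2 u)) (ofReal p)
        (gaussianSob s) ≤ ofReal (G + D) := by
    intro P
    rw [ofReal_add hG0 hD]
    refine (eLpNorm_add_le (hm1 P) (hm2 P) hp1).trans (add_le_add ?_ ?_)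
    · by_cases hP : P.1 < P.2
      · have h1 : eLpNorm ((sobBall σ R).indicator fun u => ρ (X P u)) (ofReal p)
            (gaussianSob s) ≤ eLpNorm ((sobBall σ R).indicator (X P)) (ofReal p)
            (gaussianSob s) := by
          refine eLpNorm_mono fun u => ?_
          by_cases hu : u ∈ sobBall σ R
          · simpa [hu] using hρ (X P u)
          · simp [hu]
        refine h1.trans ?_
        refine eLpNorm_form_sub_pairing_le hP.ne hA hR hΓ (S P) (fun κ => (c κ : ℂ)) (fun v => ?_) hp
        refine le_trans ?_ (hHS P.1 P.2 hP v)
        have hsub : (S P).filter (fun κ => lowPart P.1 P.2 κ = v)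
            ⊆ (bigPair T M P.1 P.2).filter (fun κ => lowPart P.1 P.2 κ = v) :=
          Finset.filter_subset_filter _ (hSsub P)
        refine le_trans (le_of_eq ?_) (Finset.sum_le_sum_of_subset_of_nonneg hsub fun κ _ _ => ?_)
        · exact sum_congr rfl fun κ _ => by
            rw [norm_real, norm_eq_abs, sq_abs]
        · have := wt_pos s (κ P.1)
          have := wt_pos s (κ P.2)
          positivity
      · have : X P = fun _ => 0 := by ext u; simp [hX, hSemp P hP]
        simp [this, hρ0]
    · have h1 : ∀ u, ‖(sobBall σ R).indicator (fun u => ρ (pairSum s (S P) c P.1 P.2 u)) u‖ ≤ D := by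
        intro u
        by_cases hu : u ∈ sobBall σ R
        · rw [indicator_of_mem hu, norm_eq_abs]
          by_cases hP : P.1 < P.2
          · exact hpair P.1 P.2 hP (S P) (hSsub P) (hSlow P hP) u hu
          · rw [hSemp P hP]; simp [pairSum, hρ0, hD]
        · rw [indicator_of_notMem hu, norm_zero]; exact hD
      have := eLpNorm_le_of_ae_bound (p := ofReal p) (μ := gaussianSob s) (ae_of_all _ h1)
      rwa [measure_univ, one_rpow, one_mul] at this
  refine (sum_le_sum fun P _ => hone P).trans (le_of_eq ?_)
  rw [sum_const, nsmul_eq_mul, ← ENNReal.ofReal_natCast, ← ofReal_mul (by positivity)]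
  congr 2
  simp [sq]

lemma norm_mono_le {n : ℕ} {σ R : ℝ} (hσ : 0 ≤ σ) (hR : 0 ≤ R) {u : Coeff}
    (hu : u ∈ sobBall σ R) (κ : Fin n → Freq) : ‖mono u κ‖ ≤ R ^ n := by
  rw [mono, norm_prod]
  calc ∏ m, ‖twist (slotConj m) (u (κ m))‖ ≤ ∏ _m : Fin n, R := by
        refine Finset.prod_le_prod (fun _ _ => norm_nonneg _) fun m _ => ?_
        rw [norm_twist]
        refine (norm_le_of_mem_sobBall hR hu _).trans ?_
        exact mul_le_of_le_one_right hR
          (Real.rpow_le_one_of_one_le_of_nonpos (one_le_br _) (by linarith))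
    _ = R ^ n := by simp

lemma IsShell.card_le {n : ℕ} {T : Finset (Fin n → Freq)} {M : ℝ} (hT : IsShell T M) :
    (T.card : ℝ) ≤ (343 * M ^ 3) ^ n := by
  have hsub : T ⊆ Fintype.piFinset fun _ : Fin n => freqBox ⌊3 * M⌋₊ := by
    intro κ hκ
    rw [Fintype.mem_piFinset]
    exact fun m => mem_freqBox_of_br_le (hT.br_le κ hκ m)
  have h1 := Finset.card_le_card hsub
  rw [Fintype.card_piFinset] at h1
  simp only [card_freqBox, prod_const, card_univ, Fintype.card_fin] at h1
  calc (T.card : ℝ) ≤ ((2 * (⌊3 * M⌋₊ : ℝ) + 1) ^ 3) ^ n := by exact_mod_cast h1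
    _ ≤ ((7 * M) ^ 3) ^ n := by gcongr; exact two_mul_floor_add_one_le hT.one_le
    _ = _ := by ring

lemma IsShell.norm_formSum_le {n : ℕ} {T : Finset (Fin n → Freq)} {M : ℝ} (hT : IsShell T M)
    {σ R : ℝ} (hσ : 0 ≤ σ) (hR : 0 ≤ R) {c : (Fin n → Freq) → ℝ} {b : ℝ} (hb : 0 ≤ b)
    (hc : ∀ κ ∈ T, |c κ| ≤ b)
    {u : Coeff} (hu : u ∈ sobBall σ R) : ‖formSum T c u‖ ≤ (343 * M ^ 3) ^ n * (b * R ^ n) := by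
  refine (norm_sum_le _ _).trans ?_
  calc ∑ κ ∈ T, ‖(c κ : ℂ) * mono u κ‖ ≤ ∑ _κ ∈ T, b * R ^ n := by
        refine sum_le_sum fun κ hκ => ?_
        rw [norm_mul, norm_real, norm_eq_abs]
        exact mul_le_mul (hc κ hκ) (norm_mono_le hσ hR hu κ) (norm_nonneg _) hb
    _ = T.card * (b * R ^ n) := by rw [sum_const, nsmul_eq_mul]
    _ ≤ _ := by gcongr; exact hT.card_le

/-! ### The shells -/

/-- The tuples with alternating sum zero whose size, measured by `size`, is about `4^j`. -/
def shell {n : ℕ} (size : (Fin n → Freq) → ℕ) (j : ℕ) : Finset (Fin n → Freq) :=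
  (Fintype.piFinset fun _ => freqBox (2 ^ (j + 1))).filter fun κ =>
    altSum κ = 0 ∧ Nat.log 4 (size κ) = j

lemma mem_shell {n : ℕ} {size : (Fin n → Freq) → ℕ}
    (hsize : ∀ κ m, (nsqInt (κ m)).toNat ≤ size κ) {j : ℕ} {κ : Fin n → Freq} :
    κ ∈ shell size j ↔ altSum κ = 0 ∧ Nat.log 4 (size κ) = j := by
  rw [shell, mem_filter, and_iff_right_iff_imp, Fintype.mem_piFinset]
  intro h m
  rw [freqBox, Fintype.mem_piFinset]
  intro i
  have h1 : size κ < 4 ^ (j + 1) := by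
    rw [← h.2]; exact Nat.lt_pow_succ_log_self (by norm_num) _
  have h2 : nsqInt (κ m) < 4 ^ (j + 1) := by
    have := hsize κ m
    have h3 : ((4 ^ (j + 1) : ℕ) : ℤ) = 4 ^ (j + 1) := by push_cast; rfl
    omega
  have h4 : κ m i ^ 2 ≤ nsqInt (κ m) :=
    single_le_sum (f := fun i => κ m i ^ 2) (fun i _ => sq_nonneg _) (Finset.mem_univ i)
  have h5 : κ m i ^ 2 ≤ (2 ^ (j + 1)) ^ 2 := by
    have : (4 : ℤ) ^ (j + 1) = (2 ^ (j + 1)) ^ 2 := by rw [← pow_mul, mul_comm, pow_mul]; norm_num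
    linarith
  have h6 := abs_le_of_sq_le_sq h5 (by positivity)
  rw [Finset.mem_Icc]
  push_cast
  exact abs_le.1 h6

lemma hasSum_shell {n : ℕ} {size : (Fin n → Freq) → ℕ}
    (hsize : ∀ κ m, (nsqInt (κ m)).toNat ≤ size κ) {F : (Fin n → Freq) → ℂ}
    (h0 : ∀ κ, altSum κ ≠ 0 → F κ = 0) (hF : Summable F) :
    HasSum (fun j => ∑ κ ∈ shell size j, F κ) (∑' κ, F κ) := by
  have := hF.hasSum.tsum_fiberwise fun κ => Nat.log 4 (size κ)
  suffices hE : (fun j => ∑ κ ∈ shell size j, F κ)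
      = fun j => ∑' b : ((fun κ => Nat.log 4 (size κ)) ⁻¹' {j} : Set _), F b by
    rw [hE]; exact this
  funext j
  rw [tsum_subtype ((fun κ => Nat.log 4 (size κ)) ⁻¹' {j}) F, tsum_eq_sum (s := shell size j)]
  · refine sum_congr rfl fun κ hκ => ?_
    rw [indicator_of_mem]
    exact ((mem_shell hsize).1 hκ).2
  · intro κ hκ
    by_cases hj : Nat.log 4 (size κ) = j
    · rw [indicator_of_mem (by exact hj)]
      refine h0 κ fun ha => hκ ((mem_shell hsize).2 ⟨ha, hj⟩)
    · exact indicator_of_notMem (by exact hj) _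

lemma br_le_of_nsqInt_lt {k : Freq} {j : ℕ} (h : nsqInt k < 4 ^ (j + 1)) : br k ≤ 3 * 2 ^ j := by
  have h1 : br k ^ 2 ≤ (3 * 2 ^ j) ^ 2 := by
    rw [br_sq, nsq_eq_cast]
    have h2 : (nsqInt k : ℝ) < 4 ^ (j + 1) := by exact_mod_cast h
    have h3 : ((2:ℝ) ^ j) ^ 2 = 4 ^ j := by rw [← pow_mul, mul_comm, pow_mul]; norm_num
    have h4 : (1:ℝ) ≤ 4 ^ j := one_le_pow₀ (by norm_num)
    rw [mul_pow, h3]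
    rw [pow_succ] at h2
    linarith
  exact abs_le_of_sq_le_sq' h1 (by positivity) |>.2

lemma two_pow_le_br {k : Freq} {j : ℕ} (h : Nat.log 4 (nsqInt k).toNat = j) : (2:ℝ) ^ j ≤ br k := by
  rcases Nat.eq_zero_or_pos j with rfl | hj
  · simpa using one_le_br k
  · have h0 : (nsqInt k).toNat ≠ 0 := by
      intro h0; rw [h0] at h; simp at h; omega
    have h1 : 4 ^ j ≤ (nsqInt k).toNat := by
      rw [← h]; exact Nat.pow_log_le_self _ h0
    have h2 : (4:ℤ) ^ j ≤ nsqInt k := by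
      have : ((4 ^ j : ℕ) : ℤ) = 4 ^ j := by push_cast; rfl
      omega
    have h3 : (4:ℝ) ^ j ≤ nsq k := by rw [nsq_eq_cast]; exact_mod_cast h2
    have h4 : ((2:ℝ) ^ j) ^ 2 ≤ br k ^ 2 := by
      rw [br_sq, ← pow_mul, mul_comm, pow_mul]; norm_num; linarith
    exact abs_le_of_sq_le_sq' h4 (br_pos k).le |>.2

lemma exists_pair_of_altSum_eq_zero {n : ℕ} (hn2 : 2 ≤ n) (hn : n ≤ 10)
    {κ : Fin n → Freq} (h : altSum κ = 0)
    {a : Fin n} {M : ℝ} (hM : M / 6 ≤ br (κ a)) (hM1 : 1 ≤ M) :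
    ∃ i i', i < i' ∧ M / 60 ≤ br (κ i) ∧ M / 60 ≤ br (κ i') := by
  by_cases hb : ∃ b, b ≠ a ∧ M / 60 ≤ br (κ b)
  · obtain ⟨b, hne, hb⟩ := hb
    rcases lt_or_gt_of_ne hne with hlt | hlt
    · exact ⟨b, a, hlt, hb, by linarith⟩
    · exact ⟨a, b, hlt, by linarith, hb⟩
  · exfalso
    push Not at hb
    have h1 : (-1 : ℤ) ^ (a : ℕ) • κ a = -∑ m ∈ Finset.univ.erase a, (-1 : ℤ) ^ (m : ℕ) • κ m := by
      rw [altSum, ← add_sum_erase _ _ (Finset.mem_univ a)] at h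
      exact eq_neg_of_add_eq_zero_left h
    have h2 : br (κ a) ≤ 1 + ∑ m ∈ Finset.univ.erase a, br (κ m) := by
      rw [← br_neg_one_pow_smul (a : ℕ) (κ a), h1, br_neg]
      refine (br_sum_le _ _).trans (le_of_eq ?_)
      congr 1
      exact sum_congr rfl fun m _ => br_neg_one_pow_smul _ _
    have he : (Finset.univ.erase a).Nonempty := by
      rw [← Finset.card_pos, Finset.card_erase_of_mem (Finset.mem_univ a)]; simp; omega
    obtain ⟨b, hbm⟩ := he
    have hb60 : 1 < M / 60 := (one_le_br _).trans_lt (hb b (ne_of_mem_erase hbm))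
    have h3 : ∑ m ∈ Finset.univ.erase a, br (κ m) ≤ 9 * (M / 60) := by
      calc _ ≤ ∑ _m ∈ Finset.univ.erase a, M / 60 :=
            sum_le_sum fun m hm => (hb m (ne_of_mem_erase hm)).le
        _ = ((Finset.univ.erase a).card : ℝ) * (M / 60) := by simp
        _ ≤ 9 * (M / 60) := by
          have : (Finset.univ.erase a).card ≤ 9 := by
            rw [Finset.card_erase_of_mem (Finset.mem_univ a)]; simp; omega
          gcongr; exact_mod_cast this
    linarith

end

section

/-! ### The multipliers and their sizes -/

lemma IsFreqCutoff.exists_bound (hχ : IsFreqCutoff χ) :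
    ∃ C : ℝ, 1 ≤ C ∧ ∀ N k, |cut χ N k| ≤ C := by
  have hc : HasCompactSupport χ := HasCompactSupport.of_support_subset_isCompact
    (isCompact_closedBall (0 : EuclideanSpace ℝ (Fin 3)) 1)
    (fun _ hx => Metric.ball_subset_closedBall (hχ.supp (subset_tsupport _ hx)))
  obtain ⟨C, hC⟩ := hc.exists_bound_of_continuous hχ.smooth.continuous
  refine ⟨max C 1, le_max_right _ _, fun N k => ?_⟩
  unfold cut
  split_ifs
  · simp
  · exact (hC _).trans (le_max_left _ _)

lemma IsFreqCutoff.cut_neg (hχ : IsFreqCutoff χ) (N : ℕ∞)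
    (k : Freq) : cut χ N (-k) = cut χ N k := by
  unfold cut
  split_ifs
  · rfl
  · refine hχ.radial _ _ ?_
    have : toEuclid (-k) = -toEuclid k := by ext i; simp [toEuclid]
    rw [this, smul_neg, norm_neg]

lemma abs_prod_cut_le {C : ℝ} (hC : ∀ N k, |cut χ N k| ≤ C)
    {n : ℕ} (N : ℕ∞) (κ : Fin n → Freq) : |∏ m, cut χ N (κ m)| ≤ C ^ n := by
  rw [Finset.abs_prod]
  calc ∏ m, |cut χ N (κ m)| ≤ ∏ _m : Fin n, C :=
        Finset.prod_le_prod (fun _ _ => abs_nonneg _) fun m _ => hC _ _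
    _ = C ^ n := by simp

/-- The coefficients of the correction. -/
def corrMul (χ : EuclideanSpace ℝ (Fin 3) → ℝ) (η : ℝ → ℝ) (s δ : ℝ) (N : ℕ∞)
    (k : Fin 6 → Freq) : ℝ :=
  cutInv η (lam k ^ δ) (Om k) * psi s k * ∏ m, cut χ N (k m)

/-- The coefficients of the nearly resonant part of the energy rate. -/
def resMul (χ : EuclideanSpace ℝ (Fin 3) → ℝ) (η : ℝ → ℝ) (s δ : ℝ) (N : ℕ∞)
    (k : Fin 6 → Freq) : ℝ :=
  η (Om k / lam k ^ δ) * psi s k * ∏ m, cut χ N (k m)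

/-- The output frequency of the first five slots. -/
def kOne (κ : Fin 10 → Freq) : Freq := altSum fun m : Fin 5 => κ (Fin.castAdd 5 m)

/-- The six frequencies at which the multiplier of the ten-linear form is evaluated. -/
def toSix (κ : Fin 10 → Freq) : Fin 6 → Freq :=
  Fin.cons (kOne κ) fun m : Fin 5 => κ (Fin.natAdd 5 m)

/-- The coefficients of the ten-linear part of the energy rate. -/
def tenMul (χ : EuclideanSpace ℝ (Fin 3) → ℝ) (η : ℝ → ℝ) (s δ : ℝ) (N : ℕ∞)
    (κ : Fin 10 → Freq) : ℝ :=
  cutInv η (lam (toSix κ) ^ δ) (Om (toSix κ)) * psi s (toSix κ) *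
    (cut χ N (kOne κ) ^ 2 * ∏ m, cut χ N (κ m))

lemma lam_sq (k : Fin 6 → Freq) : lam k ^ 2 = ∑ m, nsq (k m) := by
  rw [lam, sq_sqrt (sum_nonneg fun m _ => nsq_nonneg _)]

lemma lam_nonneg (k : Fin 6 → Freq) : 0 ≤ lam k := Real.sqrt_nonneg _

lemma lam_eq_zero_or (k : Fin 6 → Freq) : lam k = 0 ∨ 1 ≤ lam k := by
  have e : ∑ m, nsq (k m) = ((∑ m, nsqInt (k m) : ℤ) : ℝ) := by
    push_cast; exact sum_congr rfl fun m _ => nsq_eq_cast _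
  rcases lt_or_ge (∑ m, nsqInt (k m)) 1 with h | h
  · left
    rw [lam, e, Real.sqrt_eq_zero']
    exact_mod_cast Int.lt_add_one_iff.1 h
  · right
    rw [lam, e, Real.one_le_sqrt]
    exact_mod_cast h

lemma Om_eq_zero_of_lam {k : Fin 6 → Freq} (h : lam k = 0) : Om k = 0 := by
  have h1 := lam_sq k
  rw [h] at h1
  have h2 := (Finset.sum_eq_zero_iff_of_nonneg (s := Finset.univ) (f := fun m => nsq (k m))
    fun m _ => nsq_nonneg _).1 (by linarith)
  rw [Om]
  exact sum_eq_zero fun m hm => by rw [h2 m hm, mul_zero]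

lemma IsBump.abs_cutInv_lam_le (h : IsBump η) {δ : ℝ} (hδ : 0 ≤ δ)
    (k : Fin 6 → Freq) : |cutInv η (lam k ^ δ) (Om k)| ≤ 2 := by
  rcases lam_eq_zero_or k with hk | hk
  · rw [Om_eq_zero_of_lam hk]; simp [cutInv]
  · have h1 : 1 ≤ lam k ^ δ := one_le_rpow hk hδ
    refine (h.abs_cutInv_le (by linarith) _).trans ?_
    rw [div_le_iff₀ (by linarith)]; linarith

lemma nsq_le_of_br_le {k : Freq} {b : ℝ} (h : br k ≤ b) : nsq k ≤ b ^ 2 := by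
  have h1 : br k ^ 2 ≤ b ^ 2 := pow_le_pow_left₀ (br_pos k).le h 2
  rw [br_sq] at h1; linarith

section sizes

variable {s M : ℝ}

lemma nine_mul_sq_rpow_sub_one (hM : 0 < M) :
    (9 * M ^ 2) ^ (s - 1) = 9 ^ (s - 1) * (M ^ (2 * s) * (M ^ 2)⁻¹) := by
  rw [mul_rpow (by norm_num) (by positivity)]
  congr 1
  rw [← rpow_natCast, ← rpow_mul hM.le, ← rpow_neg hM.le, ← rpow_add hM]
  congr 1; push_cast; ring

lemma nine_mul_sq_rpow_sub_two (hM : 0 < M) :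
    (9 * M ^ 2) ^ (s - 2) = 9 ^ (s - 2) * (M ^ (2 * s) * (M ^ 4)⁻¹) := by
  rw [mul_rpow (by norm_num) (by positivity)]
  congr 1
  rw [← rpow_natCast, ← rpow_natCast, ← rpow_mul hM.le, ← rpow_neg hM.le,
    ← rpow_add hM]
  congr 1; push_cast; ring

/-- The constant in the bound `wt_le_of_big`. -/
def wtConst (s : ℝ) : ℝ := 2 ^ s * 60 ^ (2 * s)

lemma wtConst_pos (s : ℝ) : 0 < wtConst s := by unfold wtConst; positivity

lemma wt_le_of_big (hs : 0 ≤ s) (hM : 0 < M) {k : Freq} (hk : M / 60 ≤ br k) :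
    wt s k ≤ wtConst s * (M ^ (2 * s))⁻¹ := by
  refine (wt_le hs k).trans ?_
  have h1 : br k ^ (-(2 * s)) ≤ (M / 60) ^ (-(2 * s)) :=
    Real.rpow_le_rpow_of_nonpos (by positivity) hk (by linarith)
  have h2 : (M / 60) ^ (-(2 * s)) = 60 ^ (2 * s) * (M ^ (2 * s))⁻¹ := by
    rw [rpow_neg (by positivity), div_rpow hM.le (by norm_num), inv_div,
      div_eq_mul_inv]
  rw [h2] at h1
  rw [wtConst, mul_assoc]
  gcongr

variable {k : Fin 6 → Freq} {E : ℝ} {i i' : Fin 6}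

lemma abs_psi_le_of_br (hs : 1 ≤ s) (hM : 0 < M) (hne : i ≠ i') (hB : ∀ m, br (k m) ≤ 3 * M)
    (hlow : ∀ m ∈ lowSlots i i', br (k m) ≤ E) :
    |psi s k| ≤ s * 9 ^ (s - 1) * (M ^ (2 * s) * (M ^ 2)⁻¹) * (|Om k| + 12 * E ^ 2) := by
  have := abs_psi_le_Om hs hne (B := 9 * M ^ 2) (E := E ^ 2) (sq_nonneg E) (fun m =>
    (nsq_le_of_br_le (hB m)).trans (le_of_eq (by ring))) fun m hm => nsq_le_of_br_le (hlow m hm)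
  rw [nine_mul_sq_rpow_sub_one hM] at this
  refine this.trans (le_of_eq (by ring))

lemma abs_psi_low_le_of_br (hs : 2 ≤ s) (hM : 0 < M) (hne : i ≠ i') (hB : ∀ m, br (k m) ≤ 3 * M)
    (hlow : ∀ m ∈ lowSlots i i', br (k m) ≤ E) :
    |psi s k - ((-1 : ℝ) ^ (i : ℕ) * nsq (k i) ^ s + (-1 : ℝ) ^ (i' : ℕ) * nsq (k i') ^ s)|
      ≤ 6 * 9 ^ (s - 2) * (M ^ (2 * s) * (M ^ 4)⁻¹) * E ^ 4 := by
  have := abs_psi_pair_le hs hne (B := 9 * M ^ 2) (E := E ^ 2) (fun m =>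
    (nsq_le_of_br_le (hB m)).trans (le_of_eq (by ring))) fun m hm => nsq_le_of_br_le (hlow m hm)
  rw [nine_mul_sq_rpow_sub_two hM] at this
  refine this.trans (le_of_eq (by ring))

lemma abs_cutInv_mul_psi_le (h : IsBump η) {δ : ℝ} (hδ : 0 ≤ δ) (hs : 1 ≤ s)
    (hM : 0 < M) (hne : i ≠ i') (hB : ∀ m, br (k m) ≤ 3 * M) (hE : 1 ≤ E)
    (hlow : ∀ m ∈ lowSlots i i', br (k m) ≤ E) :
    |cutInv η (lam k ^ δ) (Om k) * psi s k|
      ≤ 25 * s * 9 ^ (s - 1) * (M ^ (2 * s) * (M ^ 2)⁻¹) * E ^ 2 := by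
  have h1 := abs_psi_le_of_br hs hM hne hB hlow
  have h2 := h.abs_cutInv_lam_le hδ k
  have h3 := h.abs_mul_cutInv_le (lam k ^ δ) (Om k)
  rw [abs_mul] at h3 ⊢
  set f := |cutInv η (lam k ^ δ) (Om k)|
  have hf : 0 ≤ f := abs_nonneg _
  set Z := s * 9 ^ (s - 1) * (M ^ (2 * s) * (M ^ 2)⁻¹) with hZ
  have hZ0 : 0 ≤ Z := by positivity
  have e : 25 * s * 9 ^ (s - 1) * (M ^ (2 * s) * (M ^ 2)⁻¹) * E ^ 2 = Z * (25 * E ^ 2) := by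
    rw [hZ]; ring
  rw [e]
  calc f * |psi s k| ≤ f * (Z * (|Om k| + 12 * E ^ 2)) := by gcongr
    _ = Z * (|Om k| * f + f * (12 * E ^ 2)) := by ring
    _ ≤ Z * (1 + 2 * (12 * E ^ 2)) := by gcongr
    _ ≤ Z * (25 * E ^ 2) := by gcongr; nlinarith

end sizes

lemma norm_covTerm_le (s : ℝ) (τ τ' : Bool) (k l : Freq) : ‖covTerm s τ τ' k l‖ ≤ 2 * wt s k := by
  unfold covTerm pairMean
  have := wt_pos s k
  split_ifs <;> simp [abs_of_pos this] <;> linarith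

lemma covTerm_eq_zero_of_same {s : ℝ} {τ τ' : Bool} {k l : Freq} (h : τ = τ') :
    covTerm s τ τ' k l = 0 := by
  simp [covTerm, pairMean, h]

lemma covTerm_eq_zero_of_ne {s : ℝ} {τ τ' : Bool} {k l : Freq} (h : k ≠ l) :
    covTerm s τ τ' k l = 0 := by
  simp [covTerm, h]

section shellBounds

variable {n : ℕ} {T : Finset (Fin n → Freq)} {M s : ℝ} {i i' : Fin n} {c : (Fin n → Freq) → ℝ}

lemma mem_bigPair {κ : Fin n → Freq} : κ ∈ bigPair T M i i' ↔
    κ ∈ T ∧ M / 60 ≤ br (κ i) ∧ M / 60 ≤ br (κ i') := by simp [bigPair]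

open scoped Classical in
lemma hs_le_of_abs_le (hT : IsShell T M) (hs : 0 ≤ s) (hii' : i < i') {v : Fin n → Freq} {b : ℝ}
    (hc : ∀ κ ∈ bigPair T M i i', lowPart i i' κ = v → |c κ| ≤ b * M ^ (2 * s)) :
    ∑ κ ∈ bigPair T M i i' with lowPart i i' κ = v, c κ ^ 2 * (wt s (κ i) * wt s (κ i'))
      ≤ 343 * M ^ 3 * (b * wtConst s) ^ 2 := by
  have hM := hT.one_le
  have hM0 : 0 < M := by linarith
  have hP : 0 < M ^ (2 * s) := rpow_pos_of_pos hM0 _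
  refine sum_fiber_le hii'.ne hM (fun κ hκ => hT.altSum_eq κ (mem_bigPair.1 hκ).1)
    (fun κ hκ => hT.br_le κ (mem_bigPair.1 hκ).1 i) v (sq_nonneg _) fun κ hκ hv => ?_
  have hκ' := mem_bigPair.1 hκ
  have h1 := wt_le_of_big hs hM0 hκ'.2.1
  have h2 := wt_le_of_big hs hM0 hκ'.2.2
  have h3 := hc κ hκ hv
  have hW := wtConst_pos s
  calc c κ ^ 2 * (wt s (κ i) * wt s (κ i'))
      ≤ (b * M ^ (2 * s)) ^ 2 * ((wtConst s * (M ^ (2 * s))⁻¹) * (wtConst s * (M ^ (2 * s))⁻¹)) := by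
        rw [← sq_abs (c κ)]
        have := wt_pos s (κ i)
        have := wt_pos s (κ i')
        gcongr
    _ = _ := by field_simp

lemma abs_pairSum_le (hT : IsShell T M) (hs : 0 ≤ s) (hii' : i < i') {σ A R : ℝ}
    (hA : A + 3 < σ) (hR : 1 ≤ R) {T' : Finset (Fin n → Freq)} (hT' : T' ⊆ bigPair T M i i')
    {a : ℝ} (ha : 0 ≤ a)
    (hc : slotConj i ≠ slotConj i' → ∀ κ ∈ T', κ i = κ i' →
      |c κ| ≤ a * (M ^ (2 * s) * (M ^ 4)⁻¹) * lowBr i i' κ ^ A) {u : Coeff} (hu : u ∈ sobBall σ R) :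
    ‖pairSum s T' c i i' u‖ ≤ R ^ n * brMass (σ - A) ^ n * (686 * a * wtConst s * M⁻¹) := by
  classical
  have hM := hT.one_le
  have hM0 : 0 < M := by linarith
  have hP : 0 < M ^ (2 * s) := rpow_pos_of_pos hM0 _
  have hW := wtConst_pos s
  have e : pairSum s T' c i i' u = ∑ κ ∈ T', ((c κ : ℂ) *
      covTerm s (slotConj i) (slotConj i') (κ i) (κ i')) * lowMono i i' u κ := by
    rw [pairSum]; exact sum_congr rfl fun κ _ => by ring
  rw [e]
  refine norm_sum_lowMono_le hA hR (by positivity) T' _ (fun v => ?_) hu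
  refine (norm_sum_le _ _).trans ?_
  have hl := one_le_lowBr i i' v
  have hlA : 0 ≤ lowBr i i' v ^ A := rpow_nonneg (by linarith) _
  refine (sum_fiber_le hii'.ne hM (b := 2 * a * wtConst s * (M ^ 4)⁻¹ * lowBr i i' v ^ A)
    (fun κ hκ => hT.altSum_eq κ (mem_bigPair.1 (hT' hκ)).1)
    (fun κ hκ => hT.br_le κ (mem_bigPair.1 (hT' hκ)).1 i) v (by positivity)
    fun κ hκ hv => ?_).trans (le_of_eq (by field_simp; ring))
  rw [norm_mul, norm_real, norm_eq_abs]
  by_cases h1 : slotConj i = slotConj i'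
  · rw [covTerm_eq_zero_of_same h1, norm_zero, mul_zero]; positivity
  by_cases h2 : κ i = κ i'
  · have h3 := hc h1 κ hκ h2
    rw [← lowBr_lowPart, hv] at h3
    have h4 := (norm_covTerm_le s (slotConj i) (slotConj i') (κ i) (κ i'))
    have h5 := wt_le_of_big hs hM0 (mem_bigPair.1 (hT' hκ)).2.1
    calc _ ≤ (a * (M ^ (2 * s) * (M ^ 4)⁻¹) * lowBr i i' v ^ A) *
          (2 * (wtConst s * (M ^ (2 * s))⁻¹)) := by
          gcongr
          linarith
      _ = _ := by field_simp
  · rw [covTerm_eq_zero_of_ne h2, norm_zero, mul_zero]; positivity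

lemma slotConj_ne_iff : slotConj i ≠ slotConj i' ↔ (-1 : ℝ) ^ (i : ℕ) = -(-1 : ℝ) ^ (i' : ℕ) := by
  unfold slotConj
  rcases Nat.mod_two_eq_zero_or_one (i : ℕ) with h | h <;>
  rcases Nat.mod_two_eq_zero_or_one (i' : ℕ) with h' | h' <;>
  simp only [h, h'] <;>
  first
  | rw [Even.neg_one_pow (Nat.even_iff.2 h)]
  | rw [Odd.neg_one_pow (odd_iff.2 h)]
  all_goals first
  | rw [Even.neg_one_pow (Nat.even_iff.2 h')]
  | rw [Odd.neg_one_pow (odd_iff.2 h')]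
  all_goals norm_num

end shellBounds

end

section

/-! ### Moments of the six-linear forms -/

lemma rpow_five (x : ℝ) : x ^ (5 : ℝ) = x ^ 5 := by
  rw [← rpow_natCast]; norm_num

lemma inv_le_rpow_neg_sq {M θ : ℝ} (hM : 1 ≤ M) (hθ : θ ≤ 1 / 2) : M⁻¹ ≤ (M ^ (-θ)) ^ 2 := by
  rw [← rpow_natCast, ← rpow_mul (by linarith), ← rpow_neg_one]
  exact rpow_le_rpow_of_exponent_le hM (by push_cast; linarith)

lemma inv_le_rpow_neg {M θ : ℝ} (hM : 1 ≤ M) (hθ : θ ≤ 1) : M⁻¹ ≤ M ^ (-θ) := by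
  rw [← rpow_neg_one]
  exact rpow_le_rpow_of_exponent_le hM (by linarith)

open scoped Classical in
lemma moment_of_bounds {n : ℕ} {ρ : ℂ → ℝ} (hρ : ∀ z, |ρ z| ≤ ‖z‖) (hρm : Measurable ρ)
    (hρadd : ∀ z w, ρ (z + w) = ρ z + ρ w) {T : Finset (Fin n → Freq)} {M : ℝ} (hT : IsShell T M)
    {s σ R C₁ C₂ θ : ℝ} (hσ : 8 < σ) (hR : 1 ≤ R) (h1 : 0 ≤ C₁) (h2 : 0 ≤ C₂)
    (c : (Fin n → Freq) → ℝ)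
    (hHS : ∀ i i', i < i' → ∀ v, ∑ κ ∈ bigPair T M i i' with lowPart i i' κ = v,
      c κ ^ 2 * (wt s (κ i) * wt s (κ i')) ≤ (C₁ * M ^ (-θ) * lowBr i i' v ^ 5) ^ 2)
    (hpair : ∀ i i', i < i' → ∀ T' ⊆ bigPair T M i i',
      (∀ κ ∈ T, lowBr i i' κ < M / 600 → κ ∈ T') → ∀ u ∈ sobBall σ R,
      |ρ (pairSum s T' c i i' u)| ≤ R ^ n * brMass (σ - 5) ^ n * (C₂ * M ^ (-θ)))
    {p : ℝ} (hp : 2 ≤ p) :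
    eLpNorm ((sobBall σ R).indicator fun u => ρ (formSum T c u)) (ofReal p) (gaussianSob s)
      ≤ ofReal (n ^ 2 * (128 * C₁ + C₂) * (R ^ n * brMass (σ - 5) ^ n) *
          (p * M ^ (-θ))) := by
  have hM := hT.one_le
  have hMθ : 0 < M ^ (-θ) := rpow_pos_of_pos (by linarith) _
  have hbm : 0 ≤ brMass (σ - 5) := tsum_nonneg fun k => (rpow_pos_of_pos (br_pos k) _).le
  refine (eLpNorm_formSum_le hρ hρm hρadd hT (A := 5) (by linarith) hR (Γ := C₁ * M ^ (-θ))
    (by positivity) (D := R ^ n * brMass (σ - 5) ^ n * (C₂ * M ^ (-θ))) (by positivity) c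
    (fun i i' h v => by rw [rpow_five]; exact hHS i i' h v) hpair hp).trans
    (ofReal_le_ofReal ?_)
  have h3 : R ^ n * brMass (σ - 5) ^ n * (C₂ * M ^ (-θ))
      ≤ R ^ n * brMass (σ - 5) ^ n * (C₂ * M ^ (-θ)) * p :=
    le_mul_of_one_le_right (by positivity) (by linarith)
  calc _ ≤ (n:ℝ) ^ 2 * (128 * R ^ n * brMass (σ - 5) ^ n * (C₁ * M ^ (-θ)) * p
        + R ^ n * brMass (σ - 5) ^ n * (C₂ * M ^ (-θ)) * p) := by gcongr
    _ = _ := by ring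

section

variable {n : ℕ} {T : Finset (Fin n → Freq)} {M s θ : ℝ} {i i' : Fin n} {c : (Fin n → Freq) → ℝ}

open scoped Classical in
lemma hs_of_sq_decay (hT : IsShell T M) (hs : 0 ≤ s) (hθ : θ ≤ 1 / 2) (hii' : i < i')
    {a : ℝ} (ha : 0 ≤ a)
    (hc : ∀ κ ∈ bigPair T M i i',
      |c κ| ≤ a * (M ^ (2 * s) * (M ^ 2)⁻¹) * lowBr i i' κ ^ 5) (v : Fin n → Freq) :
    ∑ κ ∈ bigPair T M i i' with lowPart i i' κ = v, c κ ^ 2 * (wt s (κ i) * wt s (κ i'))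
      ≤ (19 * a * wtConst s * M ^ (-θ) * lowBr i i' v ^ 5) ^ 2 := by
  have hM := hT.one_le
  have hM0 : 0 < M := by linarith
  have hl := one_le_lowBr i i' v
  have hW := wtConst_pos s
  refine (hs_le_of_abs_le hT hs hii' (b := a * (M ^ 2)⁻¹ * lowBr i i' v ^ 5)
    (fun κ hκ hv => ?_)).trans ?_
  · have := hc κ hκ
    rw [← lowBr_lowPart, hv] at this
    exact this.trans (le_of_eq (by ring))
  · have h1 := inv_le_rpow_neg_sq hM hθ
    calc 343 * M ^ 3 * (a * (M ^ 2)⁻¹ * lowBr i i' v ^ 5 * wtConst s) ^ 2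
        = 343 * (a * wtConst s * lowBr i i' v ^ 5) ^ 2 * M⁻¹ := by field_simp
      _ ≤ 361 * (a * wtConst s * lowBr i i' v ^ 5) ^ 2 * (M ^ (-θ)) ^ 2 := by
          gcongr; norm_num
      _ = _ := by ring

lemma pair_of_decay (hT : IsShell T M) (hs : 0 ≤ s) (hθ : θ ≤ 1) (hii' : i < i') {σ R : ℝ}
    (hσ : 8 < σ) (hR : 1 ≤ R) {T' : Finset (Fin n → Freq)} (hT' : T' ⊆ bigPair T M i i')
    {a : ℝ} (ha : 0 ≤ a)
    (hc : slotConj i ≠ slotConj i' → ∀ κ ∈ T', κ i = κ i' →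
      |c κ| ≤ a * (M ^ (2 * s) * (M ^ 4)⁻¹) * lowBr i i' κ ^ 5) {u : Coeff} (hu : u ∈ sobBall σ R) :
    ‖pairSum s T' c i i' u‖
      ≤ R ^ n * brMass (σ - 5) ^ n * (686 * a * wtConst s * M ^ (-θ)) := by
  have hbm : 0 ≤ brMass (σ - 5) := tsum_nonneg fun k => (rpow_pos_of_pos (br_pos k) _).le
  have hW := wtConst_pos s
  refine (abs_pairSum_le hT hs hii' (A := 5) (by linarith) hR hT' ha (fun h κ hκ he => ?_) hu).trans ?_
  · rw [rpow_five]; exact hc h κ hκ he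
  · gcongr
    exact inv_le_rpow_neg hT.one_le hθ

end

section six

variable {s δ Cχ : ℝ}
  {T : Finset (Fin 6 → Freq)} {M : ℝ}

lemma psi_pair_cancel {k : Fin 6 → Freq} {i i' : Fin 6} (hp : slotConj i ≠ slotConj i')
    (he : k i = k i') :
    (-1 : ℝ) ^ (i : ℕ) * nsq (k i) ^ s + (-1 : ℝ) ^ (i' : ℕ) * nsq (k i') ^ s = 0 := by
  rw [slotConj_ne_iff.1 hp, he]; ring

lemma abs_psi_of_pair {k : Fin 6 → Freq} {i i' : Fin 6} (hs : 2 ≤ s) (hM : 0 < M) (hne : i ≠ i')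
    (hB : ∀ m, br (k m) ≤ 3 * M) {E : ℝ} (hlow : ∀ m ∈ lowSlots i i', br (k m) ≤ E)
    (hp : slotConj i ≠ slotConj i') (he : k i = k i') :
    |psi s k| ≤ 6 * 9 ^ (s - 2) * (M ^ (2 * s) * (M ^ 4)⁻¹) * E ^ 4 := by
  have := abs_psi_low_le_of_br hs hM hne hB hlow
  rwa [psi_pair_cancel hp he, sub_zero] at this

theorem corr_moment (hη : IsBump η) (hC1 : 1 ≤ Cχ) (hC : ∀ N k, |cut χ N k| ≤ Cχ) (hs : 2 ≤ s)
    (hδ : 0 ≤ δ) {θ : ℝ} (hθ : θ ≤ 1 / 2) : ∃ C, 0 ≤ C ∧ ∀ (T : Finset (Fin 6 → Freq)) (M : ℝ),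
      IsShell T M → ∀ N : ℕ∞, ∀ σ R p : ℝ, 8 < σ → 1 ≤ R → 2 ≤ p →
      eLpNorm ((sobBall σ R).indicator fun u => (formSum T (corrMul χ η s δ N) u).re)
        (ofReal p) (gaussianSob s)
        ≤ ofReal (C * (R ^ 6 * brMass (σ - 5) ^ 6) * (p * M ^ (-θ))) := by
  have hW := wtConst_pos s
  set a₁ := 25 * s * 9 ^ (s - 1) * Cχ ^ 6 with ha1
  set a₂ := 12 * 9 ^ (s - 2) * Cχ ^ 6 with ha2
  have h1 : 0 ≤ a₁ := by positivity
  have h2 : 0 ≤ a₂ := by positivity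
  refine ⟨(6:ℕ) ^ 2 * (128 * (19 * a₁ * wtConst s) + 686 * a₂ * wtConst s), by positivity,
    fun T M hT N σ R p hσ hR hp => ?_⟩
  have hM0 : 0 < M := by linarith [hT.one_le]
  have hP : 0 < M ^ (2 * s) := rpow_pos_of_pos hM0 _
  refine moment_of_bounds abs_re_le_norm Complex.measurable_re add_re hT hσ hR
    (by positivity) (by positivity) _ (fun i i' hii' v => ?_)
    (fun i i' hii' T' hT' _ u hu => ?_) hp
  · refine hs_of_sq_decay hT (by linarith) hθ hii' h1 (fun κ hκ => ?_) v
    have hl := one_le_lowBr i i' κ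
    have hb := abs_cutInv_mul_psi_le hη hδ (s := s) (by linarith) hM0 hii'.ne
      (hT.br_le κ (mem_bigPair.1 hκ).1) hl fun m hm => br_le_lowBr κ hm
    rw [corrMul, abs_mul]
    calc _ ≤ (25 * s * 9 ^ (s - 1) * (M ^ (2 * s) * (M ^ 2)⁻¹) * lowBr i i' κ ^ 2) * Cχ ^ 6 := by
          gcongr
          exact abs_prod_cut_le hC N κ
      _ = a₁ * (M ^ (2 * s) * (M ^ 2)⁻¹) * lowBr i i' κ ^ 2 := by rw [ha1]; ring
      _ ≤ _ := by gcongr; norm_num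
  · refine (abs_re_le_norm _).trans ?_
    refine pair_of_decay hT (by linarith) (by linarith) hii' hσ hR hT' h2
      (fun hpar κ hκ he => ?_) hu
    have hκT := mem_bigPair.1 (hT' hκ)
    have hl := one_le_lowBr i i' κ
    have hb := abs_psi_of_pair hs hM0 hii'.ne (hT.br_le κ hκT.1) (fun m hm => br_le_lowBr κ hm)
      hpar he
    rw [corrMul, abs_mul, abs_mul]
    calc _ ≤ 2 * (6 * 9 ^ (s - 2) * (M ^ (2 * s) * (M ^ 4)⁻¹) * lowBr i i' κ ^ 4) * Cχ ^ 6 := by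
          gcongr
          · exact hη.abs_cutInv_lam_le hδ κ
          · exact abs_prod_cut_le hC N κ
      _ = a₂ * (M ^ (2 * s) * (M ^ 4)⁻¹) * lowBr i i' κ ^ 4 := by rw [ha2]; ring
      _ ≤ _ := by gcongr; norm_num

lemma lam_le {k : Fin 6 → Freq} (hM : 0 < M) (hB : ∀ m, br (k m) ≤ 3 * M) : lam k ≤ 8 * M := by
  have h1 : lam k ^ 2 ≤ (8 * M) ^ 2 := by
    rw [lam_sq]
    calc ∑ m, nsq (k m) ≤ ∑ _m : Fin 6, (3 * M) ^ 2 :=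
          sum_le_sum fun m _ => nsq_le_of_br_le (hB m)
      _ ≤ _ := by rw [sum_const]; simp; nlinarith [sq_nonneg M]
  exact abs_le_of_sq_le_sq' h1 (by positivity) |>.2

lemma lam_rpow_le {k : Fin 6 → Freq} (hM : 0 < M) (hB : ∀ m, br (k m) ≤ 3 * M) (hδ : 0 ≤ δ)
    (hδ1 : δ ≤ 1) : lam k ^ δ ≤ 8 * M ^ δ := by
  calc lam k ^ δ ≤ (8 * M) ^ δ := rpow_le_rpow (lam_nonneg k) (lam_le hM hB) hδ
    _ = 8 ^ δ * M ^ δ := mul_rpow (by norm_num) hM.le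
    _ ≤ 8 ^ (1:ℝ) * M ^ δ := by
        gcongr; norm_num
    _ = _ := by norm_num

lemma abs_Om_le_of_bump_ne (hη : IsBump η) {k : Fin 6 → Freq}
    (h : η (Om k / lam k ^ δ) ≠ 0) : |Om k| ≤ lam k ^ δ := by
  by_contra hlt
  push Not at hlt
  refine h (hη.eq_zero ?_)
  have h0 : 0 ≤ lam k ^ δ := rpow_nonneg (lam_nonneg k) _
  rcases h0.eq_or_lt with h1 | h1
  · exfalso
    have : lam k = 0 := by
      by_contra hne
      exact absurd h1.symm (rpow_pos_of_pos ((lam_nonneg k).lt_of_ne' hne) _).ne'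
    rw [Om_eq_zero_of_lam this, abs_zero] at hlt
    linarith
  · rw [abs_div, abs_of_pos h1, le_div_iff₀ h1]; linarith

/-- The contribution of the slots other than `i`, `i'` to the resonant function, as an integer. -/
def lowOm (i i' : Fin 6) (v : Fin 6 → Freq) : ℤ :=
  ∑ m ∈ lowSlots i i', (-1 : ℤ) ^ (m : ℕ) * nsqInt (v m)

lemma Om_eq_lowOm {i i' : Fin 6} (hne : i ≠ i') (k : Fin 6 → Freq) :
    Om k = lowOm i i' (lowPart i i' k)
      + ((-1 : ℝ) ^ (i : ℕ) * nsq (k i) + (-1 : ℝ) ^ (i' : ℕ) * nsq (k i')) := by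
  rw [Om, sum_eq_pair_add_low hne, lowOm]
  congr 1
  push_cast
  exact sum_congr rfl fun m hm => by rw [lowPart_of_mem k hm, nsq_eq_cast]

lemma Om_eq_dotInt {i i' : Fin 6} (hne : i ≠ i') (hp : slotConj i ≠ slotConj i')
    {k : Fin 6 → Freq} (h : altSum k = 0) {v : Fin 6 → Freq} (hv : lowPart i i' k = v) :
    |Om k| = |((2 * dotInt (k i) ((-1 : ℤ) ^ (i' : ℕ) • altSum v)
      + (-nsqInt ((-1 : ℤ) ^ (i' : ℕ) • altSum v) + (-1) ^ (i : ℕ) * lowOm i i' v) : ℤ) : ℝ)| := by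
  set l := (-1 : ℤ) ^ (i' : ℕ) • altSum v with hl
  have hsgn := slotConj_ne_iff.1 hp
  have hsgnZ : (-1 : ℤ) ^ (i : ℕ) = -(-1 : ℤ) ^ (i' : ℕ) := by exact_mod_cast hsgn
  have hk : k i' = k i - l := by
    rw [partner_eq hne h, hv, ← hl, pow_add, hsgnZ]
    have : (-1 : ℤ) ^ (i' : ℕ) * -(-1 : ℤ) ^ (i' : ℕ) = -1 := by
      rw [mul_neg, ← mul_pow]; simp
    rw [this]; simp
  have hOm : Om k = (((-1) ^ (i : ℕ) * (2 * dotInt (k i) l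
      + (-nsqInt l + (-1) ^ (i : ℕ) * lowOm i i' v)) : ℤ) : ℝ) := by
    have h1 : (-1 : ℝ) ^ (i' : ℕ) = -(-1 : ℝ) ^ (i : ℕ) := by rw [hsgn, neg_neg]
    have h2 : ((-1 : ℝ) ^ (i : ℕ)) * (-1) ^ (i : ℕ) = 1 := by rw [← mul_pow]; simp
    rw [Om_eq_lowOm hne, hv, hk, nsq_eq_cast, nsq_eq_cast, nsqInt_sub, h1]
    push_cast
    linear_combination (-(lowOm i i' v : ℝ)) * h2
  rw [hOm]
  push_cast
  rw [abs_mul, abs_pow, abs_neg, abs_one, one_pow, one_mul]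

lemma summable_window (t : ℝ) : Summable fun j : ℤ => if |(j : ℝ)| ≤ t then (1:ℝ) else 0 := by
  refine summable_of_hasFiniteSupport ((Set.finite_Icc (-⌊t⌋) ⌊t⌋).subset fun j hj => ?_)
  have : |(j:ℝ)| ≤ t := by
    by_contra h
    simp [h] at hj
  rw [← Int.cast_abs] at this
  have := abs_le.1 (Int.le_floor.2 this)
  exact ⟨this.1, this.2⟩

lemma tsum_window_le {t : ℝ} (ht : 0 ≤ t) :
    ∑' j : ℤ, (if |(j : ℝ)| ≤ t then (1:ℝ) else 0) ≤ 2 * t + 1 := by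
  rw [tsum_eq_sum (s := Finset.Icc (-⌊t⌋) ⌊t⌋)]
  · calc _ ≤ ∑ _j ∈ Finset.Icc (-⌊t⌋) ⌊t⌋, (1:ℝ) := sum_le_sum fun j _ => by
          split_ifs <;> norm_num
      _ = ((Finset.Icc (-⌊t⌋) ⌊t⌋).card : ℝ) := by simp
      _ = ((2 * ⌊t⌋ + 1 : ℤ) : ℝ) := by
          have h0 : 0 ≤ ⌊t⌋ := Int.floor_nonneg.2 ht
          rw [Int.card_Icc]
          have : ((⌊t⌋ + 1 - -⌊t⌋).toNat : ℤ) = 2 * ⌊t⌋ + 1 := by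
            rw [Int.toNat_of_nonneg (by linarith)]; ring
          exact_mod_cast this
      _ ≤ _ := by push_cast; linarith [Int.floor_le t]
  · intro j hj
    rw [if_neg]
    intro h
    rw [← Int.cast_abs] at h
    have := abs_le.1 (Int.le_floor.2 h)
    exact hj (Finset.mem_Icc.2 ⟨this.1, this.2⟩)

end six

end

section

section res

variable {s δ Cχ : ℝ}

lemma rpow_neg_theta_sq {M : ℝ} (hM : 0 < M) :
    (M ^ (-((2 - 3 * δ) / 2))) ^ 2 = (M ^ δ) ^ 3 * (M ^ 2)⁻¹ := by
  rw [← rpow_natCast, ← rpow_natCast, ← rpow_natCast, ← rpow_mul hM.le,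
    ← rpow_mul hM.le, ← rpow_neg hM.le, ← rpow_add hM]
  congr 1; push_cast; ring

lemma sq_le_of_same_sign (hδ : 0 ≤ δ) {k : Fin 6 → Freq} {M : ℝ} (hM : 1 ≤ M) {i i' : Fin 6}
    (hne : i ≠ i')
    (hp : slotConj i = slotConj i') (hi : M / 60 ≤ br (k i)) (hi' : M / 60 ≤ br (k i')) {E : ℝ}
    (hE : 1 ≤ E) (hlow : ∀ m ∈ lowSlots i i', br (k m) ≤ E) (hOm : |Om k| ≤ 8 * M ^ δ) :
    M ^ 2 ≤ 28800 * (M ^ δ * E ^ 2) := by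
  have h1 := abs_Om_pair_le hne (E := E ^ 2) (sq_nonneg E) fun m hm => nsq_le_of_br_le (hlow m hm)
  have hs : (-1 : ℝ) ^ (i : ℕ) = (-1 : ℝ) ^ (i' : ℕ) := by
    have := mt slotConj_ne_iff.2 (not_not.2 hp)
    rcases neg_one_pow_eq_or ℝ (i : ℕ) with a | a <;>
      rcases neg_one_pow_eq_or ℝ (i' : ℕ) with b | b <;> rw [a, b] <;> rw [a, b] at this <;>
      norm_num at this
  rw [hs, ← mul_add] at h1
  have h2 : nsq (k i) + nsq (k i') ≤ |Om k| + 6 * E ^ 2 := by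
    have h3 := abs_sub_abs_le_abs_sub ((-1 : ℝ) ^ (i' : ℕ) * (nsq (k i) + nsq (k i'))) (Om k)
    rw [abs_sub_comm, abs_mul, abs_pow, abs_neg, abs_one, one_pow, one_mul,
      abs_of_nonneg (add_nonneg (nsq_nonneg _) (nsq_nonneg _))] at h3
    linarith
  have h4 : (M / 60) ^ 2 ≤ 1 + nsq (k i) := by rw [← br_sq]; gcongr
  have h5 : (M / 60) ^ 2 ≤ 1 + nsq (k i') := by rw [← br_sq]; gcongr
  have hD : 1 ≤ M ^ δ := one_le_rpow hM hδ
  have hE2 : 1 ≤ E ^ 2 := one_le_pow₀ hE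
  nlinarith [mul_le_mul hD hE2 (by norm_num) (by linarith)]

lemma mul_sq_le_sq {k c z C : ℝ} (hc : 0 ≤ c) (hk : k ≤ c ^ 2) (hz : 0 ≤ z) (h : c * z ≤ C) :
    k * z ^ 2 ≤ C ^ 2 := by
  calc k * z ^ 2 ≤ c ^ 2 * z ^ 2 := by gcongr
    _ = (c * z) ^ 2 := by ring
    _ ≤ C ^ 2 := by gcongr

set_option maxHeartbeats 1000000 in
theorem res_moment (hη : IsBump η) (hC1 : 1 ≤ Cχ) (hC : ∀ N k, |cut χ N k| ≤ Cχ) (hs : 2 ≤ s)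
    (hδ : 1 / 2 < δ) (hδ1 : δ < 2 / 3) :
    ∃ C, 0 ≤ C ∧ ∀ (T : Finset (Fin 6 → Freq)) (M : ℝ),
      IsShell T M → ∀ N : ℕ∞, ∀ σ R p : ℝ, 8 < σ → 1 ≤ R → 2 ≤ p →
      eLpNorm ((sobBall σ R).indicator fun u => (formSum T (resMul χ η s δ N) u).im)
        (ofReal p) (gaussianSob s)
        ≤ ofReal (C * (R ^ 6 * brMass (σ - 5) ^ 6) *
          (p * M ^ (-((2 - 3 * δ) / 2)))) := by
  classical
  have hW := wtConst_pos s
  set a₁ := 20 * s * 9 ^ (s - 1) * Cχ ^ 6 with ha1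
  set a₂ := 6 * 9 ^ (s - 2) * Cχ ^ 6 with ha2
  have h1 : 0 ≤ a₁ := by positivity
  have h2 : 0 ≤ a₂ := by positivity
  set C₁ := (30 * 28800 * a₁ + 19 * a₂) * wtConst s with hC₁
  have hx := mul_nonneg h1 hW.le
  have hy := mul_nonneg h2 hW.le
  have hC₁' : C₁ = 864000 * (a₁ * wtConst s) + 19 * (a₂ * wtConst s) := by rw [hC₁]; ring
  refine ⟨(6:ℕ) ^ 2 * (128 * C₁ + 686 * a₂ * wtConst s), by positivity,
    fun T M hT N σ R p hσ hR hp => ?_⟩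
  have hM := hT.one_le
  have hM0 : 0 < M := by linarith
  have hP : 0 < M ^ (2 * s) := rpow_pos_of_pos hM0 _
  have hD1 : 1 ≤ M ^ δ := one_le_rpow hM (by linarith)
  have hDM : M ^ δ ≤ M := by
    calc M ^ δ ≤ M ^ (1:ℝ) := rpow_le_rpow_of_exponent_le hM (by linarith)
      _ = M := rpow_one M
  set D := M ^ δ with hD
  have hlowpsi : ∀ i i' : Fin 6, i < i' → slotConj i ≠ slotConj i' → ∀ κ ∈ T, κ i = κ i' →
      |resMul χ η s δ N κ| ≤ a₂ * (M ^ (2 * s) * (M ^ 4)⁻¹) * lowBr i i' κ ^ 4 := by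
    intro i i' hii' hpar κ hκ he
    have hb := abs_psi_of_pair hs hM0 hii'.ne (hT.br_le κ hκ) (fun m hm => br_le_lowBr κ hm)
      hpar he
    rw [resMul, abs_mul, abs_mul]
    calc _ ≤ 1 * (6 * 9 ^ (s - 2) * (M ^ (2 * s) * (M ^ 4)⁻¹) * lowBr i i' κ ^ 4) * Cχ ^ 6 := by
          gcongr
          · exact hη.abs_le_one _
          · exact abs_prod_cut_le hC N κ
      _ = _ := by rw [ha2]; ring
  refine moment_of_bounds abs_im_le_norm measurable_im add_im hT hσ hR
    (C₁ := C₁) (by positivity) (by positivity) _ (fun i i' hii' v => ?_)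
    (fun i i' hii' T' hT' _ u hu => ?_) hp
  · set l := lowBr i i' v with hl
    have hl1 : 1 ≤ l := one_le_lowBr i i' v
    have hres : ∀ κ ∈ bigPair T M i i', lowPart i i' κ = v → resMul χ η s δ N κ ≠ 0 →
        |Om κ| ≤ 8 * D ∧ |resMul χ η s δ N κ| ≤ a₁ * (M ^ 2)⁻¹ * D * l ^ 2 * M ^ (2 * s) := by
      intro κ hκ hv hne
      have hκT := mem_bigPair.1 hκ
      have hO1 : |Om κ| ≤ 8 * D := by
        refine (abs_Om_le_of_bump_ne hη (fun h0 => hne ?_)).trans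
          (lam_rpow_le hM0 (hT.br_le κ hκT.1) (by linarith) (by linarith))
        rw [resMul, h0]; ring
      refine ⟨hO1, ?_⟩
      have hlκ : lowBr i i' κ = l := by rw [hl, ← hv, lowBr_lowPart]
      have hb := abs_psi_le_of_br (s := s) (by linarith) hM0 hii'.ne
        (hT.br_le κ hκT.1) fun m hm => br_le_lowBr κ hm
      rw [hlκ] at hb
      rw [resMul, abs_mul, abs_mul]
      have hl2 : 1 ≤ l ^ 2 := one_le_pow₀ hl1
      have hsum : |Om κ| + 12 * l ^ 2 ≤ 20 * (D * l ^ 2) := by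
        nlinarith [mul_le_mul hD1 hl2 (by norm_num) (by linarith)]
      calc _ ≤ 1 * (s * 9 ^ (s - 1) * (M ^ (2 * s) * (M ^ 2)⁻¹) * (20 * (D * l ^ 2))) * Cχ ^ 6 := by
            gcongr
            · exact hη.abs_le_one _
            · exact hb.trans (by gcongr)
            · exact abs_prod_cut_le hC N κ
        _ = _ := by rw [ha1]; ring
    have hgoal : (C₁ * M ^ (-((2 - 3 * δ) / 2)) * l ^ 5) ^ 2
        = C₁ ^ 2 * (D ^ 3 * (M ^ 2)⁻¹) * l ^ 10 := by
      rw [mul_pow, mul_pow, rpow_neg_theta_sq hM0]; ring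
    rw [hgoal]
    have hD3 : M⁻¹ ^ 3 ≤ D ^ 3 := by
      gcongr; exact (inv_le_one_of_one_le₀ hM).trans hD1
    by_cases hpar : slotConj i = slotConj i'
    · refine (hs_le_of_abs_le hT (by linarith) hii'
        (b := 28800 * a₁ * (M ^ 4)⁻¹ * D ^ 2 * l ^ 4) (fun κ hκ hv => ?_)).trans ?_
      · by_cases h0 : resMul χ η s δ N κ = 0
        · rw [h0, abs_zero]; positivity
        · obtain ⟨hO, hb⟩ := hres κ hκ hv h0
          have hκT := mem_bigPair.1 hκ
          have hlκ : lowBr i i' κ = l := by rw [hl, ← hv, lowBr_lowPart]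
          have hsq := sq_le_of_same_sign (by linarith) hM hii'.ne hpar hκT.2.1 hκT.2.2 hl1
            (fun m hm => by rw [← hlκ]; exact br_le_lowBr κ hm) hO
          rw [← hD] at hsq
          calc _ ≤ _ := hb
            _ = a₁ * D * l ^ 2 * M ^ (2 * s) * (M ^ 4)⁻¹ * M ^ 2 := by field_simp
            _ ≤ a₁ * D * l ^ 2 * M ^ (2 * s) * (M ^ 4)⁻¹ * (28800 * (D * l ^ 2)) := by gcongr
            _ = _ := by ring
      · have e : 343 * M ^ 3 * (28800 * a₁ * (M ^ 4)⁻¹ * D ^ 2 * l ^ 4 * wtConst s) ^ 2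
            = 343 * (28800 * a₁ * wtConst s) ^ 2 * (D ^ 4 * (M ^ 5)⁻¹) * l ^ 8 := by field_simp
        rw [e]
        have e2 : D ^ 4 * (M ^ 5)⁻¹ ≤ D ^ 3 * (M ^ 2)⁻¹ := by
          calc D ^ 4 * (M ^ 5)⁻¹ ≤ D ^ 3 * M * (M ^ 3)⁻¹ := by
                rw [pow_succ D 3]; gcongr; norm_num
            _ = _ := by field_simp
        have e3 : 343 * (28800 * a₁ * wtConst s) ^ 2 ≤ C₁ ^ 2 := by
          exact mul_sq_le_sq (c := 19) (by norm_num) (by norm_num) (by positivity) (by linarith)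
        have e4 : l ^ 8 ≤ l ^ 10 := pow_le_pow_right₀ hl1 (by norm_num)
        gcongr
    · by_cases hv0 : (-1 : ℤ) ^ (i' : ℕ) • altSum v = 0
      · refine (hs_le_of_abs_le hT (by linarith) hii'
          (b := a₂ * (M ^ 4)⁻¹ * l ^ 4) (fun κ hκ hv => ?_)).trans ?_
        · have hκT := mem_bigPair.1 hκ
          have hlκ : lowBr i i' κ = l := by rw [hl, ← hv, lowBr_lowPart]
          have he : κ i = κ i' := by
            have hsgnZ : (-1 : ℤ) ^ (i : ℕ) = -(-1 : ℤ) ^ (i' : ℕ) := by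
              exact_mod_cast slotConj_ne_iff.1 hpar
            have h5 : (-1 : ℤ) ^ (i' : ℕ) * -(-1 : ℤ) ^ (i' : ℕ) = -1 := by
              rw [mul_neg, ← mul_pow]; simp
            rw [partner_eq hii'.ne (hT.altSum_eq κ hκT.1), hv, hv0, pow_add, hsgnZ, h5]
            simp
          have := hlowpsi i i' hii' hpar κ hκT.1 he
          rw [hlκ] at this
          exact this.trans (le_of_eq (by ring))
        · have e : 343 * M ^ 3 * (a₂ * (M ^ 4)⁻¹ * l ^ 4 * wtConst s) ^ 2
              = 343 * (a₂ * wtConst s) ^ 2 * (1 * (M ^ 5)⁻¹) * l ^ 8 := by field_simp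
          rw [e]
          have e2 : 1 * (M ^ 5)⁻¹ ≤ D ^ 3 * (M ^ 2)⁻¹ := by
            gcongr
            · exact one_le_pow₀ hD1
            · norm_num
          have e3 : 343 * (a₂ * wtConst s) ^ 2 ≤ C₁ ^ 2 := by
            exact mul_sq_le_sq (c := 19) (by norm_num) (by norm_num) (by positivity) (by linarith)
          have e4 : l ^ 8 ≤ l ^ 10 := pow_le_pow_right₀ hl1 (by norm_num)
          gcongr
      · set L := (-1 : ℤ) ^ (i' : ℕ) • altSum v with hL
        set r : ℤ := -nsqInt L + (-1) ^ (i : ℕ) * lowOm i i' v with hr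
        set h : ℤ → ℝ := fun j => if |(j : ℝ)| ≤ 8 * D then (1:ℝ) else 0 with hh
        have hh0 : ∀ j, 0 ≤ h j := fun j => by simp only [hh]; split_ifs <;> norm_num
        have hhs : Summable h := summable_window _
        set b := (a₁ * (M ^ 2)⁻¹ * D * l ^ 2 * wtConst s) ^ 2 with hb
        have hb0 : 0 ≤ b := sq_nonneg _
        have hterm : ∀ κ ∈ (bigPair T M i i').filter (fun κ => lowPart i i' κ = v),
            resMul χ η s δ N κ ^ 2 * (wt s (κ i) * wt s (κ i'))
              ≤ b * h (2 * dotInt (κ i) L + r) := by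
          intro κ hκ
          rw [mem_filter] at hκ
          have hκT := mem_bigPair.1 hκ.1
          by_cases h0 : resMul χ η s δ N κ = 0
          · rw [h0]; simp; exact mul_nonneg hb0 (hh0 _)
          · obtain ⟨hO, hbd⟩ := hres κ hκ.1 hκ.2 h0
            rw [Om_eq_dotInt hii'.ne hpar (hT.altSum_eq κ hκT.1) hκ.2, ← hL, ← hr] at hO
            have : h (2 * dotInt (κ i) L + r) = 1 := by
              simp only [hh]; rw [if_pos hO]
            rw [this, mul_one]
            have w1 := wt_le_of_big (s := s) (by linarith) hM0 hκT.2.1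
            have w2 := wt_le_of_big (s := s) (by linarith) hM0 hκT.2.2
            have := wt_pos s (κ i)
            have := wt_pos s (κ i')
            rw [← sq_abs]
            calc _ ≤ (a₁ * (M ^ 2)⁻¹ * D * l ^ 2 * M ^ (2 * s)) ^ 2 *
                  ((wtConst s * (M ^ (2 * s))⁻¹) * (wtConst s * (M ^ (2 * s))⁻¹)) := by gcongr
              _ = b := by rw [hb]; field_simp
        refine (sum_le_sum hterm).trans ?_
        rw [← mul_sum]
        have hcount := sum_fiber_dotInt_le hii'.ne hM (T := bigPair T M i i')
          (fun κ hκ => hT.altSum_eq κ (mem_bigPair.1 hκ).1)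
          (fun κ hκ => hT.br_le κ (mem_bigPair.1 hκ).1 i) v hv0 r hh0 hhs
        have hwin : ∑' j, h j ≤ 17 * D := by
          refine (tsum_window_le (by positivity)).trans ?_
          linarith
        calc _ ≤ b * (49 * M ^ 2 * (17 * D)) := by
              refine mul_le_mul_of_nonneg_left (hcount.trans ?_) hb0
              gcongr
          _ = 833 * (a₁ * wtConst s) ^ 2 * (D ^ 3 * (M ^ 2)⁻¹) * l ^ 4 := by
              rw [hb]; field_simp; ring
          _ ≤ _ := by
              have e3 : 833 * (a₁ * wtConst s) ^ 2 ≤ C₁ ^ 2 := by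
                exact mul_sq_le_sq (c := 30) (by norm_num) (by norm_num) (by positivity) (by linarith)
              have e4 : l ^ 4 ≤ l ^ 10 := pow_le_pow_right₀ hl1 (by norm_num)
              gcongr
  · refine (abs_im_le_norm _).trans ?_
    refine pair_of_decay hT (by linarith) (by linarith) hii' hσ hR hT' h2
      (fun hpar κ hκ he => ?_) hu
    have hκT := mem_bigPair.1 (hT' hκ)
    have hl := one_le_lowBr i i' κ
    refine (hlowpsi i i' hii' hpar κ hκT.1 he).trans ?_
    gcongr
    norm_num

end res

end

section

/-! ### The ten-linear form -/

/-- The size of a 6-tuple. -/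
def size6 (k : Fin 6 → Freq) : ℕ := Finset.univ.sup fun m => (nsqInt (k m)).toNat

/-- The size of a 10-tuple, including the intermediate frequency. -/
def size10 (κ : Fin 10 → Freq) : ℕ :=
  max (nsqInt (kOne κ)).toNat (Finset.univ.sup fun m => (nsqInt (κ m)).toNat)

lemma le_size6 (k : Fin 6 → Freq) (m : Fin 6) : (nsqInt (k m)).toNat ≤ size6 k :=
  le_sup (f := fun m => (nsqInt (k m)).toNat) (Finset.mem_univ m)

lemma le_size10 (κ : Fin 10 → Freq) (m : Fin 10) : (nsqInt (κ m)).toNat ≤ size10 κ :=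
  (le_sup (f := fun m => (nsqInt (κ m)).toNat) (Finset.mem_univ m)).trans (le_max_right _ _)

lemma br_le_of_log {k : Freq} {n j : ℕ} (h : (nsqInt k).toNat ≤ n) (hn : Nat.log 4 n = j) :
    br k ≤ 3 * 2 ^ j := by
  refine br_le_of_nsqInt_lt ?_
  have h1 : n < 4 ^ (j + 1) := by rw [← hn]; exact Nat.lt_pow_succ_log_self (by norm_num) _
  have h3 : ((4 ^ (j + 1) : ℕ) : ℤ) = 4 ^ (j + 1) := by push_cast; rfl
  omega

lemma isShell_six (j : ℕ) : IsShell (shell size6 j) (2 ^ j) where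
  one_le := one_le_pow₀ (by norm_num)
  altSum_eq κ hκ := ((mem_shell le_size6).1 hκ).1
  br_le κ hκ m := br_le_of_log (le_size6 κ m) ((mem_shell le_size6).1 hκ).2
  exists_pair κ hκ := by
    obtain ⟨h1, h2⟩ := (mem_shell le_size6).1 hκ
    obtain ⟨m, -, hm⟩ := Finset.exists_mem_eq_sup Finset.univ ⟨0, Finset.mem_univ _⟩
      fun m => (nsqInt (κ m)).toNat
    have := two_pow_le_br (k := κ m) (j := j) (by rw [← hm]; exact h2)
    have hp : (0:ℝ) < 2 ^ j := by positivity
    exact exists_pair_of_altSum_eq_zero (by norm_num) (by norm_num) h1 (a := m)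
      (by linarith) (one_le_pow₀ (by norm_num))

lemma kOne_castAdd_natAdd (κ : Fin 10 → Freq) :
    altSum κ = kOne κ - altSum fun m : Fin 5 => κ (Fin.natAdd 5 m) := by
  have h := Fin.sum_univ_add (a := 5) (b := 5) fun m : Fin 10 => (-1 : ℤ) ^ (m : ℕ) • κ m
  rw [altSum]
  refine h.trans ?_
  rw [kOne, altSum, altSum, sub_eq_add_neg, ← sum_neg_distrib]
  congr 1
  refine sum_congr rfl fun m _ => ?_
  rw [Fin.val_natAdd, pow_add, ← neg_smul]
  norm_num

lemma kOne_eq_of_altSum {κ : Fin 10 → Freq} (h : altSum κ = 0) :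
    kOne κ = altSum fun m : Fin 5 => κ (Fin.natAdd 5 m) := by
  rw [kOne_castAdd_natAdd] at h; exact sub_eq_zero.1 h

lemma fin_ten_cases (i : Fin 10) :
    (∃ m : Fin 5, i = Fin.castAdd 5 m) ∨ ∃ m : Fin 5, i = Fin.natAdd 5 m := by
  revert i
  refine Fin.addCases (m := 5) (n := 5) (fun m => Or.inl ⟨m, rfl⟩) fun m => Or.inr ⟨m, rfl⟩

lemma br_altSum_five_le {κ : Fin 5 → Freq} {E : ℝ} (hE : 1 ≤ E) (h : ∀ m, br (κ m) ≤ E) :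
    br (altSum κ) ≤ 6 * E := by
  refine (br_altSum_le κ).trans ?_
  have : ∑ m, br (κ m) ≤ 5 * E := by
    calc ∑ m, br (κ m) ≤ ∑ _m : Fin 5, E := sum_le_sum fun m _ => h m
      _ = 5 * E := by simp
  linarith

lemma isShell_ten (j : ℕ) : IsShell (shell size10 j) (2 ^ j) where
  one_le := one_le_pow₀ (by norm_num)
  altSum_eq κ hκ := ((mem_shell le_size10).1 hκ).1
  br_le κ hκ m := br_le_of_log (le_size10 κ m) ((mem_shell le_size10).1 hκ).2
  exists_pair κ hκ := by
    obtain ⟨h1, h2⟩ := (mem_shell le_size10).1 hκ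
    have hp : (1:ℝ) ≤ 2 ^ j := one_le_pow₀ (by norm_num)
    have hex : ∃ m, (2:ℝ) ^ j / 6 ≤ br (κ m) := by
      rcases max_choice (nsqInt (kOne κ)).toNat
        (Finset.univ.sup fun m => (nsqInt (κ m)).toNat) with hm | hm
      · have := two_pow_le_br (k := kOne κ) (j := j) (by rw [← hm]; exact h2)
        by_contra hne
        push Not at hne
        have h3 : 1 < (2:ℝ) ^ j / 6 := (one_le_br _).trans_lt (hne 0)
        have h4 : br (kOne κ) ≤ 1 + ∑ m : Fin 5, br (κ (Fin.castAdd 5 m)) := br_altSum_le _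
        have h5 : ∑ m : Fin 5, br (κ (Fin.castAdd 5 m)) < ∑ _m : Fin 5, (2:ℝ) ^ j / 6 :=
          Finset.sum_lt_sum_of_nonempty ⟨0, Finset.mem_univ _⟩ fun m _ => hne _
        simp at h5
        linarith
      · obtain ⟨m, -, hm'⟩ := Finset.exists_mem_eq_sup Finset.univ ⟨0, Finset.mem_univ _⟩
          fun m => (nsqInt (κ m)).toNat
        have := two_pow_le_br (k := κ m) (j := j) (by rw [← hm', ← hm]; exact h2)
        exact ⟨m, by linarith⟩
    obtain ⟨m, hm⟩ := hex
    exact exists_pair_of_altSum_eq_zero (by norm_num) (by norm_num) h1 hm hp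

lemma br_kOne_le {j : ℕ} {κ : Fin 10 → Freq} (hκ : κ ∈ shell size10 j) : br (kOne κ) ≤ 3 * 2 ^ j :=
  br_le_of_log (le_max_left _ _) ((mem_shell le_size10).1 hκ).2

lemma br_toSix_le {j : ℕ} {κ : Fin 10 → Freq} (hκ : κ ∈ shell size10 j) (m : Fin 6) :
    br (toSix κ m) ≤ 3 * 2 ^ j := by
  refine Fin.cases ?_ (fun m => ?_) m
  · exact br_kOne_le hκ
  · exact (isShell_ten j).br_le κ hκ _

lemma br_natAdd_le {i i' : Fin 10} {κ : Fin 10 → Freq} {m : Fin 5} (h : Fin.natAdd 5 m ≠ i)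
    (h' : Fin.natAdd 5 m ≠ i') : br (κ (Fin.natAdd 5 m)) ≤ lowBr i i' κ :=
  br_le_lowBr κ (mem_lowSlots.2 ⟨h, h'⟩)

lemma br_castAdd_le {i i' : Fin 10} {κ : Fin 10 → Freq} {m : Fin 5} (h : Fin.castAdd 5 m ≠ i)
    (h' : Fin.castAdd 5 m ≠ i') : br (κ (Fin.castAdd 5 m)) ≤ lowBr i i' κ :=
  br_le_lowBr κ (mem_lowSlots.2 ⟨h, h'⟩)

lemma castAdd_ne_natAdd (m m' : Fin 5) : Fin.castAdd 5 m ≠ Fin.natAdd 5 m' := by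
  intro h
  have := congrArg Fin.val h
  simp at this
  omega

lemma natAdd_inj_ne {m m' : Fin 5} (h : m ≠ m') : Fin.natAdd 5 m ≠ Fin.natAdd 5 m' :=
  fun he => h (Fin.natAdd_injective 5 5 he)

/-- In the mixed case, the four remaining frequencies of the 6-tuple are low. -/
lemma br_toSix_mixed {m₀ m₁ : Fin 5} (κ : Fin 10 → Freq) :
    ∀ m ∈ lowSlots (0 : Fin 6) (Fin.succ m₁),
      br (toSix κ m) ≤ lowBr (Fin.castAdd 5 m₀) (Fin.natAdd 5 m₁) κ := by
  intro m hm
  rw [mem_lowSlots] at hm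
  obtain ⟨m', rfl⟩ := Fin.exists_succ_eq.2 hm.1
  refine br_natAdd_le (castAdd_ne_natAdd _ _).symm (natAdd_inj_ne ?_)
  rintro rfl
  exact hm.2 rfl

lemma br_toSix_right {m₀ m₁ : Fin 5} (κ : Fin 10 → Freq) :
    ∀ m ∈ lowSlots (Fin.succ m₀) (Fin.succ m₁),
      br (toSix κ m) ≤ 6 * lowBr (Fin.natAdd 5 m₀) (Fin.natAdd 5 m₁) κ := by
  have hl := one_le_lowBr (Fin.natAdd 5 m₀) (Fin.natAdd 5 m₁) κ
  intro m hm
  rcases Fin.eq_zero_or_eq_succ m with rfl | ⟨m', rfl⟩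
  · change br (kOne κ) ≤ _
    exact br_altSum_five_le hl fun m => br_castAdd_le (castAdd_ne_natAdd _ _) (castAdd_ne_natAdd _ _)
  · rw [mem_lowSlots] at hm
    have := br_natAdd_le (κ := κ) (natAdd_inj_ne fun h => hm.1 (congrArg Fin.succ h))
      (natAdd_inj_ne fun h => hm.2 (congrArg Fin.succ h))
    exact this.trans (by linarith)

lemma br_toSix_left {m₀ m₁ : Fin 5} {κ : Fin 10 → Freq} (h : altSum κ = 0) (m : Fin 6) :
    br (toSix κ m) ≤ 6 * lowBr (Fin.castAdd 5 m₀) (Fin.castAdd 5 m₁) κ := by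
  have hl := one_le_lowBr (Fin.castAdd 5 m₀) (Fin.castAdd 5 m₁) κ
  have hb : ∀ m : Fin 5, br (κ (Fin.natAdd 5 m)) ≤ lowBr (Fin.castAdd 5 m₀) (Fin.castAdd 5 m₁) κ :=
    fun m => br_natAdd_le (castAdd_ne_natAdd _ _).symm (castAdd_ne_natAdd _ _).symm
  refine Fin.cases ?_ (fun m' => ?_) m
  · change br (kOne κ) ≤ _
    rw [kOne_eq_of_altSum h]
    exact br_altSum_five_le hl hb
  · exact (hb m').trans (by linarith)

lemma exists_six_pair {κ : Fin 10 → Freq} (h : altSum κ = 0) {i i' : Fin 10} (hii' : i < i') :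
    ∃ a b : Fin 6, a ≠ b ∧ ∀ m ∈ lowSlots a b, br (toSix κ m) ≤ 6 * lowBr i i' κ := by
  have hl := one_le_lowBr i i' κ
  rcases fin_ten_cases i with ⟨m₀, rfl⟩ | ⟨m₀, rfl⟩ <;>
    rcases fin_ten_cases i' with ⟨m₁, rfl⟩ | ⟨m₁, rfl⟩
  · exact ⟨0, 1, by decide, fun m _ => br_toSix_left h m⟩
  · exact ⟨0, Fin.succ m₁, (Fin.succ_ne_zero _).symm, fun m hm =>
      (br_toSix_mixed κ m hm).trans (by linarith)⟩
  · exfalso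
    have := Fin.lt_def.1 hii'
    simp at this
    omega
  · refine ⟨Fin.succ m₀, Fin.succ m₁, fun he => ?_, fun m hm => br_toSix_right κ m hm⟩
    rw [Fin.succ_injective _ he] at hii'
    exact lt_irrefl _ hii'

lemma slotConj_natAdd (m : Fin 5) : slotConj (Fin.natAdd 5 m) = slotConj (Fin.succ m) := by
  unfold slotConj
  simp only [Fin.val_natAdd, Fin.val_succ, decide_eq_decide]
  omega

section bounds

variable {s δ Cχ : ℝ}

lemma abs_tenCut_le (hC : ∀ N k, |cut χ N k| ≤ Cχ) (N : ℕ∞) (κ : Fin 10 → Freq) :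
    |cut χ N (kOne κ) ^ 2 * ∏ m, cut χ N (κ m)| ≤ Cχ ^ 12 := by
  have h0 : 0 ≤ Cχ := (abs_nonneg _).trans (hC N 0)
  rw [abs_mul, abs_pow]
  calc _ ≤ Cχ ^ 2 * Cχ ^ 10 := by
        gcongr
        · exact hC _ _
        · exact abs_prod_cut_le hC N κ
    _ = _ := by ring

lemma abs_tenMul_le (hη : IsBump η) (hC : ∀ N k, |cut χ N k| ≤ Cχ) (hs : 2 ≤ s) (hδ : 0 ≤ δ)
    {j : ℕ} {κ : Fin 10 → Freq} (hκ : κ ∈ shell size10 j) {i i' : Fin 10} (hii' : i < i')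
    (N : ℕ∞) :
    |tenMul χ η s δ N κ| ≤ 900 * s * 9 ^ (s - 1) * Cχ ^ 12 *
      (((2:ℝ) ^ j) ^ (2 * s) * (((2:ℝ) ^ j) ^ 2)⁻¹) * lowBr i i' κ ^ 2 := by
  have hl := one_le_lowBr i i' κ
  obtain ⟨a, b, hab, hlow⟩ := exists_six_pair ((mem_shell le_size10).1 hκ).1 hii'
  have hb := abs_cutInv_mul_psi_le hη hδ (s := s) (by linarith) (M := 2 ^ j) (by positivity) hab
    (br_toSix_le hκ) (E := 6 * lowBr i i' κ) (by linarith) hlow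
  rw [tenMul, abs_mul]
  calc _ ≤ (25 * s * 9 ^ (s - 1) * (((2:ℝ) ^ j) ^ (2 * s) * (((2:ℝ) ^ j) ^ 2)⁻¹) *
        (6 * lowBr i i' κ) ^ 2) * Cχ ^ 12 := by
        refine mul_le_mul hb (abs_tenCut_le hC N κ) (abs_nonneg _) (by positivity)
    _ = _ := by ring

lemma abs_psi_le_all {k : Fin 6 → Freq} {M E : ℝ} (hs : 2 ≤ s) (hM : 0 < M)
    (hB : ∀ m, br (k m) ≤ 3 * M) (hlow : ∀ m, br (k m) ≤ E) :
    |psi s k| ≤ 6 * 9 ^ (s - 2) * (M ^ (2 * s) * (M ^ 4)⁻¹) * E ^ 4 := by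
  rw [psi]
  refine (abs_sum_le_sum_abs _ _).trans ?_
  calc _ ≤ ∑ _m : Fin 6, (9 * M ^ 2) ^ (s - 2) * (E ^ 2) ^ 2 := by
        refine sum_le_sum fun m _ => ?_
        rw [abs_mul, abs_pow, abs_neg, abs_one, one_pow, one_mul,
          abs_of_nonneg (rpow_nonneg (nsq_nonneg _) _)]
        exact rpow_le_mul_sq_of_le hs (nsq_nonneg _)
          ((nsq_le_of_br_le (hB m)).trans (le_of_eq (by ring))) (nsq_le_of_br_le (hlow m))
    _ = _ := by
        rw [sum_const, nine_mul_sq_rpow_sub_two hM]; simp; ring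

/-- Both paired frequencies belong to the first five slots, or both belong to the last five. -/
lemma abs_tenMul_pair_le (hη : IsBump η) (hC : ∀ N k, |cut χ N k| ≤ Cχ) (hs : 2 ≤ s) (hδ : 0 ≤ δ)
    {j : ℕ} {κ : Fin 10 → Freq} (hκ : κ ∈ shell size10 j) {i i' : Fin 10} (hii' : i < i')
    (hmix : ¬ ∃ m₀ m₁ : Fin 5, i = Fin.castAdd 5 m₀ ∧ i' = Fin.natAdd 5 m₁)
    (hp : slotConj i ≠ slotConj i') (he : κ i = κ i') (N : ℕ∞) :
    |tenMul χ η s δ N κ| ≤ 15552 * 9 ^ (s - 2) * Cχ ^ 12 *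
      (((2:ℝ) ^ j) ^ (2 * s) * (((2:ℝ) ^ j) ^ 4)⁻¹) * lowBr i i' κ ^ 4 := by
  have hl := one_le_lowBr i i' κ
  have hM : (0:ℝ) < 2 ^ j := by positivity
  have hb : |psi s (toSix κ)| ≤ 6 * 9 ^ (s - 2) *
      (((2:ℝ) ^ j) ^ (2 * s) * (((2:ℝ) ^ j) ^ 4)⁻¹) * (6 * lowBr i i' κ) ^ 4 := by
    rcases fin_ten_cases i with ⟨m₀, rfl⟩ | ⟨m₀, rfl⟩ <;>
      rcases fin_ten_cases i' with ⟨m₁, rfl⟩ | ⟨m₁, rfl⟩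
    · exact abs_psi_le_all hs hM (br_toSix_le hκ)
        fun m => br_toSix_left ((mem_shell le_size10).1 hκ).1 m
    · exact absurd ⟨m₀, m₁, rfl, rfl⟩ hmix
    · exfalso
      have := Fin.lt_def.1 hii'
      simp at this
      omega
    · rw [slotConj_natAdd, slotConj_natAdd] at hp
      refine abs_psi_of_pair hs hM (fun h => hp (by rw [h])) (br_toSix_le hκ)
        (br_toSix_right κ) hp he
  rw [tenMul, abs_mul, abs_mul]
  calc _ ≤ 2 * (6 * 9 ^ (s - 2) * (((2:ℝ) ^ j) ^ (2 * s) * (((2:ℝ) ^ j) ^ 4)⁻¹) *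
        (6 * lowBr i i' κ) ^ 4) * Cχ ^ 12 := by
        gcongr
        · exact hη.abs_cutInv_lam_le hδ _
        · exact abs_tenCut_le hC N κ
    _ = _ := by ring

end bounds

/-! ### The involution exchanging the two groups of slots -/

/-- For a mixed pair `i`, `i'` of slots, the reflection of the slots which exchanges `i` and `i'`,
the two groups of slots, and the conjugated and unconjugated slots. -/
def slotFlip (i i' : Fin 10) : Equiv.Perm (Fin 10) :=
  Equiv.swap (Fin.rev i) i' * Fin.revPerm * Equiv.swap (Fin.rev i) i'

lemma slotFlip_spec : ∀ m₀ m₁ : Fin 5, slotConj (Fin.castAdd 5 m₀) ≠ slotConj (Fin.natAdd 5 m₁) →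
    slotFlip (Fin.castAdd 5 m₀) (Fin.natAdd 5 m₁) (Fin.castAdd 5 m₀) = Fin.natAdd 5 m₁ ∧
    slotFlip (Fin.castAdd 5 m₀) (Fin.natAdd 5 m₁) (Fin.natAdd 5 m₁) = Fin.castAdd 5 m₀ ∧
    ∀ m : Fin 10, slotConj (slotFlip (Fin.castAdd 5 m₀) (Fin.natAdd 5 m₁) m) = !slotConj m ∧
      ((slotFlip (Fin.castAdd 5 m₀) (Fin.natAdd 5 m₁) m).val < 5 ↔ ¬ m.val < 5) ∧
      slotFlip (Fin.castAdd 5 m₀) (Fin.natAdd 5 m₁)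
        (slotFlip (Fin.castAdd 5 m₀) (Fin.natAdd 5 m₁) m) = m := by
  unfold slotConj slotFlip
  decide

end

section

section flip

variable {m₀ m₁ : Fin 5}

lemma neg_one_pow_eq_of_slotConj {n : ℕ} (m : Fin n) :
    (-1 : ℤ) ^ (m : ℕ) = if slotConj m then -1 else 1 := by
  unfold slotConj
  rcases Nat.mod_two_eq_zero_or_one (m : ℕ) with h | h
  · rw [Even.neg_one_pow (Nat.even_iff.2 h)]; simp [h]
  · rw [Odd.neg_one_pow (odd_iff.2 h)]; simp [h]

lemma neg_one_pow_eq_of_slotConj' {n : ℕ} (m : Fin n) :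
    (-1 : ℝ) ^ (m : ℕ) = if slotConj m then -1 else 1 := by
  have := neg_one_pow_eq_of_slotConj m
  have h2 : (((-1 : ℤ) ^ (m : ℕ) : ℤ) : ℝ) = ((if slotConj m then -1 else 1 : ℤ) : ℝ) := by rw [this]
  push_cast at h2
  exact h2

lemma kOne_eq_sum (κ : Fin 10 → Freq) :
    kOne κ = ∑ m : Fin 10, if m.val < 5 then (-1 : ℤ) ^ (m : ℕ) • κ m else 0 := by
  have h := Fin.sum_univ_add (a := 5) (b := 5)
    fun m : Fin 10 => if m.val < 5 then (-1 : ℤ) ^ (m : ℕ) • κ m else 0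
  refine Eq.trans ?_ h.symm
  simp [kOne, altSum]

lemma altSum_slotFlip (hp : slotConj (Fin.castAdd 5 m₀) ≠ slotConj (Fin.natAdd 5 m₁))
    (κ : Fin 10 → Freq) :
    altSum (κ ∘ slotFlip (Fin.castAdd 5 m₀) (Fin.natAdd 5 m₁)) = -altSum κ := by
  obtain ⟨-, -, h⟩ := slotFlip_spec m₀ m₁ hp
  set π := slotFlip (Fin.castAdd 5 m₀) (Fin.natAdd 5 m₁)
  rw [altSum, altSum, ← sum_neg_distrib, ← Equiv.sum_comp π]
  refine sum_congr rfl fun m _ => ?_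
  rw [Function.comp, (h m).2.2, neg_one_pow_eq_of_slotConj (π m), neg_one_pow_eq_of_slotConj m,
    (h m).1]
  cases slotConj m <;> simp

lemma kOne_slotFlip (hp : slotConj (Fin.castAdd 5 m₀) ≠ slotConj (Fin.natAdd 5 m₁))
    {κ : Fin 10 → Freq} (hκ : altSum κ = 0) :
    kOne (κ ∘ slotFlip (Fin.castAdd 5 m₀) (Fin.natAdd 5 m₁)) = kOne κ := by
  obtain ⟨-, -, h⟩ := slotFlip_spec m₀ m₁ hp
  set π := slotFlip (Fin.castAdd 5 m₀) (Fin.natAdd 5 m₁)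
  have h1 : kOne (κ ∘ π) + (altSum κ - kOne κ) = 0 := by
    rw [kOne_eq_sum (κ ∘ π), kOne_eq_sum κ, altSum, ← Equiv.sum_comp π, ← sum_sub_distrib,
      ← sum_add_distrib]
    refine sum_eq_zero fun m _ => ?_
    rw [Function.comp, (h m).2.2, neg_one_pow_eq_of_slotConj (π m), neg_one_pow_eq_of_slotConj m,
      (h m).1]
    by_cases hm : m.val < 5
    · have := mt (h m).2.1.1 (not_not.2 hm)
      cases slotConj m <;> simp [hm, this]
    · have := (h m).2.1.2 hm
      cases slotConj m <;> simp [hm, this]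
  rw [hκ, zero_sub] at h1
  exact add_neg_eq_zero.1 h1

lemma slotFlip_mem_lowSlots (hp : slotConj (Fin.castAdd 5 m₀) ≠ slotConj (Fin.natAdd 5 m₁))
    {m : Fin 10} (hm : m ∈ lowSlots (Fin.castAdd 5 m₀) (Fin.natAdd 5 m₁)) :
    slotFlip (Fin.castAdd 5 m₀) (Fin.natAdd 5 m₁) m
      ∈ lowSlots (Fin.castAdd 5 m₀) (Fin.natAdd 5 m₁) := by
  obtain ⟨h1, h2, h⟩ := slotFlip_spec m₀ m₁ hp
  rw [mem_lowSlots] at hm ⊢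
  constructor
  · intro he
    have := congrArg (slotFlip (Fin.castAdd 5 m₀) (Fin.natAdd 5 m₁)) he
    rw [(h m).2.2, h1] at this
    exact hm.2 this
  · intro he
    have := congrArg (slotFlip (Fin.castAdd 5 m₀) (Fin.natAdd 5 m₁)) he
    rw [(h m).2.2, h2] at this
    exact hm.1 this

lemma prod_lowSlots_slotFlip {N : Type*} [CommMonoid N]
    (hp : slotConj (Fin.castAdd 5 m₀) ≠ slotConj (Fin.natAdd 5 m₁)) (f : Fin 10 → N) :
    ∏ m ∈ lowSlots (Fin.castAdd 5 m₀) (Fin.natAdd 5 m₁),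
      f (slotFlip (Fin.castAdd 5 m₀) (Fin.natAdd 5 m₁) m)
      = ∏ m ∈ lowSlots (Fin.castAdd 5 m₀) (Fin.natAdd 5 m₁), f m := by
  have h := (slotFlip_spec m₀ m₁ hp).2.2
  exact Finset.prod_nbij' (slotFlip (Fin.castAdd 5 m₀) (Fin.natAdd 5 m₁))
    (slotFlip (Fin.castAdd 5 m₀) (Fin.natAdd 5 m₁)) (fun m hm => slotFlip_mem_lowSlots hp hm)
    (fun m hm => slotFlip_mem_lowSlots hp hm) (fun m _ => (h m).2.2) (fun m _ => (h m).2.2)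
    fun m _ => rfl

lemma lowMono_slotFlip (hp : slotConj (Fin.castAdd 5 m₀) ≠ slotConj (Fin.natAdd 5 m₁))
    (u : Coeff) (κ : Fin 10 → Freq) :
    lowMono (Fin.castAdd 5 m₀) (Fin.natAdd 5 m₁) u
        (κ ∘ slotFlip (Fin.castAdd 5 m₀) (Fin.natAdd 5 m₁))
      = conj (lowMono (Fin.castAdd 5 m₀) (Fin.natAdd 5 m₁) u κ) := by
  have h := (slotFlip_spec m₀ m₁ hp).2.2
  rw [lowMono, lowMono, map_prod, ← prod_lowSlots_slotFlip hp]
  refine prod_congr rfl fun m _ => ?_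
  rw [Function.comp, conj_twist, (h m).1, (h m).2.2]

lemma lowBr_slotFlip (hp : slotConj (Fin.castAdd 5 m₀) ≠ slotConj (Fin.natAdd 5 m₁))
    (κ : Fin 10 → Freq) :
    lowBr (Fin.castAdd 5 m₀) (Fin.natAdd 5 m₁)
        (κ ∘ slotFlip (Fin.castAdd 5 m₀) (Fin.natAdd 5 m₁))
      = lowBr (Fin.castAdd 5 m₀) (Fin.natAdd 5 m₁) κ :=
  prod_lowSlots_slotFlip hp fun m => br (κ m)

lemma size10_slotFlip (hp : slotConj (Fin.castAdd 5 m₀) ≠ slotConj (Fin.natAdd 5 m₁))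
    {κ : Fin 10 → Freq} (hκ : altSum κ = 0) :
    size10 (κ ∘ slotFlip (Fin.castAdd 5 m₀) (Fin.natAdd 5 m₁)) = size10 κ := by
  rw [size10, size10, kOne_slotFlip hp hκ]
  congr 1
  set π := slotFlip (Fin.castAdd 5 m₀) (Fin.natAdd 5 m₁)
  refine le_antisymm (Finset.sup_le fun m _ => ?_) (Finset.sup_le fun m _ => ?_)
  · exact le_sup (f := fun m => (nsqInt (κ m)).toNat) (Finset.mem_univ (π m))
  · have := le_sup (f := fun m => (nsqInt ((κ ∘ π) m)).toNat) (Finset.mem_univ (π.symm m))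
    simpa using this

/-- The mixed pairings with low remaining frequencies. -/
def mixedSet (j : ℕ) (m₀ m₁ : Fin 5) : Finset (Fin 10 → Freq) :=
  open Classical in (shell size10 j).filter fun κ =>
    lowBr (Fin.castAdd 5 m₀) (Fin.natAdd 5 m₁) κ < 2 ^ j / 600 ∧
      κ (Fin.castAdd 5 m₀) = κ (Fin.natAdd 5 m₁)

lemma mem_mixedSet {j : ℕ} {κ : Fin 10 → Freq} : κ ∈ mixedSet j m₀ m₁ ↔ κ ∈ shell size10 j ∧
    lowBr (Fin.castAdd 5 m₀) (Fin.natAdd 5 m₁) κ < 2 ^ j / 600 ∧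
      κ (Fin.castAdd 5 m₀) = κ (Fin.natAdd 5 m₁) := by
  simp [mixedSet]

lemma slotFlip_mem_mixedSet (hp : slotConj (Fin.castAdd 5 m₀) ≠ slotConj (Fin.natAdd 5 m₁))
    {j : ℕ} {κ : Fin 10 → Freq} (h : κ ∈ mixedSet j m₀ m₁) :
    κ ∘ slotFlip (Fin.castAdd 5 m₀) (Fin.natAdd 5 m₁) ∈ mixedSet j m₀ m₁ := by
  obtain ⟨h1, h2, -⟩ := slotFlip_spec m₀ m₁ hp
  rw [mem_mixedSet] at h ⊢
  obtain ⟨ha, hj⟩ := (mem_shell le_size10).1 h.1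
  refine ⟨(mem_shell le_size10).2 ⟨?_, ?_⟩, ?_, ?_⟩
  · rw [altSum_slotFlip hp, ha, neg_zero]
  · rw [size10_slotFlip hp ha, hj]
  · rw [lowBr_slotFlip hp]; exact h.2.1
  · rw [Function.comp, Function.comp, h1, h2, h.2.2]

/-- Forms whose real coefficients are invariant under the exchange of the slots are real. -/
lemma im_sum_eq_zero_of_slotFlip
    (hp : slotConj (Fin.castAdd 5 m₀) ≠ slotConj (Fin.natAdd 5 m₁)) {j : ℕ}
    {r : (Fin 10 → Freq) → ℝ} (hr : ∀ κ ∈ mixedSet j m₀ m₁,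
      r (κ ∘ slotFlip (Fin.castAdd 5 m₀) (Fin.natAdd 5 m₁)) = r κ) (u : Coeff) :
    (∑ κ ∈ mixedSet j m₀ m₁,
      (r κ : ℂ) * lowMono (Fin.castAdd 5 m₀) (Fin.natAdd 5 m₁) u κ).im = 0 := by
  have h := (slotFlip_spec m₀ m₁ hp).2.2
  rw [← Complex.conj_eq_iff_im, map_sum]
  refine sum_nbij' (fun κ => κ ∘ slotFlip (Fin.castAdd 5 m₀) (Fin.natAdd 5 m₁))
    (fun κ => κ ∘ slotFlip (Fin.castAdd 5 m₀) (Fin.natAdd 5 m₁))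
    (fun κ hκ => slotFlip_mem_mixedSet hp hκ) (fun κ hκ => slotFlip_mem_mixedSet hp hκ)
    (fun κ _ => ?_) (fun κ _ => ?_) fun κ hκ => ?_
  · funext m; simp only [Function.comp, (h m).2.2]
  · funext m; simp only [Function.comp, (h m).2.2]
  · rw [lowMono_slotFlip hp, hr κ hκ, map_mul, conj_ofReal]

end flip

namespace IsBump

variable (h : IsBump η)
include h

lemma first_diff_le {L L₀ y c ψ d Z : ℝ} (hL : 1 ≤ L) (hL₀ : 0 < L₀) (hZ : 0 ≤ Z) (hψ : |ψ| ≤ Z * |y|) :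
    |y| * |(ψ + d) * cutInv η L (y + c) - ψ * cutInv η L₀ y|
      ≤ Z * (L + L₀ + 4 * |c| + 2 * c ^ 2) + 2 * |d| * |y| := by
  have hb := h.sq_mul_cutInv_sub_le (x := y + c) (y := y) hL hL₀
  rw [show y - (y + c) = -c by ring, abs_neg, sq_abs, abs_mul, abs_of_nonneg (sq_nonneg y)] at hb
  have hf : |cutInv η L (y + c)| ≤ 2 := (h.abs_cutInv_le (by linarith) _).trans (by
    rw [div_le_iff₀ (by linarith)]; linarith)
  set Δ := cutInv η L (y + c) - cutInv η L₀ y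
  have e : (ψ + d) * cutInv η L (y + c) - ψ * cutInv η L₀ y = ψ * Δ + d * cutInv η L (y + c) := by
    simp only [Δ]; ring
  rw [e]
  calc |y| * |ψ * Δ + d * cutInv η L (y + c)|
      ≤ |y| * (|ψ| * |Δ| + |d| * 2) := by
        gcongr
        refine (abs_add_le _ _).trans ?_
        rw [abs_mul, abs_mul]
        gcongr
    _ ≤ |y| * (Z * |y| * |Δ| + |d| * 2) := by gcongr
    _ = Z * (y ^ 2 * |Δ|) + 2 * |d| * |y| := by rw [← sq_abs y]; ring
    _ ≤ _ := by gcongr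

lemma exists_sym_diff_le : ∃ K : ℝ, 0 ≤ K ∧ ∀ L L₀ y c ψ d Z : ℝ, 1 ≤ L → 0 < L₀ → L₀ ≤ L →
    0 ≤ Z → |ψ| ≤ Z * |y| →
    |((ψ + d) * cutInv η L (y + c) - ψ * cutInv η L₀ y)
      + ((-ψ + d) * cutInv η L (-y + c) - (-ψ) * cutInv η L₀ (-y))|
      ≤ Z * (K * ((1 + |c|) ^ (5 / 2 : ℝ) * L ^ (-(1 / 2) : ℝ) * (1 + |y|) ^ (-(3 / 2) : ℝ)
        + (L - L₀) / L₀)) + 4 * |d| := by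
  obtain ⟨K₁, hK1, h1⟩ := h.exists_second_diff
  obtain ⟨K₂, hK2, h2⟩ := h.exists_scale_diff
  refine ⟨K₁ + 2 * K₂, by positivity, fun L L₀ y c ψ d Z hL hL₀ hLL hZ hψ => ?_⟩
  have b1 := h1 L y c hL
  have b2 := h2 L L₀ y hL₀ hLL
  have hf : ∀ x, |cutInv η L x| ≤ 2 := fun x => (h.abs_cutInv_le (by linarith) _).trans (by
    rw [div_le_iff₀ (by linarith)]; linarith)
  set G := (1 + |c|) ^ (5 / 2 : ℝ) * L ^ (-(1 / 2) : ℝ) * (1 + |y|) ^ (-(3 / 2) : ℝ) with hG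
  set q := (L - L₀) / L₀ with hq
  have hG0 : 0 ≤ G := by positivity
  have hq0 : 0 ≤ q := div_nonneg (by linarith) hL₀.le
  set D₂ := cutInv η L (y + c) + cutInv η L (y - c) - 2 * cutInv η L y
  set D₁ := cutInv η L y - cutInv η L₀ y
  have e : ((ψ + d) * cutInv η L (y + c) - ψ * cutInv η L₀ y)
      + ((-ψ + d) * cutInv η L (-y + c) - (-ψ) * cutInv η L₀ (-y))
      = ψ * D₂ + ψ * (2 * D₁) + d * (cutInv η L (y + c) - cutInv η L (y - c)) := by
    rw [show -y + c = -(y - c) by ring, h.cutInv_neg, h.cutInv_neg]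
    simp only [D₂, D₁]; ring
  rw [e]
  have hψD : ∀ D b : ℝ, |y * D| ≤ b → |ψ * D| ≤ Z * b := by
    intro D b hD
    rw [abs_mul] at hD ⊢
    calc |ψ| * |D| ≤ Z * |y| * |D| := by gcongr
      _ = Z * (|y| * |D|) := by ring
      _ ≤ Z * b := by gcongr
  have t1 := hψD D₂ _ b1
  have t2 := hψD (2 * D₁) (2 * (K₂ * q)) (by
    rw [show y * (2 * D₁) = 2 * (y * D₁) by ring, abs_mul, abs_two]; gcongr)
  have t3 : |d * (cutInv η L (y + c) - cutInv η L (y - c))| ≤ 4 * |d| := by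
    rw [abs_mul]
    have h3 := (abs_sub (cutInv η L (y + c)) (cutInv η L (y - c))).trans
      (add_le_add (hf _) (hf _))
    nlinarith [abs_nonneg d]
  refine (abs_add_le _ _).trans (add_le_add ((abs_add_le _ _).trans (le_trans (add_le_add t1 t2) ?_)) t3)
  rw [← mul_add]
  refine mul_le_mul_of_nonneg_left ?_ hZ
  nlinarith [mul_nonneg hK1 hq0, mul_nonneg hK2 hG0]

end IsBump

end

section

section mixed

variable {m₀ m₁ : Fin 5}

/-- The alternating sum of `f` over the four low entries of the 6-tuple. -/
def lowSix (f : Freq → ℝ) (m₁ : Fin 5) (κ : Fin 10 → Freq) : ℝ :=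
  ∑ m ∈ lowSlots (0 : Fin 6) (Fin.succ m₁), (-1 : ℝ) ^ (m : ℕ) * f (toSix κ m)

/-- The alternating sum of `f` over the two remaining entries of the 6-tuple. -/
def topSix (f : Freq → ℝ) (m₁ : Fin 5) (κ : Fin 10 → Freq) : ℝ :=
  f (kOne κ) + (-1 : ℝ) ^ ((Fin.succ m₁ : Fin 6) : ℕ) * f (κ (Fin.natAdd 5 m₁))

lemma altSum_six_split (f : Freq → ℝ) (m₁ : Fin 5) (κ : Fin 10 → Freq) :
    ∑ m : Fin 6, (-1 : ℝ) ^ (m : ℕ) * f (toSix κ m) = topSix f m₁ κ + lowSix f m₁ κ := by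
  rw [sum_eq_pair_add_low (i := (0 : Fin 6)) (i' := Fin.succ m₁) (Fin.succ_ne_zero _).symm,
    add_comm, topSix, lowSix]
  congr 2
  · simp [toSix]

/-- The contribution of the pair to `λ`. -/
def lamTop (m₁ : Fin 5) (κ : Fin 10 → Freq) : ℝ :=
  sqrt (nsq (kOne κ) + nsq (κ (Fin.natAdd 5 m₁)))

lemma lam_sq_split (m₁ : Fin 5) (κ : Fin 10 → Freq) :
    lam (toSix κ) ^ 2 = lamTop m₁ κ ^ 2
      + ∑ m ∈ lowSlots (0 : Fin 6) (Fin.succ m₁), nsq (toSix κ m) := by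
  rw [lam_sq, sum_eq_pair_add_low (i := (0 : Fin 6)) (i' := Fin.succ m₁)
    (Fin.succ_ne_zero _).symm, lamTop, sq_sqrt (add_nonneg (nsq_nonneg _) (nsq_nonneg _)),
    add_comm]
  rfl

/-- The difference of the multiplier of the ten-linear form and the reference multiplier which
involves the paired frequencies only. -/
def gapMul (η : ℝ → ℝ) (s δ : ℝ) (m₁ : Fin 5) (κ : Fin 10 → Freq) : ℝ :=
  (topSix (fun k => nsq k ^ s) m₁ κ + lowSix (fun k => nsq k ^ s) m₁ κ) *
      cutInv η (lam (toSix κ) ^ δ) (topSix nsq m₁ κ + lowSix nsq m₁ κ)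
    - topSix (fun k => nsq k ^ s) m₁ κ * cutInv η (lamTop m₁ κ ^ δ) (topSix nsq m₁ κ)

/-- The product of the frequency cutoffs in the ten-linear form. -/
def tenCut (χ : EuclideanSpace ℝ (Fin 3) → ℝ) (N : ℕ∞) (κ : Fin 10 → Freq) : ℝ :=
  cut χ N (kOne κ) ^ 2 * ∏ m, cut χ N (κ m)

lemma tenMul_eq_gapMul (χ : EuclideanSpace ℝ (Fin 3) → ℝ) (η : ℝ → ℝ) (s δ : ℝ) (N : ℕ∞)
    (m₁ : Fin 5) (κ : Fin 10 → Freq) :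
    tenMul χ η s δ N κ = tenCut χ N κ * (gapMul η s δ m₁ κ
      + topSix (fun k => nsq k ^ s) m₁ κ * cutInv η (lamTop m₁ κ ^ δ) (topSix nsq m₁ κ)) := by
  have h1 : psi s (toSix κ)
      = topSix (fun k => nsq k ^ s) m₁ κ + lowSix (fun k => nsq k ^ s) m₁ κ :=
    altSum_six_split (fun k => nsq k ^ s) m₁ κ
  have h2 : Om (toSix κ) = topSix nsq m₁ κ + lowSix nsq m₁ κ :=
    altSum_six_split nsq m₁ κ
  rw [tenMul, gapMul, tenCut, h1, h2]
  ring

/-- Size information on the tuples with a mixed pairing. -/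
structure MixedFacts (s : ℝ) (m₀ m₁ : Fin 5) (M l : ℝ) (κ : Fin 10 → Freq) : Prop where
  one_le_l : 1 ≤ l
  M_gt : 600 < M
  nsq_ge : M ^ 2 / 7200 ≤ nsq (κ (Fin.natAdd 5 m₁))
  lamTop_ge : M / 85 ≤ lamTop m₁ κ
  abs_c : |lowSix nsq m₁ κ| ≤ 6 * l ^ 2
  abs_d : |lowSix (fun k => nsq k ^ s) m₁ κ| ≤
    6 * 9 ^ (s - 2) * (M ^ (2 * s) * (M ^ 4)⁻¹) * l ^ 4
  abs_ψ : |topSix (fun k => nsq k ^ s) m₁ κ| ≤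
    s * 9 ^ (s - 1) * (M ^ (2 * s) * (M ^ 2)⁻¹) * |topSix nsq m₁ κ|
  abs_y : |topSix nsq m₁ κ| ≤ 18 * M ^ 2
  lam_le : lam (toSix κ) ≤ 8 * M
  lamTop_le : lamTop m₁ κ ≤ lam (toSix κ)
  lam_sq_le : lam (toSix κ) ^ 2 ≤ lamTop m₁ κ ^ 2 + 6 * l ^ 2
  wt_le : wt s (κ (Fin.castAdd 5 m₀)) ≤ wtConst s * (M ^ (2 * s))⁻¹

lemma mixedFacts {s : ℝ} (hs : 2 ≤ s) {j : ℕ} {κ : Fin 10 → Freq} (hκ : κ ∈ mixedSet j m₀ m₁)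
    (hbig : (2:ℝ) ^ j / 60 ≤ br (κ (Fin.castAdd 5 m₀))) :
    MixedFacts s m₀ m₁ (2 ^ j) (lowBr (Fin.castAdd 5 m₀) (Fin.natAdd 5 m₁) κ) κ := by
  obtain ⟨hT, hlow, he⟩ := mem_mixedSet.1 hκ
  have hB := br_toSix_le hT
  set M : ℝ := 2 ^ j with hMdef
  set l := lowBr (Fin.castAdd 5 m₀) (Fin.natAdd 5 m₁) κ with hl
  have hl1 : 1 ≤ l := one_le_lowBr _ _ _
  have hM : 600 < M := by linarith
  have hM0 : 0 < M := by linarith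
  have hlowSix := br_toSix_mixed (m₀ := m₀) (m₁ := m₁) κ
  have hB2 : ∀ m, nsq (toSix κ m) ≤ 9 * M ^ 2 := fun m =>
    (nsq_le_of_br_le (hB m)).trans (le_of_eq (by ring))
  have hk0 : nsq (kOne κ) ≤ 9 * M ^ 2 := hB2 0
  have hk1 : nsq (κ (Fin.natAdd 5 m₁)) ≤ 9 * M ^ 2 := hB2 (Fin.succ m₁)
  have hnsq : M ^ 2 / 7200 ≤ nsq (κ (Fin.natAdd 5 m₁)) := by
    have h1 : (M / 60) ^ 2 ≤ br (κ (Fin.natAdd 5 m₁)) ^ 2 := by rw [← he]; gcongr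
    rw [br_sq] at h1
    nlinarith
  have hlamTop : M / 85 ≤ lamTop m₁ κ := by
    rw [lamTop]
    refine Real.le_sqrt_of_sq_le ?_
    have := nsq_nonneg (kOne κ)
    nlinarith
  have hlt : lamTop m₁ κ ≤ lam (toSix κ) := by
    refine abs_le_of_sq_le_sq' ?_ (lam_nonneg _) |>.2
    rw [lam_sq_split m₁ κ]
    have : 0 ≤ ∑ m ∈ lowSlots (0 : Fin 6) (Fin.succ m₁), nsq (toSix κ m) :=
      sum_nonneg fun m _ => nsq_nonneg _
    linarith
  refine ⟨hl1, hM, hnsq, hlamTop, ?_, ?_, ?_, ?_, lam_le hM0 hB, hlt, ?_,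
    wt_le_of_big (by linarith) hM0 hbig⟩
  · exact abs_low_sum_le (fun m => nsq (toSix κ m)) (sq_nonneg l) fun m hm => by
      rw [abs_of_nonneg (nsq_nonneg _)]; exact nsq_le_of_br_le (hlowSix m hm)
  · have := abs_low_sum_le (i := (0 : Fin 6)) (i' := Fin.succ m₁) (fun m => nsq (toSix κ m) ^ s)
      (b := (9 * M ^ 2) ^ (s - 2) * (l ^ 2) ^ 2) (by positivity) fun m hm => by
        rw [abs_of_nonneg (rpow_nonneg (nsq_nonneg _) _)]
        exact rpow_le_mul_sq_of_le hs (nsq_nonneg _) (hB2 m) (nsq_le_of_br_le (hlowSix m hm))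
    rw [nine_mul_sq_rpow_sub_two hM0] at this
    exact this.trans (le_of_eq (by ring))
  · have := abs_pair_rpow_le (s := s) (by linarith) (nsq_nonneg _) (nsq_nonneg _) hk0 hk1 0
      ((Fin.succ m₁ : Fin 6) : ℕ)
    rw [nine_mul_sq_rpow_sub_one hM0] at this
    simp only [pow_zero, one_mul] at this
    refine this.trans (le_of_eq ?_)
    simp only [topSix]; ring
  · rw [topSix]
    refine (abs_add_le _ _).trans ?_
    rw [abs_mul, abs_pow, abs_neg, abs_one, one_pow, one_mul, abs_of_nonneg (nsq_nonneg _),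
      abs_of_nonneg (nsq_nonneg _)]
    linarith
  · rw [lam_sq_split m₁ κ]
    have : ∑ m ∈ lowSlots (0 : Fin 6) (Fin.succ m₁), nsq (toSix κ m) ≤ 6 * l ^ 2 := by
      calc _ ≤ ∑ _m ∈ lowSlots (0 : Fin 6) (Fin.succ m₁), l ^ 2 :=
            sum_le_sum fun m hm => nsq_le_of_br_le (hlowSix m hm)
        _ = ((lowSlots (0 : Fin 6) (Fin.succ m₁)).card : ℝ) * l ^ 2 := by
            rw [sum_const, nsmul_eq_mul]
        _ ≤ _ := by
          have : (lowSlots (0 : Fin 6) (Fin.succ m₁)).card ≤ 6 :=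
            (card_le_univ _).trans (by simp)
          gcongr; exact_mod_cast this
    linarith

variable {s δ M l : ℝ} {κ : Fin 10 → Freq}

lemma MixedFacts.scales (h : MixedFacts s m₀ m₁ M l κ) (hδ : 0 ≤ δ) (hδ1 : δ ≤ 1) :
    1 ≤ lam (toSix κ) ^ δ ∧ 0 < lamTop m₁ κ ^ δ ∧ lamTop m₁ κ ^ δ ≤ lam (toSix κ) ^ δ ∧
    lam (toSix κ) ^ δ ≤ 8 * M ^ δ ∧ M ^ δ / 85 ≤ lam (toSix κ) ^ δ ∧
    (lam (toSix κ) ^ δ - lamTop m₁ κ ^ δ) / lamTop m₁ κ ^ δ ≤ 43350 * l ^ 2 * (M ^ 2)⁻¹ := by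
  have hM := h.M_gt
  have hM0 : 0 < M := by linarith
  have hT0 : 0 < lamTop m₁ κ := lt_of_lt_of_le (by positivity) h.lamTop_ge
  have hlam0 : 0 < lam (toSix κ) := hT0.trans_le h.lamTop_le
  have hlam1 : 1 ≤ lam (toSix κ) := by
    rcases lam_eq_zero_or (toSix κ) with h0 | h0
    · linarith
    · exact h0
  have hTp : 0 < lamTop m₁ κ ^ δ := rpow_pos_of_pos hT0 _
  refine ⟨one_le_rpow hlam1 hδ, hTp, rpow_le_rpow hT0.le h.lamTop_le hδ, ?_, ?_, ?_⟩
  · calc lam (toSix κ) ^ δ ≤ (8 * M) ^ δ := rpow_le_rpow hlam0.le h.lam_le hδ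
      _ = 8 ^ δ * M ^ δ := mul_rpow (by norm_num) hM0.le
      _ ≤ 8 ^ (1:ℝ) * M ^ δ := by gcongr; norm_num
      _ = _ := by norm_num
  · calc M ^ δ / 85 = M ^ δ / 85 ^ (1:ℝ) := by norm_num
      _ ≤ M ^ δ / 85 ^ δ := by gcongr; norm_num
      _ = (M / 85) ^ δ := by rw [div_rpow hM0.le (by norm_num)]
      _ ≤ _ := rpow_le_rpow (by positivity) (h.lamTop_ge.trans h.lamTop_le) hδ
  · set t := lam (toSix κ) / lamTop m₁ κ with ht
    have ht1 : 1 ≤ t := (one_le_div hT0).2 h.lamTop_le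
    have e : (lam (toSix κ) ^ δ - lamTop m₁ κ ^ δ) / lamTop m₁ κ ^ δ = t ^ δ - 1 := by
      rw [ht, div_rpow hlam0.le hT0.le, sub_div, div_self hTp.ne']
    rw [e]
    have h1 : t ^ δ ≤ t ^ 2 := by
      calc t ^ δ ≤ t ^ (2:ℝ) := rpow_le_rpow_of_exponent_le ht1 (by linarith)
        _ = t ^ 2 := by norm_cast
    have h2 : t ^ 2 - 1 ≤ 6 * l ^ 2 / lamTop m₁ κ ^ 2 := by
      rw [ht, div_pow, div_sub_one (by positivity)]
      gcongr
      linarith [h.lam_sq_le]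
    have h3 : 6 * l ^ 2 / lamTop m₁ κ ^ 2 ≤ 6 * l ^ 2 / (M / 85) ^ 2 := by
      gcongr; exact h.lamTop_ge
    calc t ^ δ - 1 ≤ 6 * l ^ 2 / (M / 85) ^ 2 := by linarith
      _ = _ := by field_simp; ring

lemma MixedFacts.scale_sum (h : MixedFacts s m₀ m₁ M l κ) (hδ : 0 ≤ δ) (hδ1 : δ ≤ 1) :
    lam (toSix κ) ^ δ + lamTop m₁ κ ^ δ + 4 * |lowSix nsq m₁ κ| + 2 * lowSix nsq m₁ κ ^ 2
      ≤ 112 * (M ^ δ * l ^ 4) := by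
  obtain ⟨-, -, h3, h4, -, -⟩ := h.scales hδ hδ1
  have hl := h.one_le_l
  have hD : 1 ≤ M ^ δ := one_le_rpow (by linarith [h.M_gt]) hδ
  have hc := h.abs_c
  have hc2 : lowSix nsq m₁ κ ^ 2 ≤ (6 * l ^ 2) ^ 2 := by
    rw [← sq_abs]; gcongr
  have hl4 : 1 ≤ l ^ 4 := one_le_pow₀ hl
  have hl24 : l ^ 2 ≤ l ^ 4 := pow_le_pow_right₀ hl (by norm_num)
  have e1 : l ^ 4 ≤ M ^ δ * l ^ 4 := le_mul_of_one_le_left (by positivity) hD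
  have e2 : M ^ δ ≤ M ^ δ * l ^ 4 := le_mul_of_one_le_right (by positivity) hl4
  nlinarith

lemma MixedFacts.mul_gapMul_le (h : MixedFacts s m₀ m₁ M l κ) (hη : IsBump η) (hs : 2 ≤ s)
    (hδ : 0 ≤ δ) (hδ1 : δ ≤ 1) :
    |topSix nsq m₁ κ| * |gapMul η s δ m₁ κ|
      ≤ (112 * s * 9 ^ (s - 1) + 216 * 9 ^ (s - 2)) *
        (M ^ (2 * s) * (M ^ 2)⁻¹) * (M ^ δ * l ^ 4) := by
  obtain ⟨h1, h2, h3, h4, -, -⟩ := h.scales hδ hδ1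
  have hM0 : 0 < M := by linarith [h.M_gt]
  have hD : 1 ≤ M ^ δ := one_le_rpow (by linarith [h.M_gt]) hδ
  have hP : 0 < M ^ (2 * s) := rpow_pos_of_pos hM0 _
  have hl := h.one_le_l
  refine (hη.first_diff_le h1 h2 (by positivity) h.abs_ψ).trans ?_
  have b1 := h.scale_sum hδ hδ1
  have b2 : 2 * |lowSix (fun k => nsq k ^ s) m₁ κ| * |topSix nsq m₁ κ|
      ≤ 216 * 9 ^ (s - 2) * (M ^ (2 * s) * (M ^ 2)⁻¹) * (M ^ δ * l ^ 4) := by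
    calc _ ≤ 2 * (6 * 9 ^ (s - 2) * (M ^ (2 * s) * (M ^ 4)⁻¹) * l ^ 4) * (18 * M ^ 2) := by
          gcongr
          · exact h.abs_d
          · exact h.abs_y
      _ = 216 * 9 ^ (s - 2) * (M ^ (2 * s) * (M ^ 2)⁻¹) * (1 * l ^ 4) := by field_simp; ring
      _ ≤ _ := by gcongr
  calc _ ≤ s * 9 ^ (s - 1) * (M ^ (2 * s) * (M ^ 2)⁻¹) * (112 * (M ^ δ * l ^ 4))
        + 216 * 9 ^ (s - 2) * (M ^ (2 * s) * (M ^ 2)⁻¹) * (M ^ δ * l ^ 4) := by gcongr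
    _ = _ := by ring

end mixed

end

section

section fibers

variable {s δ Cχ : ℝ} {m₀ m₁ : Fin 5} {j : ℕ}

/-- The coefficient of a mixed pairing after subtraction of the reference coefficient. -/
def pairGap (χ : EuclideanSpace ℝ (Fin 3) → ℝ) (η : ℝ → ℝ) (s δ : ℝ) (N : ℕ∞) (m₀ m₁ : Fin 5)
    (κ : Fin 10 → Freq) : ℝ :=
  2 * tenCut χ N κ * wt s (κ (Fin.castAdd 5 m₀)) * gapMul η s δ m₁ κ

/-- The reference coefficient of a mixed pairing. -/
def pairRef (χ : EuclideanSpace ℝ (Fin 3) → ℝ) (η : ℝ → ℝ) (s δ : ℝ) (N : ℕ∞) (m₀ m₁ : Fin 5)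
    (κ : Fin 10 → Freq) : ℝ :=
  2 * tenCut χ N κ * wt s (κ (Fin.castAdd 5 m₀)) *
    (topSix (fun k => nsq k ^ s) m₁ κ * cutInv η (lamTop m₁ κ ^ δ) (topSix nsq m₁ κ))

lemma pairRef_slotFlip (hp : slotConj (Fin.castAdd 5 m₀) ≠ slotConj (Fin.natAdd 5 m₁)) (N : ℕ∞)
    {κ : Fin 10 → Freq} (hκ : κ ∈ mixedSet j m₀ m₁) :
    pairRef χ η s δ N m₀ m₁ (κ ∘ slotFlip (Fin.castAdd 5 m₀) (Fin.natAdd 5 m₁))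
      = pairRef χ η s δ N m₀ m₁ κ := by
  obtain ⟨h1, h2, -⟩ := slotFlip_spec m₀ m₁ hp
  obtain ⟨hT, -, he⟩ := mem_mixedSet.1 hκ
  have hk := kOne_slotFlip hp ((mem_shell le_size10).1 hT).1
  have e1 : (κ ∘ slotFlip (Fin.castAdd 5 m₀) (Fin.natAdd 5 m₁)) (Fin.castAdd 5 m₀)
      = κ (Fin.castAdd 5 m₀) := by rw [Function.comp, h1, he]
  have e2 : (κ ∘ slotFlip (Fin.castAdd 5 m₀) (Fin.natAdd 5 m₁)) (Fin.natAdd 5 m₁)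
      = κ (Fin.natAdd 5 m₁) := by rw [Function.comp, h2, he]
  have e3 : tenCut χ N (κ ∘ slotFlip (Fin.castAdd 5 m₀) (Fin.natAdd 5 m₁)) = tenCut χ N κ := by
    rw [tenCut, tenCut, hk]
    congr 1
    exact Equiv.prod_comp (slotFlip (Fin.castAdd 5 m₀) (Fin.natAdd 5 m₁))
      (fun m => cut χ N (κ m))
  rw [pairRef, pairRef, topSix, topSix, topSix, topSix, lamTop, lamTop, hk, e1, e2, e3]

lemma abs_tenCut_le' (hC : ∀ N k, |cut χ N k| ≤ Cχ) (N : ℕ∞) (κ : Fin 10 → Freq) :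
    |tenCut χ N κ| ≤ Cχ ^ 12 := abs_tenCut_le hC N κ

/-- The reflection of the paired frequency which exchanges it with the intermediate one. -/
def pairReflect (m₀ m₁ : Fin 5) (κ : Fin 10 → Freq) : Fin 10 → Freq :=
  fun m => if m = Fin.castAdd 5 m₀ ∨ m = Fin.natAdd 5 m₁ then -kOne κ else κ m

lemma pairReflect_low {κ : Fin 10 → Freq} {m : Fin 10} (h : m ≠ Fin.castAdd 5 m₀)
    (h' : m ≠ Fin.natAdd 5 m₁) : pairReflect m₀ m₁ κ m = κ m := by
  rw [pairReflect, if_neg (not_or.2 ⟨h, h'⟩)]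

lemma pairReflect_castAdd (κ : Fin 10 → Freq) : pairReflect m₀ m₁ κ (Fin.castAdd 5 m₀) = -kOne κ :=
  if_pos (Or.inl rfl)

lemma pairReflect_natAdd (κ : Fin 10 → Freq) : pairReflect m₀ m₁ κ (Fin.natAdd 5 m₁) = -kOne κ :=
  if_pos (Or.inr rfl)

lemma lowPart_pairReflect (κ : Fin 10 → Freq) :
    lowPart (Fin.castAdd 5 m₀) (Fin.natAdd 5 m₁) (pairReflect m₀ m₁ κ)
      = lowPart (Fin.castAdd 5 m₀) (Fin.natAdd 5 m₁) κ := by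
  funext m
  simp only [lowPart, pairReflect]
  split_ifs <;> rfl

lemma kOne_eq_low_add (h0 : slotConj (Fin.castAdd 5 m₀) = false) (κ : Fin 10 → Freq) :
    kOne κ = kOne (lowPart (Fin.castAdd 5 m₀) (Fin.natAdd 5 m₁) κ) + κ (Fin.castAdd 5 m₀) := by
  have hsgn : (-1 : ℤ) ^ (m₀ : ℕ) = 1 := by
    have := neg_one_pow_eq_of_slotConj (Fin.castAdd 5 m₀)
    rw [h0] at this
    simpa using this
  rw [kOne, kOne, altSum, altSum, ← add_sum_erase _ _ (Finset.mem_univ m₀),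
    ← add_sum_erase (Finset.univ)
      (fun m : Fin 5 => (-1 : ℤ) ^ (m : ℕ) •
        lowPart (Fin.castAdd 5 m₀) (Fin.natAdd 5 m₁) κ (Fin.castAdd 5 m)) (Finset.mem_univ m₀)]
  have e1 : lowPart (Fin.castAdd 5 m₀) (Fin.natAdd 5 m₁) κ (Fin.castAdd 5 m₀) = 0 := by
    simp [lowPart]
  rw [e1, hsgn, smul_zero, zero_add, one_smul, add_comm]
  congr 1
  refine sum_congr rfl fun m hm => ?_
  rw [lowPart_of_mem]
  refine mem_lowSlots.2 ⟨fun h => ne_of_mem_erase hm (Fin.castAdd_injective 5 5 h),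
    castAdd_ne_natAdd _ _⟩

lemma kOne_pairReflect (h0 : slotConj (Fin.castAdd 5 m₀) = false) (κ : Fin 10 → Freq) :
    kOne (pairReflect m₀ m₁ κ) = -κ (Fin.castAdd 5 m₀) := by
  have h1 := kOne_eq_low_add (m₁ := m₁) h0 κ
  have h2 := kOne_eq_low_add (m₁ := m₁) h0 (pairReflect m₀ m₁ κ)
  rw [lowPart_pairReflect] at h2
  have h3 : pairReflect m₀ m₁ κ (Fin.castAdd 5 m₀) = -kOne κ := by simp [pairReflect]
  rw [h3, h1] at h2
  rw [h2]; abel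

lemma pairReflect_pairReflect (h0 : slotConj (Fin.castAdd 5 m₀) = false) {κ : Fin 10 → Freq}
    (he : κ (Fin.castAdd 5 m₀) = κ (Fin.natAdd 5 m₁)) :
    pairReflect m₀ m₁ (pairReflect m₀ m₁ κ) = κ := by
  funext m
  by_cases hm : m = Fin.castAdd 5 m₀ ∨ m = Fin.natAdd 5 m₁
  · rw [pairReflect, if_pos hm, kOne_pairReflect h0, neg_neg]
    rcases hm with rfl | rfl
    · rfl
    · exact he
  · push Not at hm
    rw [pairReflect_low hm.1 hm.2, pairReflect_low hm.1 hm.2]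

lemma altSum_pairReflect (hp : slotConj (Fin.castAdd 5 m₀) ≠ slotConj (Fin.natAdd 5 m₁))
    {κ : Fin 10 → Freq} (he : κ (Fin.castAdd 5 m₀) = κ (Fin.natAdd 5 m₁)) :
    altSum (pairReflect m₀ m₁ κ) = altSum κ := by
  have hne := castAdd_ne_natAdd m₀ m₁
  have hsgn : (-1 : ℤ) ^ (Fin.castAdd 5 m₀ : ℕ) = -(-1 : ℤ) ^ (Fin.natAdd 5 m₁ : ℕ) := by
    exact_mod_cast slotConj_ne_iff.1 hp
  rw [altSum_eq_pair hne, altSum_eq_pair hne κ, lowPart_pairReflect]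
  rw [pairReflect_castAdd, pairReflect_natAdd, he, hsgn, neg_smul, neg_smul, neg_add_cancel, neg_add_cancel]

lemma size10_pairReflect_le (h0 : slotConj (Fin.castAdd 5 m₀) = false) (κ : Fin 10 → Freq) :
    size10 (pairReflect m₀ m₁ κ) ≤ size10 κ := by
  have hneg : ∀ k, nsqInt (-k) = nsqInt k := fun k => by simp [nsqInt]
  rw [size10, kOne_pairReflect h0, hneg]
  refine max_le (le_size10 κ _) (Finset.sup_le fun m _ => ?_)
  rw [pairReflect]
  split_ifs
  · rw [hneg]; exact le_max_left _ _
  · exact le_size10 κ m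

lemma pairReflect_mem (hp : slotConj (Fin.castAdd 5 m₀) ≠ slotConj (Fin.natAdd 5 m₁))
    (h0 : slotConj (Fin.castAdd 5 m₀) = false) {κ : Fin 10 → Freq}
    (hκ : κ ∈ mixedSet j m₀ m₁) : pairReflect m₀ m₁ κ ∈ mixedSet j m₀ m₁ := by
  obtain ⟨hT, hlow, he⟩ := mem_mixedSet.1 hκ
  obtain ⟨ha, hj⟩ := (mem_shell le_size10).1 hT
  refine mem_mixedSet.2 ⟨(mem_shell le_size10).2 ⟨?_, ?_⟩, ?_, ?_⟩
  · rw [altSum_pairReflect hp he, ha]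
  · have h1 := size10_pairReflect_le (m₁ := m₁) h0 κ
    have h2 := size10_pairReflect_le (m₁ := m₁) h0 (pairReflect m₀ m₁ κ)
    rw [pairReflect_pairReflect h0 he] at h2
    rw [le_antisymm h1 h2, hj]
  · rwa [← lowBr_lowPart, lowPart_pairReflect, lowBr_lowPart]
  · simp [pairReflect]

lemma lowSix_pairReflect (f : Freq → ℝ) (κ : Fin 10 → Freq) :
    lowSix f m₁ (pairReflect m₀ m₁ κ) = lowSix f m₁ κ := by
  refine sum_congr rfl fun m hm => ?_
  rw [mem_lowSlots] at hm
  obtain ⟨m', rfl⟩ := Fin.exists_succ_eq.2 hm.1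
  have h1 : toSix (pairReflect m₀ m₁ κ) (Fin.succ m') = toSix κ (Fin.succ m') := by
    change pairReflect m₀ m₁ κ (Fin.natAdd 5 m') = κ (Fin.natAdd 5 m')
    refine pairReflect_low (castAdd_ne_natAdd _ _).symm (natAdd_inj_ne fun h => hm.2 ?_)
    rw [h]
  rw [h1]

lemma topSix_pairReflect (h0 : slotConj (Fin.castAdd 5 m₀) = false)
    (h1 : (-1 : ℝ) ^ ((Fin.succ m₁ : Fin 6) : ℕ) = -1) {f : Freq → ℝ} (hf : ∀ k, f (-k) = f k)
    {κ : Fin 10 → Freq} (he : κ (Fin.castAdd 5 m₀) = κ (Fin.natAdd 5 m₁)) :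
    topSix f m₁ (pairReflect m₀ m₁ κ) = -topSix f m₁ κ := by
  rw [topSix, topSix, h1, kOne_pairReflect h0, pairReflect_natAdd, hf, hf, he]
  ring

lemma lamTop_pairReflect (h0 : slotConj (Fin.castAdd 5 m₀) = false)
    {κ : Fin 10 → Freq} (he : κ (Fin.castAdd 5 m₀) = κ (Fin.natAdd 5 m₁)) :
    lamTop m₁ (pairReflect m₀ m₁ κ) = lamTop m₁ κ := by
  rw [lamTop, lamTop, kOne_pairReflect h0, pairReflect_natAdd, nsq_neg, nsq_neg, he, add_comm]

lemma lam_pairReflect (h0 : slotConj (Fin.castAdd 5 m₀) = false)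
    {κ : Fin 10 → Freq} (he : κ (Fin.castAdd 5 m₀) = κ (Fin.natAdd 5 m₁)) :
    lam (toSix (pairReflect m₀ m₁ κ)) = lam (toSix κ) := by
  have h : lam (toSix (pairReflect m₀ m₁ κ)) ^ 2 = lam (toSix κ) ^ 2 := by
    rw [lam_sq_split m₁, lam_sq_split m₁ κ, lamTop_pairReflect h0 he]
    congr 1
    refine sum_congr rfl fun m hm => ?_
    rw [mem_lowSlots] at hm
    obtain ⟨m', rfl⟩ := Fin.exists_succ_eq.2 hm.1
    change nsq (pairReflect m₀ m₁ κ (Fin.natAdd 5 m')) = nsq (κ (Fin.natAdd 5 m'))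
    rw [pairReflect_low (castAdd_ne_natAdd _ _).symm (natAdd_inj_ne fun h => hm.2 (by rw [h]))]
  exact (sq_eq_sq₀ (lam_nonneg _) (lam_nonneg _)).1 h

lemma tenCut_pairReflect (hχ : IsFreqCutoff χ) (h0 : slotConj (Fin.castAdd 5 m₀) = false) (N : ℕ∞)
    {κ : Fin 10 → Freq} (he : κ (Fin.castAdd 5 m₀) = κ (Fin.natAdd 5 m₁)) :
    tenCut χ N (pairReflect m₀ m₁ κ) = tenCut χ N κ := by
  have hne := castAdd_ne_natAdd m₀ m₁
  rw [tenCut, tenCut, kOne_pairReflect h0, prod_eq_pair_mul_low hne,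
    prod_eq_pair_mul_low hne (fun m => cut χ N (κ m)), pairReflect_castAdd,
    pairReflect_natAdd, hχ.cut_neg, hχ.cut_neg, ← he]
  have : ∏ m ∈ lowSlots (Fin.castAdd 5 m₀) (Fin.natAdd 5 m₁), cut χ N (pairReflect m₀ m₁ κ m)
      = ∏ m ∈ lowSlots (Fin.castAdd 5 m₀) (Fin.natAdd 5 m₁), cut χ N (κ m) :=
    prod_congr rfl fun m hm => by
      rw [mem_lowSlots] at hm; rw [pairReflect_low hm.1 hm.2]
  rw [this]; ring

/-- In the case of opposite slots with the same sign in the resonant function, the phase is large. -/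
lemma abs_pairGap_le_of_odd (hη : IsBump η) (hC : ∀ N k, |cut χ N k| ≤ Cχ) (hs : 2 ≤ s)
    (hδ : 0 ≤ δ) (hδ1 : δ ≤ 1) (h1 : (-1 : ℝ) ^ ((Fin.succ m₁ : Fin 6) : ℕ) = 1) {N : ℕ∞}
    {M l : ℝ} {κ : Fin 10 → Freq} (h : MixedFacts s m₀ m₁ M l κ) :
    |pairGap χ η s δ N m₀ m₁ κ| ≤ 14400 * Cχ ^ 12 * wtConst s *
      (112 * s * 9 ^ (s - 1) + 216 * 9 ^ (s - 2)) * ((M ^ 4)⁻¹ * (M ^ δ * l ^ 4)) := by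
  have hM0 : 0 < M := by linarith [h.M_gt]
  have hP : 0 < M ^ (2 * s) := rpow_pos_of_pos hM0 _
  have hC0 : 0 ≤ Cχ := (abs_nonneg _).trans (hC N 0)
  have hW := wtConst_pos s
  set K := 112 * s * 9 ^ (s - 1) + 216 * 9 ^ (s - 2) with hK
  have hK0 : 0 ≤ K := by positivity
  have hy : M ^ 2 / 7200 ≤ |topSix nsq m₁ κ| := by
    refine le_trans ?_ (le_abs_self _)
    rw [topSix, h1, one_mul]
    linarith [h.nsq_ge, nsq_nonneg (kOne κ)]
  have hg : |gapMul η s δ m₁ κ| ≤ 7200 * K * (M ^ (2 * s) * (M ^ 4)⁻¹) * (M ^ δ * l ^ 4) := by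
    have h2 := h.mul_gapMul_le hη hs hδ hδ1
    rw [← hK] at h2
    have h3 : M ^ 2 / 7200 * |gapMul η s δ m₁ κ|
        ≤ K * (M ^ (2 * s) * (M ^ 2)⁻¹) * (M ^ δ * l ^ 4) :=
      le_trans (mul_le_mul_of_nonneg_right hy (abs_nonneg _)) h2
    have e : |gapMul η s δ m₁ κ|
        = 7200 * (M ^ 2)⁻¹ * (M ^ 2 / 7200 * |gapMul η s δ m₁ κ|) := by field_simp
    rw [e]
    calc _ ≤ 7200 * (M ^ 2)⁻¹ * (K * (M ^ (2 * s) * (M ^ 2)⁻¹) * (M ^ δ * l ^ 4)) := by gcongr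
      _ = _ := by field_simp
  rw [pairGap, abs_mul, abs_mul, abs_mul, abs_two, abs_of_pos (wt_pos _ _)]
  have := wt_pos s (κ (Fin.castAdd 5 m₀))
  have hl := h.one_le_l
  calc _ ≤ 2 * Cχ ^ 12 * (wtConst s * (M ^ (2 * s))⁻¹) *
        (7200 * K * (M ^ (2 * s) * (M ^ 4)⁻¹) * (M ^ δ * l ^ 4)) := by
        gcongr
        · exact abs_tenCut_le' hC N κ
        · exact h.wt_le
    _ = _ := by field_simp; ring

/-- The decaying weight attached to an integer value of the resonant function. -/
def phaseWeight (j : ℤ) : ℝ := if j = 0 then 0 else (1 + |(j : ℝ)|) ^ (-(3 / 2) : ℝ)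

lemma phaseWeight_nonneg (j : ℤ) : 0 ≤ phaseWeight j := by
  unfold phaseWeight; split_ifs <;> positivity

lemma summable_phaseWeight : Summable phaseWeight := by
  have h1 : Summable fun n : ℤ => |(n : ℝ)| ^ (-(3 / 2) : ℝ) :=
    Real.summable_abs_int_rpow (by norm_num)
  refine Summable.of_nonneg_of_le phaseWeight_nonneg (fun n => ?_) h1
  unfold phaseWeight
  split_ifs with h
  · positivity
  · have : 0 < |(n:ℝ)| := abs_pos.2 (by exact_mod_cast h)
    exact Real.rpow_le_rpow_of_nonpos this (by linarith) (by norm_num)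

set_option maxHeartbeats 1000000 in
lemma exists_sym_pairGap (hχ : IsFreqCutoff χ) (hη : IsBump η) (hC1 : 1 ≤ Cχ)
    (hC : ∀ N k, |cut χ N k| ≤ Cχ) (hs : 2 ≤ s) (hδ : 0 ≤ δ) (hδ1 : δ ≤ 1) :
    ∃ C, 0 ≤ C ∧ ∀ (m₀ m₁ : Fin 5) (N : ℕ∞) (M l : ℝ) (κ : Fin 10 → Freq) (y : ℤ),
      slotConj (Fin.castAdd 5 m₀) = false → (-1 : ℝ) ^ ((Fin.succ m₁ : Fin 6) : ℕ) = -1 →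
      κ (Fin.castAdd 5 m₀) = κ (Fin.natAdd 5 m₁) → topSix nsq m₁ κ = y →
      (∀ m, br (toSix κ m) ≤ 3 * M) →
      MixedFacts s m₀ m₁ M l κ → MixedFacts s m₀ m₁ M l (pairReflect m₀ m₁ κ) →
      |pairGap χ η s δ N m₀ m₁ κ + pairGap χ η s δ N m₀ m₁ (pairReflect m₀ m₁ κ)|
        ≤ C * ((M ^ 2)⁻¹ * (M ^ δ) ^ (-(1 / 2) : ℝ) * l ^ 5 * phaseWeight y
          + (M ^ 4)⁻¹ * (M ^ δ * l ^ 4)) := by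
  obtain ⟨K, hK0, hK⟩ := hη.exists_sym_diff_le
  have hW := wtConst_pos s
  set K₁ := s * 9 ^ (s - 1) with hK₁
  have hK₁0 : 0 ≤ K₁ := by positivity
  set K₂ : ℝ := 9 ^ (s - 2) with hK₂
  have hK₂0 : 0 ≤ K₂ := by positivity
  set C := 2 * Cχ ^ 12 * (wtConst s * (K₁ * K * 343 * 10 + K₁ * K * 43350 + 24 * K₂)
    + wtConst s ^ 2 * K₁ * (112 * K₁ + 216 * K₂)) with hCdef
  refine ⟨C, by positivity, fun m₀ m₁ N M l κ y h0 hsg he hy hB h h' => ?_⟩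
  have hM := h.M_gt
  have hM0 : 0 < M := by linarith
  have hl := h.one_le_l
  have hP : 0 < M ^ (2 * s) := rpow_pos_of_pos hM0 _
  have hD : 1 ≤ M ^ δ := one_le_rpow (by linarith) hδ
  set D := M ^ δ with hDdef
  obtain ⟨s1, s2, s3, s4, s5, s6⟩ := h.scales hδ hδ1
  have hτ1 : topSix nsq m₁ (pairReflect m₀ m₁ κ) = -topSix nsq m₁ κ :=
    topSix_pairReflect h0 hsg nsq_neg he
  have hτ2 : topSix (fun k => nsq k ^ s) m₁ (pairReflect m₀ m₁ κ)
      = -topSix (fun k => nsq k ^ s) m₁ κ :=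
    topSix_pairReflect h0 hsg (fun k => by rw [nsq_neg]) he
  have hτw : wt s (pairReflect m₀ m₁ κ (Fin.castAdd 5 m₀)) = wt s (kOne κ) := by
    rw [pairReflect_castAdd, wt, wt, nsq_neg]
  have hwa : wt s (kOne κ) ≤ wtConst s * (M ^ (2 * s))⁻¹ := by rw [← hτw]; exact h'.wt_le
  have hwq := h.wt_le
  set q := κ (Fin.castAdd 5 m₀) with hq
  have hwa0 := wt_pos s (kOne κ)
  have hwq0 := wt_pos s q
  set g := gapMul η s δ m₁ κ with hg
  set g' := gapMul η s δ m₁ (pairReflect m₀ m₁ κ) with hg'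
  have hsym : |g + g'| ≤ M ^ (2 * s) * ((K₁ * K * 343 * 10) *
      ((M ^ 2)⁻¹ * D ^ (-(1 / 2) : ℝ) * l ^ 5 * phaseWeight y)
      + (K₁ * K * 43350 + 24 * K₂) * ((M ^ 4)⁻¹ * (D * l ^ 4))) := by
    set Z := if y = 0 then 0 else K₁ * (M ^ (2 * s) * (M ^ 2)⁻¹) with hZ
    have hZ0 : 0 ≤ Z := by simp only [hZ]; split_ifs <;> positivity
    have hZle : Z ≤ K₁ * (M ^ (2 * s) * (M ^ 2)⁻¹) := by
      simp only [hZ]; split_ifs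
      · positivity
      · exact le_rfl
    have hψ : |topSix (fun k => nsq k ^ s) m₁ κ| ≤ Z * |topSix nsq m₁ κ| := by
      have := h.abs_ψ
      by_cases hy0 : y = 0
      · rw [hy, hy0] at this ⊢; simpa using this
      · simp only [hZ, if_neg hy0]; exact this
    have hb := hK _ _ (topSix nsq m₁ κ) (lowSix nsq m₁ κ) (topSix (fun k => nsq k ^ s) m₁ κ)
      (lowSix (fun k => nsq k ^ s) m₁ κ) Z s1 s2 s3 hZ0 hψ
    have e : g + g' = ((topSix (fun k => nsq k ^ s) m₁ κ + lowSix (fun k => nsq k ^ s) m₁ κ) *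
          cutInv η (lam (toSix κ) ^ δ) (topSix nsq m₁ κ + lowSix nsq m₁ κ)
        - topSix (fun k => nsq k ^ s) m₁ κ * cutInv η (lamTop m₁ κ ^ δ) (topSix nsq m₁ κ))
        + ((-topSix (fun k => nsq k ^ s) m₁ κ + lowSix (fun k => nsq k ^ s) m₁ κ) *
          cutInv η (lam (toSix κ) ^ δ) (-topSix nsq m₁ κ + lowSix nsq m₁ κ)
        - (-topSix (fun k => nsq k ^ s) m₁ κ) *
          cutInv η (lamTop m₁ κ ^ δ) (-topSix nsq m₁ κ)) := by
      rw [hg, hg', gapMul, gapMul, hτ1, hτ2, lowSix_pairReflect, lowSix_pairReflect,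
        lam_pairReflect h0 he, lamTop_pairReflect h0 he]
    rw [e]
    refine hb.trans ?_
    have c1 : (1 + |lowSix nsq m₁ κ|) ^ (5 / 2 : ℝ) ≤ 343 * l ^ 5 := by
      have hl2 : 1 ≤ l ^ 2 := one_le_pow₀ hl
      calc (1 + |lowSix nsq m₁ κ|) ^ (5 / 2 : ℝ) ≤ (7 * l ^ 2) ^ (5 / 2 : ℝ) := by
            gcongr; linarith [h.abs_c]
        _ = 7 ^ (5 / 2 : ℝ) * l ^ 5 := by
            rw [mul_rpow (by norm_num) (by positivity), ← rpow_natCast l 2,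
              ← rpow_mul (by linarith), ← rpow_natCast l 5]
            norm_num
        _ ≤ 7 ^ (3 : ℝ) * l ^ 5 := by gcongr <;> norm_num
        _ = _ := by norm_num
    have c2 : (lam (toSix κ) ^ δ) ^ (-(1 / 2) : ℝ) ≤ 10 * D ^ (-(1 / 2) : ℝ) := by
      calc (lam (toSix κ) ^ δ) ^ (-(1 / 2) : ℝ) ≤ (D / 85) ^ (-(1 / 2) : ℝ) :=
            Real.rpow_le_rpow_of_nonpos (by positivity) s5 (by norm_num)
        _ = 85 ^ (1 / 2 : ℝ) * D ^ (-(1 / 2) : ℝ) := by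
            rw [div_rpow (by linarith) (by norm_num), rpow_neg (x := 85) (by norm_num),
              div_inv_eq_mul, mul_comm]
        _ ≤ 10 * D ^ (-(1 / 2) : ℝ) := by
            gcongr
            rw [← sqrt_eq_rpow]
            rw [sqrt_le_left (by norm_num)]; norm_num
    have c3 : 4 * |lowSix (fun k => nsq k ^ s) m₁ κ|
        ≤ M ^ (2 * s) * (24 * K₂ * ((M ^ 4)⁻¹ * (D * l ^ 4))) := by
      calc _ ≤ 4 * (6 * 9 ^ (s - 2) * (M ^ (2 * s) * (M ^ 4)⁻¹) * l ^ 4) := by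
            gcongr; exact h.abs_d
        _ = M ^ (2 * s) * (24 * K₂ * ((M ^ 4)⁻¹ * (1 * l ^ 4))) := by rw [hK₂]; ring
        _ ≤ _ := by gcongr
    have c4 : Z * (1 + |topSix nsq m₁ κ|) ^ (-(3 / 2) : ℝ)
        ≤ K₁ * (M ^ (2 * s) * (M ^ 2)⁻¹) * phaseWeight y := by
      by_cases hy0 : y = 0
      · simp only [hZ, if_pos hy0, phaseWeight, zero_mul, mul_zero]; exact le_rfl
      · simp only [hZ, if_neg hy0, phaseWeight]; rw [hy]
    have c5 : l ^ 2 ≤ D * l ^ 4 := by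
      calc l ^ 2 ≤ l ^ 4 := pow_le_pow_right₀ hl (by norm_num)
        _ ≤ D * l ^ 4 := le_mul_of_one_le_left (by positivity) hD
    have hpw := phaseWeight_nonneg y
    calc _ = K * ((1 + |lowSix nsq m₁ κ|) ^ (5 / 2 : ℝ) *
          (lam (toSix κ) ^ δ) ^ (-(1 / 2) : ℝ)) * (Z * (1 + |topSix nsq m₁ κ|) ^ (-(3 / 2) : ℝ))
          + Z * (K * ((lam (toSix κ) ^ δ - lamTop m₁ κ ^ δ) / lamTop m₁ κ ^ δ))
          + 4 * |lowSix (fun k => nsq k ^ s) m₁ κ| := by ring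
      _ ≤ K * ((343 * l ^ 5) * (10 * D ^ (-(1 / 2) : ℝ))) *
            (K₁ * (M ^ (2 * s) * (M ^ 2)⁻¹) * phaseWeight y)
          + K₁ * (M ^ (2 * s) * (M ^ 2)⁻¹) * (K * (43350 * (D * l ^ 4) * (M ^ 2)⁻¹))
          + M ^ (2 * s) * (24 * K₂ * ((M ^ 4)⁻¹ * (D * l ^ 4))) := by
          have s7 : 0 ≤ (lam (toSix κ) ^ δ - lamTop m₁ κ ^ δ) / lamTop m₁ κ ^ δ :=
            div_nonneg (by linarith) s2.le
          gcongr
          exact s6.trans (by gcongr)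
      _ = _ := by field_simp; ring
  have hdiff : |wt s (kOne κ) - wt s q| * |g'| ≤
      wtConst s ^ 2 * K₁ * (112 * K₁ + 216 * K₂) * ((M ^ 4)⁻¹ * (D * l ^ 4)) := by
    have hk0 : nsq (kOne κ) ≤ 9 * M ^ 2 := (nsq_le_of_br_le (hB 0)).trans (le_of_eq (by ring))
    have hk1 : nsq q ≤ 9 * M ^ 2 := by
      rw [he]; exact (nsq_le_of_br_le (hB (Fin.succ m₁))).trans (le_of_eq (by ring))
    have b1 := abs_wt_sub_le (s := s) (by linarith) hk0 hk1
    rw [nine_mul_sq_rpow_sub_one hM0] at b1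
    have ey : nsq (kOne κ) - nsq q = topSix nsq m₁ κ := by rw [topSix, hsg, ← he]; ring
    rw [ey] at b1
    have b2 := h'.mul_gapMul_le hη hs hδ hδ1
    rw [hτ1, abs_neg, ← hg'] at b2
    calc _ ≤ (s * (9 ^ (s - 1) * (M ^ (2 * s) * (M ^ 2)⁻¹)) * |topSix nsq m₁ κ| *
          ((wtConst s * (M ^ (2 * s))⁻¹) * (wtConst s * (M ^ (2 * s))⁻¹))) * |g'| := by
          refine mul_le_mul_of_nonneg_right (b1.trans ?_) (abs_nonneg _)
          gcongr
      _ = K₁ * (M ^ (2 * s) * (M ^ 2)⁻¹) * (wtConst s * (M ^ (2 * s))⁻¹) ^ 2 *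
          (|topSix nsq m₁ κ| * |g'|) := by rw [hK₁]; ring
      _ ≤ K₁ * (M ^ (2 * s) * (M ^ 2)⁻¹) * (wtConst s * (M ^ (2 * s))⁻¹) ^ 2 *
          ((112 * s * 9 ^ (s - 1) + 216 * 9 ^ (s - 2)) *
            (M ^ (2 * s) * (M ^ 2)⁻¹) * (M ^ δ * l ^ 4)) := by gcongr
      _ = _ := by rw [hK₁, hK₂, hDdef]; field_simp
  have hsum : pairGap χ η s δ N m₀ m₁ κ + pairGap χ η s δ N m₀ m₁ (pairReflect m₀ m₁ κ)
      = 2 * tenCut χ N κ * (wt s q * (g + g') + (wt s (kOne κ) - wt s q) * g') := by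
    rw [pairGap, pairGap, tenCut_pairReflect hχ h0 N he, hτw]; ring
  rw [hsum, abs_mul, abs_mul, abs_two]
  set U := (M ^ 2)⁻¹ * D ^ (-(1 / 2) : ℝ) * l ^ 5 * phaseWeight y with hU
  set V := (M ^ 4)⁻¹ * (D * l ^ 4) with hV
  have hU0 : 0 ≤ U := by have := phaseWeight_nonneg y; positivity
  have hV0 : 0 ≤ V := by positivity
  have hin : |wt s q * (g + g') + (wt s (kOne κ) - wt s q) * g'|
      ≤ wtConst s * ((K₁ * K * 343 * 10) * U + (K₁ * K * 43350 + 24 * K₂) * V)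
        + wtConst s ^ 2 * K₁ * (112 * K₁ + 216 * K₂) * V := by
    refine (abs_add_le _ _).trans (add_le_add ?_ ?_)
    · rw [abs_mul, abs_of_pos hwq0]
      calc _ ≤ (wtConst s * (M ^ (2 * s))⁻¹) * (M ^ (2 * s) *
            ((K₁ * K * 343 * 10) * U + (K₁ * K * 43350 + 24 * K₂) * V)) := by gcongr
        _ = _ := by field_simp
    · rw [abs_mul]; exact hdiff
  have hx := abs_tenCut_le' hC N κ
  calc _ ≤ 2 * Cχ ^ 12 * (wtConst s * ((K₁ * K * 343 * 10) * U + (K₁ * K * 43350 + 24 * K₂) * V)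
        + wtConst s ^ 2 * K₁ * (112 * K₁ + 216 * K₂) * V) := by gcongr
    _ ≤ 2 * Cχ ^ 12 * (wtConst s * ((K₁ * K * 343 * 10 + K₁ * K * 43350 + 24 * K₂) * (U + V))
        + wtConst s ^ 2 * K₁ * (112 * K₁ + 216 * K₂) * (U + V)) := by
        have a1 : 0 ≤ K₁ * K := by positivity
        have : (K₁ * K * 343 * 10) * U + (K₁ * K * 43350 + 24 * K₂) * V
            ≤ (K₁ * K * 343 * 10 + K₁ * K * 43350 + 24 * K₂) * (U + V) := by
          nlinarith [mul_nonneg a1 hU0, mul_nonneg a1 hV0, mul_nonneg hK₂0 hU0,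
            mul_nonneg hK₂0 hV0]
        gcongr
        linarith
    _ = _ := by rw [hCdef]; ring

end fibers

end

section

section ten

variable {s δ Cχ : ℝ}

lemma inv_mul_rpow_le {M : ℝ} (hM : 1 ≤ M) (hδ : 0 ≤ δ) :
    M⁻¹ * M ^ δ ≤ M ^ (-((2 - 3 * δ) / 2)) := by
  rw [← rpow_neg_one, ← rpow_add (by linarith)]
  exact rpow_le_rpow_of_exponent_le hM (by linarith)

lemma rpow_rpow_neg_half_le {M : ℝ} (hM : 1 ≤ M) (hδ : 1 / 2 ≤ δ) :
    (M ^ δ) ^ (-(1 / 2) : ℝ) ≤ M ^ (-((2 - 3 * δ) / 2)) := by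
  rw [← rpow_mul (by linarith)]
  exact rpow_le_rpow_of_exponent_le hM (by linarith)

lemma topSix_nsq_eq_intCast {m₀ m₁ : Fin 5} (h0 : slotConj (Fin.castAdd 5 m₀) = false)
    (h1 : (-1 : ℝ) ^ ((Fin.succ m₁ : Fin 6) : ℕ) = -1) {κ v : Fin 10 → Freq}
    (he : κ (Fin.castAdd 5 m₀) = κ (Fin.natAdd 5 m₁))
    (hv : lowPart (Fin.castAdd 5 m₀) (Fin.natAdd 5 m₁) κ = v) :
    topSix nsq m₁ κ
      = ((2 * dotInt (κ (Fin.castAdd 5 m₀)) (kOne v) + nsqInt (kOne v) : ℤ) : ℝ) := by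
  rw [topSix, h1, kOne_eq_low_add (m₁ := m₁) h0, hv, add_comm (kOne v), nsq_eq_cast, nsqInt_add,
    ← he, nsq_eq_cast]
  push_cast
  ring

lemma exists_fiber_pairGap (hχ : IsFreqCutoff χ) (hη : IsBump η) (hC1 : 1 ≤ Cχ)
    (hC : ∀ N k, |cut χ N k| ≤ Cχ) (hs : 2 ≤ s) (hδ : 1 / 2 ≤ δ) (hδ1 : δ ≤ 1) :
    ∃ C, 0 ≤ C ∧ ∀ (m₀ m₁ : Fin 5) (j : ℕ) (N : ℕ∞) (v : Fin 10 → Freq),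
      slotConj (Fin.castAdd 5 m₀) ≠ slotConj (Fin.natAdd 5 m₁) →
      mixedSet j m₀ m₁
        ⊆ bigPair (shell size10 j) (2 ^ j) (Fin.castAdd 5 m₀) (Fin.natAdd 5 m₁) →
      open Classical in
      |∑ κ ∈ mixedSet j m₀ m₁ with lowPart (Fin.castAdd 5 m₀) (Fin.natAdd 5 m₁) κ = v,
        pairGap χ η s δ N m₀ m₁ κ|
        ≤ C * ((2:ℝ) ^ j) ^ (-((2 - 3 * δ) / 2)) *
          lowBr (Fin.castAdd 5 m₀) (Fin.natAdd 5 m₁) v ^ 5 := by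
  classical
  obtain ⟨C, hC0, hCs⟩ := exists_sym_pairGap hχ hη hC1 hC hs (by linarith) hδ1
  have hW := wtConst_pos s
  set C' := 14400 * Cχ ^ 12 * wtConst s * (112 * s * 9 ^ (s - 1) + 216 * 9 ^ (s - 2)) with hC'
  have hC'0 : 0 ≤ C' := by positivity
  set S := ∑' j, phaseWeight j with hS
  have hS0 : 0 ≤ S := tsum_nonneg phaseWeight_nonneg
  refine ⟨343 * C' + 49 * C * S + 343 * C, by positivity, fun m₀ m₁ j N v hp hsub => ?_⟩
  set i : Fin 10 := Fin.castAdd 5 m₀ with hi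
  set i' : Fin 10 := Fin.natAdd 5 m₁ with hi'
  have hne : i ≠ i' := castAdd_ne_natAdd m₀ m₁
  set M : ℝ := 2 ^ j with hM
  have hM1 : 1 ≤ M := one_le_pow₀ (by norm_num)
  have hM0 : 0 < M := by linarith
  set l := lowBr i i' v with hl
  have hl1 : 1 ≤ l := one_le_lowBr _ _ _
  have hD : 0 < M ^ δ := rpow_pos_of_pos hM0 _
  set E := M ^ (-((2 - 3 * δ) / 2)) with hE
  have hE0 : 0 < E := rpow_pos_of_pos hM0 _
  have hsh : ∀ κ ∈ mixedSet j m₀ m₁, κ ∈ shell size10 j := fun κ hκ => (mem_mixedSet.1 hκ).1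
  have hfacts : ∀ κ ∈ mixedSet j m₀ m₁, lowPart i i' κ = v → MixedFacts s m₀ m₁ M l κ := by
    intro κ hκ hv
    have h := mixedFacts hs hκ (mem_bigPair.1 (hsub hκ)).2.1
    rwa [← lowBr_lowPart, hv] at h
  have hcount : ∀ b : ℝ, 0 ≤ b → ∀ g : (Fin 10 → Freq) → ℝ,
      (∀ κ ∈ mixedSet j m₀ m₁, lowPart i i' κ = v → g κ ≤ b * ((M ^ 4)⁻¹ * (M ^ δ * l ^ 4))) →
      ∑ κ ∈ mixedSet j m₀ m₁ with lowPart i i' κ = v, g κ ≤ 343 * b * E * l ^ 5 := by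
    intro b hb g hg
    refine (sum_fiber_le hne hM1 (fun κ hκ => (isShell_ten j).altSum_eq κ (hsh κ hκ))
      (fun κ hκ => (isShell_ten j).br_le κ (hsh κ hκ) i) v (by positivity) hg).trans ?_
    have h1 := inv_mul_rpow_le (δ := δ) hM1 (by linarith)
    calc 343 * M ^ 3 * (b * ((M ^ 4)⁻¹ * (M ^ δ * l ^ 4)))
        = 343 * b * (M⁻¹ * M ^ δ) * l ^ 4 := by field_simp
      _ ≤ 343 * b * E * l ^ 5 := by gcongr; norm_num
  have hsgn := neg_one_pow_eq_of_slotConj' (Fin.succ m₁)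
  rw [slotConj_natAdd] at hp
  by_cases h0 : slotConj i = false
  · have h1 : slotConj (Fin.succ m₁) = true := by
      rw [h0] at hp
      revert hp; cases slotConj (Fin.succ m₁) <;> simp
    rw [h1, if_pos rfl] at hsgn
    have hp' : slotConj (Fin.castAdd 5 m₀) ≠ slotConj (Fin.natAdd 5 m₁) := by
      rw [slotConj_natAdd]; exact hp
    have hmem : ∀ κ ∈ mixedSet j m₀ m₁, pairReflect m₀ m₁ κ ∈ mixedSet j m₀ m₁ :=
      fun κ hκ => pairReflect_mem hp' h0 hκ
    have hlow : ∀ κ, lowPart i i' (pairReflect m₀ m₁ κ) = lowPart i i' κ :=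
      fun κ => lowPart_pairReflect κ
    have hinv : ∀ κ ∈ mixedSet j m₀ m₁, pairReflect m₀ m₁ (pairReflect m₀ m₁ κ) = κ :=
      fun κ hκ => pairReflect_pairReflect h0 (mem_mixedSet.1 hκ).2.2
    set A := (mixedSet j m₀ m₁).filter (fun κ => lowPart i i' κ = v) with hA
    have hsym : ∑ κ ∈ A, pairGap χ η s δ N m₀ m₁ (pairReflect m₀ m₁ κ)
        = ∑ κ ∈ A, pairGap χ η s δ N m₀ m₁ κ := by
      refine sum_nbij' (pairReflect m₀ m₁) (pairReflect m₀ m₁) (fun κ hκ => ?_)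
        (fun κ hκ => ?_) (fun κ hκ => hinv κ (mem_filter.1 hκ).1)
        (fun κ hκ => hinv κ (mem_filter.1 hκ).1) fun κ _ => rfl
      all_goals
        rw [hA, mem_filter] at hκ ⊢
        exact ⟨hmem κ hκ.1, (hlow κ).trans hκ.2⟩
    have habs : |∑ κ ∈ A, pairGap χ η s δ N m₀ m₁ κ| ≤
        ∑ κ ∈ A, |pairGap χ η s δ N m₀ m₁ κ + pairGap χ η s δ N m₀ m₁ (pairReflect m₀ m₁ κ)| := by
      have e : 2 * ∑ κ ∈ A, pairGap χ η s δ N m₀ m₁ κ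
          = ∑ κ ∈ A, (pairGap χ η s δ N m₀ m₁ κ + pairGap χ η s δ N m₀ m₁ (pairReflect m₀ m₁ κ)) := by
        rw [sum_add_distrib, hsym]; ring
      have h3 := abs_sum_le_sum_abs
        (fun κ => pairGap χ η s δ N m₀ m₁ κ + pairGap χ η s δ N m₀ m₁ (pairReflect m₀ m₁ κ)) A
      rw [← e, abs_mul, abs_two] at h3
      linarith [abs_nonneg (∑ κ ∈ A, pairGap χ η s δ N m₀ m₁ κ)]
    refine habs.trans ?_
    have hterm : ∀ κ ∈ A,
        |pairGap χ η s δ N m₀ m₁ κ + pairGap χ η s δ N m₀ m₁ (pairReflect m₀ m₁ κ)|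
        ≤ C * ((M ^ 2)⁻¹ * (M ^ δ) ^ (-(1 / 2) : ℝ) * l ^ 5) *
            phaseWeight (2 * dotInt (κ i) (kOne v) + nsqInt (kOne v))
          + C * ((M ^ 4)⁻¹ * (M ^ δ * l ^ 4)) := by
      intro κ hκ
      rw [hA, mem_filter] at hκ
      have he := (mem_mixedSet.1 hκ.1).2.2
      refine (hCs m₀ m₁ N M l κ _ h0 hsgn he (topSix_nsq_eq_intCast h0 hsgn he hκ.2)
        (br_toSix_le (hsh κ hκ.1)) (hfacts κ hκ.1 hκ.2)
        (hfacts _ (hmem κ hκ.1) ((hlow κ).trans hκ.2))).trans (le_of_eq (by ring))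
    refine (sum_le_sum hterm).trans ?_
    rw [sum_add_distrib]
    have t2 : ∑ _κ ∈ A, C * ((M ^ 4)⁻¹ * (M ^ δ * l ^ 4)) ≤ 343 * C * E * l ^ 5 :=
      hcount C hC0 _ fun κ _ _ => le_rfl
    have t1 : ∑ κ ∈ A, C * ((M ^ 2)⁻¹ * (M ^ δ) ^ (-(1 / 2) : ℝ) * l ^ 5) *
            phaseWeight (2 * dotInt (κ i) (kOne v) + nsqInt (kOne v)) ≤ 49 * C * S * E * l ^ 5 := by
      rw [← mul_sum]
      by_cases hk : kOne v = 0
      · have : ∀ κ ∈ A, phaseWeight (2 * dotInt (κ i) (kOne v) + nsqInt (kOne v)) = 0 := by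
          intro κ _
          rw [hk]; simp [phaseWeight, dotInt, nsqInt]
        rw [sum_eq_zero this, mul_zero]
        positivity
      · have h3 := sum_fiber_dotInt_le hne hM1 (T := mixedSet j m₀ m₁)
          (fun κ hκ => (isShell_ten j).altSum_eq κ (hsh κ hκ))
          (fun κ hκ => (isShell_ten j).br_le κ (hsh κ hκ) i) v hk (nsqInt (kOne v))
          phaseWeight_nonneg summable_phaseWeight
        have h4 := rpow_rpow_neg_half_le hM1 hδ
        calc _ ≤ C * ((M ^ 2)⁻¹ * (M ^ δ) ^ (-(1 / 2) : ℝ) * l ^ 5) * (49 * M ^ 2 * S) := by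
              gcongr
          _ = 49 * C * S * (M ^ δ) ^ (-(1 / 2) : ℝ) * l ^ 5 := by field_simp
          _ ≤ _ := by gcongr
    calc _ ≤ 49 * C * S * E * l ^ 5 + 343 * C * E * l ^ 5 := add_le_add t1 t2
      _ ≤ 343 * C' * E * l ^ 5 + (49 * C * S * E * l ^ 5 + 343 * C * E * l ^ 5) :=
          le_add_of_nonneg_left (by positivity)
      _ = _ := by ring
  · have h1 : slotConj (Fin.succ m₁) = false := by
      revert hp h0; cases slotConj (Fin.succ m₁) <;> cases slotConj i <;> simp
    rw [h1] at hsgn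
    simp only [Bool.false_eq_true, if_false] at hsgn
    refine (abs_sum_le_sum_abs _ _).trans ?_
    refine (hcount C' hC'0 _ fun κ hκ hv =>
      abs_pairGap_le_of_odd hη hC hs (by linarith) hδ1 hsgn (hfacts κ hκ hv)).trans ?_
    calc 343 * C' * E * l ^ 5 ≤ 343 * C' * E * l ^ 5 + (49 * C * S * E * l ^ 5 + 343 * C * E * l ^ 5) :=
          le_add_of_nonneg_right (by positivity)
      _ = _ := by ring

lemma exists_mixed_le (hχ : IsFreqCutoff χ) (hη : IsBump η) (hC1 : 1 ≤ Cχ)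
    (hC : ∀ N k, |cut χ N k| ≤ Cχ) (hs : 2 ≤ s) (hδ : 1 / 2 ≤ δ) (hδ1 : δ ≤ 1) :
    ∃ C, 0 ≤ C ∧ ∀ (m₀ m₁ : Fin 5) (j : ℕ) (N : ℕ∞) (σ R : ℝ) (u : Coeff), 8 < σ → 1 ≤ R →
      u ∈ sobBall σ R → slotConj (Fin.castAdd 5 m₀) ≠ slotConj (Fin.natAdd 5 m₁) →
      mixedSet j m₀ m₁
        ⊆ bigPair (shell size10 j) (2 ^ j) (Fin.castAdd 5 m₀) (Fin.natAdd 5 m₁) →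
      |(∑ κ ∈ mixedSet j m₀ m₁, ((tenMul χ η s δ N κ * (2 * wt s (κ (Fin.castAdd 5 m₀))) : ℝ) : ℂ) *
        lowMono (Fin.castAdd 5 m₀) (Fin.natAdd 5 m₁) u κ).im|
        ≤ R ^ 10 * brMass (σ - 5) ^ 10 * (C * ((2:ℝ) ^ j) ^ (-((2 - 3 * δ) / 2))) := by
  classical
  obtain ⟨C, hC0, hF⟩ := exists_fiber_pairGap hχ hη hC1 hC hs hδ hδ1
  refine ⟨C, hC0, fun m₀ m₁ j N σ R u hσ hR hu hp hsub => ?_⟩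
  have e : ∑ κ ∈ mixedSet j m₀ m₁,
      ((tenMul χ η s δ N κ * (2 * wt s (κ (Fin.castAdd 5 m₀))) : ℝ) : ℂ) *
        lowMono (Fin.castAdd 5 m₀) (Fin.natAdd 5 m₁) u κ
      = ∑ κ ∈ mixedSet j m₀ m₁, (pairGap χ η s δ N m₀ m₁ κ : ℂ) *
          lowMono (Fin.castAdd 5 m₀) (Fin.natAdd 5 m₁) u κ
        + ∑ κ ∈ mixedSet j m₀ m₁, (pairRef χ η s δ N m₀ m₁ κ : ℂ) *
          lowMono (Fin.castAdd 5 m₀) (Fin.natAdd 5 m₁) u κ := by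
    rw [← sum_add_distrib]
    refine sum_congr rfl fun κ _ => ?_
    rw [← add_mul, ← Complex.ofReal_add]
    congr 2
    rw [tenMul_eq_gapMul χ η s δ N m₁, pairGap, pairRef]; ring
  rw [e, add_im, im_sum_eq_zero_of_slotFlip hp (fun κ hκ => pairRef_slotFlip hp N hκ),
    add_zero]
  refine (abs_im_le_norm _).trans ?_
  refine norm_sum_lowMono_le (A := 5) (by linarith) hR (by positivity) _ _ (fun v => ?_) hu
  rw [rpow_five, ← ofReal_sum, norm_real, norm_eq_abs]
  exact hF m₀ m₁ j N v hp hsub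

theorem ten_moment (hχ : IsFreqCutoff χ) (hη : IsBump η) (hC1 : 1 ≤ Cχ)
    (hC : ∀ N k, |cut χ N k| ≤ Cχ) (hs : 2 ≤ s) (hδ : 1 / 2 < δ) (hδ1 : δ < 2 / 3) :
    ∃ C, 0 ≤ C ∧ ∀ (j : ℕ) (N : ℕ∞) (σ R p : ℝ), 8 < σ → 1 ≤ R → 2 ≤ p →
      eLpNorm ((sobBall σ R).indicator fun u => (formSum (shell size10 j) (tenMul χ η s δ N) u).im)
        (ofReal p) (gaussianSob s)
        ≤ ofReal (C * (R ^ 10 * brMass (σ - 5) ^ 10) *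
          (p * ((2:ℝ) ^ j) ^ (-((2 - 3 * δ) / 2)))) := by
  classical
  have hW := wtConst_pos s
  obtain ⟨Cm, hCm0, hmix⟩ := exists_mixed_le hχ hη hC1 hC hs hδ.le (by linarith)
  set a₁ := 900 * s * 9 ^ (s - 1) * Cχ ^ 12 with ha1
  set a₂ := 15552 * 9 ^ (s - 2) * Cχ ^ 12 with ha2
  have h1 : 0 ≤ a₁ := by positivity
  have h2 : 0 ≤ a₂ := by positivity
  set θ := (2 - 3 * δ) / 2 with hθdef
  have hθ : θ ≤ 1 / 2 := by rw [hθdef]; linarith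
  set C₂ := 686 * a₂ * wtConst s + (Cm + 686 * (360000 * a₁) * wtConst s) with hC₂
  refine ⟨(10:ℕ) ^ 2 * (128 * (19 * a₁ * wtConst s) + C₂), by positivity,
    fun j N σ R p hσ hR hp => ?_⟩
  have hT := isShell_ten j
  have hM0 : (0:ℝ) < 2 ^ j := by positivity
  set M : ℝ := 2 ^ j with hM
  have hM1 : 1 ≤ M := hT.one_le
  have hP : 0 < M ^ (2 * s) := rpow_pos_of_pos hM0 _
  have hE0 : 0 < M ^ (-θ) := rpow_pos_of_pos hM0 _
  have hbm : 0 ≤ brMass (σ - 5) := tsum_nonneg fun k => (rpow_pos_of_pos (br_pos k) _).le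
  refine moment_of_bounds abs_im_le_norm measurable_im add_im hT hσ hR
    (C₂ := C₂) (by positivity) (by positivity) _ (fun i i' hii' v => ?_)
    (fun i i' hii' T' hT' hfull u hu => ?_) hp
  · refine hs_of_sq_decay hT (by linarith) hθ hii' h1 (fun κ hκ => ?_) v
    have hl := one_le_lowBr i i' κ
    refine (abs_tenMul_le hη hC hs (by linarith) (mem_bigPair.1 hκ).1 hii' N).trans ?_
    gcongr
    norm_num
  · by_cases hmixed : ∃ m₀ m₁ : Fin 5, i = Fin.castAdd 5 m₀ ∧ i' = Fin.natAdd 5 m₁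
    · obtain ⟨m₀, m₁, rfl, rfl⟩ := hmixed
      by_cases hpar : slotConj (Fin.castAdd 5 m₀) = slotConj (Fin.natAdd 5 m₁)
      · have : pairSum s T' (tenMul χ η s δ N) (Fin.castAdd 5 m₀) (Fin.natAdd 5 m₁) u = 0 := by
          refine sum_eq_zero fun κ _ => ?_
          rw [covTerm_eq_zero_of_same hpar, mul_zero, mul_zero]
        rw [this]; simp; positivity
      set T₁ := T'.filter fun κ => lowBr (Fin.castAdd 5 m₀) (Fin.natAdd 5 m₁) κ < M / 600 with hT₁
      set T₂ := T'.filter fun κ => ¬ lowBr (Fin.castAdd 5 m₀) (Fin.natAdd 5 m₁) κ < M / 600 with hT₂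
      have hsplit : pairSum s T' (tenMul χ η s δ N) (Fin.castAdd 5 m₀) (Fin.natAdd 5 m₁) u
          = pairSum s T₁ (tenMul χ η s δ N) (Fin.castAdd 5 m₀) (Fin.natAdd 5 m₁) u
          + pairSum s T₂ (tenMul χ η s δ N) (Fin.castAdd 5 m₀) (Fin.natAdd 5 m₁) u :=
        (Finset.sum_filter_add_sum_filter_not T' _ _).symm
      have hsubset : mixedSet j m₀ m₁ ⊆ T₁ := by
        intro κ hκ
        obtain ⟨ha, hb, -⟩ := mem_mixedSet.1 hκ
        exact mem_filter.2 ⟨hfull κ ha hb, hb⟩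
      have hsub : mixedSet j m₀ m₁
          ⊆ bigPair (shell size10 j) (2 ^ j) (Fin.castAdd 5 m₀) (Fin.natAdd 5 m₁) :=
        (hsubset.trans (Finset.filter_subset _ _)).trans hT'
      have e1 : pairSum s T₁ (tenMul χ η s δ N) (Fin.castAdd 5 m₀) (Fin.natAdd 5 m₁) u
          = ∑ κ ∈ mixedSet j m₀ m₁,
            ((tenMul χ η s δ N κ * (2 * wt s (κ (Fin.castAdd 5 m₀))) : ℝ) : ℂ) *
              lowMono (Fin.castAdd 5 m₀) (Fin.natAdd 5 m₁) u κ := by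
        rw [pairSum, ← Finset.sum_subset hsubset]
        · refine sum_congr rfl fun κ hκ => ?_
          have he := (mem_mixedSet.1 hκ).2.2
          rw [covTerm, if_pos he, pairMean, if_neg hpar]
          push_cast; ring
        · intro κ hκ hnot
          have hκ' := mem_filter.1 hκ
          have hne : κ (Fin.castAdd 5 m₀) ≠ κ (Fin.natAdd 5 m₁) := fun he =>
            hnot (mem_mixedSet.2 ⟨(mem_bigPair.1 (hT' hκ'.1)).1, hκ'.2, he⟩)
          rw [covTerm_eq_zero_of_ne hne, mul_zero, mul_zero]
      have b1 := hmix m₀ m₁ j N σ R u hσ hR hu hpar hsub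
      rw [← e1] at b1
      have b2 := pair_of_decay hT (s := s) (by linarith) (θ := θ) (by linarith) hii' hσ hR
        (T' := T₂) ((Finset.filter_subset _ _).trans hT') (a := 360000 * a₁)
        (c := tenMul χ η s δ N) (by positivity) (fun _ κ hκ _ => by
          have hκ' := mem_filter.1 hκ
          have hl := one_le_lowBr (Fin.castAdd 5 m₀) (Fin.natAdd 5 m₁) κ
          have hMl : M ≤ 600 * lowBr (Fin.castAdd 5 m₀) (Fin.natAdd 5 m₁) κ := by
            have := not_lt.1 hκ'.2
            linarith
          set l := lowBr (Fin.castAdd 5 m₀) (Fin.natAdd 5 m₁) κ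
          have h3 := abs_tenMul_le hη hC hs (by linarith : 0 ≤ δ)
            (mem_bigPair.1 (hT' hκ'.1)).1 hii' N
          refine h3.trans ?_
          calc a₁ * (M ^ (2 * s) * (M ^ 2)⁻¹) * l ^ 2
              = a₁ * (M ^ (2 * s) * (M ^ 4)⁻¹) * l ^ 2 * M ^ 2 := by field_simp
            _ ≤ a₁ * (M ^ (2 * s) * (M ^ 4)⁻¹) * l ^ 2 * (600 * l) ^ 2 := by gcongr
            _ = 360000 * a₁ * (M ^ (2 * s) * (M ^ 4)⁻¹) * l ^ 4 := by ring
            _ ≤ _ := by gcongr; norm_num) hu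
      rw [hsplit, add_im]
      calc _ ≤ R ^ 10 * brMass (σ - 5) ^ 10 * (Cm * M ^ (-θ))
            + R ^ 10 * brMass (σ - 5) ^ 10 * (686 * (360000 * a₁) * wtConst s * M ^ (-θ)) :=
            (abs_add_le _ _).trans (add_le_add b1 ((abs_im_le_norm _).trans b2))
        _ ≤ R ^ 10 * brMass (σ - 5) ^ 10 * (686 * a₂ * wtConst s * M ^ (-θ))
            + (R ^ 10 * brMass (σ - 5) ^ 10 * (Cm * M ^ (-θ))
            + R ^ 10 * brMass (σ - 5) ^ 10 * (686 * (360000 * a₁) * wtConst s * M ^ (-θ))) :=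
            le_add_of_nonneg_left (by positivity)
        _ = _ := by rw [hC₂]; ring
    · refine (abs_im_le_norm _).trans ?_
      refine (pair_of_decay hT (s := s) (by linarith) (θ := θ) (by linarith) hii' hσ hR hT' h2
        (fun hpar κ hκ he => ?_) hu).trans ?_
      · have hl := one_le_lowBr i i' κ
        refine (abs_tenMul_pair_le hη hC hs (by linarith) (mem_bigPair.1 (hT' hκ)).1 hii' hmixed
          hpar he N).trans ?_
        gcongr
        norm_num
      · gcongr
        rw [hC₂]
        exact le_add_of_nonneg_right (by positivity)

end ten

end

section

/-! ### Dyadic bounds for the pieces of the correction and of the energy rate -/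

variable {s σ θ K δ Cχ : ℝ}

lemma cut_top (k : Freq) : cut χ ⊤ k = 1 := if_pos rfl

lemma IsFreqCutoff.eventually_cut (hχ : IsFreqCutoff χ) (k : Freq) :
    ∀ᶠ N : ℕ in atTop, cut χ N k = 1 := by
  obtain ⟨N₀, hN₀⟩ := exists_nat_ge (2 * ∑ i, |(k i : ℝ)|)
  filter_upwards [eventually_ge_atTop (max N₀ 1)] with N hN
  have hN1 : (1 : ℝ) ≤ N := by exact_mod_cast (le_max_right _ _).trans hN
  have hN0 : (N₀ : ℝ) ≤ N := by exact_mod_cast (le_max_left _ _).trans hN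
  rw [cut, if_neg (by simp)]
  refine hχ.eq_one _ fun i => ?_
  have h1 : |(k i : ℝ)| ≤ ∑ i, |(k i : ℝ)| :=
    single_le_sum (f := fun i => |(k i : ℝ)|) (fun _ _ => abs_nonneg _) (Finset.mem_univ i)
  have h2 : (((N : ℕ∞).toNat : ℝ)⁻¹ • toEuclid k) i = (N : ℝ)⁻¹ * k i := by simp [toEuclid]
  rw [h2, abs_mul, abs_of_pos (by positivity), inv_mul_le_iff₀ (by positivity)]
  linarith

lemma DyadicBounds.add {C C' : ℝ → ℝ} {F F' : ℕ∞ → ℕ → Coeff → ℝ}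
    (h : DyadicBounds s σ θ K C F) (h' : DyadicBounds s σ θ K C' F') :
    DyadicBounds s σ θ K (fun R => C R + C' R) (fun N j u => F N j u + F' N j u) where
  meas N j := (h.meas N j).add (h'.meas N j)
  const_nonneg R hR := add_nonneg (h.const_nonneg R hR) (h'.const_nonneg R hR)
  moment R hR N hN j p hp := by
    have e : ((sobBall σ R).indicator fun u => F N j u + F' N j u)
        = (sobBall σ R).indicator (F N j) + (sobBall σ R).indicator (F' N j) :=
      indicator_add _ _ _
    have hb := measurableSet_sobBall σ R
    have hq : 0 ≤ p * 2 ^ (-(θ * j)) := by positivity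
    rw [e, add_mul, ofReal_add (mul_nonneg (h.const_nonneg R hR) hq)
      (mul_nonneg (h'.const_nonneg R hR) hq)]
    refine (eLpNorm_add_le ((h.meas N j).indicator hb).aestronglyMeasurable
      ((h'.meas N j).indicator hb).aestronglyMeasurable ?_).trans
      (add_le_add (h.moment R hR N hN j p hp) (h'.moment R hR N hN j p hp))
    exact ENNReal.one_le_ofReal.2 (by linarith)
  bound R hR N hN j u hu := by
    rw [add_mul]
    exact (abs_add_le _ _).trans (add_le_add (h.bound R hR N hN j u hu) (h'.bound R hR N hN j u hu))
  stable j := by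
    obtain ⟨a, ha⟩ := h.stable j
    obtain ⟨b, hb⟩ := h'.stable j
    refine ⟨max a b, fun N hN => ?_⟩
    rw [ha N (le_of_max_le_left hN), hb N (le_of_max_le_right hN)]

lemma dyadicBounds_form {n : ℕ} {size : (Fin n → Freq) → ℕ} {ρ : ℂ → ℝ} (hρ : ∀ z, |ρ z| ≤ ‖z‖)
    (hρm : Measurable ρ) (hshell : ∀ j, IsShell (shell size j) (2 ^ j))
    {c : ℕ∞ → (Fin n → Freq) → ℝ} {a b A B : ℝ} (hσ : 0 ≤ σ) (hb : 0 ≤ b) (hAB : 0 ≤ A * B)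
    (hK : 3 * n + a ≤ K) (hc : ∀ N j, ∀ κ ∈ shell size j, |c N κ| ≤ b * ((2:ℝ) ^ j) ^ a)
    (hmom : ∀ (j : ℕ) (N : ℕ∞) (R p : ℝ), 1 ≤ R → 2 ≤ p →
      eLpNorm ((sobBall σ R).indicator fun u => ρ (formSum (shell size j) (c N) u))
        (ofReal p) (gaussianSob s)
        ≤ ofReal (A * (R ^ n * B) * (p * ((2:ℝ) ^ j) ^ (-θ))))
    (hst : ∀ κ, ∀ᶠ N : ℕ in atTop, c N κ = c ⊤ κ) :
    DyadicBounds s σ θ K (fun R => (A * B + 343 ^ n * b) * R ^ n)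
      (fun N j u => ρ (formSum (shell size j) (c N) u)) where
  meas N j := hρm.comp (measurable_formSum _ _)
  const_nonneg R hR := by positivity
  moment R hR N hN j p hp := by
    refine (hmom j N R p hR hp).trans (ofReal_le_ofReal ?_)
    have e : ((2:ℝ) ^ j) ^ (-θ) = 2 ^ (-(θ * j)) := by
      rw [← Real.rpow_natCast_mul (by norm_num)]; congr 1; ring
    rw [e]
    refine mul_le_mul_of_nonneg_right ?_ (by positivity)
    have : 0 ≤ 343 ^ n * b * R ^ n := by positivity
    linarith
  bound R hR N hN j u hu := by
    refine (hρ _).trans (((hshell j).norm_formSum_le hσ (by linarith) (by positivity) (hc N j)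
      hu).trans ?_)
    have e : ((2:ℝ) ^ j) ^ (3 * n + a) ≤ 2 ^ (K * j) := by
      rw [← Real.rpow_natCast_mul (by norm_num), mul_comm]
      exact rpow_le_rpow_of_exponent_le (by norm_num) (by gcongr)
    have e2 : (((2:ℝ) ^ j) ^ 3) ^ n * ((2:ℝ) ^ j) ^ a = ((2:ℝ) ^ j) ^ (3 * n + a) := by
      rw [rpow_add (by positivity), ← pow_mul]
      congr 1
      rw [← rpow_natCast]; push_cast; rfl
    calc (343 * ((2:ℝ) ^ j) ^ 3) ^ n * (b * ((2:ℝ) ^ j) ^ a * R ^ n)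
        = (343 ^ n * b * R ^ n) * ((((2:ℝ) ^ j) ^ 3) ^ n * ((2:ℝ) ^ j) ^ a) := by
          rw [mul_pow]; ring
      _ ≤ ((A * B + 343 ^ n * b) * R ^ n) * 2 ^ (K * j) := by
          rw [e2]
          have : 0 ≤ R ^ n := by positivity
          gcongr
          linarith
  stable j := by
    have h : ∀ᶠ N : ℕ in atTop, ∀ κ ∈ shell size j, c N κ = c ⊤ κ := by
      rw [Filter.eventually_all_finset]; exact fun κ _ => hst κ
    obtain ⟨N₀, hN₀⟩ := eventually_atTop.1 h
    refine ⟨N₀, fun N hN => ?_⟩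
    funext u
    congr 1
    exact sum_congr rfl fun κ hκ => by rw [hN₀ N hN κ hκ]

lemma abs_psi_le_pow (hs : 2 ≤ s) {k : Fin 6 → Freq} {M : ℝ} (hM : 0 < M)
    (hB : ∀ m, br (k m) ≤ 3 * M) : |psi s k| ≤ 6 * 9 ^ (s - 2) * 81 * M ^ (2 * s) := by
  refine (abs_psi_le_all hs hM hB hB).trans (le_of_eq ?_)
  have : M ^ 4 ≠ 0 := by positivity
  field_simp
  ring

/-- The contribution of the shell `j` to the correction. -/
def corrPiece (χ : EuclideanSpace ℝ (Fin 3) → ℝ) (η : ℝ → ℝ) (s δ : ℝ) (N : ℕ∞) (j : ℕ)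
    (u : Coeff) : ℝ :=
  1 / 6 * (formSum (shell size6 j) (corrMul χ η s δ N) u).re

/-- The contribution of the shell `j` to the energy rate. -/
def ratePiece (χ : EuclideanSpace ℝ (Fin 3) → ℝ) (η : ℝ → ℝ) (s δ : ℝ) (N : ℕ∞) (j : ℕ)
    (u : Coeff) : ℝ :=
  -(1 / 6) * (formSum (shell size6 j) (resMul χ η s δ N) u).im +
    (formSum (shell size10 j) (tenMul χ η s δ N) u).im

lemma abs_mul_le_norm {c : ℝ} (hc : |c| ≤ 1) {x : ℝ} {z : ℂ} (h : |x| ≤ ‖z‖) : |c * x| ≤ ‖z‖ := by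
  rw [abs_mul]
  exact (mul_le_of_le_one_left (abs_nonneg _) hc).trans h

lemma eLpNorm_indicator_const_mul_le {c : ℝ} (hc : |c| ≤ 1) (B : Set Coeff) (f : Coeff → ℝ)
    (p : ℝ≥0∞) (μ : Measure Coeff) :
    eLpNorm (B.indicator fun u => c * f u) p μ ≤ eLpNorm (B.indicator f) p μ := by
  refine eLpNorm_mono fun u => ?_
  by_cases hu : u ∈ B
  · simp only [indicator_of_mem hu, norm_mul, norm_eq_abs]
    exact mul_le_of_le_one_left (abs_nonneg _) hc
  · simp [hu]

lemma brMass_nonneg (a : ℝ) : 0 ≤ brMass a :=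
  tsum_nonneg fun k => (rpow_pos_of_pos (br_pos k) _).le

theorem exists_dyadicBounds_corr (hχ : IsFreqCutoff χ) (hη : IsBump η) (hs : 2 ≤ s) (hδ : 0 ≤ δ)
    (hσ : 8 < σ) : ∃ C, DyadicBounds s σ (1 / 2) (30 + 2 * s) C (corrPiece χ η s δ) := by
  obtain ⟨Cχ, hC1, hC⟩ := hχ.exists_bound
  obtain ⟨A, hA, h⟩ := corr_moment hη hC1 hC hs hδ (le_refl (1 / 2 : ℝ))
  refine ⟨_, dyadicBounds_form (n := 6) (size := size6) (ρ := fun z => 1 / 6 * z.re)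
    (c := fun N => corrMul χ η s δ N) (a := 2 * s) (A := A) (B := brMass (σ - 5) ^ 6)
    (b := 2 * (6 * 9 ^ (s - 2) * 81) * Cχ ^ 6)
    (fun z => abs_mul_le_norm (by norm_num [abs_le]) (abs_re_le_norm z))
    (Complex.measurable_re.const_mul _) isShell_six (by linarith) (by positivity)
    (mul_nonneg hA (pow_nonneg (brMass_nonneg _) _)) (by norm_num) (fun N j κ hκ => ?_)
    (fun j N R p hR hp => (eLpNorm_indicator_const_mul_le (by norm_num [abs_le]) _ _ _ _).trans
      (h _ _ (isShell_six j) N σ R p hσ hR hp)) fun κ => ?_⟩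
  · rw [corrMul, abs_mul, abs_mul]
    have h1 := hη.abs_cutInv_lam_le hδ κ
    have h2 := abs_psi_le_pow hs (by positivity) ((isShell_six j).br_le κ hκ)
    have h3 := abs_prod_cut_le hC N κ
    calc _ ≤ 2 * (6 * 9 ^ (s - 2) * 81 * ((2:ℝ) ^ j) ^ (2 * s)) * Cχ ^ 6 := by gcongr
      _ = _ := by ring
  · have h1 : ∀ᶠ N : ℕ in atTop, ∀ m, cut χ N (κ m) = 1 :=
      eventually_all.2 fun m => hχ.eventually_cut (κ m)
    filter_upwards [h1] with N hN
    simp only [corrMul, cut_top, hN]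

theorem exists_dyadicBounds_rate (hχ : IsFreqCutoff χ) (hη : IsBump η) (hs : 2 ≤ s)
    (hδ : 1 / 2 < δ) (hδ1 : δ < 2 / 3) (hσ : 8 < σ) :
    ∃ C, DyadicBounds s σ ((2 - 3 * δ) / 2) (30 + 2 * s) C (ratePiece χ η s δ) := by
  obtain ⟨Cχ, hC1, hC⟩ := hχ.exists_bound
  obtain ⟨A, hA, h⟩ := res_moment hη hC1 hC hs hδ hδ1
  obtain ⟨A', hA', h'⟩ := ten_moment hχ hη hC1 hC hs hδ hδ1
  refine ⟨_, (dyadicBounds_form (n := 6) (size := size6) (ρ := fun z => -(1 / 6) * z.im)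
    (c := fun N => resMul χ η s δ N) (a := 2 * s) (A := A) (B := brMass (σ - 5) ^ 6)
    (b := (6 * 9 ^ (s - 2) * 81) * Cχ ^ 6)
    (fun z => abs_mul_le_norm (by norm_num [abs_le]) (abs_im_le_norm z))
    (measurable_im.const_mul _) isShell_six (by linarith) (by positivity)
    (mul_nonneg hA (pow_nonneg (brMass_nonneg _) _)) (by norm_num) (fun N j κ hκ => ?_)
    (fun j N R p hR hp => (eLpNorm_indicator_const_mul_le (by norm_num [abs_le]) _ _ _ _).trans
      (h _ _ (isShell_six j) N σ R p hσ hR hp)) fun κ => ?_).add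
    (dyadicBounds_form (n := 10) (size := size10) (ρ := fun z => z.im)
    (c := fun N => tenMul χ η s δ N) (a := 2 * s) (A := A') (B := brMass (σ - 5) ^ 10)
    (b := 2 * (6 * 9 ^ (s - 2) * 81) * Cχ ^ 12) abs_im_le_norm
    measurable_im isShell_ten (by linarith) (by positivity)
    (mul_nonneg hA' (pow_nonneg (brMass_nonneg _) _)) (by norm_num) (fun N j κ hκ => ?_)
    (fun j N R p hR hp => h' j N σ R p hσ hR hp) fun κ => ?_)⟩
  · rw [resMul, abs_mul, abs_mul]
    have h1 : |η (Om κ / lam κ ^ δ)| ≤ 1 := hη.abs_le_one _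
    have h2 := abs_psi_le_pow hs (by positivity) ((isShell_six j).br_le κ hκ)
    have h3 := abs_prod_cut_le hC N κ
    calc _ ≤ 1 * (6 * 9 ^ (s - 2) * 81 * ((2:ℝ) ^ j) ^ (2 * s)) * Cχ ^ 6 := by gcongr
      _ = _ := by ring
  · have h1 : ∀ᶠ N : ℕ in atTop, ∀ m, cut χ N (κ m) = 1 :=
      eventually_all.2 fun m => hχ.eventually_cut (κ m)
    filter_upwards [h1] with N hN
    simp only [resMul, cut_top, hN]
  · rw [tenMul, abs_mul, abs_mul]
    have h1 := hη.abs_cutInv_lam_le (by linarith : 0 ≤ δ) (toSix κ)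
    have h2 := abs_psi_le_pow hs (by positivity) (br_toSix_le hκ)
    have h3 := abs_tenCut_le hC N κ
    calc _ ≤ 2 * (6 * 9 ^ (s - 2) * 81 * ((2:ℝ) ^ j) ^ (2 * s)) * Cχ ^ 12 := by gcongr
      _ = _ := by ring
  · have h1 : ∀ᶠ N : ℕ in atTop, ∀ m, cut χ N (κ m) = 1 :=
      eventually_all.2 fun m => hχ.eventually_cut (κ m)
    filter_upwards [h1, hχ.eventually_cut (kOne κ)] with N hN hN'
    simp only [tenMul, cut_top, hN, hN']

end

section

/-! ### Sums of nonnegative sequences: the algebra property of `H^s` -/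

lemma sq_tsum_mul_le {α : Type*} (f g : α → ℝ≥0∞) :
    (∑' a, f a * g a) ^ 2 ≤ (∑' a, f a ^ 2) * ∑' a, g a ^ 2 := by
  let _ : MeasurableSpace α := ⊤
  have h := ENNReal.lintegral_mul_le_Lp_mul_Lq (Measure.count (α := α))
    (Real.HolderConjugate.two_two) (f := f) (g := g) measurable_from_top.aemeasurable
    measurable_from_top.aemeasurable
  simp only [lintegral_count, Pi.mul_apply, rpow_two] at h
  calc _ ≤ ((∑' a, f a ^ 2) ^ (1 / 2 : ℝ) * (∑' a, g a ^ 2) ^ (1 / 2 : ℝ)) ^ 2 := by gcongr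
    _ = _ := by
      rw [← mul_rpow_of_nonneg _ _ (by norm_num), ← rpow_two, ← ENNReal.rpow_mul]
      norm_num

/-- The weight `(1+|k|²)^s`. -/
def hw (s : ℝ) (k : Freq) : ℝ≥0∞ := ofReal (br k ^ (2 * s))

/-- The square of the `H^s` norm, for sequences in `[0,∞]`. -/
def hsq (s : ℝ) (f : Freq → ℝ≥0∞) : ℝ≥0∞ := ∑' k, hw s k * f k ^ 2

/-- The sum `∑_a f_a g_{a-k}`. -/
def corrSum (f g : Freq → ℝ≥0∞) (k : Freq) : ℝ≥0∞ := ∑' a, f a * g (a - k)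

variable {s : ℝ}

lemma hw_ne_zero (s : ℝ) (k : Freq) : hw s k ≠ 0 := by
  rw [hw, Ne, ENNReal.ofReal_eq_zero, not_le]; exact rpow_pos_of_pos (br_pos k) _

lemma hw_ne_top (s : ℝ) (k : Freq) : hw s k ≠ ⊤ := ofReal_ne_top

lemma one_le_hw (hs : 0 ≤ s) (k : Freq) : 1 ≤ hw s k := by
  rw [hw, ← ofReal_one]
  exact ofReal_le_ofReal (one_le_rpow (one_le_br k) (by linarith))

lemma sobNorm_sq (σ : ℝ) (u : Coeff) : sobNorm σ u ^ 2 = hsq σ fun k => ‖u k‖ₑ := by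
  rw [sobNorm, ← rpow_two, ← ENNReal.rpow_mul, hsq]
  norm_num
  refine tsum_congr fun k => ?_
  rw [one_add_nsq_rpow, ofReal_mul (rpow_nonneg (br_pos k).le _), hw,
    ofReal_pow (norm_nonneg _), ofReal_norm]

lemma mem_Sob_iff {σ : ℝ} {u : Coeff} : u ∈ Sob σ ↔ hsq σ (fun k => ‖u k‖ₑ) ≠ ⊤ := by
  rw [← sobNorm_sq, Sob, mem_ofPred_eq, ← lt_top_iff_ne_top]
  simp [lt_top_iff_ne_top]

/-- The sum of the inverse weights. -/
def invMass (s : ℝ) : ℝ≥0∞ := ∑' k, (hw s k)⁻¹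

lemma invMass_ne_top (hs : 3 / 2 < s) : invMass s ≠ ⊤ := by
  have : ∀ k, (hw s k)⁻¹ = ofReal (br k ^ (-(2 * s))) := fun k => by
    rw [hw, ← ENNReal.ofReal_inv_of_pos (rpow_pos_of_pos (br_pos k) _),
      rpow_neg (br_pos k).le]
  simp only [invMass, this]
  exact (summable_br_rpow (by linarith)).tsum_ofReal_ne_top

/-- The constant in the algebra property. -/
def algConst (s : ℝ) : ℝ≥0∞ := ofReal (2 ^ (2 * s)) * (2 * invMass s)

lemma algConst_ne_top (hs : 3 / 2 < s) : algConst s ≠ ⊤ :=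
  mul_ne_top ofReal_ne_top (mul_ne_top (by simp) (invMass_ne_top hs))

lemma hw_le (hs : 0 ≤ s) (a k : Freq) :
    hw s k ≤ ofReal (2 ^ (2 * s)) * (hw s a + hw s (a - k)) := by
  have hp := fun k => (rpow_pos_of_pos (br_pos k) (2 * s)).le
  simp only [hw]
  rw [← ofReal_add (hp _) (hp _), ← ofReal_mul (by positivity)]
  refine ofReal_le_ofReal ?_
  have h : br k ≤ br a + br (a - k) := by simpa using br_sub_le a (a - k)
  have h2 : br k ≤ 2 * max (br a) (br (a - k)) := by
    linarith [le_max_left (br a) (br (a - k)), le_max_right (br a) (br (a - k))]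
  refine (rpow_le_rpow (br_pos k).le h2 (by linarith)).trans ?_
  rw [mul_rpow (by norm_num) (le_max_of_le_left (br_pos a).le)]
  gcongr
  rcases max_cases (br a) (br (a - k)) with ⟨e, -⟩ | ⟨e, -⟩ <;> rw [e]
  · linarith [hp (a - k)]
  · linarith [hp a]

lemma sq_tsum_le {α : Type*} (u v : α → ℝ≥0∞) (h0 : ∀ a, v a ≠ 0) (ht : ∀ a, v a ≠ ⊤) :
    (∑' a, u a) ^ 2 ≤ (∑' a, u a ^ 2 * v a) * ∑' a, (v a)⁻¹ := by
  have h := sq_tsum_mul_le (fun a => u a * v a ^ (1 / 2 : ℝ)) fun a => ((v a)⁻¹) ^ (1 / 2 : ℝ)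
  have e1 : ∀ x : ℝ≥0∞, (x ^ (1 / 2 : ℝ)) ^ 2 = x := fun x => by
    rw [← rpow_two, ← ENNReal.rpow_mul]; norm_num
  have e2 : ∀ a, u a * v a ^ (1 / 2 : ℝ) * ((v a)⁻¹) ^ (1 / 2 : ℝ) = u a := fun a => by
    rw [mul_assoc, ← mul_rpow_of_nonneg _ _ (by norm_num),
      ENNReal.mul_inv_cancel (h0 a) (ht a), one_rpow, mul_one]
  simpa only [mul_pow, e1, e2] using h

lemma hsq_corrSum_le (hs : 0 ≤ s) (f g : Freq → ℝ≥0∞) :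
    hsq s (corrSum f g) ≤ algConst s * (hsq s f * hsq s g) := by
  have h1 : ∀ k, hw s k * corrSum f g k ^ 2
      ≤ algConst s * ∑' a, (hw s a * f a ^ 2) * (hw s (a - k) * g (a - k) ^ 2) := by
    intro k
    have hv : ∀ a, hw s k * (hw s a * hw s (a - k))⁻¹
        ≤ ofReal (2 ^ (2 * s)) * ((hw s (a - k))⁻¹ + (hw s a)⁻¹) := by
      intro a
      refine (mul_le_mul_left (hw_le hs a k) _).trans (le_of_eq ?_)
      rw [ENNReal.mul_inv (Or.inl (hw_ne_zero s a)) (Or.inl (hw_ne_top s a)), mul_assoc]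
      congr 1
      rw [add_mul, ← mul_assoc, ENNReal.mul_inv_cancel (hw_ne_zero s a) (hw_ne_top s a), one_mul,
        mul_comm (hw s a)⁻¹, ← mul_assoc, ENNReal.mul_inv_cancel (hw_ne_zero s _) (hw_ne_top s _),
        one_mul]
    have hsum : ∑' a, hw s k * (hw s a * hw s (a - k))⁻¹ ≤ algConst s := by
      refine (tsum_le_tsum hv).trans (le_of_eq ?_)
      rw [ENNReal.tsum_mul_left, tsum_add, algConst]
      have := (Equiv.subRight k).tsum_eq fun a => (hw s a)⁻¹
      simp only [Equiv.subRight_apply] at this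
      rw [this, ← two_mul, invMass]
    calc hw s k * corrSum f g k ^ 2
        ≤ hw s k * ((∑' a, (f a * g (a - k)) ^ 2 * (hw s a * hw s (a - k))) *
          ∑' a, (hw s a * hw s (a - k))⁻¹) := by
          gcongr
          exact sq_tsum_le _ _ (fun a => mul_ne_zero (hw_ne_zero _ _) (hw_ne_zero _ _))
            fun a => mul_ne_top (hw_ne_top _ _) (hw_ne_top _ _)
      _ = (∑' a, hw s k * (hw s a * hw s (a - k))⁻¹) *
          ∑' a, (hw s a * f a ^ 2) * (hw s (a - k) * g (a - k) ^ 2) := by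
          rw [ENNReal.tsum_mul_left, mul_left_comm, mul_comm]
          congr 1
          exact tsum_congr fun a => by ring
      _ ≤ _ := by gcongr
  refine (tsum_le_tsum h1).trans (le_of_eq ?_)
  rw [ENNReal.tsum_mul_left, ENNReal.tsum_comm]
  congr 1
  simp only [ENNReal.tsum_mul_left]
  rw [hsq, ← ENNReal.tsum_mul_right]
  refine tsum_congr fun a => ?_
  congr 1
  exact (Equiv.subLeft a).tsum_eq fun k => hw s k * g k ^ 2

/-- The sum of `∏ f(κ_m)` over the tuples with alternating sum `k`. -/
def absForm (n : ℕ) (f : Freq → ℝ≥0∞) (k : Freq) : ℝ≥0∞ :=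
  ∑' κ : Fin n → Freq, if altSum κ = k then ∏ m, f (κ m) else 0

lemma altSum_cons {n : ℕ} (a : Freq) (κ : Fin n → Freq) :
    altSum (Fin.cons a κ : Fin (n + 1) → Freq) = a - altSum κ := by
  simp only [altSum, Fin.sum_univ_succ, Fin.cons_zero, Fin.cons_succ, Fin.val_zero, pow_zero,
    one_smul, Fin.val_succ, pow_succ, mul_neg_one, neg_smul, sum_neg_distrib, sub_eq_add_neg]

lemma tsum_cons {n : ℕ} (F : (Fin (n + 1) → Freq) → ℝ≥0∞) :
    ∑' κ, F κ = ∑' a, ∑' κ : Fin n → Freq, F (Fin.cons a κ) := by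
  rw [← (Fin.consEquiv fun _ : Fin (n + 1) => Freq).tsum_eq]
  exact ENNReal.tsum_prod (f := fun a (κ : Fin n → Freq) => F (Fin.cons a κ))

lemma absForm_succ (n : ℕ) (f : Freq → ℝ≥0∞) : absForm (n + 1) f = corrSum f (absForm n f) := by
  funext k
  rw [absForm, tsum_cons, corrSum]
  refine tsum_congr fun a => ?_
  rw [absForm, ← ENNReal.tsum_mul_left]
  refine tsum_congr fun κ => ?_
  have : altSum (Fin.cons a κ : Fin (n + 1) → Freq) = k ↔ altSum κ = a - k := by
    rw [altSum_cons, sub_eq_iff_eq_add, eq_sub_iff_add_eq, eq_comm, add_comm]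
  simp only [this, Fin.prod_univ_succ, Fin.cons_zero, Fin.cons_succ,
    mul_ite, mul_zero]

lemma absForm_one (f : Freq → ℝ≥0∞) : absForm 1 f = f := by
  funext k
  rw [absForm, tsum_eq_single (fun _ => k)]
  · simp [altSum]
  · intro κ hκ
    rw [if_neg]
    intro h
    refine hκ (funext fun m => ?_)
    rw [Subsingleton.elim m 0, ← h]; simp [altSum]

lemma hsq_absForm_le (hs : 0 ≤ s) (f : Freq → ℝ≥0∞) (n : ℕ) :
    hsq s (absForm (n + 1) f) ≤ algConst s ^ n * hsq s f ^ (n + 1) := by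
  induction n with
  | zero => simp [absForm_one]
  | succ n ih =>
    rw [absForm_succ]
    refine (hsq_corrSum_le hs _ _).trans ?_
    calc _ ≤ algConst s * (hsq s f * (algConst s ^ n * hsq s f ^ (n + 1))) := by gcongr
      _ = _ := by ring

lemma tsum_hw_mul_sq_le (f g : Freq → ℝ≥0∞) :
    (∑' k, hw s k * (f k * g k)) ^ 2 ≤ hsq s f * hsq s g := by
  have e1 : ∀ x : ℝ≥0∞, (x ^ (1 / 2 : ℝ)) ^ 2 = x := fun x => by
    rw [← rpow_two, ← ENNReal.rpow_mul]; norm_num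
  have := sq_tsum_mul_le (fun k => hw s k ^ (1 / 2 : ℝ) * f k) fun k => hw s k ^ (1 / 2 : ℝ) * g k
  simp only [mul_pow, e1] at this
  refine le_trans (le_of_eq ?_) this
  congr 2
  funext k
  nth_rw 1 [← e1 (hw s k)]
  ring

/-! ### The dihedral symmetry of the six slots -/

lemma neg_one_pow_sub : ∀ j m : Fin 6, (-1 : ℤ) ^ ((j - m : Fin 6) : ℕ)
    = (-1) ^ (j : ℕ) * (-1) ^ (m : ℕ) := by decide

lemma sum_neg_one_pow_sub {M : Type*} [AddCommGroup M] (g : Fin 6 → M) (j : Fin 6) :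
    ∑ m : Fin 6, (-1 : ℤ) ^ (m : ℕ) • g (j - m)
      = (-1 : ℤ) ^ (j : ℕ) • ∑ m : Fin 6, (-1 : ℤ) ^ (m : ℕ) • g m := by
  rw [← (Equiv.subLeft j).sum_comp, Finset.smul_sum]
  refine sum_congr rfl fun m _ => ?_
  simp only [Equiv.subLeft_apply, neg_one_pow_sub, sub_sub_cancel, mul_smul]

lemma altSum_sub_eq_zero_iff (κ : Fin 6 → Freq) (j : Fin 6) :
    (altSum fun m => κ (j - m)) = 0 ↔ altSum κ = 0 := by
  rw [altSum, sum_neg_one_pow_sub κ j, ← altSum]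
  rcases neg_one_pow_eq_or ℤ (j : ℕ) with h | h <;> simp [h]

/-- Reindexing of the six slots by `m ↦ j - m`. -/
def reflectSlots (j : Fin 6) : (Fin 6 → Freq) ≃ (Fin 6 → Freq) :=
  (Equiv.subLeft j).arrowCongr (Equiv.refl _)

lemma reflectSlots_apply (j : Fin 6) (κ : Fin 6 → Freq) (m : Fin 6) :
    reflectSlots j κ m = κ (j - m) := by
  simp [reflectSlots, Equiv.arrowCongr, neg_add_eq_sub]

lemma tsum_hw_prod_ne_top (hs : 3 / 2 < s) {f : Freq → ℝ≥0∞} (hf : hsq s f ≠ ⊤) :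
    ∑' κ : Fin 6 → Freq, (if altSum κ = 0 then (∑ j, hw s (κ j)) * ∏ m, f (κ m) else 0) ≠ ⊤ := by
  have e : ∀ κ : Fin 6 → Freq, (if altSum κ = 0 then (∑ j, hw s (κ j)) * ∏ m, f (κ m) else 0)
      = ∑ j, if altSum κ = 0 then hw s (κ j) * ∏ m, f (κ m) else 0 := by
    intro κ
    split_ifs
    · rw [sum_mul]
    · simp
  simp only [e]
  rw [Summable.tsum_finsetSum fun _ _ => ENNReal.summable]
  refine ENNReal.sum_ne_top.2 fun j _ => ?_
  rw [← (reflectSlots j).tsum_eq]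
  have e2 : ∀ κ : Fin 6 → Freq, (if altSum (reflectSlots j κ) = 0 then
      hw s (reflectSlots j κ j) * ∏ m, f (reflectSlots j κ m) else 0)
      = if altSum κ = 0 then hw s (κ 0) * ∏ m, f (κ m) else 0 := by
    intro κ
    simp only [← altSum_sub_eq_zero_iff κ j, reflectSlots_apply, sub_self]
    congr 2
    · ext; simp [altSum, reflectSlots_apply]
    · exact (Equiv.subLeft j).prod_comp fun m => f (κ m)
  simp only [e2]
  have h := tsum_hw_mul_sq_le (s := s) f (absForm 5 f)
  have h2 : hsq s f * hsq s (absForm 5 f) ≠ ⊤ := by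
    refine mul_ne_top hf (ne_top_of_le_ne_top ?_ (hsq_absForm_le (by linarith) f 4))
    exact mul_ne_top (pow_ne_top (algConst_ne_top hs)) (pow_ne_top hf)
  have h3 := ne_top_of_le_ne_top h2 h
  rw [tsum_cons (n := 5)]
  convert (fun h => h3 (by simp [h]) : ∑' k, hw s k * (f k * absForm 5 f k) ≠ ⊤) using 3 with a
  rw [absForm, ← ENNReal.tsum_mul_left, ← ENNReal.tsum_mul_left]
  refine tsum_congr fun κ => ?_
  have : altSum (Fin.cons a κ : Fin (5 + 1) → Freq) = 0 ↔ altSum κ = a := by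
    rw [altSum_cons, sub_eq_zero, eq_comm]
  simp only [this, Fin.prod_univ_succ (n := 5), Fin.cons_zero, Fin.cons_succ,
    mul_ite, mul_zero]

end

section

/-! ### The nonlinearity in Fourier space -/

lemma summable_norm_of_enorm {α : Type*} {f : α → ℂ} (h : ∑' a, ‖f a‖ₑ ≠ ⊤) :
    Summable fun a => ‖f a‖ :=
  summable_norm_iff.2 (.of_nnnorm (ENNReal.tsum_coe_ne_top_iff_summable.1 h))

lemma enorm_tsum_le {α : Type*} (f : α → ℂ) : ‖∑' a, f a‖ₑ ≤ ∑' a, ‖f a‖ₑ := by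
  by_cases h : ∑' a, ‖f a‖ₑ = ⊤
  · rw [h]; exact le_top
  · have h1 := summable_norm_of_enorm h
    have h2 := norm_tsum_le_tsum_norm h1
    rw [← ofReal_norm]
    refine (ofReal_le_ofReal h2).trans (le_of_eq ?_)
    rw [ofReal_tsum_of_nonneg (fun _ => norm_nonneg _) h1]
    exact tsum_congr fun a => ofReal_norm _

/-- The sequence `|u_k|`, in `[0,∞]`. -/
def mag (u : Coeff) (k : Freq) : ℝ≥0∞ := ‖u k‖ₑ

variable {s : ℝ}

lemma sq_le_hsq (hs : 0 ≤ s) (f : Freq → ℝ≥0∞) (k : Freq) : f k ^ 2 ≤ hsq s f :=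
  (le_mul_of_one_le_left' (one_le_hw hs k)).trans (le_tsum k)

lemma ne_top_of_hsq (hs : 0 ≤ s) {f : Freq → ℝ≥0∞} (hf : hsq s f ≠ ⊤) (k : Freq) : f k ≠ ⊤ :=
  fun h => ne_top_of_le_ne_top hf (sq_le_hsq hs f k) (by simp [h])

lemma tsum_ne_top_of_hsq (hs : 3 / 2 < s) {f : Freq → ℝ≥0∞} (hf : hsq s f ≠ ⊤) :
    ∑' k, f k ≠ ⊤ := by
  have h := sq_tsum_le f (hw s) (hw_ne_zero s) (hw_ne_top s)
  simp only [mul_comm (_ ^ 2)] at h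
  have h2 := ne_top_of_le_ne_top (mul_ne_top hf (invMass_ne_top hs)) h
  exact fun h3 => h2 (by simp [h3])

lemma absForm_ne_top (hs : 3 / 2 < s) {f : Freq → ℝ≥0∞} (hf : hsq s f ≠ ⊤) (n : ℕ) :
    hsq s (absForm (n + 1) f) ≠ ⊤ :=
  ne_top_of_le_ne_top (mul_ne_top (pow_ne_top (algConst_ne_top hs))
    (pow_ne_top hf)) (hsq_absForm_le (by linarith) f n)

/-- The form `∑ û_{κ₀} conj(û_{κ₁}) ⋯` over the tuples with alternating sum `k`. -/
def altForm (n : ℕ) (u : Coeff) (k : Freq) : ℂ :=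
  ∑' κ : Fin n → Freq, if altSum κ = k then mono u κ else 0

/-- The Fourier coefficients `∑_a f_a conj(g_{a-k})` of `f · conj g`. -/
def corr (f g : Coeff) (k : Freq) : ℂ := ∑' a, f a * conj (g (a - k))

lemma enorm_mono {n : ℕ} (u : Coeff) (κ : Fin n → Freq) : ‖mono u κ‖ₑ = ∏ m, mag u (κ m) := by
  simp only [mono, mag, enorm_eq_nnnorm]
  rw [← ENNReal.ofNNReal_finsetProd]
  congr 1
  rw [nnnorm_prod]
  exact prod_congr rfl fun m _ => NNReal.eq (norm_twist _ _)

lemma tsum_enorm_altForm (n : ℕ) (u : Coeff) (k : Freq) :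
    ∑' κ : Fin n → Freq, ‖if altSum κ = k then mono u κ else 0‖ₑ = absForm n (mag u) k := by
  refine tsum_congr fun κ => ?_
  split_ifs
  · exact enorm_mono u κ
  · simp

lemma enorm_altForm_le (n : ℕ) (u : Coeff) (k : Freq) :
    mag (altForm n u) k ≤ absForm n (mag u) k :=
  (enorm_tsum_le _).trans (tsum_enorm_altForm n u k).le

lemma slotConj_succ' {n : ℕ} (m : Fin n) : slotConj m.succ = !slotConj m := by
  simp only [slotConj, Fin.val_succ]
  rcases Nat.mod_two_eq_zero_or_one m with h | h <;> simp [Nat.add_mod, h]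

lemma mono_cons {n : ℕ} (u : Coeff) (a : Freq) (κ : Fin n → Freq) :
    mono u (Fin.cons a κ : Fin (n + 1) → Freq) = u a * conj (mono u κ) := by
  simp only [mono, Fin.prod_univ_succ, Fin.cons_zero, Fin.cons_succ, map_prod, conj_twist,
    slotConj_succ']
  rfl

lemma altSum_cons_eq_iff {n : ℕ} {a k : Freq} {κ : Fin n → Freq} :
    altSum (Fin.cons a κ : Fin (n + 1) → Freq) = k ↔ altSum κ = a - k := by
  rw [altSum_cons, sub_eq_iff_eq_add, eq_sub_iff_add_eq, eq_comm, add_comm]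

lemma altForm_succ {n : ℕ} {u : Coeff} {k : Freq} (h : absForm (n + 1) (mag u) k ≠ ⊤) :
    altForm (n + 1) u k = corr u (altForm n u) k := by
  rw [← tsum_enorm_altForm] at h
  have hs := (summable_norm_of_enorm h).of_norm
  rw [altForm, ← (Fin.consEquiv fun _ : Fin (n + 1) => Freq).tsum_eq, corr]
  refine ((((Fin.consEquiv fun _ : Fin (n + 1) => Freq).summable_iff).2 hs).tsum_prod).trans ?_
  refine tsum_congr fun a => ?_
  rw [altForm, conj_tsum, ← tsum_mul_left]
  refine tsum_congr fun κ => ?_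
  change (if altSum (Fin.cons a κ : Fin (n + 1) → Freq) = k then
    mono u (Fin.cons a κ : Fin (n + 1) → Freq) else 0) = _
  simp only [altSum_cons_eq_iff, mono_cons, apply_ite conj, map_zero, mul_ite, mul_zero]

lemma altForm_one (v : Coeff) : altForm 1 v = v := by
  funext k
  rw [altForm, tsum_eq_single (fun _ => k)]
  · simp [altSum, mono, slotConj]
  · intro κ hκ
    rw [if_neg]
    intro h
    refine hκ (funext fun m => ?_)
    rw [Subsingleton.elim m 0, ← h]; simp [altSum]

/-- The Fourier series with coefficients `f`. -/
def fourierSum (f : Coeff) (y : UnitAddTorus (Fin 3)) : ℂ := ∑' k, f k * mFourier k y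

lemma norm_mFourier_apply (k : Freq) (y : UnitAddTorus (Fin 3)) :
    ‖mFourier k y‖ = 1 := by
  simp [mFourier, fourier_apply, Circle.norm_coe]

/-- The Haar probability measure on the torus. -/
def torusMeasure : Measure (UnitAddTorus (Fin 3)) := Measure.pi fun _ => AddCircle.haarAddCircle

instance : IsProbabilityMeasure torusMeasure := by unfold torusMeasure; infer_instance

lemma mFourierCoeff_fourierSum {f : Coeff} (hf : Summable fun k => ‖f k‖) (n : Freq) :
    UnitAddTorus.mFourierCoeff (fourierSum f) n = f n := by
  have h1 : ∀ k, Integrable (fun y => mFourier (-n) y •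
      (f k * mFourier k y)) torusMeasure := fun k =>
    ((map_continuous (mFourier (-n))).smul (continuous_const.mul
      (map_continuous (mFourier k)))).integrable_of_hasCompactSupport
        (HasCompactSupport.of_compactSpace _)
  have h2 : ∀ k, (∫ y, ‖mFourier (-n) y • (f k * mFourier k y)‖ ∂torusMeasure)
      = ‖f k‖ := fun k => by
    simp [norm_mFourier_apply]
  have h3 := integral_tsum_of_summable_integral_norm h1 (by simpa only [h2] using hf)
  have h4 := orthonormal_iff_ite.1 (UnitAddTorus.orthonormal_mFourier (d := Fin 3)) n
  simp only [ContinuousMap.inner_toLp, ← mFourier_neg] at h4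
  calc _ = ∫ y, mFourier (-n) y • fourierSum f y ∂torusMeasure := rfl
    _ = ∫ y, ∑' k, mFourier (-n) y • (f k * mFourier k y)
          ∂torusMeasure :=
        integral_congr_ae (ae_of_all _ fun y => by
          simp only [fourierSum, smul_eq_mul, tsum_mul_left])
    _ = ∑' k, f k * if n = k then 1 else 0 := by
        rw [← h3]
        refine tsum_congr fun k => ?_
        rw [← h4 k, ← integral_const_mul]
        exact integral_congr_ae (ae_of_all _ fun y => by simp only [smul_eq_mul]; ring)
    _ = f n := by simp

lemma fourierSum_corr {f g : Coeff} (hf : Summable fun k => ‖f k‖) (hg : Summable fun k => ‖g k‖)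
    (y : UnitAddTorus (Fin 3)) :
    fourierSum (corr f g) y = fourierSum f y * conj (fourierSum g y) := by
  set e := fun k => mFourier k y with he
  have hE : ∀ a k, e k = e a * conj (e (a - k)) := fun a k => by
    rw [he]
    simp only [← mFourier_neg, ← UnitAddTorus.mFourier_add]
    congr 1; abel_nf
  have h1 : Summable fun k => ‖f k * e k‖ := by
    simpa only [he, norm_mul, norm_mFourier_apply, mul_one] using hf
  have h2 : Summable fun k => ‖conj (g k * e k)‖ := by
    simpa only [he, norm_mul, norm_mFourier_apply, mul_one, RCLike.norm_conj] using hg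
  have h3 := summable_mul_of_summable_norm h1 h2
  let E : Freq × Freq ≃ Freq × Freq :=
    { toFun := fun p => (p.2, p.2 - p.1)
      invFun := fun p => (p.1 - p.2, p.1)
      left_inv := fun p => by simp
      right_inv := fun p => by simp }
  have h4 := E.summable_iff.2 h3
  rw [fourierSum, fourierSum, fourierSum, conj_tsum,
    tsum_mul_tsum_of_summable_norm h1 h2, ← E.tsum_eq]
  refine Eq.symm ((h4.tsum_prod).trans (tsum_congr fun k => ?_))
  rw [corr, ← tsum_mul_right]
  refine tsum_congr fun a => ?_
  change f a * e a * conj (g (a - k) * e (a - k)) = f a * conj (g (a - k)) * e k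
  rw [hE a k, map_mul]; ring

/-- The coefficients after the smoothing. -/
def cutMul (χ : EuclideanSpace ℝ (Fin 3) → ℝ) (N : ℕ∞) (u : Coeff) : Coeff :=
  fun k => (cut χ N k : ℂ) * u k

theorem nonlin_eq {N : ℕ∞} {u : Coeff} (hs : 3 / 2 < s)
    (hu : hsq s (mag (cutMul χ N u)) ≠ ⊤) (k : Freq) :
    nonlin χ N u k = cut χ N k * altForm 5 (cutMul χ N u) k := by
  set v := cutMul χ N u with hv
  have hsum : ∀ n, Summable fun k => ‖altForm (n + 1) v k‖ := fun n =>
    summable_norm_of_enorm (ne_top_of_le_ne_top (tsum_ne_top_of_hsq hs (absForm_ne_top hs hu n))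
      (tsum_le_tsum fun k => enorm_altForm_le (n + 1) v k))
  have hv1 : Summable fun k => ‖v k‖ := summable_norm_of_enorm (tsum_ne_top_of_hsq hs hu)
  have hstep : ∀ n, altForm (n + 1 + 1) v = corr v (altForm (n + 1) v) := fun n => funext fun k =>
    altForm_succ (ne_top_of_hsq (by linarith) (absForm_ne_top hs hu (n + 1)) k)
  have hF : ∀ n y, fourierSum (altForm (n + 1 + 1) v) y
      = fourierSum v y * conj (fourierSum (altForm (n + 1) v) y) := fun n y => by
    rw [hstep, fourierSum_corr hv1 (hsum n)]
  rw [nonlin, ← mFourierCoeff_fourierSum (hsum 4) k]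
  congr 2
  funext y
  have hsm : smoothed χ N u y = fourierSum v y := rfl
  rw [hsm, hF 3, hF 2, hF 1, hF 0, altForm_one]
  set z := fourierSum v y
  simp only [map_mul, Complex.conj_conj]
  have : ((‖z‖ ^ 4 : ℝ) : ℂ) = (z * conj z) * (z * conj z) := by
    rw [Complex.mul_conj, Complex.normSq_eq_norm_sq]; push_cast; ring
  rw [this]; ring

end

section

/-! ### The Hilbert space of weighted coefficients -/

/-- Square summable families; `x` stands for the function with coefficients `(1+|k|²)^{-s/2} x_k`. -/
abbrev L2Freq := lp (fun _ : Freq => ℂ) 2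

variable {s σ : ℝ}

lemma memℓp_two_iff {f : Coeff} : Memℓp f 2 ↔ ∑' k, ‖f k‖ₑ ^ 2 ≠ ⊤ := by
  rw [memℓp_gen_iff (by norm_num)]
  have e : ∀ k, ‖f k‖ₑ ^ 2 = ((‖f k‖₊ ^ 2 : NNReal) : ℝ≥0∞) := fun k => by
    rw [enorm_eq_nnnorm]; push_cast; rfl
  simp only [e, ENNReal.tsum_coe_ne_top_iff_summable]
  rw [← NNReal.summable_coe]
  simp

lemma enorm_sq_eq (x : L2Freq) : ‖x‖ₑ ^ 2 = ∑' k, ‖x k‖ₑ ^ 2 := by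
  have h := lp.hasSum_norm (p := 2) (by norm_num) x
  simp only [toReal_ofNat, Real.rpow_two] at h
  rw [← ofReal_norm, ← ofReal_pow (norm_nonneg _), ← h.tsum_eq,
    ofReal_tsum_of_nonneg (fun _ => by positivity) h.summable]
  exact tsum_congr fun k => by rw [ofReal_pow (norm_nonneg _), ofReal_norm]

/-- The coefficients `(1+|k|²)^{-s/2} x_k`. -/
def lower (s : ℝ) (x : Coeff) : Coeff := fun k => ((br k ^ (-s) : ℝ) : ℂ) * x k

lemma enorm_ofReal_rpow_sq (s : ℝ) (k : Freq) : ‖((br k ^ s : ℝ) : ℂ)‖ₑ ^ 2 = hw s k := by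
  have h := rpow_pos_of_pos (br_pos k) s
  rw [← ofReal_norm, norm_real, norm_of_nonneg h.le, ← ofReal_pow h.le, hw,
    ← rpow_natCast, ← rpow_mul (br_pos k).le]
  congr 2; push_cast; ring

lemma rpow_neg_mul (s : ℝ) (k : Freq) : ((br k ^ s : ℝ) : ℂ) * ((br k ^ (-s) : ℝ) : ℂ) = 1 := by
  rw [← Complex.ofReal_mul, ← rpow_add (br_pos k)]; simp

lemma hsq_eq (f : Coeff) : hsq s (mag f) = ∑' k, ‖((br k ^ s : ℝ) : ℂ) * f k‖ₑ ^ 2 := by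
  refine tsum_congr fun k => ?_
  rw [enorm_mul, mul_pow, enorm_ofReal_rpow_sq]; rfl

lemma upper_lower (s : ℝ) (x : Coeff) (k : Freq) : ((br k ^ s : ℝ) : ℂ) * lower s x k = x k := by
  rw [lower, ← mul_assoc, rpow_neg_mul, one_mul]

lemma hsq_lower (x : L2Freq) : hsq s (mag (lower s x)) = ‖x‖ₑ ^ 2 := by
  simp only [hsq_eq, upper_lower, enorm_sq_eq]

lemma hsq_lower_ne_top (x : L2Freq) : hsq s (mag (lower s x)) ≠ ⊤ := by
  rw [hsq_lower]; exact pow_ne_top enorm_ne_top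

/-- The element with coefficients `f ∈ H^s`. -/
def raise (s : ℝ) (f : Coeff) (hf : hsq s (mag f) ≠ ⊤) : L2Freq :=
  ⟨fun k => ((br k ^ s : ℝ) : ℂ) * f k, memℓp_two_iff.2 (by rwa [← hsq_eq])⟩

lemma lower_raise (f : Coeff) (hf : hsq s (mag f) ≠ ⊤) : lower s (raise s f hf) = f := by
  funext k
  change ((br k ^ (-s) : ℝ) : ℂ) * (((br k ^ s : ℝ) : ℂ) * f k) = f k
  rw [← mul_assoc, mul_comm ((br k ^ (-s) : ℝ) : ℂ), rpow_neg_mul, one_mul]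

lemma sobNorm_lower (x : L2Freq) : sobNorm σ (lower σ x) = ‖x‖ₑ := by
  have h : sobNorm σ (lower σ x) ^ 2 = ‖x‖ₑ ^ 2 := by rw [sobNorm_sq]; exact hsq_lower x
  exact (ENNReal.pow_right_strictMono two_ne_zero).injective h

lemma mag_corr_le (f g : Coeff) (k : Freq) : mag (corr f g) k ≤ corrSum (mag f) (mag g) k := by
  refine (enorm_tsum_le _).trans (le_of_eq (tsum_congr fun a => ?_))
  rw [enorm_mul]
  congr 1
  simp [mag, enorm_eq_nnnorm]

lemma hsq_mono {f g : Freq → ℝ≥0∞} (h : ∀ k, f k ≤ g k) : hsq s f ≤ hsq s g :=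
  tsum_le_tsum fun k => by gcongr; exact h k

lemma hsq_corr_le (hs : 0 ≤ s) (x y : L2Freq) :
    hsq s (mag (corr (lower s x) (lower s y))) ≤ algConst s * (‖x‖ₑ ^ 2 * ‖y‖ₑ ^ 2) := by
  refine (hsq_mono (mag_corr_le _ _)).trans ((hsq_corrSum_le hs _ _).trans ?_)
  rw [hsq_lower, hsq_lower]

lemma summable_corr (hs : 3 / 2 < s) (x y : L2Freq) (k : Freq) :
    Summable fun a => lower s x a * conj (lower s y (a - k)) := by
  refine (summable_norm_of_enorm ?_).of_norm
  have h : hsq s (corrSum (mag (lower s x)) (mag (lower s y))) ≠ ⊤ :=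
    ne_top_of_le_ne_top (mul_ne_top (algConst_ne_top hs) (mul_ne_top
      (hsq_lower_ne_top x) (hsq_lower_ne_top y))) (hsq_corrSum_le (by linarith) _ _)
  refine ne_top_of_le_ne_top (ne_top_of_hsq (by linarith) h k) (le_of_eq (tsum_congr fun a => ?_))
  rw [enorm_mul]
  congr 1
  simp [mag, enorm_eq_nnnorm]

lemma corr_ne_top (hs : 3 / 2 < s) (x y : L2Freq) :
    hsq s (mag (corr (lower s x) (lower s y))) ≠ ⊤ :=
  ne_top_of_le_ne_top (mul_ne_top (algConst_ne_top hs) (mul_ne_top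
    (pow_ne_top enorm_ne_top) (pow_ne_top enorm_ne_top)))
      (hsq_corr_le (by linarith) x y)

lemma lower_add (x y : L2Freq) (k : Freq) : lower s (x + y : L2Freq) k
    = lower s x k + lower s y k := by
  simp [lower, mul_add]

lemma lower_smul (c : ℝ) (x : L2Freq) (k : Freq) : lower s (c • x : L2Freq) k
    = c * lower s x k := by
  simp [lower]; ring

/-- `corr` as a bounded bilinear map on `H^s`. -/
def corrL (hs : 3 / 2 < s) : L2Freq →L[ℝ] L2Freq →L[ℝ] L2Freq :=
  LinearMap.mkContinuous₂ (LinearMap.mk₂ ℝ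
    (fun x y : L2Freq => raise s (corr (lower s x) (lower s y)) (corr_ne_top hs x y))
    (fun x x' y => by
      ext k
      change _ * corr _ _ k = _ * corr _ _ k + _ * corr _ _ k
      rw [← mul_add, corr, corr, corr,
        ← (summable_corr hs x y k).tsum_add (summable_corr hs x' y k)]
      simp only [lower_add, add_mul])
    (fun c x y => by
      ext k
      change _ * corr _ _ k = c • (_ * corr _ _ k)
      rw [real_smul, mul_left_comm, corr, corr, ← tsum_mul_left (a := (c : ℂ))]
      simp only [lower_smul, mul_assoc])
    (fun x y y' => by
      ext k
      change _ * corr _ _ k = _ * corr _ _ k + _ * corr _ _ k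
      rw [← mul_add, corr, corr, corr,
        ← (summable_corr hs x y k).tsum_add (summable_corr hs x y' k)]
      simp only [lower_add, map_add, mul_add])
    (fun c x y => by
      ext k
      change _ * corr _ _ k = c • (_ * corr _ _ k)
      rw [real_smul, mul_left_comm, corr, corr, ← tsum_mul_left (a := (c : ℂ))]
      simp only [lower_smul, map_mul, conj_ofReal, mul_left_comm]))
    (sqrt (algConst s).toReal) (fun x y => by
      have h := hsq_corr_le (s := s) (by linarith) x y
      rw [← lower_raise _ (corr_ne_top hs x y), hsq_lower] at h
      have h2 := toReal_mono (mul_ne_top (algConst_ne_top hs) (mul_ne_top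
        (pow_ne_top enorm_ne_top) (pow_ne_top enorm_ne_top))) h
      simp only [toReal_mul, ENNReal.toReal_pow, toReal_enorm] at h2
      refine (Real.le_sqrt_of_sq_le h2).trans (le_of_eq ?_)
      rw [sqrt_mul toReal_nonneg, ← mul_pow, sqrt_sq (by positivity), mul_assoc])

lemma lower_corrL (hs : 3 / 2 < s) (x y : L2Freq) :
    lower s (corrL hs x y) = corr (lower s x) (lower s y) := lower_raise _ (corr_ne_top hs x y)

/-- The quintic form `u ↦ |u|⁴ u` on `H^s`. -/
def quint (hs : 3 / 2 < s) (x : L2Freq) : L2Freq :=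
  corrL hs x (corrL hs x (corrL hs x (corrL hs x x)))

lemma contDiff_quint (hs : 3 / 2 < s) : ContDiff ℝ 1 (quint hs) := by
  have h : ContDiff ℝ 1 fun x => corrL hs x := (corrL hs).contDiff
  exact h.clm_apply (h.clm_apply (h.clm_apply (h.clm_apply contDiff_id)))

lemma lower_quint (hs : 3 / 2 < s) (x : L2Freq) (k : Freq) :
    lower s (quint hs x) k = altForm 5 (lower s x) k := by
  have hstep : ∀ n, altForm (n + 1 + 1) (lower s x)
      = corr (lower s x) (altForm (n + 1) (lower s x)) := fun n => funext fun k =>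
    altForm_succ (ne_top_of_hsq (by linarith) (absForm_ne_top hs (hsq_lower_ne_top x) (n + 1)) k)
  rw [quint, lower_corrL, lower_corrL, lower_corrL, lower_corrL, hstep 3, hstep 2, hstep 1, hstep 0,
    altForm_one]

lemma tsum_mul_sq_le {m : Coeff} {b : ℝ} (hm : ∀ k, ‖m k‖ ≤ b) (x : L2Freq) :
    ∑' k, ‖m k * x k‖ₑ ^ 2 ≤ (ofReal b * ‖x‖ₑ) ^ 2 := by
  rw [mul_pow, enorm_sq_eq, ← ENNReal.tsum_mul_left]
  refine tsum_le_tsum fun k => ?_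
  rw [enorm_mul, mul_pow, ← ofReal_norm (m k)]
  gcongr
  exact hm k

/-- The product of `x` with a bounded sequence. -/
def diagMul (m : Coeff) (b : ℝ) (hm : ∀ k, ‖m k‖ ≤ b) (x : L2Freq) : L2Freq :=
  ⟨fun k => m k * x k, memℓp_two_iff.2 (ne_top_of_le_ne_top
    (pow_ne_top (mul_ne_top ofReal_ne_top enorm_ne_top))
      (tsum_mul_sq_le hm x))⟩

lemma diagMul_apply {m : Coeff} {b : ℝ} (hm : ∀ k, ‖m k‖ ≤ b) (x : L2Freq) (k : Freq) :
    diagMul m b hm x k = m k * x k := rfl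

lemma norm_diagMul_le {m : Coeff} {b : ℝ} (hb : 0 ≤ b) (hm : ∀ k, ‖m k‖ ≤ b) (x : L2Freq) :
    ‖diagMul m b hm x‖ ≤ b * ‖x‖ := by
  have h2 : ‖diagMul m b hm x‖ₑ ^ 2 ≤ (ofReal b * ‖x‖ₑ) ^ 2 := by
    rw [enorm_sq_eq]; exact tsum_mul_sq_le hm x
  have h3 := toReal_mono (mul_ne_top ofReal_ne_top enorm_ne_top)
    ((ENNReal.pow_le_pow_left_iff two_ne_zero).1 h2)
  rwa [toReal_mul, toReal_enorm, toReal_enorm, toReal_ofReal hb] at h3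

/-- The Fourier multiplier with bounded symbol `m`. -/
def diagL (m : Coeff) (b : ℝ) (hb : 0 ≤ b) (hm : ∀ k, ‖m k‖ ≤ b) : L2Freq →L[ℝ] L2Freq :=
  LinearMap.mkContinuous
    { toFun := diagMul m b hm
      map_add' := fun x y => by
        ext k
        rw [lp.coeFn_add, Pi.add_apply, diagMul_apply, diagMul_apply, diagMul_apply, lp.coeFn_add,
          Pi.add_apply, mul_add]
      map_smul' := fun c x => by
        ext k
        rw [RingHom.id_apply, lp.coeFn_smul, Pi.smul_apply, diagMul_apply, diagMul_apply,
          lp.coeFn_smul, Pi.smul_apply, mul_smul_comm] } b (norm_diagMul_le hb hm)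

lemma norm_diagL_le {m : Coeff} {b : ℝ} (hb : 0 ≤ b) (hm : ∀ k, ‖m k‖ ≤ b) (x : L2Freq) :
    ‖diagL m b hb hm x‖ ≤ b * ‖x‖ := norm_diagMul_le hb hm x

/-- The symbol `e^{it|k|²}` of the free evolution. -/
def phase (t : ℝ) (k : Freq) : ℂ := Complex.exp ((t * nsq k : ℝ) * Complex.I)

lemma norm_phase (t : ℝ) (k : Freq) : ‖phase t k‖ = 1 := Complex.norm_exp_ofReal_mul_I _

lemma phase_add (t t' : ℝ) (k : Freq) : phase (t + t') k = phase t k * phase t' k := by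
  rw [phase, phase, phase, ← Complex.exp_add]; congr 1; push_cast; ring

@[simp] lemma phase_zero (k : Freq) : phase 0 k = 1 := by simp [phase]

lemma phase_neg_mul (t : ℝ) (k : Freq) : phase (-t) k * phase t k = 1 := by
  rw [← phase_add]; simp

lemma hasDerivAt_phase (t : ℝ) (k : Freq) :
    HasDerivAt (fun t => phase t k) (Complex.I * nsq k * phase t k) t := by
  have h : HasDerivAt (fun t : ℝ => ((t * nsq k : ℝ) : ℂ) * Complex.I) (nsq k * Complex.I) t := by
    have := ((hasDerivAt_id t).mul_const (nsq k)).ofReal_comp.mul_const Complex.I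
    simpa using this
  refine h.cexp.congr_deriv ?_
  rw [phase]; ring

/-- The free evolution. -/
def freeL (t : ℝ) : L2Freq →L[ℝ] L2Freq :=
  diagL (phase t) 1 zero_le_one fun k => (norm_phase t k).le

lemma norm_freeL_le (t : ℝ) (x : L2Freq) : ‖freeL t x‖ ≤ ‖x‖ :=
  (norm_diagL_le zero_le_one (fun k => (norm_phase t k).le) x).trans_eq (one_mul _)

lemma continuous_freeL (x : L2Freq) : Continuous fun t => freeL t x := by
  refine continuous_iff_continuousAt.2 fun t₀ => ?_
  rw [ContinuousAt, tendsto_iff_norm_sub_tendsto_zero]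
  have hx := (lp.hasSum_norm (p := 2) (by norm_num) x).summable
  have h0 : Tendsto (fun t => ‖freeL t x - freeL t₀ x‖ ^ 2) (𝓝 t₀) (𝓝 0) := by
    have e : ∀ t, ‖freeL t x - freeL t₀ x‖ ^ 2 = ∑' k, ‖(phase t k - phase t₀ k) * x k‖ ^ 2 := by
      intro t
      have := (lp.hasSum_norm (p := 2) (by norm_num) (freeL t x - freeL t₀ x)).tsum_eq
      simp only [toReal_ofNat, Real.rpow_two] at this
      rw [← this]
      refine tsum_congr fun k => ?_
      rw [sub_mul, lp.coeFn_sub, Pi.sub_apply]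
      rfl
    simp only [e]
    have hlim := tendsto_tsum_of_dominated_convergence (𝓕 := 𝓝 t₀)
      (f := fun t k => ‖(phase t k - phase t₀ k) * x k‖ ^ 2) (g := fun _ => (0:ℝ))
      (bound := fun k => 4 * ‖x k‖ ^ (2 : ℝ≥0∞).toReal) (hx.mul_left 4) (fun k => ?_)
      (Eventually.of_forall fun t k => ?_)
    · simpa using hlim
    · have hc : Continuous fun t => ‖(phase t k - phase t₀ k) * x k‖ ^ 2 := by
        unfold phase; fun_prop
      simpa using hc.tendsto t₀
    · have h1 : ‖phase t k - phase t₀ k‖ ≤ 2 :=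
        (norm_sub_le _ _).trans (by rw [norm_phase, norm_phase]; norm_num)
      simp only [toReal_ofNat, Real.rpow_two, norm_mul, norm_pow, norm_norm, mul_pow]
      gcongr
      calc _ ≤ (2:ℝ) ^ 2 := by gcongr
        _ = 4 := by norm_num
  have := h0.sqrt
  simpa [sqrt_sq] using this

lemma continuousAt_freeL {z : ℝ → L2Freq} {t₀ : ℝ} {S : Set ℝ} (hz : ContinuousWithinAt z S t₀)
    {τ : ℝ → ℝ} (hτ : Continuous τ) : ContinuousWithinAt (fun t => freeL (τ t) (z t)) S t₀ := by
  rw [ContinuousWithinAt, tendsto_iff_norm_sub_tendsto_zero] at hz ⊢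
  have h1 := (tendsto_iff_norm_sub_tendsto_zero.1
    (((continuous_freeL (z t₀)).comp hτ).tendsto t₀)).mono_left (nhdsWithin_le_nhds (s := S))
  refine squeeze_zero (fun _ => norm_nonneg _) (fun t => ?_) (by simpa using hz.add h1)
  calc ‖freeL (τ t) (z t) - freeL (τ t₀) (z t₀)‖
      = ‖freeL (τ t) (z t - z t₀) + (freeL (τ t) (z t₀) - freeL (τ t₀) (z t₀))‖ := by
        rw [map_sub]; congr 1; abel
    _ ≤ _ := (norm_add_le _ _).trans (add_le_add (norm_freeL_le _ _) le_rfl)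

end

section

/-! ### Local existence -/

variable {s σ : ℝ} {N : ℕ∞}

/-- Evaluation of a coordinate. -/
def coordL (k : Freq) : L2Freq →L[ℝ] ℂ :=
  LinearMap.mkContinuous
    { toFun := fun x => x k
      map_add' := fun _ _ => rfl
      map_smul' := fun _ _ => rfl } 1 fun x =>
    (lp.norm_apply_le_norm two_ne_zero x k).trans_eq (one_mul _).symm

lemma tendsto_enorm_of_continuousAt {α : ℝ → L2Freq} {t : ℝ} (h : ContinuousAt α t) :
    Tendsto (fun t' => ‖α t' - α t‖ₑ) (𝓝 t) (𝓝 0) := by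
  have := (h.sub (continuousAt_const (y := α t))).enorm
  simpa [ContinuousAt] using this

theorem exists_isPicardLindelof (hs : 3 / 2 < s) (M₁ M₂ : L2Freq →L[ℝ] L2Freq) (x₀ : L2Freq) :
    ∃ (T : ℝ) (hT : 0 < T) (a L K : NNReal), IsPicardLindelof
      (fun t x => M₂ (freeL t (quint hs (M₁ (freeL (-t) x))))) (tmin := -T) (tmax := T)
      ⟨0, by simp [hT.le]⟩ x₀ a 0 L K := by
  obtain ⟨K, V, hV, hK⟩ := (contDiff_quint hs).contDiffAt.exists_lipschitzOnWith (x := M₁ x₀)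
  obtain ⟨ρ, hρ, hball⟩ := Metric.mem_nhds_iff.1 hV
  set a : ℝ := ρ / (2 * (‖M₁‖ + 1)) with ha
  have hM1 : 0 ≤ ‖M₁‖ := norm_nonneg _
  have ha0 : 0 < a := by positivity
  have hcont : Tendsto (fun t => ‖freeL (-t) x₀ - x₀‖) (𝓝 0) (𝓝 0) := by
    have h := (((continuous_freeL x₀).comp continuous_neg).sub
      (continuous_const (y := x₀))).norm.tendsto 0
    have e : freeL 0 x₀ = x₀ := by
      ext k
      change phase 0 k * x₀ k = x₀ k
      simp
    simpa [e] using h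
  obtain ⟨T₀, hT₀, hsmall⟩ := Metric.eventually_nhds_iff.1 (hcont.eventually (gt_mem_nhds ha0))
  have hin : ∀ t, |t| < T₀ → ∀ x ∈ Metric.closedBall x₀ a, M₁ (freeL (-t) x) ∈ Metric.ball (M₁ x₀) ρ := by
    intro t ht x hx
    rw [Metric.mem_closedBall, dist_eq_norm] at hx
    have h1 := hsmall (y := t) (by simpa using ht)
    have h2 : ‖freeL (-t) x - x₀‖ < a + a := by
      have e : freeL (-t) x - x₀ = freeL (-t) (x - x₀) + (freeL (-t) x₀ - x₀) := by
        rw [map_sub]; abel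
      rw [e]
      exact (norm_add_le _ _).trans_lt
        (add_lt_add_of_le_of_lt ((norm_freeL_le _ _).trans hx) h1)
    rw [Metric.mem_ball, dist_eq_norm, ← map_sub]
    calc _ ≤ ‖M₁‖ * ‖freeL (-t) x - x₀‖ := M₁.le_opNorm _
      _ ≤ ‖M₁‖ * (a + a) := by gcongr
      _ < (‖M₁‖ + 1) * (a + a) := by gcongr; linarith
      _ = ρ := by rw [ha]; field_simp; ring
  have hqlip : ∀ t, |t| < T₀ → ∀ x ∈ Metric.closedBall x₀ a, ∀ y ∈ Metric.closedBall x₀ a,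
      ‖quint hs (M₁ (freeL (-t) x)) - quint hs (M₁ (freeL (-t) y))‖ ≤ K * (‖M₁‖ * ‖x - y‖) := by
    intro t ht x hx y hy
    have h := hK.norm_sub_le (hball (hin t ht x hx)) (hball (hin t ht y hy))
    refine h.trans ?_
    gcongr
    rw [← map_sub, ← map_sub]
    exact (M₁.le_opNorm _).trans (by gcongr; exact norm_freeL_le _ _)
  set L : ℝ := ‖M₂‖ * (‖quint hs (M₁ x₀)‖ + K * ρ) with hL
  have hL0 : 0 ≤ L := by positivity
  refine ⟨min (T₀ / 2) (a / (L + 1)), by positivity, ⟨a, ha0.le⟩, ⟨L, hL0⟩,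
    ‖M₂‖₊ * (K * ‖M₁‖₊), ⟨fun t ht => ?_, fun x hx => ?_, fun t ht x hx => ?_, ?_⟩⟩
  · have ht' : |t| < T₀ := (abs_le.2 ht).trans_lt ((min_le_left _ _).trans_lt (by linarith))
    refine LipschitzOnWith.of_dist_le_mul fun x hx y hy => ?_
    rw [dist_eq_norm, dist_eq_norm, ← map_sub, ← map_sub]
    calc _ ≤ ‖M₂‖ * ‖freeL t (quint hs (M₁ (freeL (-t) x)) - quint hs (M₁ (freeL (-t) y)))‖ :=
          M₂.le_opNorm _
      _ ≤ ‖M₂‖ * (K * (‖M₁‖ * ‖x - y‖)) := by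
          gcongr
          exact (norm_freeL_le _ _).trans (hqlip t ht' x hx y hy)
      _ = _ := by push_cast; ring
  · intro t _
    refine M₂.continuous.continuousAt.comp_continuousWithinAt
      (continuousAt_freeL ?_ continuous_id)
    refine (contDiff_quint hs).continuous.continuousAt.comp_continuousWithinAt
      (M₁.continuous.continuousAt.comp_continuousWithinAt ?_)
    exact ((continuous_freeL x).comp continuous_neg).continuousWithinAt
  · have ht' : |t| < T₀ := (abs_le.2 ht).trans_lt ((min_le_left _ _).trans_lt (by linarith))
    have h1 := hin t ht' x hx
    have h2 := hK.norm_sub_le (hball h1) (hball (Metric.mem_ball_self hρ))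
    rw [Metric.mem_ball, dist_eq_norm] at h1
    change _ ≤ L
    calc _ ≤ ‖M₂‖ * ‖freeL t (quint hs (M₁ (freeL (-t) x)))‖ := M₂.le_opNorm _
      _ ≤ ‖M₂‖ * (‖quint hs (M₁ x₀)‖ + K * ρ) := by
          gcongr
          refine (norm_freeL_le _ _).trans ((norm_le_insert' _ (quint hs (M₁ x₀))).trans ?_)
          gcongr
          exact h2.trans (by gcongr)
  · change L * max (_ - 0) (0 - _) ≤ a - 0
    simp only [sub_zero, zero_sub, neg_neg, max_self]
    calc L * min (T₀ / 2) (a / (L + 1)) ≤ L * (a / (L + 1)) := by gcongr; exact min_le_right _ _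
      _ ≤ (L + 1) * (a / (L + 1)) := by gcongr; linarith
      _ = a := by field_simp

theorem exists_isSolution (hs : 3 / 2 < s) {b₁ b₂ : ℝ} (hb₁ : 0 ≤ b₁) (hb₂ : 0 ≤ b₂)
    (h₁ : ∀ k, ‖((br k ^ (s - σ) * cut χ N k : ℝ) : ℂ)‖ ≤ b₁)
    (h₂ : ∀ k, ‖-Complex.I * ((br k ^ (σ - s) * cut χ N k : ℝ) : ℂ)‖ ≤ b₂)
    {u : Coeff} (hu : u ∈ Sob σ) : ∃ T > 0, ∃ U, IsSolution χ N σ T u U := by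
  have hu' := mem_Sob_iff.1 hu
  obtain ⟨T, hT, a, L, K, hPL⟩ := exists_isPicardLindelof hs (diagL _ b₁ hb₁ h₁) (diagL _ b₂ hb₂ h₂)
    (raise σ u hu')
  obtain ⟨α, hα0, hα⟩ := hPL.exists_eq_forall_mem_Icc_hasDerivWithinAt₀
  have hd : ∀ t ∈ Ioo (-T) T, HasDerivAt α _ t := fun t ht =>
    (hα t (Ioo_subset_Icc_self ht)).hasDerivAt (Icc_mem_nhds ht.1 ht.2)
  set U : ℝ → Coeff := fun t => lower σ (freeL (-t) (α t)) with hU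
  refine ⟨T, hT, U, ?_, fun t _ => ?_, fun t ht => ?_, fun t ht k => ?_⟩
  · have e : freeL (-0) (α 0) = α 0 := by
      ext k
      change phase (-0) k * α 0 k = α 0 k
      simp
    simp only [hU, e]
    rw [hα0]
    exact lower_raise u hu'
  · rw [Sob, mem_ofPred_eq, hU]
    simp only [sobNorm_lower]
    exact enorm_lt_top
  · have hc : ContinuousAt (fun t => freeL (-t) (α t)) t := by
      have := continuousAt_freeL (S := univ) (hd t ht).continuousAt.continuousWithinAt continuous_neg
      simpa [continuousWithinAt_univ] using this
    refine (tendsto_enorm_of_continuousAt hc).congr fun t' => ?_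
    rw [← sobNorm_lower (σ := σ)]
    congr 1
    funext k
    simp only [lower, hU, Pi.sub_apply, lp.coeFn_sub, mul_sub]
  · have h1 := (coordL k).hasFDerivAt.comp_hasDerivAt t (hd t ht)
    have h2 : HasDerivAt (fun t => phase (-t) k) (-(Complex.I * nsq k * phase (-t) k)) t := 
      ((hasDerivAt_phase (-t) k).scomp t (hasDerivAt_neg t)).congr_deriv (by simp)
    have h3 := (h2.mul h1).const_mul ((br k ^ (-σ) : ℝ) : ℂ)
    refine (h3.congr_of_eventuallyEq (Eventually.of_forall fun t' => rfl)).congr_deriv ?_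
    have hlow : lower s (diagL _ b₁ hb₁ h₁ (freeL (-t) (α t))) = cutMul χ N (U t) := by
      funext k
      change ((br k ^ (-s) : ℝ) : ℂ) * (((br k ^ (s - σ) * cut χ N k : ℝ) : ℂ) *
        (phase (-t) k * α t k)) = cut χ N k * (((br k ^ (-σ) : ℝ) : ℂ) * (phase (-t) k * α t k))
      have : br k ^ (-σ) = br k ^ (-s) * br k ^ (s - σ) := by
        rw [← rpow_add (br_pos k)]; congr 1; ring
      rw [this]; push_cast; ring
    have hN := nonlin_eq (χ := χ) (N := N) (u := U t) hs
      (by rw [← hlow]; exact hsq_lower_ne_top _) k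
    rw [hN, ← hlow, ← lower_quint hs]
    have hcoord : ∀ x : L2Freq, coordL k x = x k := fun _ => rfl
    have hpow : br k ^ (-s) = br k ^ (-σ) * br k ^ (σ - s) := by
      rw [← rpow_add (br_pos k)]; congr 1; ring
    have hph := phase_neg_mul t k
    set q := quint hs (diagL _ b₁ hb₁ h₁ (freeL (-t) (α t))) with hq
    change ((br k ^ (-σ) : ℝ) : ℂ) * (-(Complex.I * nsq k * phase (-t) k) * α t k + phase (-t) k *
      (-Complex.I * ((br k ^ (σ - s) * cut χ N k : ℝ) : ℂ) * (phase t k * q k)))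
      = -Complex.I * (nsq k * (((br k ^ (-σ) : ℝ) : ℂ) * (phase (-t) k * α t k)) +
        cut χ N k * (((br k ^ (-s) : ℝ) : ℂ) * q k))
    rw [hpow]; push_cast
    linear_combination (-Complex.I * ((br k ^ (-σ) : ℝ) : ℂ) * ((br k ^ (σ - s) : ℝ) : ℂ)
      * cut χ N k * q k) * hph

lemma cut_eq_zero (hχ : IsFreqCutoff χ) {N : ℕ} (hN : N ≠ 0) {k : Freq}
    (h : (N : ℝ) ^ 2 < nsq k) :
    cut χ N k = 0 := by
  rw [cut, if_neg (by simp)]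
  refine image_eq_zero_of_notMem_tsupport fun hm => ?_
  have h1 := hχ.supp hm
  rw [mem_ball_zero_iff, norm_smul] at h1
  have h2 : ‖toEuclid k‖ ^ 2 = nsq k := by
    rw [EuclideanSpace.norm_sq_eq]; simp [toEuclid, nsq]
  have hN' : (0:ℝ) < N := by exact_mod_cast Nat.pos_of_ne_zero hN
  have h3 : ‖toEuclid k‖ < N := by
    simpa [inv_mul_lt_iff₀ hN'] using h1
  have := pow_lt_pow_left₀ h3 (norm_nonneg _) two_ne_zero
  linarith

/-- Local existence for the truncated equations. -/
theorem exists_isSolution_nat (hχ : IsFreqCutoff χ) {N : ℕ} (hN : N ≠ 0) {u : Coeff}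
    (hu : u ∈ Sob σ) : ∃ T > 0, ∃ U, IsSolution χ N σ T u U := by
  obtain ⟨C, hC1, hC⟩ := hχ.exists_bound
  have hb : ∀ (r : ℝ) (k : Freq), |br k ^ r * cut χ N k| ≤ (N + 1) ^ |r| * C := fun r k => by
    rcases lt_or_ge ((N : ℝ) ^ 2) (nsq k) with h | h
    · rw [cut_eq_zero hχ hN h]; simp; positivity
    · rw [abs_mul, abs_of_pos (rpow_pos_of_pos (br_pos k) _)]
      have h1 : br k ≤ N + 1 := by
        refine (sqrt_le_left (by positivity)).2 ?_
        have : (0:ℝ) ≤ N := by positivity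
        nlinarith
      refine mul_le_mul ?_ (hC N k) (abs_nonneg _) (by positivity)
      exact (rpow_le_rpow_of_exponent_le (one_le_br k) (le_abs_self r)).trans
        (rpow_le_rpow (br_pos k).le h1 (abs_nonneg r))
  refine exists_isSolution (s := 2) (b₁ := (N + 1) ^ |2 - σ| * C) (b₂ := (N + 1) ^ |σ - 2| * C)
    (by norm_num) (by positivity) (by positivity) (fun k => ?_) (fun k => ?_) hu
  · rw [norm_real]; exact hb _ k
  · rw [norm_mul, norm_real]; simpa using hb (σ - 2) k

/-- Local existence for the limiting equation. -/
theorem exists_isSolution_top (hs : 3 / 2 < s) {u : Coeff} (hu : u ∈ Sob s) :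
    ∃ T > 0, ∃ U, IsSolution χ ⊤ s T u U :=
  exists_isSolution hs zero_le_one zero_le_one (by simp [cut_top]) (by simp [cut_top]) hu

end

section

/-! ### A majorant for solutions, uniform in time -/

variable {s T C : ℝ} {N : ℕ∞} {u : Coeff} {V : ℝ → Coeff}

lemma ennreal_add_sq_le (a b : ℝ≥0∞) : (a + b) ^ 2 ≤ 4 * (a ^ 2 + b ^ 2) := by
  have key : ∀ a b : ℝ≥0∞, a ≤ b → (a + b) ^ 2 ≤ 4 * (a ^ 2 + b ^ 2) := fun a b h => by
    calc (a + b) ^ 2 ≤ (b + b) ^ 2 := by gcongr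
      _ = 4 * b ^ 2 := by ring
      _ ≤ _ := by gcongr; exact le_add_self
  rcases le_total a b with h | h
  · exact key a b h
  · rw [add_comm, add_comm (a ^ 2)]; exact key b a h

lemma hsq_add_le (f g : Freq → ℝ≥0∞) : hsq s (fun k => f k + g k) ≤ 4 * (hsq s f + hsq s g) := by
  rw [hsq, hsq, hsq, ← tsum_add, ← ENNReal.tsum_mul_left]
  refine tsum_le_tsum fun k => ?_
  calc _ ≤ hw s k * (4 * (f k ^ 2 + g k ^ 2)) := by gcongr; exact ennreal_add_sq_le _ _
    _ = _ := by ring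

lemma hsq_const_mul (c : ℝ≥0∞) (f : Freq → ℝ≥0∞) : hsq s (fun k => c * f k) = c ^ 2 * hsq s f := by
  rw [hsq, hsq, ← ENNReal.tsum_mul_left]
  exact tsum_congr fun k => by ring

lemma hsq_add_ne_top {f g : Freq → ℝ≥0∞} (hf : hsq s f ≠ ⊤) (hg : hsq s g ≠ ⊤) :
    hsq s (fun k => f k + g k) ≠ ⊤ :=
  ne_top_of_le_ne_top (mul_ne_top (by simp) (add_ne_top.2 ⟨hf, hg⟩))
    (hsq_add_le f g)

lemma sq_lintegral_le {α : Type*} [MeasurableSpace α] {μ : Measure α} {f : α → ℝ≥0∞}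
    (hf : AEMeasurable f μ) : (∫⁻ a, f a ∂μ) ^ 2 ≤ (∫⁻ a, f a ^ 2 ∂μ) * μ univ := by
  have h := ENNReal.lintegral_mul_le_Lp_mul_Lq μ Real.HolderConjugate.two_two hf
    (g := fun _ => 1) aemeasurable_const
  simp only [Pi.mul_apply, mul_one, rpow_two, one_pow, lintegral_const, one_mul] at h
  calc _ ≤ ((∫⁻ a, f a ^ 2 ∂μ) ^ (1 / 2 : ℝ) * μ univ ^ (1 / 2 : ℝ)) ^ 2 := by gcongr
    _ = _ := by
      rw [← mul_rpow_of_nonneg _ _ (by norm_num), ← rpow_two, ← ENNReal.rpow_mul]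
      norm_num

lemma absForm_mono {f g : Freq → ℝ≥0∞} (h : ∀ k, f k ≤ g k) (n : ℕ) (k : Freq) :
    absForm n f k ≤ absForm n g k := by
  refine tsum_le_tsum fun κ => ?_
  split_ifs
  · exact prod_le_prod' fun m _ => h _
  · exact le_rfl

lemma mag_cutMul_le (hC : ∀ k, |cut χ N k| ≤ C) (u : Coeff) (k : Freq) :
    mag (cutMul χ N u) k ≤ ofReal C * mag u k := by
  rw [mag, cutMul, enorm_mul, ← ofReal_norm (cut χ N k : ℂ), norm_real]
  exact mul_le_mul_left (ofReal_le_ofReal (hC k)) _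

lemma mag_nonlin_le (hs : 3 / 2 < s) (hC : ∀ k, |cut χ N k| ≤ C) {u : Coeff} {f : Freq → ℝ≥0∞}
    (hu : ∀ k, mag u k ≤ f k) (hf : hsq s f ≠ ⊤) (k : Freq) :
    mag (nonlin χ N u) k
      ≤ ofReal C * absForm 5 (fun k => ofReal C * f k) k := by
  have h1 : ∀ k, mag (cutMul χ N u) k ≤ ofReal C * f k := fun k =>
    (mag_cutMul_le hC u k).trans (by gcongr; exact hu k)
  have h2 : hsq s (mag (cutMul χ N u)) ≠ ⊤ := by
    refine ne_top_of_le_ne_top ?_ (hsq_mono h1)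
    rw [hsq_const_mul]
    exact mul_ne_top (pow_ne_top ofReal_ne_top) hf
  rw [mag, nonlin_eq hs h2]
  exact (mag_cutMul_le hC _ k).trans
    (mul_le_mul_right ((enorm_altForm_le 5 _ k).trans (absForm_mono h1 5 k)) _)

/-- The profile `e^{it|k|²} V_k(t)` of a solution. -/
def profile (V : ℝ → Coeff) (k : Freq) (t : ℝ) : ℂ := phase t k * V t k

lemma IsSolution.hasDerivAt_profile (hV : IsSolution χ N s T u V) {t : ℝ} (ht : t ∈ Ioo (-T) T)
    (k : Freq) : HasDerivAt (profile V k) (-Complex.I * (phase t k * nonlin χ N (V t) k)) t :=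
  ((hasDerivAt_phase t k).mul (hV.eqn t ht k)).congr_deriv (by ring)

lemma enorm_phase_mul (t : ℝ) (k : Freq) (z : ℂ) : ‖phase t k * z‖ₑ = ‖z‖ₑ := by
  rw [enorm_mul, ← ofReal_norm (phase t k), norm_phase]; simp

theorem IsSolution.exists_majorant (hs : 3 / 2 < s) (hC : ∀ k, |cut χ N k| ≤ C) (hT : 0 < T)
    (hV : IsSolution χ N s T u V) : ∃ T' > 0, T' ≤ T ∧ ∃ D : Freq → ℝ≥0∞, hsq s D ≠ ⊤ ∧
      ∀ t ∈ Ioo (-T') T', ∀ k, mag (V t) k ≤ D k ∧ mag (nonlin χ N (V t)) k ≤ D k := by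
  have h0T : (0:ℝ) ∈ Ioo (-T) T := ⟨by linarith, hT⟩
  have hu : hsq s (mag u) ≠ ⊤ := by
    have := hV.mem 0 h0T
    rwa [hV.init, mem_Sob_iff] at this
  obtain ⟨T₀, hT₀, hclose⟩ := Metric.eventually_nhds_iff.1
    ((hV.cont 0 h0T).eventually (gt_mem_nhds (zero_lt_one (α := ℝ≥0∞))))
  set T' := min (T₀) T with hT'
  set J : Set ℝ := Ioo (-T') T' with hJ
  have hJT : ∀ t ∈ J, t ∈ Ioo (-T) T := fun t ht => Ioo_subset_Ioo (by simp [hT']) (by simp [hT']) ht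
  set H : ℝ≥0∞ := 4 * (1 + hsq s (mag u)) with hH
  have hHt : H ≠ ⊤ := mul_ne_top (by simp) (add_ne_top.2 ⟨by simp, hu⟩)
  have hVH : ∀ t ∈ J, hsq s (mag (V t)) ≤ H := by
    intro t ht
    have h1 := hclose (y := t) (by
      rw [dist_zero_right, norm_eq_abs, abs_lt]
      exact ⟨by linarith [ht.1, min_le_left T₀ T], by linarith [ht.2, min_le_left T₀ T]⟩)
    have h2 : hsq s (mag (V t - V 0)) ≤ 1 := by
      change hsq s (fun k => ‖(V t - V 0) k‖ₑ) ≤ 1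
      rw [← sobNorm_sq]; exact pow_le_one₀ zero_le h1.le
    calc _ ≤ hsq s (fun k => mag (V t - V 0) k + mag u k) := hsq_mono fun k => by
          have := enorm_add_le ((V t - V 0) k) (V 0 k)
          rw [← hV.init]
          simpa [mag] using this
      _ ≤ 4 * (hsq s (mag (V t - V 0)) + hsq s (mag u)) := hsq_add_le _ _
      _ ≤ H := by rw [hH]; gcongr
  set c := ofReal C with hc
  have hct : c ≠ ⊤ := ofReal_ne_top
  set G : ℝ≥0∞ := c ^ 2 * (algConst s ^ 4 * (c ^ 2 * H) ^ 5) with hG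
  have hGt : G ≠ ⊤ := mul_ne_top (pow_ne_top hct) (mul_ne_top
    (pow_ne_top (algConst_ne_top hs)) (pow_ne_top
      (mul_ne_top (pow_ne_top hct) hHt)))
  have hnG : ∀ t ∈ J, hsq s (mag (nonlin χ N (V t))) ≤ G := by
    intro t ht
    refine (hsq_mono (mag_nonlin_le hs hC (fun _ => le_rfl)
      (ne_top_of_le_ne_top hHt (hVH t ht)))).trans ?_
    rw [hsq_const_mul, hG]
    gcongr
    refine (hsq_absForm_le (by linarith) _ 4).trans ?_
    rw [hsq_const_mul]
    gcongr
    exact hVH t ht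
  have hderiv : ∀ t ∈ J, ∀ k, ‖deriv (profile V k) t‖ₑ = mag (nonlin χ N (V t)) k := fun t ht k => by
    rw [(hV.hasDerivAt_profile (hJT t ht) k).deriv, mag, enorm_mul, enorm_phase_mul,
      ← ofReal_norm (-Complex.I)]
    simp
  set I : Freq → ℝ≥0∞ := fun k => ∫⁻ t in J, ‖deriv (profile V k) t‖ₑ with hI
  set A : Freq → ℝ≥0∞ := fun k => mag u k + I k with hA
  have hIm : ∀ k, Measurable fun t => ‖deriv (profile V k) t‖ₑ := fun k =>
    (measurable_deriv _).enorm
  have hJvol : volume J ≠ ⊤ := by simp [hJ]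
  have hIt : hsq s I ≠ ⊤ := by
    have h1 : hsq s I ≤ ∑' k, hw s k * ((∫⁻ t in J, ‖deriv (profile V k) t‖ₑ ^ 2) * volume J) := by
      refine tsum_le_tsum fun k => ?_
      gcongr
      simpa using sq_lintegral_le (μ := volume.restrict J) (hIm k).aemeasurable
    have h2 : ∑' k, hw s k * ((∫⁻ t in J, ‖deriv (profile V k) t‖ₑ ^ 2) * volume J)
        = (∫⁻ t in J, ∑' k, hw s k * ‖deriv (profile V k) t‖ₑ ^ 2) * volume J := by
      rw [lintegral_tsum fun k => (((hIm k).pow_const 2).const_mul _).aemeasurable,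
        ← ENNReal.tsum_mul_right]
      refine tsum_congr fun k => ?_
      rw [lintegral_const_mul _ ((hIm k).pow_const 2), mul_assoc]
    refine ne_top_of_le_ne_top (mul_ne_top (mul_ne_top hGt hJvol) hJvol)
      (h1.trans (h2.le.trans ?_))
    gcongr
    rw [← setLIntegral_const]
    refine setLIntegral_mono measurable_const fun t ht => ?_
    refine le_trans (le_of_eq (tsum_congr fun k => ?_)) (hnG t ht)
    rw [hderiv t ht]
  have hAt : hsq s A ≠ ⊤ := hsq_add_ne_top hu hIt
  have hVA : ∀ t ∈ J, ∀ k, mag (V t) k ≤ A k := by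
    intro t ht k
    have h0J : (0:ℝ) ∈ J := ⟨by simp [hT', hT₀, hT], by simp [hT', hT₀, hT]⟩
    have hsub : uIcc 0 t ⊆ J := ordConnected_Ioo.uIcc_subset h0J ht
    have hbd : ∀ τ ∈ J, ‖deriv (profile V k) τ‖ ≤ (G ^ (1 / 2 : ℝ)).toReal := by
      intro τ hτ
      have h1 := (sq_le_hsq (by linarith) (mag (nonlin χ N (V τ))) k).trans (hnG τ hτ)
      rw [← hderiv τ hτ k] at h1
      rw [← toReal_enorm]
      refine toReal_mono (ENNReal.rpow_ne_top_of_nonneg (by norm_num) hGt) ?_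
      rwa [one_div, ENNReal.le_rpow_inv_iff (by norm_num), rpow_two]
    have hint : IntervalIntegrable (deriv (profile V k)) volume 0 t := by
      rw [intervalIntegrable_iff]
      refine Measure.integrableOn_of_bounded (by simp [uIoc])
        (measurable_deriv _).aestronglyMeasurable
        ((ae_restrict_iff' measurableSet_uIoc).2 (ae_of_all _ fun τ hτ =>
          hbd τ (hsub (uIoc_subset_uIcc hτ))))
    have hft := intervalIntegral.integral_eq_sub_of_hasDerivAt (fun τ hτ =>
      (hV.hasDerivAt_profile (hJT τ (hsub hτ)) k).differentiableAt.hasDerivAt) hint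
    have h1 : ‖profile V k t - profile V k 0‖ₑ ≤ I k := by
      rw [← hft, ← ofReal_norm, intervalIntegral.norm_integral_eq_norm_integral_uIoc, ofReal_norm]
      exact (enorm_integral_le_lintegral_enorm _).trans
        (lintegral_mono_set (uIoc_subset_uIcc.trans hsub))
    have h2 : mag (V t) k = ‖profile V k t‖ₑ := (enorm_phase_mul t k _).symm
    have h3 : mag u k = ‖profile V k 0‖ₑ := by rw [profile, enorm_phase_mul, hV.init]; rfl
    rw [h2, hA]
    simp only [h3]
    calc _ = ‖profile V k 0 + (profile V k t - profile V k 0)‖ₑ := by congr 1; ring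
      _ ≤ _ := (enorm_add_le _ _).trans (add_le_add le_rfl h1)
  have hcA : hsq s (fun k => c * A k) ≠ ⊤ := by
    rw [hsq_const_mul]; exact mul_ne_top (pow_ne_top hct) hAt
  refine ⟨T', by simp [hT', hT₀, hT], min_le_right _ _,
    fun k => A k + c * absForm 5 (fun k => c * A k) k, hsq_add_ne_top hAt ?_, fun t ht k => ⟨?_, ?_⟩⟩
  · rw [hsq_const_mul]
    exact mul_ne_top (pow_ne_top hct) (absForm_ne_top hs hcA 4)
  · exact (hVA t ht k).trans le_self_add
  · exact (mag_nonlin_le hs hC (hVA t ht) hAt k).trans le_add_self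

end

section

/-! ### Symmetrization of the forms on the hyperplane -/

variable {s δ C : ℝ} {N : ℕ∞} {n u : Coeff}
  {D : Freq → ℝ≥0∞}

open scoped Classical in
/-- The restriction of a multiplier to the tuples with alternating sum zero. -/
def onPlane {n : ℕ} (c : (Fin n → Freq) → ℝ) (κ : Fin n → Freq) : ℝ :=
  if altSum κ = 0 then c κ else 0

/-- The monomial of `u`, with `n` in place of `u` in the slot `m`. -/
def slotForm (m : Fin 6) (n u : Coeff) (κ : Fin 6 → Freq) : ℂ :=
  ∏ j, twist (slotConj j) (if j = m then n (κ j) else u (κ j))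

lemma slotConj_sub : ∀ j m : Fin 6, slotConj (j - m) = xor (slotConj j) (slotConj m) := by decide

lemma twist_xor (b b' : Bool) (z : ℂ) : twist (xor b b') z = twist b (twist b' z) := by
  cases b <;> cases b' <;> simp

lemma twist_prod {ι : Type*} (t : Finset ι) (b : Bool) (f : ι → ℂ) :
    twist b (∏ i ∈ t, f i) = ∏ i ∈ t, twist b (f i) := by
  cases b <;> simp

lemma im_twist : ∀ (m : Fin 6) (z : ℂ), (twist (slotConj m) z).im = (-1) ^ (m : ℕ) * z.im := by
  intro m z
  fin_cases m <;> simp [slotConj] <;> ring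

lemma slotForm_reflect (m : Fin 6) (κ : Fin 6 → Freq) :
    slotForm m n u (reflectSlots m κ) = twist (slotConj m) (slotForm 0 n u κ) := by
  rw [slotForm, slotForm, twist_prod, ← (Equiv.subLeft m).prod_comp]
  refine prod_congr rfl fun j _ => ?_
  simp only [Equiv.subLeft_apply, reflectSlots_apply, sub_sub_cancel, sub_eq_self, slotConj_sub,
    twist_xor]

lemma mono_reflect (m : Fin 6) (κ : Fin 6 → Freq) :
    mono u (reflectSlots m κ) = twist (slotConj m) (mono u κ) := by
  simpa [slotForm, mono] using slotForm_reflect (n := u) (u := u) m κ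

lemma onPlane_reflect {b : (Fin 6 → Freq) → ℝ} {m : Fin 6} {κ : Fin 6 → Freq}
    (hb : b (reflectSlots m κ) = b κ) : onPlane b (reflectSlots m κ) = onPlane b κ := by
  have h : altSum (reflectSlots m κ) = 0 ↔ altSum κ = 0 := by
    rw [← altSum_sub_eq_zero_iff κ m]
    exact Iff.of_eq (congrArg (· = 0) (congrArg altSum (funext fun j => reflectSlots_apply m κ j)))
  simp only [onPlane, h, hb]

lemma tsum_onPlane_reflect {b : (Fin 6 → Freq) → ℝ} {m : Fin 6}
    (hb : ∀ κ, b (reflectSlots m κ) = b κ) {z : Fin 6 → (Fin 6 → Freq) → ℝ}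
    (hz : ∀ κ, z m (reflectSlots m κ) = (-1) ^ (m : ℕ) * z 0 κ) :
    ∑' κ, onPlane b κ * ((-1) ^ (m : ℕ) * z m κ) = ∑' κ, onPlane b κ * z 0 κ := by
  rw [← (reflectSlots m).tsum_eq]
  refine tsum_congr fun κ => ?_
  rw [onPlane_reflect (hb κ), hz, ← mul_assoc ((-1 : ℝ) ^ _), ← mul_pow]
  simp

lemma altReal_reflect (f : Freq → ℝ) (m : Fin 6) (κ : Fin 6 → Freq) :
    ∑ j : Fin 6, (-1 : ℝ) ^ (j : ℕ) * f (reflectSlots m κ j)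
      = (-1) ^ (m : ℕ) * ∑ j : Fin 6, (-1 : ℝ) ^ (j : ℕ) * f (κ j) := by
  simpa [reflectSlots_apply, zsmul_eq_mul] using sum_neg_one_pow_sub (fun j => f (κ j)) m

lemma prod_cut_reflect (m : Fin 6) (κ : Fin 6 → Freq) :
    ∏ j, cut χ N (reflectSlots m κ j) = ∏ j, cut χ N (κ j) := by
  simp only [reflectSlots_apply]
  exact (Equiv.subLeft m).prod_comp fun j => cut χ N (κ j)

lemma corrMul_reflect (hη : IsBump η) (m : Fin 6) (κ : Fin 6 → Freq) :
    corrMul χ η s δ N (reflectSlots m κ) = corrMul χ η s δ N κ := by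
  have h1 : Om (reflectSlots m κ) = (-1) ^ (m : ℕ) * Om κ := altReal_reflect nsq m κ
  have h2 : psi s (reflectSlots m κ) = (-1) ^ (m : ℕ) * psi s κ :=
    altReal_reflect (fun k => nsq k ^ s) m κ
  have h3 : lam (reflectSlots m κ) = lam κ := by
    simp only [lam, reflectSlots_apply]
    exact congrArg sqrt ((Equiv.subLeft m).sum_comp fun j => nsq (κ j))
  rw [corrMul, corrMul, prod_cut_reflect, h1, h2, h3]
  rcases neg_one_pow_eq_or ℝ (m : ℕ) with h | h
  · simp [h]
  · rw [h, neg_one_mul, neg_one_mul, hη.cutInv_neg]; ring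

/-! ### Absolute convergence -/

/-- The majorant of the six-linear forms. -/
def planeBound (s : ℝ) (D : Freq → ℝ≥0∞) (κ : Fin 6 → Freq) : ℝ≥0∞ :=
  if altSum κ = 0 then (∑ j, hw s (κ j)) * ∏ m, D (κ m) else 0

lemma tsum_planeBound_ne_top (hs : 3 / 2 < s) (hD : hsq s D ≠ ⊤) : ∑' κ, planeBound s D κ ≠ ⊤ :=
  tsum_hw_prod_ne_top hs hD

lemma enorm_onPlane_mul_le {w : (Fin 6 → Freq) → ℝ} {K : ℝ} (hK : 0 ≤ K)
    (hw : ∀ κ, |w κ| ≤ K * ∑ j, br (κ j) ^ (2 * s)) {z : ℂ} {κ : Fin 6 → Freq}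
    (hz : ‖z‖ₑ ≤ ∏ m, D (κ m)) :
    ‖(onPlane w κ : ℂ) * z‖ₑ ≤ ofReal K * planeBound s D κ := by
  rw [onPlane, planeBound]
  split_ifs
  · rw [enorm_mul, ← mul_assoc, ← ofReal_norm (w κ : ℂ), norm_real, norm_eq_abs]
    have e : ofReal K * ∑ j, NLSEnergy.hw s (κ j)
        = ofReal (K * ∑ j, br (κ j) ^ (2 * s)) := by
      rw [ofReal_mul hK, ENNReal.ofReal_sum_of_nonneg fun j _ =>
        (rpow_pos_of_pos (br_pos _) _).le]
      rfl
    rw [e]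
    gcongr
    exact hw κ
  · simp

lemma summable_onPlane (hs : 3 / 2 < s) (hD : hsq s D ≠ ⊤) {w : (Fin 6 → Freq) → ℝ} {K : ℝ}
    (hK : 0 ≤ K) (hw : ∀ κ, |w κ| ≤ K * ∑ j, br (κ j) ^ (2 * s)) {z : (Fin 6 → Freq) → ℂ}
    (hz : ∀ κ, ‖z κ‖ₑ ≤ ∏ m, D (κ m)) : Summable fun κ => (onPlane w κ : ℂ) * z κ := by
  refine (summable_norm_of_enorm (ne_top_of_le_ne_top
    (b := ofReal K * ∑' κ, planeBound s D κ) (mul_ne_top ofReal_ne_top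
    (tsum_planeBound_ne_top hs hD)) ?_)).of_norm
  rw [← ENNReal.tsum_mul_left]
  exact tsum_le_tsum fun κ => enorm_onPlane_mul_le hK hw (hz κ)

lemma enorm_slotForm_le (hn : ∀ k, mag n k ≤ D k) (hu : ∀ k, mag u k ≤ D k) (m : Fin 6)
    (κ : Fin 6 → Freq) : ‖slotForm m n u κ‖ₑ ≤ ∏ j, D (κ j) := by
  have : slotForm m n u κ = ∏ j, twist (slotConj j) (if j = m then n (κ j) else u (κ j)) := rfl
  rw [this, enorm_eq_nnnorm, nnnorm_prod, ENNReal.ofNNReal_finsetProd]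
  refine prod_le_prod' fun j _ => ?_
  have e : ∀ z : ℂ, (‖twist (slotConj j) z‖₊ : ℝ≥0∞) = ‖z‖ₑ := fun z => by
    rw [enorm_eq_nnnorm]; congr 1; exact NNReal.eq (norm_twist _ _)
  rw [e]
  split_ifs
  · exact hn _
  · exact hu _

lemma enorm_mono_le (hu : ∀ k, mag u k ≤ D k) (κ : Fin 6 → Freq) : ‖mono u κ‖ₑ ≤ ∏ j, D (κ j) := by
  rw [enorm_mono]; exact prod_le_prod' fun j _ => hu _

lemma nsq_rpow_le (hs : 0 ≤ s) (k : Freq) : nsq k ^ s ≤ br k ^ (2 * s) := by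
  rw [← one_add_nsq_rpow]
  exact rpow_le_rpow (nsq_nonneg k) (by linarith) hs

lemma sum_br_rpow_nonneg (s : ℝ) (κ : Fin 6 → Freq) : 0 ≤ ∑ j, br (κ j) ^ (2 * s) :=
  sum_nonneg fun _ _ => (rpow_pos_of_pos (br_pos _) _).le

lemma abs_psi_le_sum (hs : 0 ≤ s) (κ : Fin 6 → Freq) : |psi s κ| ≤ ∑ j, br (κ j) ^ (2 * s) := by
  refine (abs_sum_le_sum_abs _ _).trans (sum_le_sum fun j _ => ?_)
  rw [abs_mul, abs_pow, abs_neg, abs_one, one_pow, one_mul,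
    abs_of_nonneg (rpow_nonneg (nsq_nonneg _) _)]
  exact nsq_rpow_le hs _

lemma abs_mul_psi_mul_cut_le (hs : 0 ≤ s) (hC : ∀ N k, |cut χ N k| ≤ C) {a b : ℝ} (ha : |a| ≤ b)
    (κ : Fin 6 → Freq) :
    |a * psi s κ * ∏ m, cut χ N (κ m)| ≤ b * C ^ 6 * ∑ j, br (κ j) ^ (2 * s) := by
  rw [abs_mul, abs_mul]
  have h1 := abs_psi_le_sum hs κ
  have h2 := abs_prod_cut_le hC N κ
  have h3 : 0 ≤ b := (abs_nonneg _).trans ha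
  have h4 := sum_br_rpow_nonneg s κ
  calc _ ≤ b * (∑ j, br (κ j) ^ (2 * s)) * C ^ 6 := by gcongr
    _ = _ := by ring

lemma mono_cutMul {n : ℕ} (κ : Fin n → Freq) :
    mono (cutMul χ N u) κ = ((∏ m, cut χ N (κ m) : ℝ) : ℂ) * mono u κ := by
  simp only [mono, cutMul, twist_mul, twist_ofReal, Finset.prod_mul_distrib, Complex.ofReal_prod]

/-! ### The nonlinearity inserted into the quadratic and six-linear forms -/

lemma conj_nonlin (hs : 3 / 2 < s) (hu : hsq s (mag (cutMul χ N u)) ≠ ⊤) (k : Freq) :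
    u k * conj (nonlin χ N u k) = ∑' κ : Fin 5 → Freq,
      ((onPlane (fun κ => ∏ m, cut χ N (κ m)) (Fin.cons k κ : Fin (5 + 1) → Freq) : ℝ) : ℂ) *
        mono u (Fin.cons k κ : Fin (5 + 1) → Freq) := by
  rw [nonlin_eq hs hu, altForm, map_mul, conj_ofReal, conj_tsum, ← tsum_mul_left,
    ← tsum_mul_left]
  refine tsum_congr fun κ => ?_
  simp only [onPlane, altSum_cons_eq_iff, sub_zero, mono_cutMul, mono_cons, Fin.prod_univ_succ,
    Fin.cons_zero, Fin.cons_succ]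
  split_ifs
  · rw [map_mul, conj_ofReal]; push_cast; ring
  · simp

theorem tsum_mass_eq (hs : 3 / 2 < s) (hC : ∀ N k, |cut χ N k| ≤ C) (hD : hsq s D ≠ ⊤)
    (hu : ∀ k, mag u k ≤ D k) (huc : hsq s (mag (cutMul χ N u)) ≠ ⊤) :
    Summable (fun k => ((1 + nsq k ^ s : ℝ) : ℂ) * (u k * conj (nonlin χ N u k))) ∧
    6 * (∑' k, ((1 + nsq k ^ s : ℝ) : ℂ) * (u k * conj (nonlin χ N u k))).im
      = ∑' κ, onPlane (fun κ => psi s κ * ∏ m, cut χ N (κ m)) κ * (mono u κ).im := by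
  have hs0 : 0 ≤ s := by linarith
  have hC0 : 0 ≤ C := (abs_nonneg _).trans (hC 0 0)
  have hw : ∀ (m : Fin 6) (κ : Fin 6 → Freq), |(1 + nsq (κ m) ^ s) * ∏ j, cut χ N (κ j)|
      ≤ 2 * C ^ 6 * ∑ j, br (κ j) ^ (2 * s) := by
    intro m κ
    rw [abs_mul, abs_of_nonneg (by linarith [rpow_nonneg (nsq_nonneg (κ m)) s])]
    have h1 : 1 + nsq (κ m) ^ s ≤ 2 * ∑ j, br (κ j) ^ (2 * s) := by
      have h2 := nsq_rpow_le hs0 (κ m)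
      have h3 : 1 ≤ br (κ m) ^ (2 * s) := one_le_rpow (one_le_br _) (by linarith)
      have h4 := single_le_sum (f := fun j => br (κ j) ^ (2 * s))
        (fun j _ => (rpow_pos_of_pos (br_pos (κ j)) _).le) (Finset.mem_univ m)
      linarith
    calc _ ≤ (2 * ∑ j, br (κ j) ^ (2 * s)) * C ^ 6 :=
          mul_le_mul h1 (abs_prod_cut_le hC N κ) (abs_nonneg _)
            (mul_nonneg zero_le_two (sum_br_rpow_nonneg s κ))
      _ = _ := by ring
  set W : Fin 6 → (Fin 6 → Freq) → ℝ := fun m κ => (1 + nsq (κ m) ^ s) * ∏ j, cut χ N (κ j) with hW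
  have hsum : ∀ m, Summable fun κ => (onPlane (W m) κ : ℂ) * mono u κ := fun m =>
    summable_onPlane hs hD (by positivity) (hw m) (enorm_mono_le hu)
  have hterm : ∀ k, ((1 + nsq k ^ s : ℝ) : ℂ) * (u k * conj (nonlin χ N u k))
      = ∑' κ : Fin 5 → Freq, ((onPlane (W 0) (Fin.cons k κ : Fin (5 + 1) → Freq) : ℝ) : ℂ) *
        mono u (Fin.cons k κ : Fin (5 + 1) → Freq) := by
    intro k
    rw [conj_nonlin hs huc, ← tsum_mul_left]
    refine tsum_congr fun κ => ?_
    rw [← mul_assoc, ← Complex.ofReal_mul]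
    congr 2
    simp only [onPlane, hW, mul_ite, mul_zero, Fin.cons_zero]
  have hcons := (Fin.consEquiv fun _ : Fin (5 + 1) => Freq).summable_iff.2 (hsum 0)
  have hS : Summable (fun k => ((1 + nsq k ^ s : ℝ) : ℂ) * (u k * conj (nonlin χ N u k))) := by
    simp only [hterm]
    exact hcons.prod
  have hT : ∑' k, ((1 + nsq k ^ s : ℝ) : ℂ) * (u k * conj (nonlin χ N u k))
      = ∑' κ, (onPlane (W 0) κ : ℂ) * mono u κ := by
    simp only [hterm]
    rw [← (Fin.consEquiv fun _ : Fin (5 + 1) => Freq).tsum_eq]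
    exact hcons.tsum_prod.symm
  have him : ∀ m, Summable fun κ => onPlane (W m) κ * (mono u κ).im := fun m => by
    simpa using hasSum_im (hsum m).hasSum |>.summable
  have hsym : ∀ m : Fin 6, ∑' κ, (-1) ^ (m : ℕ) * (onPlane (W m) κ * (mono u κ).im)
      = ∑' κ, onPlane (W 0) κ * (mono u κ).im := by
    intro m
    have := tsum_onPlane_reflect (b := fun κ => ∏ j, cut χ N (κ j)) (m := m)
      (fun κ => prod_cut_reflect m κ) (z := fun m κ => (1 + nsq (κ m) ^ s) * (mono u κ).im)
      (fun κ => by rw [mono_reflect, im_twist, reflectSlots_apply, sub_self]; ring)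
    refine Eq.trans (tsum_congr fun κ => ?_) (this.trans (tsum_congr fun κ => ?_)) <;>
    · simp only [onPlane, hW]; split_ifs <;> ring
  refine ⟨hS, ?_⟩
  rw [hT, im_tsum (hsum 0)]
  simp only [im_ofReal_mul]
  calc _ = ∑ m : Fin 6, ∑' κ, (-1) ^ (m : ℕ) * (onPlane (W m) κ * (mono u κ).im) := by
        rw [sum_congr rfl fun m _ => hsym m]; simp
    _ = _ := by
        rw [← Summable.tsum_finsetSum fun m _ => (him m).mul_left _]
        refine tsum_congr fun κ => ?_
        simp only [onPlane, hW, psi]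
        split_ifs
        · simp only [Fin.sum_univ_six]; simp; ring
        · simp

end

section

/-! ### The nonlinearity inserted into the correction -/

variable {s δ C : ℝ} {N : ℕ∞} {n u : Coeff}
  {D : Freq → ℝ≥0∞}

lemma slotForm_cons (a : Freq) (κ : Fin 5 → Freq) :
    slotForm 0 n u (Fin.cons a κ : Fin (5 + 1) → Freq) = n a * conj (mono u κ) := by
  have h : slotForm 0 n u (Fin.cons a κ : Fin (5 + 1) → Freq) = ∏ j : Fin (5 + 1),
    twist (slotConj j) (if j = 0 then n ((Fin.cons a κ : Fin (5 + 1) → Freq) j)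
      else u ((Fin.cons a κ : Fin (5 + 1) → Freq) j)) := rfl
  rw [h, Fin.prod_univ_succ]
  simp only [mono, map_prod, conj_twist, Fin.cons_zero, Fin.cons_succ, slotConj_succ',
    Fin.succ_ne_zero, if_false, if_true]
  rfl

lemma mono_append (κ κ' : Fin 5 → Freq) :
    mono u (Fin.append κ κ' : Fin (5 + 5) → Freq) = mono u κ * conj (mono u κ') := by
  simp only [mono, map_prod, conj_twist, Fin.prod_univ_add, Fin.append_left, Fin.append_right]
  congr 1

lemma altSum_append (κ κ' : Fin 5 → Freq) :
    altSum (Fin.append κ κ' : Fin (5 + 5) → Freq) = altSum κ - altSum κ' := by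
  simp only [altSum, Fin.sum_univ_add, Fin.append_left, Fin.append_right, Fin.val_castAdd,
    Fin.val_natAdd, pow_add]
  rw [sub_eq_add_neg, ← sum_neg_distrib]
  congr 1
  exact sum_congr rfl fun m _ => by norm_num

lemma tenMul_append (κ κ' : Fin 5 → Freq) (h : altSum κ = altSum κ') :
    tenMul χ η s δ N (Fin.append κ κ' : Fin (5 + 5) → Freq)
      = corrMul χ η s δ N (Fin.cons (altSum κ') κ' : Fin (5 + 1) → Freq) *
        (cut χ N (altSum κ') * ∏ m, cut χ N (κ m)) := by
  have h1 : kOne (Fin.append κ κ' : Fin (5 + 5) → Freq) = altSum κ' := by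
    simp [kOne, Fin.append_left, h]
  have h2 : toSix (Fin.append κ κ' : Fin (5 + 5) → Freq)
      = (Fin.cons (altSum κ') κ' : Fin (5 + 1) → Freq) := by
    rw [toSix, h1]
    congr 1
    funext m
    exact Fin.append_right κ κ' m
  have h3 : ∏ m, cut χ N ((Fin.append κ κ' : Fin (5 + 5) → Freq) m)
      = (∏ m, cut χ N (κ m)) * ∏ m, cut χ N (κ' m) := by
    simp only [Fin.prod_univ_add, Fin.append_left, Fin.append_right]
  have h4 : ∏ m, cut χ N ((Fin.cons (altSum κ') κ' : Fin (5 + 1) → Freq) m)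
      = cut χ N (altSum κ') * ∏ m, cut χ N (κ' m) := by
    simp only [Fin.prod_univ_succ (n := 5), Fin.cons_zero, Fin.cons_succ]
  rw [tenMul, corrMul, h1, h2]
  refine Eq.trans (congrArg _ (congrArg _ h3)) (Eq.trans ?_
    (congrArg (fun x => _ * x * _) h4.symm))
  ring

theorem tsum_ten_eq (hs : 3 / 2 < s) (hη : IsBump η) (hδ : 0 ≤ δ)
    (hC : ∀ N k, |cut χ N k| ≤ C) (hD : hsq s D ≠ ⊤) (hu : ∀ k, mag u k ≤ D k)
    (huc : hsq s (mag (cutMul χ N u)) ≠ ⊤)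
    (hform : ∀ k, absForm 5 (mag (cutMul χ N u)) k ≤ D k) :
    Summable (fun κ : Fin 10 → Freq => (onPlane (tenMul χ η s δ N) κ : ℂ) * mono u κ) ∧
    ∑' κ, (onPlane (corrMul χ η s δ N) κ : ℂ) * slotForm 0 (nonlin χ N u) u κ
      = ∑' κ : Fin 10 → Freq, (onPlane (tenMul χ η s δ N) κ : ℂ) * mono u κ := by
  set c := corrMul χ η s δ N with hc
  have hC0 : 0 ≤ C := (abs_nonneg _).trans (hC 0 0)
  have hcb : ∀ κ, |c κ| ≤ 2 * C ^ 6 * ∑ j, br (κ j) ^ (2 * s) := fun κ =>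
    abs_mul_psi_mul_cut_le (by linarith) hC (hη.abs_cutInv_lam_le hδ κ) κ
  let ι : (Fin 5 → Freq) → (Fin (5 + 1) → Freq) := fun κ => Fin.cons (altSum κ) κ
  have hι : Function.Injective ι := fun κ κ' h => (Fin.cons_inj.1 h).2
  have hι0 : ∀ κ, altSum (ι κ) = 0 := fun κ => by simp only [ι, altSum_cons, sub_self]
  have hrange : ∀ κ : Fin (5 + 1) → Freq, altSum κ = 0 → κ ∈ range ι := fun κ h => by
    refine ⟨Fin.tail κ, ?_⟩
    have h2 : κ 0 = altSum (Fin.tail κ) := by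
      rw [← Fin.cons_self_tail κ, altSum_cons] at h
      exact sub_eq_zero.1 h
    simp only [ι, ← h2, Fin.cons_self_tail]
  set f : Freq → (Fin 5 → Freq) → ℂ := fun a κ =>
    if altSum κ = a then mono (cutMul χ N u) κ else 0 with hf
  let e : (Fin 5 → Freq) × (Fin 5 → Freq) ≃ (Fin (5 + 5) → Freq) :=
    (Equiv.prodComm _ _).trans (Fin.appendEquiv 5 5)
  set F : (Fin 10 → Freq) → ℂ := fun κ => (onPlane (tenMul χ η s δ N) κ : ℂ) * mono u κ with hF
  have hFe : ∀ κ' κ, F (e (κ', κ)) = ((c (ι κ') : ℝ) : ℂ) * (cut χ N (altSum κ') *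
      f (altSum κ') κ) * conj (mono u κ') := by
    intro κ' κ
    change (onPlane (tenMul χ η s δ N) (Fin.append κ κ' : Fin (5 + 5) → Freq) : ℂ) *
      mono u (Fin.append κ κ' : Fin (5 + 5) → Freq) = _
    rw [mono_append]
    simp only [onPlane, altSum_append, sub_eq_zero, hf]
    split_ifs with h
    · rw [tenMul_append κ κ' h, mono_cutMul]
      push_cast; ring
    · simp
  have hsum : Summable (F ∘ e) := by
    refine (summable_norm_of_enorm (ne_top_of_le_ne_top
      (b := ofReal (2 * C ^ 6 * C) * ∑' κ, planeBound s D κ)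
      (mul_ne_top ofReal_ne_top (tsum_planeBound_ne_top hs hD)) ?_)).of_norm
    rw [ENNReal.tsum_prod', ← ENNReal.tsum_mul_left]
    refine le_trans (tsum_le_tsum fun κ' => ?_)
      (ENNReal.tsum_comp_le_tsum_of_injective hι fun κ =>
        ofReal (2 * C ^ 6 * C) * planeBound s D κ)
    simp only [comp_apply, hFe, enorm_mul, ENNReal.tsum_mul_left, ENNReal.tsum_mul_right]
    rw [tsum_enorm_altForm]
    have h1 := enorm_onPlane_mul_le (D := D) (by positivity) hcb (κ := ι κ')
      (z := slotForm 0 (fun k => ((absForm 5 (mag (cutMul χ N u)) k).toReal : ℂ)) u (ι κ')) ?_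
    · have h2 : onPlane c (ι κ') = c (ι κ') := if_pos (hι0 κ')
      rw [h2, show slotForm 0 _ u (ι κ') = _ from slotForm_cons _ κ', enorm_mul, enorm_mul] at h1
      have h3 : ‖((absForm 5 (mag (cutMul χ N u)) (altSum κ')).toReal : ℂ)‖ₑ
          = absForm 5 (mag (cutMul χ N u)) (altSum κ') := by
        rw [← ofReal_norm, norm_real, norm_of_nonneg toReal_nonneg,
          ENNReal.ofReal_toReal (ne_top_of_hsq (by linarith) (absForm_ne_top hs huc 4) _)]
      rw [h3] at h1
      have h4 : ‖(cut χ N (altSum κ') : ℂ)‖ₑ ≤ ofReal C := by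
        rw [← ofReal_norm, norm_real]; exact ofReal_le_ofReal (hC N _)
      calc _ = ‖(cut χ N (altSum κ') : ℂ)‖ₑ * (‖((c (ι κ') : ℝ) : ℂ)‖ₑ *
            (absForm 5 (mag (cutMul χ N u)) (altSum κ') * ‖conj (mono u κ')‖ₑ)) := by ring
        _ ≤ ofReal C * (ofReal (2 * C ^ 6) * planeBound s D (ι κ')) :=
          mul_le_mul' h4 h1
        _ = _ := by
          rw [← mul_assoc, ← ofReal_mul hC0, mul_comm C]
    · refine enorm_slotForm_le (fun k => ?_) hu 0 _
      rw [mag, ← ofReal_norm, norm_real, norm_of_nonneg toReal_nonneg]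
      exact ENNReal.ofReal_toReal_le.trans (hform k)
  refine ⟨e.summable_iff.1 hsum, ?_⟩
  change _ = ∑' κ, F κ
  rw [← e.tsum_eq]
  refine Eq.trans (Eq.symm (hι.tsum_eq fun κ hκ => hrange κ ?_)) (Eq.trans ?_ hsum.tsum_prod.symm)
  · by_contra h
    exact hκ (by simp [onPlane, h])
  · refine tsum_congr fun κ' => ?_
    have h2 : onPlane c (ι κ') = c (ι κ') := if_pos (hι0 κ')
    simp only [comp_apply, hFe]
    rw [h2, show slotForm 0 _ u (ι κ') = _ from slotForm_cons _ κ', nonlin_eq hs huc, altForm,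
      tsum_mul_right, tsum_mul_left, tsum_mul_left]
    ring

end

section

/-! ### The time derivative of the modified energy -/

variable {s σ δ C T : ℝ} {N : ℕ∞} {u : Coeff}
  {V : ℝ → Coeff} {D : Freq → ℝ≥0∞}

lemma hasDerivAt_tsum_of_enorm_le {ι E : Type*} [NormedAddCommGroup E] [NormedSpace ℝ E]
    [CompleteSpace E] (hT : 0 < T) {g g' : ι → ℝ → E} {b b₀ : ι → ℝ≥0∞} (hb : ∑' i, b i ≠ ⊤)
    (hb₀ : ∑' i, b₀ i ≠ ⊤) (hg : ∀ i, ∀ t ∈ Ioo (-T) T, HasDerivAt (g i) (g' i t) t)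
    (hg' : ∀ i, ∀ t ∈ Ioo (-T) T, ‖g' i t‖ₑ ≤ b i) (h0 : ∀ i, ‖g i 0‖ₑ ≤ b₀ i) :
    HasDerivAt (fun t => ∑' i, g i t) (∑' i, g' i 0) 0 := by
  have hm : (0:ℝ) ∈ Ioo (-T) T := ⟨by linarith, hT⟩
  have e : ∀ {x : E} {a : ℝ≥0∞}, a ≠ ⊤ → ‖x‖ₑ ≤ a → ‖x‖ ≤ a.toReal := fun ha h => by
    rw [← toReal_enorm]; exact toReal_mono ha h
  exact hasDerivAt_tsum_of_isPreconnected (ENNReal.summable_toReal hb) isOpen_Ioo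
    isPreconnected_Ioo hg (fun i t ht => e (ENNReal.ne_top_of_tsum_ne_top hb i) (hg' i t ht)) hm
    (Summable.of_norm_bounded (ENNReal.summable_toReal hb₀) fun i =>
      e (ENNReal.ne_top_of_tsum_ne_top hb₀ i) (h0 i)) hm

lemma hasDerivAt_mono {n : Coeff} {t : ℝ}
    (h : ∀ k, HasDerivAt (fun t' => V t' k) (-Complex.I * ((nsq k : ℂ) * V t k + n k)) t)
    (κ : Fin 6 → Freq) : HasDerivAt (fun t' => mono (V t') κ)
      (-Complex.I * ((Om κ : ℂ) * mono (V t) κ +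
        ∑ m : Fin 6, (-1 : ℂ) ^ (m : ℕ) * slotForm m n (V t) κ)) t := by
  have h1 : ∀ m : Fin 6, HasDerivAt (fun t' => twist (slotConj m) (V t' (κ m)))
      (-Complex.I * ((-1) ^ (m : ℕ) * ((nsq (κ m) : ℂ) * twist (slotConj m) (V t (κ m)) +
        twist (slotConj m) (n (κ m))))) t := by
    intro m
    have h2 : (slotConj m = false ∧ (-1 : ℂ) ^ (m : ℕ) = 1) ∨
        (slotConj m = true ∧ (-1 : ℂ) ^ (m : ℕ) = -1) := by
      fin_cases m <;> norm_num [slotConj]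
    rcases h2 with ⟨h2, h3⟩ | ⟨h2, h3⟩ <;> rw [h2, h3]
    · exact (h (κ m)).congr_deriv (by simp)
    · exact (h (κ m)).star.congr_deriv (by simp; ring)
  have h4 := HasDerivAt.fun_finsetProd (u := Finset.univ) fun m _ => h1 m
  refine HasDerivAt.congr_deriv h4 ?_
  rw [Om, ofReal_sum, sum_mul, ← sum_add_distrib, mul_sum]
  refine sum_congr rfl fun m _ => ?_
  have h5 : mono (V t) κ = twist (slotConj m) (V t (κ m)) *
      ∏ j ∈ Finset.univ.erase m, twist (slotConj j) (V t (κ j)) :=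
    (mul_prod_erase _ _ (Finset.mem_univ m)).symm
  have h6 : slotForm m n (V t) κ = twist (slotConj m) (n (κ m)) *
      ∏ j ∈ Finset.univ.erase m, twist (slotConj j) (V t (κ j)) := by
    rw [slotForm, ← mul_prod_erase _ _ (Finset.mem_univ m), if_pos rfl]
    congr 1
    exact prod_congr rfl fun j hj => by rw [if_neg (ne_of_mem_erase hj)]
  rw [h5, h6, smul_eq_mul]
  push_cast
  ring

lemma corrTerm_eq (κ : Hyperplane) : corrTerm χ η s δ N u κ
    = Complex.I * ((corrMul χ η s δ N κ.1 : ℂ) * mono u κ.1) := by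
  have h : mono u κ.1 = u (κ.1 0) * conj (u (κ.1 1)) * u (κ.1 2) * conj (u (κ.1 3)) * u (κ.1 4) *
      conj (u (κ.1 5)) := by
    simp [mono, Fin.prod_univ_six, slotConj]
  have h2 : (psi s κ.1 : ℂ) / (-Complex.I * (Om κ.1 : ℂ))
      = psi s κ.1 * (Complex.I * (Om κ.1 : ℂ)⁻¹) := by
    rw [div_eq_mul_inv, mul_inv, inv_neg, Complex.inv_I, neg_neg]
  rw [corrTerm, corrMul, cutInv, h, h2]
  push_cast
  ring

lemma indicator_corr (κ : Fin 6 → Freq) : {κ : Fin 6 → Freq | altSum κ = 0}.indicator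
    (fun κ => Complex.I * ((corrMul χ η s δ N κ : ℂ) * mono u κ)) κ
      = Complex.I * ((onPlane (corrMul χ η s δ N) κ : ℂ) * mono u κ) := by
  by_cases h : altSum κ = 0
  · rw [indicator_of_mem (by exact h), onPlane, if_pos h]
  · rw [indicator_of_notMem (by exact h), onPlane, if_neg h]; simp

lemma corrSeries_eq : corrSeries χ η s δ N u
    = 1 / 6 * (∑' κ, (onPlane (corrMul χ η s δ N) κ : ℂ) * mono u κ).re := by
  have h : ∑' κ, corrTerm χ η s δ N u κ
      = Complex.I * ∑' κ, (onPlane (corrMul χ η s δ N) κ : ℂ) * mono u κ := by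
    rw [← tsum_mul_left, ← tsum_congr fun κ => indicator_corr κ, ← tsum_subtype]
    exact tsum_congr corrTerm_eq
  rw [corrSeries, h]
  simp

lemma summable_corrTerm_iff : Summable (corrTerm χ η s δ N u) ↔
    Summable fun κ => (onPlane (corrMul χ η s δ N) κ : ℂ) * mono u κ := by
  rw [← summable_mul_left_iff (f := fun κ => (onPlane (corrMul χ η s δ N) κ : ℂ) * mono u κ)
    Complex.I_ne_zero, ← summable_congr fun κ => indicator_corr κ,
    ← summable_subtype_iff_indicator]
  exact Eq.to_iff (congrArg Summable (funext corrTerm_eq))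

lemma hasSum_formSum_shell {n : ℕ} {size : (Fin n → Freq) → ℕ}
    (hsize : ∀ κ m, (nsqInt (κ m)).toNat ≤ size κ) {c : (Fin n → Freq) → ℝ}
    (h : Summable fun κ => (onPlane c κ : ℂ) * mono u κ) :
    HasSum (fun j => formSum (shell size j) c u) (∑' κ, (onPlane c κ : ℂ) * mono u κ) := by
  convert hasSum_shell hsize (fun κ hκ => by simp [onPlane, hκ]) h using 2 with j
  exact sum_congr rfl fun κ hκ => by rw [onPlane, if_pos ((mem_shell hsize).1 hκ).1]

lemma tsum_corrPiece (h : Summable (corrTerm χ η s δ N u)) :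
    ∑' j, corrPiece χ η s δ N j u = corrSeries χ η s δ N u := by
  rw [corrSeries_eq]
  exact ((Complex.hasSum_re (hasSum_formSum_shell le_size6
    (summable_corrTerm_iff.1 h))).mul_left (1 / 6)).tsum_eq

lemma mul_corrMul (hη : IsBump η) (κ : Fin 6 → Freq) : Om κ * corrMul χ η s δ N κ
    = psi s κ * (∏ m, cut χ N (κ m)) - resMul χ η s δ N κ := by
  have := hη.mul_cutInv (lam κ ^ δ) (Om κ)
  rw [corrMul, resMul, mul_assoc, ← mul_assoc, this]
  ring

lemma enorm_ofReal_le {x K : ℝ} (h : |x| ≤ K) : ‖(x : ℂ)‖ₑ ≤ ofReal K := by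
  rw [← ofReal_norm, norm_real]
  exact ofReal_le_ofReal h

lemma tsum_hw_sq_ne_top (hD : hsq s D ≠ ⊤) (c : ℝ) :
    ∑' k, ofReal c * (hw s k * D k ^ 2) ≠ ⊤ := by
  rw [ENNReal.tsum_mul_left]; exact mul_ne_top ofReal_ne_top hD

lemma tsum_mul_planeBound_ne_top (hs : 3 / 2 < s) (hD : hsq s D ≠ ⊤) (c : ℝ≥0∞) (hc : c ≠ ⊤) :
    ∑' κ, c * planeBound s D κ ≠ ⊤ := by
  rw [ENNReal.tsum_mul_left]; exact mul_ne_top hc (tsum_planeBound_ne_top hs hD)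

lemma enorm_massTerm_le (hs : 0 ≤ s) {k : Freq} {z w : ℂ} (hz : ‖z‖ₑ ≤ D k) (hw' : ‖w‖ₑ ≤ D k) :
    ‖((1 + nsq k ^ s : ℝ) : ℂ) * (z * conj w)‖ₑ ≤ ofReal 2 * (hw s k * D k ^ 2) := by
  have h1 : |1 + nsq k ^ s| ≤ 2 * br k ^ (2 * s) := by
    rw [abs_of_nonneg (by linarith [rpow_nonneg (nsq_nonneg k) s])]
    linarith [nsq_rpow_le hs k, one_le_rpow (one_le_br k) (by linarith : 0 ≤ 2 * s)]
  have h2 : ‖conj w‖ₑ = ‖w‖ₑ := by rw [← ofReal_norm, norm_conj, ofReal_norm]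
  rw [enorm_mul, enorm_mul, h2, sq, ← mul_assoc (ofReal 2), hw,
    ← ofReal_mul zero_le_two]
  exact mul_le_mul' (enorm_ofReal_le h1) (mul_le_mul' hz hw')

theorem hasDerivAt_mass (hs : 3 / 2 < s) (hT : 0 < T) (hV : IsSolution χ N s T u V)
    (hD : hsq s D ≠ ⊤) (hb : ∀ t ∈ Ioo (-T) T, ∀ k, mag (V t) k ≤ D k ∧
      mag (nonlin χ N (V t)) k ≤ D k) :
    HasDerivAt (fun t => ∑' k, (1 + nsq k ^ s) * ‖V t k‖ ^ 2)
      (∑' k, -2 * (((1 + nsq k ^ s : ℝ) : ℂ) * (u k * conj (nonlin χ N u k))).im) 0 := by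
  have hs0 : 0 ≤ s := by linarith
  have hle : ∀ {x : ℝ} {a : ℝ≥0∞} {z : ℂ}, |x| ≤ ‖z‖ → ‖z‖ₑ ≤ a → ‖x‖ₑ ≤ a := fun h h' => by
    rw [← ofReal_norm] at h' ⊢
    exact (ofReal_le_ofReal h).trans h'
  have := hasDerivAt_tsum_of_enorm_le hT (g := fun k t => (1 + nsq k ^ s) * ‖V t k‖ ^ 2)
    (g' := fun k t => -2 * (((1 + nsq k ^ s : ℝ) : ℂ) * (V t k * conj (nonlin χ N (V t) k))).im)
    (b := fun k => ofReal 2 * (ofReal 2 * (NLSEnergy.hw s k * D k ^ 2)))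
    (b₀ := fun k => ofReal 2 * (NLSEnergy.hw s k * D k ^ 2))
    (by rw [ENNReal.tsum_mul_left]
        exact mul_ne_top ofReal_ne_top (tsum_hw_sq_ne_top hD 2))
    (tsum_hw_sq_ne_top hD 2) (fun k t ht => ?_) (fun k t ht => ?_) fun k => ?_
  · simpa only [hV.init] using this
  · refine ((hV.eqn t ht k).norm_sq.const_mul _).congr_deriv ?_
    simp only [Complex.inner, mul_re, Complex.mul_im, Complex.conj_re, Complex.conj_im,
      Complex.neg_re, Complex.neg_im, Complex.I_re, Complex.I_im, add_re, add_im,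
      Complex.ofReal_re, Complex.ofReal_im]
    ring
  · rw [enorm_mul]
    refine mul_le_mul' (by rw [← ofReal_norm]; norm_num) (hle (abs_im_le_norm _)
      (enorm_massTerm_le hs0 (hb t ht k).1 (hb t ht k).2))
  · have h0 := (hb 0 ⟨by linarith, hT⟩ k).1
    refine hle (le_of_eq ?_) (enorm_massTerm_le hs0 h0 h0)
    rw [norm_mul, norm_mul, norm_conj, norm_real, abs_mul, abs_pow, abs_norm, sq]
    rfl

theorem hasDerivAt_corr (hs : 3 / 2 < s) (hη : IsBump η) (hδ : 0 ≤ δ)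
    (hC : ∀ N k, |cut χ N k| ≤ C) (hT : 0 < T) (hV : IsSolution χ N s T u V)
    (hD : hsq s D ≠ ⊤) (hb : ∀ t ∈ Ioo (-T) T, ∀ k, mag (V t) k ≤ D k ∧
      mag (nonlin χ N (V t)) k ≤ D k) :
    HasDerivAt (fun t => ∑' κ, (onPlane (corrMul χ η s δ N) κ : ℂ) * mono (V t) κ)
      (-Complex.I * ((∑' κ, (onPlane (fun κ => Om κ * corrMul χ η s δ N κ) κ : ℂ) * mono u κ) +
        ∑ m : Fin 6, (-1 : ℂ) ^ (m : ℕ) *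
          ∑' κ, (onPlane (corrMul χ η s δ N) κ : ℂ) * slotForm m (nonlin χ N u) u κ)) 0 := by
  have hs0 : 0 ≤ s := by linarith
  have hC0 : 0 ≤ C := (abs_nonneg _).trans (hC 0 0)
  have hw1 : ∀ κ, |corrMul χ η s δ N κ| ≤ 2 * C ^ 6 * ∑ j, br (κ j) ^ (2 * s) := fun κ =>
    abs_mul_psi_mul_cut_le hs0 hC (hη.abs_cutInv_lam_le hδ κ) κ
  have hw2 : ∀ κ, |Om κ * corrMul χ η s δ N κ| ≤ 1 * C ^ 6 * ∑ j, br (κ j) ^ (2 * s) := fun κ => by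
    have h1 : |Om κ * cutInv η (lam κ ^ δ) (Om κ)| ≤ 1 := by
      rw [hη.mul_cutInv, abs_le]
      constructor <;> linarith [hη.nonneg (Om κ / lam κ ^ δ), hη.le_one (Om κ / lam κ ^ δ)]
    rw [corrMul, ← mul_assoc, ← mul_assoc]
    exact abs_mul_psi_mul_cut_le hs0 hC h1 κ
  have h0 : (0:ℝ) ∈ Ioo (-T) T := ⟨by linarith, hT⟩
  have hu := hb 0 h0
  rw [hV.init] at hu
  set P := fun (κ : Fin 6 → Freq) (t : ℝ) =>
    (onPlane (fun κ => Om κ * corrMul χ η s δ N κ) κ : ℂ) * mono (V t) κ with hP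
  set Z := fun (m : Fin 6) (κ : Fin 6 → Freq) (t : ℝ) =>
    (onPlane (corrMul χ η s δ N) κ : ℂ) * slotForm m (nonlin χ N (V t)) (V t) κ with hZ
  set a := ofReal (1 * C ^ 6) with ha
  set b := ofReal (2 * C ^ 6) with hb'
  have := hasDerivAt_tsum_of_enorm_le hT
    (g := fun κ t => (onPlane (corrMul χ η s δ N) κ : ℂ) * mono (V t) κ)
    (g' := fun κ t => -Complex.I * (P κ t + ∑ m : Fin 6, (-1 : ℂ) ^ (m : ℕ) * Z m κ t))
    (b := fun κ => (a + 6 * b) * planeBound s D κ) (b₀ := fun κ => b * planeBound s D κ)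
    (tsum_mul_planeBound_ne_top hs hD _ (by finiteness))
    (tsum_mul_planeBound_ne_top hs hD _ (by finiteness)) (fun κ t ht => ?_) (fun κ t ht => ?_)
    fun κ => enorm_onPlane_mul_le (by positivity) hw1 (enorm_mono_le (fun k => (hb 0 h0 k).1) κ)
  · refine this.congr_deriv ?_
    have hZs : ∀ m : Fin 6, Summable fun κ => (-1 : ℂ) ^ (m : ℕ) * Z m κ 0 := fun m => by
      refine (summable_onPlane hs hD (by positivity) hw1 (enorm_slotForm_le ?_ ?_ m)).mul_left _
      exacts [fun k => (hb 0 h0 k).2, fun k => (hb 0 h0 k).1]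
    rw [tsum_mul_left, Summable.tsum_add (summable_onPlane hs hD (by positivity) hw2
      (enorm_mono_le fun k => (hb 0 h0 k).1)) (summable_sum fun m _ => hZs m),
      Summable.tsum_finsetSum fun m _ => hZs m]
    simp only [tsum_mul_left, hZ, hV.init]
  · refine ((hasDerivAt_mono (hV.eqn t ht) κ).const_mul _).congr_deriv ?_
    have : ∀ m : Fin 6, (-1 : ℂ) ^ (m : ℕ) * Z m κ t = (onPlane (corrMul χ η s δ N) κ : ℂ) *
        ((-1 : ℂ) ^ (m : ℕ) * slotForm m (nonlin χ N (V t)) (V t) κ) := fun m => by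
      simp only [hZ]; ring
    simp only [this, ← mul_sum, hP]
    have : (onPlane (fun κ => Om κ * corrMul χ η s δ N κ) κ : ℂ)
        = Om κ * (onPlane (corrMul χ η s δ N) κ : ℂ) := by
      simp only [onPlane]; split_ifs <;> simp
    rw [this]; ring
  · have h1 : ‖-Complex.I‖ₑ = 1 := by rw [← ofReal_norm]; simp
    have h2 : ∀ m : Fin 6, ‖(-1 : ℂ) ^ (m : ℕ)‖ₑ = 1 := fun m => by rw [← ofReal_norm]; simp
    rw [enorm_mul, h1, one_mul, add_mul]
    refine (enorm_add_le _ _).trans (add_le_add (enorm_onPlane_mul_le (by positivity) hw2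
      (enorm_mono_le (fun k => (hb t ht k).1) κ)) ((enorm_sum_le _ _).trans ?_))
    refine (Finset.sum_le_card_nsmul _ _ (b * planeBound s D κ) fun m _ => ?_).trans
      (le_of_eq (by simp [mul_assoc]))
    rw [enorm_mul, h2, one_mul]
    exact enorm_onPlane_mul_le (by positivity) hw1
      (enorm_slotForm_le (fun k => (hb t ht k).2) (fun k => (hb t ht k).1) m κ)

end

section

/-! ### The energy rate -/

variable {s σ δ C T : ℝ} {N : ℕ∞} {u : Coeff}
  {V U : ℝ → Coeff} {D : Freq → ℝ≥0∞}

theorem hasDerivAt_energy (hs : 3 / 2 < s) (hη : IsBump η) (hδ : 0 ≤ δ)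
    (hC : ∀ N k, |cut χ N k| ≤ C) (hT : 0 < T) (hV : IsSolution χ N s T u V) :
    HasDerivAt (fun t => energy χ η s δ N (V t)) (∑' j, ratePiece χ η s δ N j u) 0 := by
  have hs0 : 0 ≤ s := by linarith
  have hC0 : 0 ≤ C := (abs_nonneg _).trans (hC 0 0)
  obtain ⟨T', hT', hTT, D, hD, hb⟩ := hV.exists_majorant hs (hC N) hT
  have hsub : ∀ t ∈ Ioo (-T') T', t ∈ Ioo (-T) T := fun t ht =>
    ⟨by linarith [ht.1], by linarith [ht.2]⟩
  have hV' : IsSolution χ N s T' u V :=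
    ⟨hV.init, fun t ht => hV.mem t (hsub t ht), fun t ht => hV.cont t (hsub t ht),
      fun t ht => hV.eqn t (hsub t ht)⟩
  have hu : ∀ k, mag u k ≤ D k ∧ mag (nonlin χ N u) k ≤ D k := by
    have := hb 0 ⟨by linarith, hT'⟩
    rwa [hV.init] at this
  have huc : hsq s (mag (cutMul χ N u)) ≠ ⊤ := by
    refine ne_top_of_le_ne_top ?_ (hsq_mono fun k => (mag_cutMul_le (hC N) u k).trans
      (mul_le_mul_right (hu k).1 _))
    rw [hsq_const_mul]
    exact mul_ne_top (by finiteness) hD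
  obtain ⟨hten, hteq⟩ := tsum_ten_eq (δ := δ) (η := η) hs hη hδ hC (u := u)
    (hsq_add_ne_top hD (absForm_ne_top hs huc 4)) (fun k => (hu k).1.trans le_self_add) huc
    fun k => le_add_self
  obtain ⟨hms, hmeq⟩ := tsum_mass_eq hs hC hD (fun k => (hu k).1) huc
  have hS1 : Summable fun κ => (onPlane (fun κ => psi s κ * ∏ m, cut χ N (κ m)) κ : ℂ) * mono u κ :=
    summable_onPlane (K := 1 * C ^ 6) hs hD (by positivity) (fun κ => by
      simpa only [one_mul] using abs_mul_psi_mul_cut_le hs0 hC (abs_one (α := ℝ)).le κ)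
      (enorm_mono_le fun k => (hu k).1)
  have hS2 : Summable fun κ => (onPlane (resMul χ η s δ N) κ : ℂ) * mono u κ := 
    summable_onPlane (K := 1 * C ^ 6) hs hD (by positivity) (fun κ =>
      abs_mul_psi_mul_cut_le hs0 hC (hη.abs_le_one _) κ) (enorm_mono_le fun k => (hu k).1)
  have hS3 : ∀ m : Fin 6, Summable fun κ =>
      (onPlane (corrMul χ η s δ N) κ : ℂ) * slotForm m (nonlin χ N u) u κ := fun m =>
    summable_onPlane hs hD (by positivity) (fun κ =>
      abs_mul_psi_mul_cut_le hs0 hC (hη.abs_cutInv_lam_le hδ κ) κ)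
      (enorm_slotForm_le (fun k => (hu k).2) (fun k => (hu k).1) m)
  have hB : ∀ m : Fin 6, ((-1 : ℂ) ^ (m : ℕ) *
      ∑' κ, (onPlane (corrMul χ η s δ N) κ : ℂ) * slotForm m (nonlin χ N u) u κ).im
      = (∑' κ : Fin 10 → Freq, (onPlane (tenMul χ η s δ N) κ : ℂ) * mono u κ).im := by
    intro m
    have h := tsum_onPlane_reflect (fun κ => corrMul_reflect (χ := χ) (s := s) (δ := δ) (N := N)
      hη m κ) (z := fun m κ => (slotForm m (nonlin χ N u) u κ).im)
      fun κ => by rw [slotForm_reflect, im_twist]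
    have e : ∀ x : ℂ, ((-1 : ℂ) ^ (m : ℕ) * x).im = (-1) ^ (m : ℕ) * x.im := fun x => by
      have : (-1 : ℂ) ^ (m : ℕ) = (((-1) ^ (m : ℕ) : ℝ) : ℂ) := by push_cast; rfl
      rw [this, im_ofReal_mul]
    rw [← hteq, e, im_tsum (hS3 m), im_tsum (hS3 0), ← tsum_mul_left]
    simp only [im_ofReal_mul]
    rw [← h]
    exact tsum_congr fun κ => by ring
  have hA : ∑' κ, (onPlane (fun κ => Om κ * corrMul χ η s δ N κ) κ : ℂ) * mono u κ
      = (∑' κ, (onPlane (fun κ => psi s κ * ∏ m, cut χ N (κ m)) κ : ℂ) * mono u κ)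
        - ∑' κ, (onPlane (resMul χ η s δ N) κ : ℂ) * mono u κ := by
    rw [← hS1.tsum_sub hS2]
    refine tsum_congr fun κ => ?_
    simp only [onPlane]
    split_ifs
    · rw [mul_corrMul hη]; push_cast; ring
    · simp
  have h3 := ((hasDerivAt_mass hs hT' hV' hD hb).const_mul (1 / 2)).add
    ((reCLM.hasFDerivAt.comp_hasDerivAt 0
      (hasDerivAt_corr hs hη hδ hC hT' hV' hD hb)).const_mul (1 / 6))
  refine (h3.congr_deriv ?_).congr_of_eventuallyEq (Eventually.of_forall fun t => ?_)
  · have hR : ∑' j, ratePiece χ η s δ N j u = _ :=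
      (((hasSum_im (hasSum_formSum_shell le_size6 hS2)).mul_left (-(1 / 6))).add
        (hasSum_im (hasSum_formSum_shell le_size10 hten))).tsum_eq
    rw [hR, tsum_mul_left, ← im_tsum hms, hA]
    have e : ∀ z : ℂ, reCLM (-Complex.I * z) = z.im := fun z => by simp
    rw [e, add_im, Complex.im_sum, sum_congr rfl fun m _ => hB m, Complex.sub_im,
      im_tsum hS1]
    simp only [im_ofReal_mul]
    rw [← hmeq]
    simp
    ring
  · exact congrArg (_ + ·) corrSeries_eq

lemma cutMul_proj (hχ : IsFreqCutoff χ) {N : ℕ} (hN : N ≠ 0) :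
    cutMul χ N (proj N u) = cutMul χ N u := by
  funext k
  rw [cutMul, cutMul, proj]
  split_ifs with h
  · rfl
  · rw [not_or, not_le] at h
    simp [cut_eq_zero hχ hN (by simpa using h.2)]

lemma nonlin_proj (hχ : IsFreqCutoff χ) {N : ℕ} (hN : N ≠ 0) :
    nonlin χ N (proj N u) = nonlin χ N u := by
  have h : smoothed χ N (proj N u) = smoothed χ N u := by
    funext y
    exact tsum_congr fun k => congrArg (· * _) (congrFun (cutMul_proj hχ hN) k)
  funext k
  rw [nonlin, nonlin, h]

lemma ratePiece_proj (hχ : IsFreqCutoff χ) {N : ℕ} (hN : N ≠ 0) (j : ℕ) :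
    ratePiece χ η s δ N j (proj N u) = ratePiece χ η s δ N j u := by
  have h : ∀ {n : ℕ} (T : Finset (Fin n → Freq)) (a : (Fin n → Freq) → ℝ),
      formSum T (fun κ => a κ * ∏ m, cut χ N (κ m)) (proj N u)
        = formSum T (fun κ => a κ * ∏ m, cut χ N (κ m)) u := fun T a => by
    refine sum_congr rfl fun κ _ => ?_
    simp only [Complex.ofReal_mul, mul_assoc, ← mono_cutMul, cutMul_proj hχ hN]
  have h1 := h (shell size6 j) fun κ => η (Om κ / lam κ ^ δ) * psi s κ
  have h2 := h (shell size10 j) fun κ => cutInv η (lam (toSix κ) ^ δ) (Om (toSix κ)) *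
    psi s (toSix κ) * cut χ N (kOne κ) ^ 2
  have e : tenMul χ η s δ N = fun κ => cutInv η (lam (toSix κ) ^ δ) (Om (toSix κ)) *
      psi s (toSix κ) * cut χ N (kOne κ) ^ 2 * ∏ m, cut χ N (κ m) :=
    funext fun κ => (mul_assoc _ _ _).symm
  rw [ratePiece, ratePiece, e, ← h2]
  exact congrArg (fun z : ℂ => -(1 / 6) * z.im + _) h1

lemma enorm_proj_le (s σ : ℝ) (N : ℕ) : ∃ c : ℝ≥0∞, c ≠ ⊤ ∧ ∀ w,
    sobNorm s (proj N w) ≤ c * sobNorm σ w := by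
  refine ⟨ofReal ((N + 1 : ℝ) ^ |s - σ|), ofReal_ne_top, fun w => ?_⟩
  rw [← ENNReal.pow_le_pow_left_iff two_ne_zero, mul_pow, sobNorm_sq, sobNorm_sq, hsq, hsq,
    ← ENNReal.tsum_mul_left]
  refine tsum_le_tsum fun k => ?_
  rw [proj]
  split_ifs with h
  · have h : nsq k ≤ (N : ℝ) ^ 2 := by simpa using h
    have h1 : br k ≤ N + 1 := by
      refine (sqrt_le_left (by positivity)).2 ?_
      nlinarith [Nat.cast_nonneg (α := ℝ) N]
    rw [← mul_assoc]
    refine mul_le_mul_left ?_ _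
    rw [hw, hw, ← ofReal_pow (by positivity), ← ofReal_mul (by positivity)]
    refine ofReal_le_ofReal ?_
    rw [show 2 * s = 2 * (s - σ) + 2 * σ by ring, rpow_add (br_pos k), mul_comm 2 (s - σ),
      rpow_mul (br_pos k).le, Real.rpow_two]
    gcongr
    · exact (rpow_pos_of_pos (br_pos k) _).le
    · exact (rpow_pos_of_pos (br_pos k) _).le
    · exact (rpow_le_rpow_of_exponent_le (one_le_br k) (le_abs_self _)).trans
        (rpow_le_rpow (br_pos k).le h1 (abs_nonneg _))
  · simp

lemma IsSolution.proj (hχ : IsFreqCutoff χ) {N : ℕ} (hN : N ≠ 0) (hU : IsSolution χ N σ T u U)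
    (s : ℝ) : IsSolution χ N s T (proj N u) fun t => NLSEnergy.proj N (U t) := by
  obtain ⟨c, hc, h⟩ := enorm_proj_le s σ N
  refine ⟨by rw [hU.init], fun t ht => (h _).trans_lt (ENNReal.mul_lt_top hc.lt_top
    (hU.mem t ht)), fun t ht => ?_, fun t ht k => ?_⟩
  · have h1 := ENNReal.Tendsto.const_mul (hU.cont t ht) (Or.inr hc)
    rw [mul_zero] at h1
    refine tendsto_of_tendsto_of_tendsto_of_le_of_le tendsto_const_nhds h1 (fun _ => zero_le)
      fun t' => ?_
    have : NLSEnergy.proj N (U t') - NLSEnergy.proj N (U t) = NLSEnergy.proj N (U t' - U t) := by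
      funext k; simp only [NLSEnergy.proj, Pi.sub_apply]; split_ifs <;> simp
    rw [this]
    exact h _
  · rw [nonlin_proj hχ hN]
    simp only [NLSEnergy.proj]
    split_ifs with hk
    · exact hU.eqn t ht k
    · rw [not_or, not_le] at hk
      have : nonlin χ N (U t) k = 0 := by
        rw [nonlin, cut_eq_zero hχ hN (by simpa using hk.2)]; simp
      rw [this]
      simpa using hasDerivAt_const t (0 : ℂ)

theorem isEnergyRateOn_nat (hs : 3 / 2 < s) (hχ : IsFreqCutoff χ) (hη : IsBump η) (hδ : 0 ≤ δ)
    {N : ℕ} (hN : N ≠ 0) (σ : ℝ) :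
    IsEnergyRateOn χ η s δ N σ fun u => ∑' j, ratePiece χ η s δ N j u := by
  obtain ⟨C, -, hC⟩ := hχ.exists_bound
  refine fun u hu => ⟨exists_isSolution_nat hχ hN hu, fun T hT U hU => ?_⟩
  have := hasDerivAt_energy hs hη hδ hC hT (hU.proj hχ hN s)
  simpa only [ratePiece_proj hχ hN] using this

theorem isEnergyRateOn_top (hs : 3 / 2 < s) (hχ : IsFreqCutoff χ) (hη : IsBump η) (hδ : 0 ≤ δ) :
    IsEnergyRateOn χ η s δ ⊤ s fun u => ∑' j, ratePiece χ η s δ ⊤ j u := by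
  obtain ⟨C, -, hC⟩ := hχ.exists_bound
  refine fun u hu => ⟨exists_isSolution_top hs hu, fun T hT U hU => ?_⟩
  have e : ∀ v : Coeff, proj ⊤ v = v := fun v => funext fun k => if_pos (Or.inl rfl)
  simpa only [e] using hasDerivAt_energy hs hη hδ hC hT hU

lemma summable_corrTerm_nat (hχ : IsFreqCutoff χ) {N : ℕ} (hN : N ≠ 0) (u : Coeff) :
    Summable (corrTerm χ η s δ N u) := by
  rw [summable_corrTerm_iff]
  refine summable_of_ne_finset_zero (s := Fintype.piFinset fun _ => freqBox ⌊(N + 1 : ℝ)⌋₊)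
    fun κ hκ => ?_
  obtain ⟨m, hm⟩ : ∃ m, κ m ∉ freqBox ⌊(N + 1 : ℝ)⌋₊ := by simpa using hκ
  have h : (N : ℝ) ^ 2 < nsq (κ m) := by
    by_contra! h
    refine hm (mem_freqBox_of_br_le ((sqrt_le_left (by positivity)).2 ?_))
    nlinarith [Nat.cast_nonneg (α := ℝ) N]
  have : corrMul χ η s δ N κ = 0 := by
    rw [corrMul, Finset.prod_eq_zero (Finset.mem_univ m) (cut_eq_zero hχ hN h), mul_zero]
  simp [onPlane, this]

end

section

/-! ### Exponential moments and the weighted measures -/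

lemma exists_pow_div_factorial_le {K β : ℝ} (hK : 0 < K) (hβ0 : 0 < β) (hβ : β < 1) :
    ∃ A : ℝ, 1 ≤ A ∧ ∀ n : ℕ, 2 ^ n / (n.factorial : ℝ) * (K * (n + 2 : ℝ) ^ β) ^ n
      ≤ A * (1 / 2) ^ n := by
  set γ := 1 - β with hγ
  have hγ0 : 0 < γ := by linarith
  set a := 4 * K * exp 1 with ha
  have ha0 : 0 < a := by positivity
  set c := a ^ (1 / γ) with hc
  have hc0 : 0 < c := by positivity
  refine ⟨exp 2 * exp c ^ γ, one_le_mul_of_one_le_of_one_le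
    (one_le_exp zero_le_two) (one_le_rpow (one_le_exp hc0.le) hγ0.le), fun n => ?_⟩
  set F : ℝ := (n.factorial : ℝ) with hF
  have hF0 : 0 < F := by positivity
  have h1 : ((n + 2 : ℝ) ^ β) ^ n ≤ F ^ β * (exp 2 * exp 1 ^ n) := by
    rw [← Real.rpow_mul_natCast (by positivity), mul_comm β, Real.rpow_natCast_mul (by positivity)]
    have h2 : (n + 2 : ℝ) ^ n ≤ F * exp (n + 2) := by
      have := Real.pow_div_factorial_le_exp (n + 2 : ℝ) (by positivity) n
      rwa [div_le_iff₀' hF0] at this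
    refine (rpow_le_rpow (by positivity) h2 hβ0.le).trans ?_
    rw [mul_rpow hF0.le (exp_pos _).le]
    refine mul_le_mul_of_nonneg_left ?_ (by positivity)
    rw [← Real.exp_nat_mul, ← exp_add, mul_one, add_comm 2]
    exact (rpow_le_rpow_of_exponent_le (one_le_exp (by positivity)) hβ.le).trans_eq
      (rpow_one _)
  have h3 : a ^ n ≤ F ^ γ * exp c ^ γ := by
    have h4 : c ^ n ≤ F * exp c := by
      have := Real.pow_div_factorial_le_exp c hc0.le n
      rwa [div_le_iff₀' hF0] at this
    have h5 := rpow_le_rpow (by positivity) h4 hγ0.le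
    rwa [mul_rpow hF0.le (exp_pos _).le, ← Real.rpow_natCast_mul hc0.le, mul_comm (n : ℝ),
      Real.rpow_mul_natCast hc0.le, hc, ← rpow_mul ha0.le, one_div_mul_cancel hγ0.ne',
      rpow_one] at h5
  have h6 : F = F ^ β * F ^ γ := by
    rw [← rpow_add hF0, hγ, add_sub_cancel, rpow_one]
  rw [div_mul_eq_mul_div, div_le_iff₀ hF0, mul_pow]
  calc 2 ^ n * (K ^ n * ((n + 2 : ℝ) ^ β) ^ n)
      ≤ 2 ^ n * (K ^ n * (F ^ β * (exp 2 * exp 1 ^ n))) := by gcongr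
    _ = exp 2 * F ^ β * (1 / 2) ^ n * a ^ n := by
        rw [ha, mul_pow, mul_pow, show (4:ℝ) = 2 * 2 by norm_num, mul_pow, one_div, inv_pow]
        field_simp
    _ ≤ exp 2 * F ^ β * (1 / 2) ^ n * (F ^ γ * exp c ^ γ) := by gcongr
    _ = exp 2 * exp c ^ γ * (1 / 2) ^ n * (F ^ β * F ^ γ) := by ring
    _ = _ := by rw [← h6]

variable {α : Type*} [MeasurableSpace α] {μ : Measure α}

lemma exists_lintegral_exp_le [IsProbabilityMeasure μ] {K β : ℝ} (hK : 0 < K) (hβ0 : 0 < β)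
    (hβ : β < 1) : ∃ A : ℝ, 1 ≤ A ∧ ∀ f : α → ℝ, AEStronglyMeasurable f μ →
      (∀ p : ℝ, 2 ≤ p → eLpNorm f (ofReal p) μ ≤ ofReal (K * p ^ β)) →
      ∫⁻ x, ofReal (exp (2 * |f x|)) ∂μ ≤ ofReal A := by
  obtain ⟨A, hA, h⟩ := exists_pow_div_factorial_le hK hβ0 hβ
  refine ⟨A * 2, by linarith, fun f hf hfp => ?_⟩
  have hexp : ∀ x, ofReal (exp (2 * |f x|))
      = ∑' n : ℕ, ofReal (2 ^ n / (n.factorial : ℝ)) * ‖f x‖ₑ ^ n := fun x => by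
    have h1 : HasSum (fun n : ℕ => (2 * |f x|) ^ n / (n.factorial : ℝ)) (exp (2 * |f x|)) := by
      rw [Real.exp_eq_exp_ℝ]; exact NormedSpace.expSeries_div_hasSum_exp _
    rw [← h1.tsum_eq, ofReal_tsum_of_nonneg (fun n => by positivity) h1.summable]
    refine tsum_congr fun n => ?_
    rw [← ofReal_norm, ← ofReal_pow (norm_nonneg _), ← ofReal_mul (by positivity),
      norm_eq_abs, mul_pow]
    congr 1; ring
  have hpow : ∀ n : ℕ, ∫⁻ x, ‖f x‖ₑ ^ n ∂μ ≤ ofReal ((K * (n + 2 : ℝ) ^ β) ^ n) := by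
    intro n
    rcases Nat.eq_zero_or_pos n with rfl | hn
    · simp
    have hn0 : (n : ℝ) ≠ 0 := by positivity
    have h1 : eLpNorm f n μ ≤ ofReal (K * (n + 2 : ℝ) ^ β) := by
      refine (eLpNorm_le_eLpNorm_of_exponent_le ?_ hf).trans
        (hfp (n + 2) (by linarith [n.cast_nonneg (α := ℝ)]))
      rw [← ENNReal.ofReal_natCast]; exact ofReal_le_ofReal (by linarith)
    rw [ofReal_pow (by positivity)]
    refine le_trans (le_of_eq ?_) (pow_le_pow_left' h1 n)
    rw [eLpNorm_eq_lintegral_rpow_enorm_toReal (by simpa using hn.ne') (by simp),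
      ENNReal.toReal_natCast, ← ENNReal.rpow_natCast, ← ENNReal.rpow_mul,
      one_div_mul_cancel hn0, ENNReal.rpow_one]
    simp
  simp only [hexp]
  rw [lintegral_tsum fun n => ((hf.enorm.pow_const n).const_mul _)]
  calc _ ≤ ∑' n : ℕ, ofReal (A * (1 / 2) ^ n) := by
        refine tsum_le_tsum fun n => ?_
        rw [lintegral_const_mul'' _ (hf.enorm.pow_const n)]
        refine (mul_le_mul_right (hpow n) _).trans ?_
        rw [← ofReal_mul (by positivity)]
        exact ofReal_le_ofReal (h n)
    _ = _ := by
        rw [← ofReal_tsum_of_nonneg (fun n => by positivity)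
          (summable_geometric_two.mul_left A), tsum_mul_left, tsum_geometric_two]

lemma eLpNorm_withDensity_exp_le {B : Set α} (hB : MeasurableSet B) {f g : α → ℝ} {A p : ℝ}
    (hA : 1 ≤ A) (hp : 1 ≤ p) (hf : AEMeasurable f μ) (hg : AEMeasurable g μ)
    (h : ∫⁻ x, ofReal (exp (2 * |B.indicator f x|)) ∂μ ≤ ofReal A) :
    eLpNorm (B.indicator g) (ofReal p)
        (μ.withDensity fun x => ofReal (exp (-f x)))
      ≤ ofReal A * eLpNorm (B.indicator g) (ofReal (2 * p)) μ := by
  have hp0 : 0 < p := by linarith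
  have hm : AEMeasurable (fun x => ofReal (exp (-f x))) μ :=
    (Real.measurable_exp.comp_aemeasurable hf.neg).ennreal_ofReal
  have hG : AEMeasurable (fun x => ‖B.indicator g x‖ₑ ^ p) μ :=
    ((hg.indicator hB).enorm).pow_const p
  rw [eLpNorm_ofReal hp0, eLpNorm_ofReal (by linarith),
    lintegral_withDensity_eq_lintegral_mul_non_measurable₀ _ hm (by simp)]
  have h1 : ∫⁻ x, ((fun x => ofReal (exp (-f x))) *
      fun x => ‖B.indicator g x‖ₑ ^ p) x ∂μ
      ≤ ofReal A ^ (1 / 2 : ℝ) *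
        (∫⁻ x, ‖B.indicator g x‖ₑ ^ (2 * p) ∂μ) ^ (1 / 2 : ℝ) := by
    calc _ = ∫⁻ x, ((B.indicator fun x => ofReal (exp (-f x))) *
          fun x => ‖B.indicator g x‖ₑ ^ p) x ∂μ := by
          refine lintegral_congr fun x => ?_
          by_cases hx : x ∈ B <;> simp [hx, hp0]
      _ ≤ _ := ENNReal.lintegral_mul_le_Lp_mul_Lq μ Real.HolderConjugate.two_two
          (hm.indicator hB) hG
      _ ≤ _ := by
          gcongr ?_ ^ _ * ?_ ^ _
          · refine (lintegral_mono fun x => ?_).trans h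
            by_cases hx : x ∈ B
            · simp only [indicator_of_mem hx, rpow_two]
              rw [← ofReal_pow (exp_pos _).le, ← Real.exp_nat_mul]
              refine ofReal_le_ofReal (Real.exp_le_exp.2 ?_)
              push_cast
              linarith [neg_le_abs (f x)]
            · simp [hx]
          · refine lintegral_mono fun x => ?_
            rw [← ENNReal.rpow_mul, mul_comm]
  calc _ ≤ (ofReal A ^ (1 / 2 : ℝ) *
        (∫⁻ x, ‖B.indicator g x‖ₑ ^ (2 * p) ∂μ) ^ (1 / 2 : ℝ)) ^ (1 / p) := by gcongr
    _ = ofReal A ^ (1 / (2 * p)) *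
        (∫⁻ x, ‖B.indicator g x‖ₑ ^ (2 * p) ∂μ) ^ (1 / (2 * p)) := by
        rw [mul_rpow_of_nonneg _ _ (by positivity), ← ENNReal.rpow_mul, ← ENNReal.rpow_mul,
          one_div_mul_one_div]
    _ ≤ _ := by
        refine mul_le_mul_left ?_ _
        have h2 : (1:ℝ≥0∞) ≤ ofReal A := by simpa using ofReal_le_ofReal hA
        refine (ENNReal.rpow_le_rpow_of_exponent_le h2 (z := 1) ?_).trans_eq (ENNReal.rpow_one _)
        rw [div_le_one (by positivity)]; linarith

lemma weighted_le (hη : IsBump η) (s σ R : ℝ) (Rc : ℕ∞ → Coeff → ℝ) (N : ℕ∞) :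
    weighted η s σ R Rc N
      ≤ (gaussianSob s).withDensity fun u => ofReal (exp (-Rc N u)) := by
  refine withDensity_mono (ae_of_all _ fun u => (indicator_le_self _ _ _).trans ?_)
  exact ofReal_le_ofReal (mul_le_of_le_one_left (exp_pos _).le (hη.le_one _))

end

end NLSEnergy
end

open NLSEnergy

theorem proposition2p2
    (χ : EuclideanSpace ℝ (Fin 3) → ℝ) (hχ : NLSEnergy.IsFreqCutoff χ)
    (η : ℝ → ℝ) (hη : NLSEnergy.IsBump η) (s : ℝ) (hs : 10 ≤ s) :
    ∃ δ₁ : ℝ, 0 < δ₁ ∧ δ₁ < 2 / 3 ∧ ∀ δ₀ : ℝ, δ₁ < δ₀ → δ₀ < 2 / 3 →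
      ∃ (Rc Q : ℕ∞ → NLSEnergy.Coeff → ℝ),
        NLSEnergy.IsCorrection χ η s δ₀ Rc ∧ NLSEnergy.IsEnergyRate χ η s δ₀ Q ∧
        ∃ ε : ℝ, 0 < ε ∧ ∃ β : ℝ, 0 < β ∧ β < 1 ∧ ∀ R : ℝ, 1 ≤ R → ∃ C : ℝ, 0 < C ∧
          ∀ σ : ℝ, s - 3 / 2 - ε < σ → σ < s - 3 / 2 → ∀ N : ℕ∞, N ≠ 0 →
            (∀ p : ℝ, 2 ≤ p →
              eLpNorm ((NLSEnergy.sobBall σ R).indicator (Q N)) (ENNReal.ofReal p)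
                (NLSEnergy.gaussianSob s) ≤ ENNReal.ofReal (C * p ^ β)) ∧
            (∀ p : ℝ, 1 ≤ p →
              eLpNorm ((NLSEnergy.sobBall σ R).indicator (Q N)) (ENNReal.ofReal p)
                (NLSEnergy.weighted η s σ R Rc N) ≤ ENNReal.ofReal (C * p ^ β)) := by
  refine ⟨1 / 2, by norm_num, by norm_num, fun δ hδ hδ1 => ?_⟩
  have hσ : 8 < s - 7 / 4 := by linarith
  have hσ' : s - 7 / 4 < s - 3 / 2 := by linarith
  have hs0 : 0 ≤ s := by linarith
  have hs1 : 3 / 2 < s := by linarith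
  have hK : 0 ≤ 30 + 2 * s := by linarith
  have hδ0 : 0 ≤ δ := by linarith
  have hθ : 0 < (2 - 3 * δ) / 2 := by linarith
  obtain ⟨C₁, h₁⟩ := exists_dyadicBounds_corr hχ hη (by linarith : 2 ≤ s) hδ0 hσ
  obtain ⟨C₂, h₂⟩ := exists_dyadicBounds_rate hχ hη (by linarith : 2 ≤ s) hδ hδ1 hσ
  have hRm := fun N hN => h₁.aemeasurable (N := N) hs0 hσ' one_half_pos hK hN
  have hQm := fun N hN => h₂.aemeasurable (N := N) hs0 hσ' hθ hK hN
  set Rc : ℕ∞ → Coeff → ℝ := fun N u => ∑' j, corrPiece χ η s δ N j u with hRc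
  set Q : ℕ∞ → Coeff → ℝ := fun N u => ∑' j, ratePiece χ η s δ N j u with hQ
  have hβ' := interpExp_mem one_half_pos hK
  have hβ := interpExp_mem hθ hK
  refine ⟨Rc, Q, ⟨hRm, fun N hN u => tsum_corrPiece
    (summable_corrTerm_nat hχ hN u), fun u => tsum_corrPiece,
    h₁.tendstoInMeasure hs0 hσ' one_half_pos hK⟩,
    ⟨hQm, fun N hN σ _ => isEnergyRateOn_nat hs1 hχ hη hδ0 hN σ,
      isEnergyRateOn_top hs1 hχ hη hδ0, h₂.tendstoInMeasure hs0 hσ' hθ hK⟩,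
    1 / 4, by norm_num, interpExp ((2 - 3 * δ) / 2) (30 + 2 * s), hβ.1, hβ.2,
    fun R hR => ?_⟩
  have hgeom : ∀ θ : ℝ, 0 ≤ ∑' j : ℕ, (2:ℝ) ^ (-(θ / 2 * j)) := fun θ =>
    tsum_nonneg fun j => by positivity
  have hK₁ := mul_nonneg (h₁.const_nonneg R hR) (hgeom (1 / 2))
  have hK₂ := mul_nonneg (h₂.const_nonneg R hR) (hgeom ((2 - 3 * δ) / 2))
  set K₁ := C₁ R * ∑' j : ℕ, (2:ℝ) ^ (-(1 / 2 / 2 * (j : ℝ))) with hK₁'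
  set K₂ := C₂ R * ∑' j : ℕ, (2:ℝ) ^ (-((2 - 3 * δ) / 2 / 2 * (j : ℝ))) with hK₂'
  set β := interpExp ((2 - 3 * δ) / 2) (30 + 2 * s) with hβdef
  obtain ⟨A, hA, hexp⟩ := exists_lintegral_exp_le (μ := gaussianSob s)
    (by linarith : 0 < K₁ + 1) hβ'.1 hβ'.2
  refine ⟨A * ((K₂ + 1) * 2), by positivity, fun σ hσ1 hσ2 N hN => ?_⟩
  have hsub : sobBall σ R ⊆ sobBall (s - 7 / 4) R :=
    sobBall_mono (by linarith)
  have hmono : ∀ (f : Coeff → ℝ) (p : ℝ≥0∞) (μ : Measure Coeff),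
      eLpNorm ((sobBall σ R).indicator f) p μ
        ≤ eLpNorm ((sobBall (s - 7 / 4) R).indicator f) p μ := fun f p μ =>
    eLpNorm_mono fun u => norm_indicator_le_of_subset hsub f u
  have hQp : ∀ p : ℝ, 2 ≤ p → eLpNorm ((sobBall σ R).indicator (Q N))
      (ENNReal.ofReal p) (gaussianSob s) ≤ ENNReal.ofReal ((K₂ + 1) * p ^ β) :=
    fun p hp => (hmono _ _ _).trans ((h₂.eLpNorm_tsum_le hθ hK hR hN hp).trans
      (ENNReal.ofReal_le_ofReal (mul_le_mul_of_nonneg_right (by linarith) (by positivity))))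
  have hBm := measurableSet_sobBall σ R
  have hE := hexp ((sobBall σ R).indicator (Rc N))
    ((hRm N hN).indicator hBm).aestronglyMeasurable fun p hp => (hmono _ _ _).trans
      ((h₁.eLpNorm_tsum_le one_half_pos hK hR hN hp).trans
      (ENNReal.ofReal_le_ofReal (mul_le_mul_of_nonneg_right (by linarith) (by positivity))))
  refine ⟨fun p hp => (hQp p hp).trans (ENNReal.ofReal_le_ofReal
    (mul_le_mul_of_nonneg_right (by nlinarith) (by positivity))), fun p hp => ?_⟩
  refine (eLpNorm_mono_measure _ (weighted_le hη s σ R Rc N)).trans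
    ((eLpNorm_withDensity_exp_le hBm hA hp (hRm N hN) (hQm N hN) hE).trans
    ((mul_le_mul_right (hQp (2 * p) (by linarith)) _).trans ?_))
  rw [← ENNReal.ofReal_mul (by linarith), mul_assoc A, mul_assoc (K₂ + 1)]
  refine ENNReal.ofReal_le_ofReal ?_
  have h2 : (2 * p) ^ β ≤ 2 * p ^ β := by
    rw [Real.mul_rpow zero_le_two (by linarith)]
    refine mul_le_mul_of_nonneg_right ?_ (by positivity)
    exact (Real.rpow_le_rpow_of_exponent_le one_le_two hβ.2.le).trans_eq (Real.rpow_one 2)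
  gcongr
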